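/- **Theorem (The Fast Row Selection Algorithm).** Let $\|\cdot\|_F$ be the Frobenius norm, $X^\dagger$ the Moore–Penrose inverse of $X$, and $A_k$ the rank-$k$ truncated singular value decomposition of $A$. *Model.* Programs run on a real random access machine (exact real arithmetic $+,-,\times,/,\sqrt{\ }$, comparisons, index arithmetic and array access at unit cost, independent standard normal and uniform $[0,1]$ random numbers at unit cost, and an eigenvalue decomposition of a symmetric $d\times d$ matrix at cost $d^3$, computed by an arbitrary correct measurable routine). There are one program, a constant $K$, functions $\ell,r_1,r_2$ of $(k,\rho,\epsilon)$ and a function $\delta(\epsilon)$ with $\delta(\epsilon)\to0$ as $\epsilon\to0^+$ such that $r=r_1+r_2$ satisfies $r=\frac{2\rho}{\epsilon}(1+o(1))$, namely $|r-\frac{2\rho}{\epsilon}|\le\frac{2\rho}{\epsilon}\delta(\epsilon)$ for all $1\le k\le\rho$ and $0<\epsilon\le1$, and such that the following holds for all $A\in\mathbb R^{m\times n}$, $C\in\mathbb R^{m\times c}$ with $\mathrm{rank}(C)=\mathrm{rank}(CC^\dagger A)=\rho$, all integers $1\le k\le\rho$ and all $0<\epsilon\le1$. On input $(A,k,\rho,\epsilon)$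 the program randomly selects at most $r$ rows of $A$ (repetitions allowed), which form a matrix $R$, and 1. $\mathbb E\,\|A-CC^\dagger AR^\dagger R\|_F^2\le\|A-CC^\dagger A\|_F^2+\epsilon\,\|A-A_k\|_F^2$, the expectation being over the random choice of $R$; 2. the running time is always at most $K\,(mnk+mk^3)\,\epsilon^{-2/3}$; 3. whenever $2\rho/\epsilon\le m$, the rows are, almost surely, the result of the following three steps. - *Randomized SVD.* With $\Omega$ an $n\times\ell$ standard Gaussian matrix and $Y=A\Omega$, take the rank-$k$ truncated singular value decomposition $\tilde U\tilde\Sigma\tilde V^T$ of $YY^\dagger A$. - *Dual set spectral-Frobenius sparsification.* Let $x_i$ ($i\le m$) be the rows of $A-\tilde U\tilde\Sigma\tilde V^T$ and $v_i\in\mathbb R^k$ the rows of $\tilde U$; let $k<r_1$, $L_\tau=\tau-\sqrt{r_1k}$, $\phi(L,M)=\sum_i(\lambda_i(M)-L)^{-1}$, $\delta_U=\sum_i\|x_i\|_2^2/(1-\sqrt{k/r_1})$, with the convention $\delta_U^{-1}=0$ if $\delta_U=0$. Start with $M_0=0$; for $\tau=0,\dots,r_1-1$ choose an index $j$ and a weight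 $t>0$ with $$\delta_U^{-1}\|x_j\|_2^2\le t^{-1}\le\frac{v_j^T(M_\tau-(L_\tau+1)I)^{-2}v_j}{\phi(L_\tau+1,M_\tau)-\phi(L_\tau,M_\tau)}-v_j^T(M_\tau-(L_\tau+1)I)^{-1}v_j$$ and put $M_{\tau+1}=M_\tau+t\,v_jv_j^T$. The $i$-th output weight is $\frac{1-\sqrt{k/r_1}}{r_1}$ times the sum of the weights $t$ of the iterations that chose $j=i$. The rows of $A$ with non-zero output weight, each taken once, form $R_1$. - *Adaptive sampling.* With $B=A-AR_1^\dagger R_1$, draw $r_2$ further rows of $A$ independently, the $i$-th row with probability $\|b^{(i)}\|_2^2/\|B\|_F^2$, where $b^{(i)}$ is the $i$-th row of $B$ (arbitrary rows if $B=0$). The rows of $R_1$ and these rows form $R$. -/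

import Mathlib

open MeasureTheory ProbabilityTheory Filter Topology
open scoped Matrix

attribute [local instance] Matrix.frobeniusNormedAddCommGroup

/-! ## Matrices: Moore–Penrose inverse, truncated SVD, row submatrices -/

/-- `X` satisfies the four Penrose equations for the real matrix `A`. -/
structure IsMoorePenrose {m n : ℕ} (A : Matrix (Fin m) (Fin n) ℝ)
    (X : Matrix (Fin n) (Fin m) ℝ) : Prop where
  mul_mul_self : A * X * A = A
  self_mul_mul : X * A * X = X
  symm_left : (A * X)ᵀ = A * X
  symm_right : (X * A)ᵀ = X * A

/-- Every real matrix has a Moore–Penrose inverse. -/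
theorem exists_isMoorePenrose {m n : ℕ} (A : Matrix (Fin m) (Fin n) ℝ) :
    ∃ X, IsMoorePenrose A X := by
  have hB : (A * Aᵀ).IsHermitian := by
    simpa [Matrix.conjTranspose_eq_transpose_of_trivial] using
      Matrix.isHermitian_mul_conjTranspose_self A
  let U : Matrix (Fin m) (Fin m) ℝ := hB.eigenvectorUnitary
  let D := Matrix.diagonal hB.eigenvalues
  let D' := Matrix.diagonal fun i => (hB.eigenvalues i)⁻¹
  have hU : Uᵀ * U = 1 := by
    have := Unitary.coe_star_mul_self hB.eigenvectorUnitary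
    simpa [U, Matrix.star_eq_conjTranspose, Matrix.conjTranspose_eq_transpose_of_trivial] using this
  have hspec : A * Aᵀ = U * D * Uᵀ := by
    have h := hB.spectral_theorem
    rw [Unitary.conjStarAlgAut_apply] at h
    simpa [U, D, Matrix.star_eq_conjTranspose, Matrix.conjTranspose_eq_transpose_of_trivial,
      Function.comp_def] using h
  have hD1 : D * D' * D = D := by
    simp only [D, D', Matrix.diagonal_mul_diagonal]
    congr 1; funext i
    by_cases h : hB.eigenvalues i = 0 <;> simp [h]
  have hD2 : D' * (D * D') = D' := by
    simp only [D, D', Matrix.diagonal_mul_diagonal]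
    congr 1; funext i
    by_cases h : hB.eigenvalues i = 0 <;> simp [h]
  have hDt : (D * D')ᵀ = D * D' := by
    simp only [D, D', Matrix.diagonal_mul_diagonal, Matrix.diagonal_transpose]
  have hDt' : D'ᵀ = D' := by simp only [D', Matrix.diagonal_transpose]
  let X := Aᵀ * (U * D' * Uᵀ)
  have hAX : A * X = U * (D * D') * Uᵀ := by
    calc A * X = A * Aᵀ * (U * D' * Uᵀ) := by simp only [X, Matrix.mul_assoc]
      _ = U * D * (Uᵀ * U) * D' * Uᵀ := by rw [hspec]; simp only [Matrix.mul_assoc]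
      _ = U * (D * D') * Uᵀ := by rw [hU, Matrix.mul_one, Matrix.mul_assoc U D D']
  have hsymm : (A * X)ᵀ = A * X := by
    rw [hAX, Matrix.transpose_mul, Matrix.transpose_mul, hDt, Matrix.transpose_transpose,
      ← Matrix.mul_assoc]
  have hkey : (A * X) * (A * Aᵀ) = A * Aᵀ := by
    rw [hAX, hspec]
    calc U * (D * D') * Uᵀ * (U * D * Uᵀ) = U * (D * D') * (Uᵀ * U) * D * Uᵀ := by
          simp only [Matrix.mul_assoc]
      _ = U * (D * D' * D) * Uᵀ := by rw [hU]; simp only [Matrix.mul_assoc, Matrix.one_mul]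
      _ = _ := by rw [hD1]
  refine ⟨X, ?_, ?_, hsymm, ?_⟩
  · have hz : (A * X * A - A) * (A * X * A - A)ᵀ = 0 := by
      rw [Matrix.transpose_sub, Matrix.transpose_mul, hsymm, Matrix.sub_mul, Matrix.mul_sub,
        Matrix.mul_sub]
      have e1 : A * X * A * (Aᵀ * (A * X)) = (A * X) * (A * Aᵀ) * (A * X) := by
        simp only [Matrix.mul_assoc]
      have e2 : A * X * A * Aᵀ = A * Aᵀ := by rw [← hkey]; simp only [Matrix.mul_assoc]
      rw [e1, hkey, e2]
      simp [Matrix.mul_assoc]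
    have := (Matrix.self_mul_conjTranspose_eq_zero (A := A * X * A - A)).1
      (by simpa [Matrix.conjTranspose_eq_transpose_of_trivial] using hz)
    exact sub_eq_zero.1 this
  · calc X * A * X = X * (A * X) := by rw [Matrix.mul_assoc]
      _ = Aᵀ * U * D' * (Uᵀ * U) * (D * D') * Uᵀ := by
          rw [hAX]; simp only [X, Matrix.mul_assoc]
      _ = Aᵀ * U * (D' * (D * D')) * Uᵀ := by
          rw [hU]; simp only [Matrix.mul_assoc, Matrix.one_mul]
      _ = X := by rw [hD2]; simp only [X, Matrix.mul_assoc]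
  · simp only [X, Matrix.transpose_mul, Matrix.transpose_transpose, hDt', Matrix.mul_assoc]

/-- The Moore–Penrose inverse `A†`. -/
noncomputable def pinv {m n : ℕ} (A : Matrix (Fin m) (Fin n) ℝ) : Matrix (Fin n) (Fin m) ℝ :=
  (exists_isMoorePenrose A).choose

theorem pinv_spec {m n : ℕ} (A : Matrix (Fin m) (Fin n) ℝ) : IsMoorePenrose A (pinv A) :=
  (exists_isMoorePenrose A).choose_spec

/-- `M = ∑ i < q, σ i • u i (v i)ᵀ` is a singular value decomposition. -/
structure IsSVD {m n q : ℕ} (M : Matrix (Fin m) (Fin n) ℝ) (U : Matrix (Fin m) (Fin q) ℝ)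
    (σ : Fin q → ℝ) (V : Matrix (Fin n) (Fin q) ℝ) : Prop where
  left_orthonormal : Uᵀ * U = 1
  right_orthonormal : Vᵀ * V = 1
  nonneg : ∀ i, 0 ≤ σ i
  antitone : Antitone σ
  eq : M = U * Matrix.diagonal σ * Vᵀ

/-- `U`, `σ`, `V` are the top `k` left singular vectors, singular values and right singular
vectors in some singular value decomposition of `M`. -/
def IsTruncatedSVD {m n k : ℕ} (M : Matrix (Fin m) (Fin n) ℝ) (U : Matrix (Fin m) (Fin k) ℝ)
    (σ : Fin k → ℝ) (V : Matrix (Fin n) (Fin k) ℝ) : Prop :=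
  ∃ (q : ℕ) (h : k ≤ q) (U' : Matrix (Fin m) (Fin q) ℝ) (σ' : Fin q → ℝ)
    (V' : Matrix (Fin n) (Fin q) ℝ), IsSVD M U' σ' V' ∧
      U = U'.submatrix id (Fin.castLE h) ∧ σ = σ' ∘ Fin.castLE h ∧
      V = V'.submatrix id (Fin.castLE h)

/-- `Ak` is the rank-`k` truncated singular value decomposition `A_k` of `A`. -/
def IsRankTruncation {m n : ℕ} (k : ℕ) (A Ak : Matrix (Fin m) (Fin n) ℝ) : Prop :=
  ∃ (U : Matrix (Fin m) (Fin k) ℝ) (σ : Fin k → ℝ) (V : Matrix (Fin n) (Fin k) ℝ),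
    IsTruncatedSVD A U σ V ∧ Ak = U * Matrix.diagonal σ * Vᵀ

/-- The matrix whose rows are the rows of `A` with the listed indices (an index that is not a row
index of `A` would give a zero row). -/
def selectRows {m n : ℕ} (A : Matrix (Fin m) (Fin n) ℝ) (l : List ℕ) :
    Matrix (Fin l.length) (Fin n) ℝ :=
  Matrix.of fun i j => if h : l.get i < m then A ⟨l.get i, h⟩ j else 0

/-! ## A real random access machine

Programs are finite syntax trees that do not depend on the input. The memory holds arrays of
natural numbers (used for indices and counters) and two-dimensional arrays of real numbers. -/

namespace RealRAM

/-- Index expressions. `get a e` reads entry `e` of the natural-number array named `a`;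
`minus` is truncated, `half` rounds down. -/
inductive NExp
  | lit (c : ℕ)
  | get (a : ℕ) (e : NExp)
  | plus (e f : NExp)
  | minus (e f : NExp)
  | half (e : NExp)

/-- Real expressions. `get a e f` reads entry `(e, f)` of the real array named `a`. -/
inductive RExp
  | ofNat (e : NExp)
  | get (a : ℕ) (e f : NExp)
  | plus (x y : RExp)
  | minus (x y : RExp)
  | times (x y : RExp)
  | quot (x y : RExp)
  | sqrt (x : RExp)

/-- Tests. -/
inductive Test
  | nle (e f : NExp)
  | rle (x y : RExp)

/-- Programs. `gauss a e f` / `unif a e f` draw a fresh independent standard normal / uniform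
`[0,1]` sample into entry `(e, f)` of the real array `a`; `eig M e lam vec` computes an
eigenvalue decomposition of the symmetric matrix in the upper left `e × e` block of the array `M`;
`loop x e c` runs `c` with entry `0` of the natural-number array `x` set to `0, 1, …, e - 1`. -/
inductive Cmd
  | skip
  | setN (a : ℕ) (e : NExp) (v : NExp)
  | setR (a : ℕ) (e f : NExp) (v : RExp)
  | gauss (a : ℕ) (e f : NExp)
  | unif (a : ℕ) (e f : NExp)
  | eig (M : ℕ) (e : NExp) (lam vec : ℕ)
  | seq (c d : Cmd)
  | ite (t : Test) (c d : Cmd)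
  | loop (x : ℕ) (e : NExp) (c : Cmd)

/-- Memory contents, the number of normal and of uniform samples drawn so far, and the number of
elementary operations performed so far. -/
structure State where
  nat : ℕ → ℕ → ℕ
  real : ℕ → ℕ → ℕ → ℝ
  gaussUsed : ℕ
  unifUsed : ℕ
  clock : ℕ

/-- The supply of random numbers. -/
abbrev Tape := (ℕ → ℝ) × (ℕ → unitInterval)

/-- All random numbers are independent, the first sequence standard normal, the second uniform. -/
noncomputable def tapeMeasure : Measure Tape :=
  (Measure.infinitePi fun _ : ℕ => gaussianReal 0 1).prod
    (Measure.infinitePi fun _ : ℕ => (volume : Measure unitInterval))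

/-- A routine that computes an eigenvalue decomposition `M = Q diag(λ) Qᵀ`, with `Q` orthogonal
and `λ` in decreasing order, of every real symmetric matrix `M`. -/
structure EigenSolver where
  val : (d : ℕ) → (Fin d → Fin d → ℝ) → Fin d → ℝ
  vec : (d : ℕ) → (Fin d → Fin d → ℝ) → Fin d → Fin d → ℝ
  measurable_val : ∀ d, Measurable (val d)
  measurable_vec : ∀ d, Measurable (vec d)
  orthonormal : ∀ d (M : Matrix (Fin d) (Fin d) ℝ), M.IsSymm →
    (Matrix.of (vec d M))ᵀ * Matrix.of (vec d M) = 1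
  eigen : ∀ d (M : Matrix (Fin d) (Fin d) ℝ), M.IsSymm →
    M * Matrix.of (vec d M) = Matrix.of (vec d M) * Matrix.diagonal (val d M)
  antitone : ∀ d (M : Matrix (Fin d) (Fin d) ℝ), M.IsSymm → Antitone (val d M)

theorem exists_measurable_selection_cantor {X : Type*} [TopologicalSpace X] [MeasurableSpace X]
    [OpensMeasurableSpace X] (G : Set (X × (ℕ → Bool))) (hG : IsClosed G)
    (hne : ∀ x, ∃ c, (x, c) ∈ G) :
    ∃ f : X → ℕ → Bool, Measurable f ∧ ∀ x, (x, f x) ∈ G := by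
  classical
  let _ : MeasurableSpace (List Bool) := ⊤
  let E : List Bool → Set X := fun w =>
    {x | ∃ c, (x, c) ∈ G ∧ ∀ i (h : i < w.length), c i = w[i]}
  have hE : ∀ w, IsClosed (E w) := by
    intro w
    have h1 : IsClosed (G ∩ {z : X × (ℕ → Bool) | ∀ i (h : i < w.length), z.2 i = w[i]}) := by
      refine hG.inter ?_
      simp only [Set.ofPred_forall]
      refine isClosed_iInter fun i => isClosed_iInter fun h => ?_
      exact isClosed_eq (by fun_prop) continuous_const
    have h2 := isClosedMap_fst_of_compactSpace (X := X) (Y := ℕ → Bool) _ h1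
    convert h2 using 1
    ext x
    simp [E]
  let p : ℕ → X → List Bool := fun n => Nat.rec (fun _ => [])
    (fun _ q x => if x ∈ E (q x ++ [false]) then q x ++ [false] else q x ++ [true]) n
  have hp : ∀ n x, p (n + 1) x =
      if x ∈ E (p n x ++ [false]) then p n x ++ [false] else p n x ++ [true] := fun n x => rfl
  have hlen : ∀ n x, (p n x).length = n := by
    intro n x
    induction n with
    | zero => rfl
    | succ n ih => rw [hp]; split_ifs <;> simp [ih]
  have hmeas : ∀ n, Measurable (p n) := by
    intro n
    induction n with
    | zero => exact measurable_const
    | succ n ih =>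
      have hs : MeasurableSet {x | x ∈ E (p n x ++ [false])} := by
        have : {x | x ∈ E (p n x ++ [false])} =
            ⋃ w : List Bool, (p n ⁻¹' {w}) ∩ E (w ++ [false]) := by
          ext x; simp
        rw [this]
        exact MeasurableSet.iUnion fun w =>
          (ih (MeasurableSpace.measurableSet_top)).inter (hE _).measurableSet
      exact Measurable.ite hs
        ((measurable_from_top (f := fun w : List Bool => w ++ [false])).comp ih)
        ((measurable_from_top (f := fun w : List Bool => w ++ [true])).comp ih)
  have hmem : ∀ n x, x ∈ E (p n x) := by
    intro n x
    induction n with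
    | zero => obtain ⟨c, hc⟩ := hne x; exact ⟨c, hc, fun i h => absurd h (Nat.not_lt_zero i)⟩
    | succ n ih =>
      rw [hp]
      split_ifs with h
      · exact h
      · obtain ⟨c, hc, hcw⟩ := ih
        have hn : c n = true := by
          by_contra hcon
          apply h
          refine ⟨c, hc, fun i hi => ?_⟩
          rw [List.length_append, hlen, List.length_singleton] at hi
          by_cases hin : i < n
          · rw [List.getElem_append_left (by rw [hlen]; exact hin)]
            exact hcw i (by rw [hlen]; exact hin)
          · have : i = n := by omega
            subst this
            simpa [List.getElem_append, hlen] using hcon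
        refine ⟨c, hc, fun i hi => ?_⟩
        rw [List.length_append, hlen, List.length_singleton] at hi
        by_cases hin : i < n
        · rw [List.getElem_append_left (by rw [hlen]; exact hin)]
          exact hcw i (by rw [hlen]; exact hin)
        · have : i = n := by omega
          subst this
          simpa [List.getElem_append, hlen] using hn
  have hstep : ∀ x i n, i < n → (p n x).getD i false = (p (i + 1) x).getD i false := by
    intro x i n hin
    induction n, hin using Nat.le_induction with
    | base => rfl
    | succ n hn ih =>
      rw [← ih, hp]
      have : i < (p n x).length := by rw [hlen]; omega
      split_ifs <;> simp [List.getD_eq_getElem?_getD, List.getElem?_append_left this]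
  refine ⟨fun x i => (p (i + 1) x).getD i false, ?_, fun x => ?_⟩
  · refine measurable_pi_lambda _ fun i => ?_
    exact (measurable_from_top (f := fun w : List Bool => w.getD i false)).comp (hmeas (i + 1))
  · choose c hc hcw using fun n => hmem n x
    have hlim : Tendsto (fun n => (x, c n)) atTop
        (𝓝 (x, fun i => (p (i + 1) x).getD i false)) := by
      refine Tendsto.prodMk_nhds tendsto_const_nhds (tendsto_pi_nhds.2 fun i => ?_)
      refine tendsto_const_nhds.congr' ?_
      filter_upwards [eventually_gt_atTop i] with n hn
      have h : i < (p n x).length := by rw [hlen]; exact hn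
      rw [hcw n i h, ← hstep x i n hn, List.getD_eq_getElem _ _ h]
    exact hG.mem_of_tendsto hlim (Eventually.of_forall hc)

theorem exists_measurable_selection_compact {X Y : Type*} [TopologicalSpace X] [MeasurableSpace X]
    [OpensMeasurableSpace X] [MetricSpace Y] [CompactSpace Y] [Nonempty Y] [MeasurableSpace Y]
    [BorelSpace Y] (G : Set (X × Y)) (hG : IsClosed G) (hne : ∀ x, ∃ y, (x, y) ∈ G) :
    ∃ f : X → Y, Measurable f ∧ ∀ x, (x, f x) ∈ G := by
  obtain ⟨h, hc, hs⟩ := exists_nat_bool_continuous_surjective_of_compact Y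
  obtain ⟨f, hf, hfG⟩ := exists_measurable_selection_cantor
    ((fun z : X × (ℕ → Bool) => (z.1, h z.2)) ⁻¹' G) (hG.preimage (by fun_prop)) (fun x => by
      obtain ⟨y, hy⟩ := hne x
      obtain ⟨c, rfl⟩ := hs y
      exact ⟨c, hy⟩)
  exact ⟨fun x => h (f x), hc.measurable.comp hf, hfG⟩

theorem exists_eigen {d : ℕ} (M : Matrix (Fin d) (Fin d) ℝ) (hM : M.IsSymm) :
    ∃ Q : Matrix (Fin d) (Fin d) ℝ, Qᵀ * Q = 1 ∧
      M * Q = Q * Matrix.diagonal (fun i => (Qᵀ * M * Q) i i) ∧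
      Antitone fun i => (Qᵀ * M * Q) i i := by
  have hH : M.IsHermitian := by
    rw [Matrix.IsHermitian, Matrix.conjTranspose_eq_transpose_of_trivial]; exact hM
  let U : Matrix (Fin d) (Fin d) ℝ := hH.eigenvectorUnitary
  have hU : Uᵀ * U = 1 := by
    have := Unitary.coe_star_mul_self hH.eigenvectorUnitary
    simpa [U, Matrix.star_eq_conjTranspose, Matrix.conjTranspose_eq_transpose_of_trivial] using this
  have hU' : U * Uᵀ = 1 := mul_eq_one_comm.1 hU
  have hspec : M = U * Matrix.diagonal hH.eigenvalues * Uᵀ := by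
    have h := hH.spectral_theorem
    rw [Unitary.conjStarAlgAut_apply] at h
    simpa [U, Matrix.star_eq_conjTranspose, Matrix.conjTranspose_eq_transpose_of_trivial,
      Function.comp_def] using h
  obtain ⟨π, hπ⟩ : ∃ π : Equiv.Perm (Fin d), Antitone (hH.eigenvalues ∘ π) :=
    ⟨Tuple.sort (fun i => OrderDual.toDual (hH.eigenvalues i)),
      fun i j h => Tuple.monotone_sort (fun i => OrderDual.toDual (hH.eigenvalues i)) h⟩
  let Q : Matrix (Fin d) (Fin d) ℝ := U.submatrix id π
  have hQ : Qᵀ * Q = 1 := by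
    have : Qᵀ * Q = (Uᵀ * U).submatrix π π := by
      ext i j; simp [Q, Matrix.mul_apply]
    rw [this, hU]; simp
  have hMQ : M * Q = Q * Matrix.diagonal (hH.eigenvalues ∘ π) := by
    have h1 : M * U = U * Matrix.diagonal hH.eigenvalues := by
      conv_lhs => rw [hspec]
      rw [Matrix.mul_assoc, hU, Matrix.mul_one]
    ext i j
    have := congrFun (congrFun h1 i) (π j)
    rw [Matrix.mul_diagonal] at this ⊢
    simpa [Q, Matrix.mul_apply] using this
  have hdiag : (fun i => (Qᵀ * M * Q) i i) = hH.eigenvalues ∘ π := by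
    rw [Matrix.mul_assoc, hMQ, ← Matrix.mul_assoc, hQ, Matrix.one_mul]
    ext i; simp
  exact ⟨Q, hQ, by rw [hdiag]; exact hMQ, by rw [hdiag]; exact hπ⟩

theorem exists_measurable_eigen (d : ℕ) : ∃ Q : (Fin d → Fin d → ℝ) → Fin d → Fin d → ℝ,
    Measurable Q ∧ ∀ M : Matrix (Fin d) (Fin d) ℝ, M.IsSymm →
      (Matrix.of (Q M))ᵀ * Matrix.of (Q M) = 1 ∧
      M * Matrix.of (Q M) = Matrix.of (Q M) *
        Matrix.diagonal (fun i => ((Matrix.of (Q M))ᵀ * M * Matrix.of (Q M)) i i) ∧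
      Antitone fun i => ((Matrix.of (Q M))ᵀ * M * Matrix.of (Q M)) i i := by
  let Y := Fin d → Fin d → Set.Icc (-1 : ℝ) 1
  let T : Y → Matrix (Fin d) (Fin d) ℝ := fun y => Matrix.of fun i j => (y i j : ℝ)
  have hT : Continuous T := by
    refine continuous_pi fun i => continuous_pi fun j => ?_
    exact continuous_subtype_val.comp ((continuous_apply j).comp (continuous_apply i))
  let Sy : (Fin d → Fin d → ℝ) → Matrix (Fin d) (Fin d) ℝ := fun M =>
    (2⁻¹ : ℝ) • (Matrix.of M + (Matrix.of M)ᵀ)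
  have hSy : Continuous Sy := by
    refine continuous_pi fun i => continuous_pi fun j => ?_
    simp only [Sy, Matrix.smul_apply, Matrix.add_apply, Matrix.of_apply, Matrix.transpose_apply]
    fun_prop
  have hSymm : ∀ M, (Sy M).IsSymm := by
    intro M; ext i j; simp [Sy, add_comm]
  have hSelf : ∀ M : Matrix (Fin d) (Fin d) ℝ, M.IsSymm → Sy M = M := by
    intro M hM; ext i j
    have := hM.apply i j
    change (2⁻¹ : ℝ) * (M i j + M j i) = M i j
    rw [this]
    ring
  have hD : Continuous fun z : (Fin d → Fin d → ℝ) × Y => (T z.2)ᵀ * Sy z.1 * T z.2 := by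
    have h1 : Continuous fun z : (Fin d → Fin d → ℝ) × Y => T z.2 := hT.comp continuous_snd
    have h2 : Continuous fun z : (Fin d → Fin d → ℝ) × Y => Sy z.1 := hSy.comp continuous_fst
    exact (h1.matrix_transpose.matrix_mul h2).matrix_mul h1
  let G : Set ((Fin d → Fin d → ℝ) × Y) := {z | (T z.2)ᵀ * T z.2 = 1 ∧
    Sy z.1 * T z.2 = T z.2 * Matrix.diagonal (fun i => ((T z.2)ᵀ * Sy z.1 * T z.2) i i) ∧
    Antitone fun i => ((T z.2)ᵀ * Sy z.1 * T z.2) i i}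
  have hG : IsClosed G := by
    have h1 : Continuous fun z : (Fin d → Fin d → ℝ) × Y => T z.2 := hT.comp continuous_snd
    have h2 : Continuous fun z : (Fin d → Fin d → ℝ) × Y => Sy z.1 := hSy.comp continuous_fst
    have hd : ∀ i, Continuous fun z : (Fin d → Fin d → ℝ) × Y =>
        ((T z.2)ᵀ * Sy z.1 * T z.2) i i := fun i =>
      (continuous_apply i).comp ((continuous_apply i).comp hD)
    refine IsClosed.inter (isClosed_eq (h1.matrix_transpose.matrix_mul h1) continuous_const)
      (IsClosed.inter (isClosed_eq (h2.matrix_mul h1) (h1.matrix_mul ?_)) ?_)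
    · exact (continuous_pi hd).matrix_diagonal
    · have : {z : (Fin d → Fin d → ℝ) × Y | Antitone fun i => ((T z.2)ᵀ * Sy z.1 * T z.2) i i} =
          ⋂ i, ⋂ j, ⋂ (_ : i ≤ j), {z | ((T z.2)ᵀ * Sy z.1 * T z.2) j j ≤
            ((T z.2)ᵀ * Sy z.1 * T z.2) i i} := by
        ext z
        simp only [Set.mem_ofPred_eq, Set.mem_iInter]
        exact ⟨fun h i j hij => h hij, fun h i j hij => h i j hij⟩
      change IsClosed {z : (Fin d → Fin d → ℝ) × Y |
        Antitone fun i => ((T z.2)ᵀ * Sy z.1 * T z.2) i i}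
      rw [this]
      exact isClosed_iInter fun i => isClosed_iInter fun j => isClosed_iInter fun _ =>
        isClosed_le (hd j) (hd i)
  have : Nonempty Y := ⟨fun _ _ => ⟨0, by norm_num⟩⟩
  obtain ⟨f, hf, hfG⟩ := exists_measurable_selection_compact G hG (fun M => by
    obtain ⟨Q, hQ, h2, h3⟩ := exists_eigen (Sy M) (hSymm M)
    have hb : ∀ i j, Q i j ∈ Set.Icc (-1 : ℝ) 1 := by
      intro i j
      have h := congrFun (congrFun hQ j) j
      simp only [Matrix.mul_apply, Matrix.transpose_apply, Matrix.one_apply_eq] at h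
      have h' : Q i j * Q i j ≤ 1 := by
        rw [← h]
        exact Finset.single_le_sum (f := fun x => Q x j * Q x j)
          (fun x _ => mul_self_nonneg _) (Finset.mem_univ i)
      exact abs_le.1 (abs_le_one_iff_mul_self_le_one.2 h')
    have hTQ : T (fun i j => ⟨Q i j, hb i j⟩) = Q := by ext i j; rfl
    refine ⟨fun i j => ⟨Q i j, hb i j⟩, ?_⟩
    change _ ∧ _ ∧ _
    simp only [hTQ]
    exact ⟨hQ, h2, h3⟩)
  refine ⟨fun M i j => (f M i j : ℝ), ?_, fun M hM => ?_⟩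
  · refine measurable_pi_lambda _ fun i => measurable_pi_lambda _ fun j => ?_
    exact measurable_subtype_coe.comp
      ((measurable_pi_apply j).comp ((measurable_pi_apply i).comp hf))
  · have h : (T (f M))ᵀ * T (f M) = 1 ∧
      Sy M * T (f M) = T (f M) * Matrix.diagonal (fun i => ((T (f M))ᵀ * Sy M * T (f M)) i i) ∧
      Antitone fun i => ((T (f M))ᵀ * Sy M * T (f M)) i i := hfG M
    rw [hSelf M hM] at h
    exact h

/-- A measurable eigenvalue routine exists. -/
theorem EigenSolver.nonempty : Nonempty EigenSolver := by
  choose Q hQm hQ using exists_measurable_eigen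
  refine ⟨{ val := fun d M i => ((Matrix.of (Q d M))ᵀ * Matrix.of M * Matrix.of (Q d M)) i i
            vec := Q
            measurable_val := fun d => ?_
            measurable_vec := hQm
            orthonormal := fun d M hM => (hQ d M hM).1
            eigen := fun d M hM => (hQ d M hM).2.1
            antitone := fun d M hM => (hQ d M hM).2.2 }⟩
  refine measurable_pi_lambda _ fun i => ?_
  have hq : ∀ a b, Measurable fun M : Fin d → Fin d → ℝ => Q d M a b := fun a b =>
    (measurable_pi_apply b).comp ((measurable_pi_apply a).comp (hQm d))
  have hm : ∀ a b, Measurable fun M : Fin d → Fin d → ℝ => M a b := fun a b =>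
    (measurable_pi_apply b).comp (measurable_pi_apply a)
  simp only [Matrix.mul_apply, Matrix.transpose_apply, Matrix.of_apply]
  exact Finset.measurable_sum _ fun x _ =>
    (Finset.measurable_sum _ fun y _ => (hq y i).mul (hm y x)).mul (hq x i)

def NExp.eval (s : State) : NExp → ℕ
  | .lit c => c
  | .get a e => s.nat a (e.eval s)
  | .plus e f => e.eval s + f.eval s
  | .minus e f => e.eval s - f.eval s
  | .half e => e.eval s / 2

/-- Every node of an expression costs one operation. -/
def NExp.cost : NExp → ℕ
  | .lit _ => 1
  | .get _ e => e.cost + 1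
  | .plus e f => e.cost + f.cost + 1
  | .minus e f => e.cost + f.cost + 1
  | .half e => e.cost + 1

noncomputable def RExp.eval (s : State) : RExp → ℝ
  | .ofNat e => (e.eval s : ℝ)
  | .get a e f => s.real a (e.eval s) (f.eval s)
  | .plus x y => x.eval s + y.eval s
  | .minus x y => x.eval s - y.eval s
  | .times x y => x.eval s * y.eval s
  | .quot x y => x.eval s / y.eval s
  | .sqrt x => Real.sqrt (x.eval s)

def RExp.cost : RExp → ℕ
  | .ofNat e => e.cost + 1
  | .get _ e f => e.cost + f.cost + 1
  | .plus x y => x.cost + y.cost + 1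
  | .minus x y => x.cost + y.cost + 1
  | .times x y => x.cost + y.cost + 1
  | .quot x y => x.cost + y.cost + 1
  | .sqrt x => x.cost + 1

def Test.holds (s : State) : Test → Prop
  | .nle e f => e.eval s ≤ f.eval s
  | .rle x y => x.eval s ≤ y.eval s

def Test.cost : Test → ℕ
  | .nle e f => e.cost + f.cost + 1
  | .rle x y => x.cost + y.cost + 1

def State.tick (s : State) (t : ℕ) : State := { s with clock := s.clock + t }

def State.setN (s : State) (a i v : ℕ) : State :=
  { s with nat := fun a' i' => if a' = a ∧ i' = i then v else s.nat a' i' }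

noncomputable def State.setR (s : State) (a i j : ℕ) (v : ℝ) : State :=
  { s with real := fun a' i' j' => if a' = a ∧ i' = i ∧ j' = j then v else s.real a' i' j' }

/-- Eigenvalue `j` goes to entry `(0, j)` of the array `lam`, and entry `i` of the `j`-th
eigenvector to entry `(i, j)` of the array `vec`. -/
noncomputable def State.eig (S : EigenSolver) (s : State) (M d lam vec : ℕ) : State :=
  let B : Fin d → Fin d → ℝ := fun i j => s.real M i j
  { s with real := fun a i j =>
      if h : a = vec ∧ i < d ∧ j < d then S.vec d B ⟨i, h.2.1⟩ ⟨j, h.2.2⟩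
      else if h : a = lam ∧ i = 0 ∧ j < d then S.val d B ⟨j, h.2.2⟩
      else s.real a i j }

open Classical in
/-- Execution of a program. Elementary operations cost one unit each, the eigenvalue decomposition
of a `d × d` matrix costs `d ^ 3`. -/
noncomputable def Cmd.exec (S : EigenSolver) (ω : Tape) : Cmd → State → State
  | .skip, s => s.tick 1
  | .setN a e v, s => (s.setN a (e.eval s) (v.eval s)).tick (e.cost + v.cost + 1)
  | .setR a e f v, s =>
      (s.setR a (e.eval s) (f.eval s) (v.eval s)).tick (e.cost + f.cost + v.cost + 1)
  | .gauss a e f, s =>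
      { (s.setR a (e.eval s) (f.eval s) (ω.1 s.gaussUsed)).tick (e.cost + f.cost + 1) with
        gaussUsed := s.gaussUsed + 1 }
  | .unif a e f, s =>
      { (s.setR a (e.eval s) (f.eval s) (ω.2 s.unifUsed : ℝ)).tick (e.cost + f.cost + 1) with
        unifUsed := s.unifUsed + 1 }
  | .eig M e lam vec, s => (s.eig S M (e.eval s) lam vec).tick (e.cost + (e.eval s) ^ 3 + 1)
  | .seq c d, s => d.exec S ω (c.exec S ω s)
  | .ite t c d, s =>
      if t.holds s then c.exec S ω (s.tick (t.cost + 1)) else d.exec S ω (s.tick (t.cost + 1))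
  | .loop x e c, s =>
      Nat.rec (s.tick (e.cost + 1)) (fun i s' => c.exec S ω ((s'.setN x 0 i).tick 1)) (e.eval s)

/-- The initial memory: `m, n, k, ρ` in the natural-number array `0`, the matrix `A` in the real
array `0`, the number `ε` in entry `(0, 0)` of the real array `1`, and zero elsewhere. -/
noncomputable def inputState {m n : ℕ} (A : Matrix (Fin m) (Fin n) ℝ) (k ρ : ℕ) (ε : ℝ) :
    State where
  nat a i :=
    if a = 0 then (if i = 0 then m else if i = 1 then n else if i = 2 then k
      else if i = 3 then ρ else 0) else 0
  real a i j :=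
    if a = 0 then (if h : i < m ∧ j < n then A ⟨i, h.1⟩ ⟨j, h.2⟩ else 0)
    else if a = 1 ∧ i = 0 ∧ j = 0 then ε else 0
  gaussUsed := 0
  unifUsed := 0
  clock := 0

/-- The final memory of a program that is run on the input `(A, k, ρ, ε)`. -/
noncomputable def Cmd.final (P : Cmd) (S : EigenSolver) (ω : Tape) {m n : ℕ}
    (A : Matrix (Fin m) (Fin n) ℝ) (k ρ : ℕ) (ε : ℝ) : State :=
  P.exec S ω (inputState A k ρ ε)

/-- The output, a list of row indices: its length is entry `0` of the natural-number array `1`,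
its items are the first entries of the natural-number array `2`. -/
def State.output (s : State) : List ℕ := (List.range (s.nat 1 0)).map (s.nat 2)

end RealRAM

/-! ## The three steps of fast row selection -/

/-- The matrix `∑ i < τ, t i • v_{j i} v_{j i}ᵀ` before iteration `τ` of dual set sparsification. -/
def dualSetMatrix {N k : ℕ} (v : Fin N → Fin k → ℝ) (j : ℕ → Fin N) (t : ℕ → ℝ) (τ : ℕ) :
    Matrix (Fin k) (Fin k) ℝ :=
  ∑ i ∈ Finset.range τ, t i • Matrix.vecMulVec (v (j i)) (v (j i))

theorem dualSetMatrix_isHermitian {N k : ℕ} (v : Fin N → Fin k → ℝ) (j : ℕ → Fin N) (t : ℕ → ℝ)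
    (τ : ℕ) : (dualSetMatrix v j t τ).IsHermitian := by
  ext a b
  simp only [dualSetMatrix, Matrix.conjTranspose_apply, Matrix.sum_apply, Matrix.smul_apply,
    Matrix.vecMulVec_apply, star_trivial, smul_eq_mul]
  exact Finset.sum_congr rfl fun i _ => by ring

/-- The barrier function `φ(L, M) = ∑ i, (λ_i(M) - L)⁻¹`. -/
noncomputable def barrier {k : ℕ} (L : ℝ) {M : Matrix (Fin k) (Fin k) ℝ} (hM : M.IsHermitian) : ℝ :=
  ∑ i, (hM.eigenvalues i - L)⁻¹

/-- `s` is a vector of weights that can be returned by deterministic dual set spectral-Frobenius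
sparsification with input vectors `x i ∈ ℝˡ`, `v i ∈ ℝᵏ` and `r` iterations. In iteration `τ` the
index `j τ` and the weight `t τ` are any ones that meet the two inequalities. -/
def IsDualSetOutput {N l k : ℕ} (x : Fin N → Fin l → ℝ) (v : Fin N → Fin k → ℝ) (r : ℕ)
    (s : Fin N → ℝ) : Prop :=
  k < r ∧ ∃ (j : ℕ → Fin N) (t : ℕ → ℝ),
    (∀ τ < r,
      let L : ℝ := τ - Real.sqrt (r * k)
      let M := dualSetMatrix v j t τ
      let hM : M.IsHermitian := dualSetMatrix_isHermitian v j t τ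
      let δ : ℝ := (∑ i, x i ⬝ᵥ x i) / (1 - Real.sqrt (k / r))
      let W : Matrix (Fin k) (Fin k) ℝ := (M - (L + 1) • (1 : Matrix (Fin k) (Fin k) ℝ))⁻¹
      0 < t τ ∧
      δ⁻¹ * (x (j τ) ⬝ᵥ x (j τ)) ≤ (t τ)⁻¹ ∧
      (t τ)⁻¹ ≤ (v (j τ) ⬝ᵥ ((W * W) *ᵥ v (j τ))) / (barrier (L + 1) hM - barrier L hM)
        - v (j τ) ⬝ᵥ (W *ᵥ v (j τ))) ∧
    ∀ i, s i = (1 - Real.sqrt (k / r)) / r *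
      ∑ τ ∈ Finset.range r, if j τ = i then t τ else 0

/-- The `n × ℓ` matrix filled row by row with the numbers `g 0, g 1, …`. -/
def sketchMatrix (n ℓ : ℕ) (g : ℕ → ℝ) : Matrix (Fin n) (Fin ℓ) ℝ :=
  Matrix.of fun i j => g (i * ℓ + j)

/-- `U`, `σ`, `V` is an approximate truncated SVD of `A` by random projection: the truncated SVD
of the projection of `A` onto the column space of the sketch `A * Ω`. -/
def IsRandomizedSVD {m n k : ℕ} (A : Matrix (Fin m) (Fin n) ℝ) (ℓ : ℕ) (g : ℕ → ℝ)
    (U : Matrix (Fin m) (Fin k) ℝ) (σ : Fin k → ℝ) (V : Matrix (Fin n) (Fin k) ℝ) : Prop :=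
  let Y := A * sketchMatrix n ℓ g
  IsTruncatedSVD (Y * pinv Y * A) U σ V

/-- `l` arises from `R₁` by adaptive sampling: with `B = A - A R₁† R₁` and
`p i = ‖b_i‖² / ‖B‖_F²` for the rows `b_i` of `B`, item `t` of `l` is drawn from the distribution
`p` by inversion of its distribution function at the number `u t`. (If `B = 0` then there is no
distribution `p`, and the items are arbitrary.) -/
def IsAdaptiveSample {m n r₁ : ℕ} (A : Matrix (Fin m) (Fin n) ℝ)
    (R₁ : Matrix (Fin r₁) (Fin n) ℝ) (u : ℕ → ℝ) (l : List (Fin m)) : Prop :=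
  let B := A - A * pinv R₁ * R₁
  let p : Fin m → ℝ := fun i => (∑ j, B i j ^ 2) / ‖B‖ ^ 2
  B ≠ 0 → ∀ t : Fin l.length,
    ∑ i ∈ Finset.Iio (l.get t), p i ≤ u t ∧ u t < ∑ i ∈ Finset.Iic (l.get t), p i

/-- `out` lists the rows selected from `A` by randomized SVD with `ℓ` Gaussian test vectors, dual
set sparsification with `r₁` iterations and adaptive sampling of `r₂` rows, with random numbers
`ω`. -/
def IsFastRowSelection {m n : ℕ} (A : Matrix (Fin m) (Fin n) ℝ) (k ℓ r₁ r₂ : ℕ)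
    (ω : RealRAM.Tape) (out : List ℕ) : Prop :=
  ∃ (U : Matrix (Fin m) (Fin k) ℝ) (σ : Fin k → ℝ) (V : Matrix (Fin n) (Fin k) ℝ)
    (s : Fin m → ℝ) (l₁ l₂ : List (Fin m)),
    IsRandomizedSVD A ℓ ω.1 U σ V ∧
    IsDualSetOutput (fun i => (A - U * Matrix.diagonal σ * Vᵀ) i) (fun i => U i) r₁ s ∧
    l₁.Nodup ∧ (∀ i, i ∈ l₁ ↔ s i ≠ 0) ∧
    l₂.length = r₂ ∧
    IsAdaptiveSample A (selectRows A (l₁.map Fin.val)) (fun t => (ω.2 t : ℝ)) l₂ ∧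
    out = (l₁ ++ l₂).map Fin.val

/-!
The rows come from three steps whose errors multiply. Let `P` be the orthogonal projection onto the
column space of `C`, of rank `ρ`.

* *Sketch.* A Gaussian sketch with `ℓ` columns gives `U`, `Σ`, `V` such that the mean of
  `‖A - U Σ Vᵀ‖²` is at most `(1 + k / (ℓ - k - 1)) ‖A - A_k‖²`. For every sketch the excess error
  is at most the image of `A - A_k` under a pseudoinverse of the sketch
  (`IsTruncatedSVD.randomized_error_le`). In coordinates that extend the right singular vectors of
  `A_k` the sketch is again Gaussian, with independent blocks, and the mean of this image reduces to
  the trace of an inverse Gram matrix of Gaussian rows, that is, to the mean of an inverse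
  chi-squared variable (`gaussian_sketch`).
* *Sparsification.* The two-barrier argument shows that every iteration finds an admissible row. The
  potential stays at most its initial value and the barrier `L_τ` stays below the spectrum of `M_τ`,
  so that the final weights satisfy a lower spectral and an upper trace bound
  (`IsDualSetOutput.bounds`). Such weights certify
  `‖A - A R₁† R₁‖² ≤ (1 + 1 / (1 - √(k / r₁))²) ‖A - U Σ Vᵀ‖²`
  (`frobenius_sub_mul_proj_le_of_weights`).
* *Adaptive sampling.* The importance weighted average of the `r₂` drawn rows is an unbiased
  estimator of `P (A - A R₁† R₁)`, and its rows lie in the row space of `R`. Its variance shows that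
  the mean of `‖A - P A R† R‖²` is at most `‖A - P A‖² + (ρ / r₂) ‖A - A R₁† R₁‖²`
  (`lintegral_adaptive_error_le`).

With `s` the least integer that is at least `ε ^ (-1 / 3)`, the choices `ℓ = k + 1 + k s²` and
`r₁ = 4 k s²` bound the product of the first two factors by `2 (1 + 4 / s)`, so that
`r₂ ≈ (2 ρ / ε) (1 + 4 / s)` draws suffice (`error_factor_le`). As `r₁` is of order
`k ε ^ (-2 / 3)`, the total is `(2 ρ / ε) (1 + O(ε ^ (1 / 3)))`.

The program avoids pseudoinverses: projections are computed by Gram–Schmidt orthogonalisation, the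
truncated singular value decomposition comes from the eigenvalue decomposition of the small matrix
`Q A (Q A)ᵀ` with `Q` an orthonormal basis of the range of the sketch, and a row is drawn by
bisection in the array of cumulative weights. If `ε m < 2 ρ`, it outputs all rows of `A`, for which
the error is `‖A - P A‖²` exactly. Correctness and running time are proved together: `RunW` bounds
the number of passes through the innermost loops and the cost of the eigenvalue decompositions, up
to a factor that depends only on the command. The first two steps read the normal variables only, so
that the expectation is an iterated integral, over the uniform variables inside and over the normal
ones outside (`lintegral_selection_error_le`).
-/

/-! ### Standard Gaussian vectors -/

/-- The law of a vector with independent standard normal entries. -/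
noncomputable abbrev stdNormal (ι : Type*) [Fintype ι] : Measure (ι → ℝ) :=
  Measure.pi fun _ => gaussianReal 0 1

/-- An orthogonal transformation preserves the standard normal law. -/
theorem stdNormal_map_mulVec {ι : Type*} [Fintype ι] [DecidableEq ι] (O : Matrix ι ι ℝ)
    (hO : Oᵀ * O = 1) : (stdNormal ι).map (fun x => O *ᵥ x) = stdNormal ι := by
  have hon : Orthonormal ℝ
      (fun i : ι => (WithLp.toLp 2 (fun a => O a i) : EuclideanSpace ℝ ι)) := by
    rw [orthonormal_iff_ite]
    intro i j
    have := congrFun (congrFun hO i) j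
    simp only [Matrix.mul_apply, Matrix.transpose_apply, Matrix.one_apply] at this
    simp [PiLp.inner_apply, ← this, mul_comm]
  obtain ⟨b, hb⟩ := Orthonormal.exists_orthonormalBasis_extension_of_card_eq (𝕜 := ℝ)
    (E := EuclideanSpace ℝ ι) (ι := ι) (by simp) (s := Set.univ)
    (v := fun i : ι => (WithLp.toLp 2 (fun a => O a i) : EuclideanSpace ℝ ι))
    (hon.comp _ Subtype.val_injective)
  have h1 := stdGaussian_eq_map_pi_orthonormalBasis b
  rw [← map_pi_eq_stdGaussian] at h1
  have h2 : (fun x : ι → ℝ => ∑ i, x i • b i) = fun x => WithLp.toLp 2 (O *ᵥ x) := by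
    funext x
    ext a
    simp [hb, Matrix.mulVec, dotProduct, mul_comm]
  rw [h2] at h1
  have h3 := congrArg (fun μ : Measure (EuclideanSpace ℝ ι) => μ.map (WithLp.ofLp)) h1
  simp only at h3
  rw [Measure.map_map (by fun_prop) (by fun_prop), Measure.map_map (by fun_prop)
    (by have : Measurable fun x : ι → ℝ => O *ᵥ x := by
          unfold Matrix.mulVec dotProduct; fun_prop
        fun_prop)] at h3
  have e1 : (WithLp.ofLp ∘ WithLp.toLp 2 : (ι → ℝ) → (ι → ℝ)) = id := rfl
  have e2 : (WithLp.ofLp ∘ fun x => WithLp.toLp 2 (O *ᵥ x) : (ι → ℝ) → (ι → ℝ)) =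
    fun x => O *ᵥ x := rfl
  rw [e1, e2, Measure.map_id] at h3
  exact h3.symm

/-- Reading off distinct coordinates of a standard normal vector yields one. -/
theorem stdNormal_map_comp {ι κ : Type*} [Fintype ι] [Fintype κ] {f : κ → ι}
    (hf : Function.Injective f) : (stdNormal ι).map (fun x i => x (f i)) = stdNormal κ := by
  rw [stdNormal, stdNormal, ← Measure.infinitePi_eq_pi, ← Measure.infinitePi_eq_pi]
  exact Measure.map_infinitePi_infinitePi_of_inj (P := fun _ : ι => gaussianReal 0 1) hf

open Classical in
/-- `x` on the coordinates with property `p`, and `y` on the others. -/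
noncomputable def mergeOn {ι : Type*} (p : ι → Prop) (x y : ι → ℝ) : ι → ℝ :=
  fun i => if p i then x i else y i

theorem measurable_mergeOn {ι : Type*} (p : ι → Prop) :
    Measurable fun z : (ι → ℝ) × (ι → ℝ) => mergeOn p z.1 z.2 := by
  refine measurable_pi_lambda _ fun i => ?_
  unfold mergeOn
  split_ifs <;> fun_prop

theorem stdNormal_map_mergeOn {ι : Type*} [Fintype ι] (p : ι → Prop) :
    ((stdNormal ι).prod (stdNormal ι)).map (fun z => mergeOn p z.1 z.2) = stdNormal ι := by
  classical
  refine (Measure.pi_eq fun s hs => ?_).symm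
  rw [Measure.map_apply (measurable_mergeOn p) (MeasurableSet.univ_pi hs)]
  have : (fun z : (ι → ℝ) × (ι → ℝ) => mergeOn p z.1 z.2) ⁻¹' Set.univ.pi s =
      (Set.univ.pi fun i => if p i then s i else Set.univ) ×ˢ
        (Set.univ.pi fun i => if p i then Set.univ else s i) := by
    ext z
    simp only [Set.mem_preimage, Set.mem_pi, Set.mem_univ, true_implies, Set.mem_prod, mergeOn]
    constructor
    · intro h
      refine ⟨fun i => ?_, fun i => ?_⟩
      · have := h i
        by_cases hp : p i <;> simp_all
      · have := h i
        by_cases hp : p i <;> simp_all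
    · rintro ⟨h1, h2⟩ i
      by_cases hp : p i
      · simpa [hp] using h1 i
      · simpa [hp] using h2 i
  rw [this, Measure.prod_prod, Measure.pi_pi, Measure.pi_pi, ← Finset.prod_mul_distrib]
  refine Finset.prod_congr rfl fun i _ => ?_
  by_cases hp : p i <;> simp [hp]

theorem lintegral_stdNormal_eq_mergeOn {ι : Type*} [Fintype ι] (p : ι → Prop)
    {f : (ι → ℝ) → ENNReal} (hf : Measurable f) :
    ∫⁻ x, f x ∂(stdNormal ι) =
      ∫⁻ x, ∫⁻ y, f (mergeOn p x y) ∂(stdNormal ι) ∂(stdNormal ι) := by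
  conv_lhs => rw [← stdNormal_map_mergeOn p]
  rw [lintegral_map hf (measurable_mergeOn p)]
  exact lintegral_prod _ (hf.comp (measurable_mergeOn p)).aemeasurable

theorem ae_stdNormal_of_ae_mergeOn {ι : Type*} [Fintype ι] (p : ι → Prop)
    {P : (ι → ℝ) → Prop} (hP : MeasurableSet {x | P x})
    (h : ∀ᵐ x ∂(stdNormal ι), ∀ᵐ y ∂(stdNormal ι), P (mergeOn p x y)) :
    ∀ᵐ x ∂(stdNormal ι), P x := by
  rw [← stdNormal_map_mergeOn p, ae_map_iff (measurable_mergeOn p).aemeasurable hP]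
  exact (Measure.ae_prod_iff_ae_ae (measurable_mergeOn p hP)).2 h

/-- The Laplace transform of the square of a standard normal variable. -/
theorem lintegral_exp_neg_mul_sq {t : ℝ} (ht : 0 < t) :
    ∫⁻ x, ENNReal.ofReal (Real.exp (-t * x ^ 2)) ∂(gaussianReal 0 1) =
      ENNReal.ofReal ((1 + 2 * t) ^ (-(1 / 2) : ℝ)) := by
  have hint : Integrable (fun x : ℝ => Real.exp (-t * x ^ 2)) (gaussianReal 0 1) := by
    refine Integrable.mono' (integrable_const (1 : ℝ)) (by fun_prop) (ae_of_all _ fun x => ?_)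
    rw [Real.norm_of_nonneg (Real.exp_nonneg _), Real.exp_le_one_iff]
    nlinarith [sq_nonneg x]
  rw [← ofReal_integral_eq_lintegral_ofReal hint (ae_of_all _ fun x => Real.exp_nonneg _),
    integral_gaussianReal_eq_integral_smul one_ne_zero]
  congr 1
  have : ∀ x : ℝ, gaussianPDFReal 0 1 x • Real.exp (-t * x ^ 2) =
      (√(2 * Real.pi))⁻¹ * Real.exp (-(t + 1 / 2) * x ^ 2) := by
    intro x
    rw [gaussianPDFReal, smul_eq_mul, mul_assoc, ← Real.exp_add]
    simp only [NNReal.coe_one, mul_one, sub_zero]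
    congr 2
    ring
  simp_rw [this]
  rw [integral_const_mul, integral_gaussian, Real.rpow_neg (by positivity),
    ← Real.sqrt_eq_rpow, ← Real.sqrt_inv, ← Real.sqrt_inv, ← Real.sqrt_mul (by positivity)]
  congr 1
  field_simp
  ring

theorem lintegral_exp_neg_mul_Ioi {a : ℝ} (ha : 0 < a) :
    ∫⁻ t in Set.Ioi (0 : ℝ), ENNReal.ofReal (Real.exp (-t * a)) = (ENNReal.ofReal a)⁻¹ := by
  have h1 := integral_exp_mul_Ioi (a := -a) (by linarith) 0
  have h2 : IntegrableOn (fun t : ℝ => Real.exp (-a * t)) (Set.Ioi 0) :=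
    integrableOn_exp_mul_Ioi (by linarith) 0
  have : ∀ t : ℝ, Real.exp (-t * a) = Real.exp (-a * t) := fun t => by ring_nf
  simp_rw [this]
  rw [← ofReal_integral_eq_lintegral_ofReal h2 (ae_of_all _ fun x => Real.exp_nonneg _), h1,
    ← ENNReal.ofReal_inv_of_pos ha]
  congr 1
  simp

theorem lintegral_one_add_two_mul_rpow {d : ℕ} (hd : 3 ≤ d) :
    ∫⁻ t in Set.Ioi (0 : ℝ), ENNReal.ofReal ((1 + 2 * t) ^ (-(d / 2) : ℝ)) =
      ENNReal.ofReal (1 / ((d : ℝ) - 2)) := by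
  have hd' : (3 : ℝ) ≤ d := by exact_mod_cast hd
  have hder : ∀ t ∈ Set.Ici (0 : ℝ), HasDerivAt
      (fun t : ℝ => -(1 / ((d : ℝ) - 2)) * (1 + 2 * t) ^ (1 - d / 2 : ℝ))
      ((1 + 2 * t) ^ (-(d / 2) : ℝ)) t := by
    intro t ht
    have ht : (0 : ℝ) ≤ t := ht
    have h1 : HasDerivAt (fun t : ℝ => 1 + 2 * t) 2 t := by
      simpa using ((hasDerivAt_id t).const_mul 2).const_add 1
    have h2 := (h1.rpow_const (p := (1 - d / 2 : ℝ)) (Or.inl (by positivity))).const_mul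
      (-(1 / ((d : ℝ) - 2)))
    convert! h2 using 1
    rw [show (1 - d / 2 - 1 : ℝ) = -(d / 2) by ring]
    have : (d : ℝ) - 2 ≠ 0 := by linarith
    field_simp
    ring
  have hlim : Tendsto (fun t : ℝ => -(1 / ((d : ℝ) - 2)) * (1 + 2 * t) ^ (1 - d / 2 : ℝ)) atTop
      (𝓝 (-(1 / ((d : ℝ) - 2)) * 0)) := by
    refine Tendsto.const_mul _ ?_
    have h1 : Tendsto (fun t : ℝ => 1 + 2 * t) atTop atTop :=
      tendsto_atTop_add_const_left _ _ (tendsto_id.const_mul_atTop (by norm_num))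
    have h2 := (tendsto_rpow_neg_atTop (y := (d / 2 - 1 : ℝ)) (by linarith)).comp h1
    simpa [Function.comp_def] using h2
  have hpos : ∀ t ∈ Set.Ioi (0 : ℝ), 0 ≤ (1 + 2 * t) ^ (-(d / 2) : ℝ) := fun t ht =>
    Real.rpow_nonneg (by have : (0 : ℝ) < t := ht; positivity) _
  have hint := integrableOn_Ioi_deriv_of_nonneg' hder hpos hlim
  have hval := integral_Ioi_of_hasDerivAt_of_nonneg' hder hpos hlim
  rw [← ofReal_integral_eq_lintegral_ofReal hint
    ((ae_restrict_iff' measurableSet_Ioi).2 (ae_of_all _ hpos)), hval]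
  congr 1
  simp

/-- The mean of the inverse of a chi-squared variable with `d ≥ 3` degrees of freedom is at most
`1 / (d - 2)`. In particular such a variable is almost surely not zero. -/
theorem lintegral_inv_sum_sq_le {ι : Type*} [Fintype ι] (s : Finset ι) (hs : 3 ≤ s.card) :
    ∫⁻ x, (ENNReal.ofReal (∑ i ∈ s, x i ^ 2))⁻¹ ∂(stdNormal ι) ≤
      ENNReal.ofReal (1 / ((s.card : ℝ) - 2)) := by
  have key : ∀ x : ι → ℝ, (ENNReal.ofReal (∑ i ∈ s, x i ^ 2))⁻¹ =
      ∫⁻ t in Set.Ioi (0 : ℝ), ENNReal.ofReal (Real.exp (-t * ∑ i ∈ s, x i ^ 2)) := by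
    intro x
    rcases (Finset.sum_nonneg fun i (_ : i ∈ s) => sq_nonneg (x i)).eq_or_lt with h | h
    · simp [← h]
    · exact (lintegral_exp_neg_mul_Ioi h).symm
  simp_rw [key]
  rw [lintegral_lintegral_swap (by
    refine Measurable.aemeasurable ?_
    simp only [Function.uncurry_def]
    fun_prop)]
  rw [← lintegral_one_add_two_mul_rpow hs]
  refine (setLIntegral_congr_fun measurableSet_Ioi fun t ht => ?_).le
  have ht : 0 < t := ht
  have h1 : ∀ x : ι → ℝ, ENNReal.ofReal (Real.exp (-t * ∑ i ∈ s, x i ^ 2)) =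
      ∏ i ∈ s, ENNReal.ofReal (Real.exp (-t * x i ^ 2)) := by
    intro x
    rw [← ENNReal.ofReal_prod_of_nonneg fun i _ => Real.exp_nonneg _, ← Real.exp_sum,
      Finset.mul_sum]
  simp_rw [h1]
  have hm : Measurable fun y : ℝ => ENNReal.ofReal (Real.exp (-t * y ^ 2)) := by fun_prop
  have hind : iIndepFun (fun (i : ι) (x : ι → ℝ) => ENNReal.ofReal (Real.exp (-t * x i ^ 2)))
      (stdNormal ι) := iIndepFun_pi (X := fun _ y => ENNReal.ofReal (Real.exp (-t * y ^ 2)))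
        fun i => hm.aemeasurable
  rw [lintegral_prod_eq_prod_lintegral_of_indepFun s _ hind fun i => by fun_prop]
  have h2 : ∀ i : ι, ∫⁻ x : ι → ℝ, ENNReal.ofReal (Real.exp (-t * x i ^ 2)) ∂(stdNormal ι) =
      ENNReal.ofReal ((1 + 2 * t) ^ (-(1 / 2) : ℝ)) := by
    intro i
    rw [← lintegral_exp_neg_mul_sq ht]
    exact (measurePreserving_eval (fun _ : ι => gaussianReal 0 1) i).lintegral_comp hm
  simp_rw [h2]
  rw [Finset.prod_const, ← ENNReal.ofReal_pow (by positivity), ← Real.rpow_natCast,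
    ← Real.rpow_mul (by positivity)]
  congr 2
  ring

/-! ### The Frobenius norm -/

theorem frobenius_sq {m n : ℕ} (A : Matrix (Fin m) (Fin n) ℝ) :
    ‖A‖ ^ 2 = ∑ i, ∑ j, A i j ^ 2 := by
  rw [Matrix.frobenius_norm_def, ← Real.sqrt_eq_rpow, Real.sq_sqrt (by positivity)]
  simp

theorem frobenius_sq_eq_trace {m n : ℕ} (A : Matrix (Fin m) (Fin n) ℝ) :
    ‖A‖ ^ 2 = (Aᵀ * A).trace := by
  rw [frobenius_sq, Finset.sum_comm]
  simp [Matrix.trace, Matrix.mul_apply, sq]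

theorem frobenius_sq_eq_trace' {m n : ℕ} (A : Matrix (Fin m) (Fin n) ℝ) :
    ‖A‖ ^ 2 = (A * Aᵀ).trace := by
  rw [frobenius_sq_eq_trace, Matrix.trace_mul_comm]

theorem frobenius_norm_transpose' {m n : ℕ} (A : Matrix (Fin m) (Fin n) ℝ) :
    ‖Aᵀ‖ ^ 2 = ‖A‖ ^ 2 := by
  rw [frobenius_sq_eq_trace, frobenius_sq_eq_trace', Matrix.transpose_transpose]

theorem frobenius_sq_add_of_transpose_mul {m n : ℕ} {A B : Matrix (Fin m) (Fin n) ℝ}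
    (h : Aᵀ * B = 0) : ‖A + B‖ ^ 2 = ‖A‖ ^ 2 + ‖B‖ ^ 2 := by
  have h' : Bᵀ * A = 0 := by
    rw [← Matrix.transpose_transpose (Bᵀ * A), Matrix.transpose_mul, Matrix.transpose_transpose, h,
      Matrix.transpose_zero]
  simp only [frobenius_sq_eq_trace, Matrix.transpose_add, Matrix.add_mul, Matrix.mul_add, h, h',
    add_zero, zero_add, Matrix.trace_add]

theorem frobenius_sq_add_of_mul_transpose {m n : ℕ} {A B : Matrix (Fin m) (Fin n) ℝ}
    (h : A * Bᵀ = 0) : ‖A + B‖ ^ 2 = ‖A‖ ^ 2 + ‖B‖ ^ 2 := by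
  rw [← frobenius_norm_transpose', ← frobenius_norm_transpose' A, ← frobenius_norm_transpose' B,
    Matrix.transpose_add]
  exact frobenius_sq_add_of_transpose_mul (by rwa [Matrix.transpose_transpose])

/-- The Pythagorean theorem for an orthogonal projection of the columns. -/
theorem frobenius_sq_proj_mul_le {m n : ℕ} {P : Matrix (Fin m) (Fin m) ℝ} (hs : Pᵀ = P)
    (hi : P * P = P) (A : Matrix (Fin m) (Fin n) ℝ) :
    ‖A - P * A‖ ^ 2 + ‖P * A‖ ^ 2 = ‖A‖ ^ 2 := by
  rw [← frobenius_sq_add_of_transpose_mul, sub_add_cancel]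
  rw [Matrix.transpose_sub, Matrix.transpose_mul, hs, Matrix.sub_mul, Matrix.mul_assoc,
    ← Matrix.mul_assoc P P, hi, sub_self]

theorem frobenius_sq_mul_proj_le {m n : ℕ} {P : Matrix (Fin n) (Fin n) ℝ} (hs : Pᵀ = P)
    (hi : P * P = P) (A : Matrix (Fin m) (Fin n) ℝ) :
    ‖A - A * P‖ ^ 2 + ‖A * P‖ ^ 2 = ‖A‖ ^ 2 := by
  have := frobenius_sq_proj_mul_le hs hi Aᵀ
  rw [← frobenius_norm_transpose', ← frobenius_norm_transpose' (A * P),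
    ← frobenius_norm_transpose' A, Matrix.transpose_sub, Matrix.transpose_mul, hs]
  exact this

/-! ### Gaussian matrices -/

theorem lintegral_sq_sum_stdNormal {ι : Type*} [Fintype ι] (c : ι → ℝ) :
    ∫⁻ y, ENNReal.ofReal ((∑ p, c p * y p) ^ 2) ∂(stdNormal ι) =
      ENNReal.ofReal (∑ p, c p ^ 2) := by
  have hL : ∀ p, MemLp (fun t : ℝ => c p * t) 2 (gaussianReal 0 1) := fun p =>
    (memLp_id_gaussianReal 2).const_mul (c p)
  have hLp : ∀ p, MemLp (fun y : ι → ℝ => c p * y p) 2 (stdNormal ι) := fun p =>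
    (hL p).comp_measurePreserving (measurePreserving_eval (fun _ : ι => gaussianReal 0 1) p)
  have hsum : MemLp (fun y : ι → ℝ => ∑ p, c p * y p) 2 (stdNormal ι) :=
    memLp_finsetSum _ fun p _ => hLp p
  have hmean : ∫ y, ∑ p, c p * y p ∂(stdNormal ι) = 0 := by
    rw [integral_finsetSum _ fun p _ => (hLp p).integrable (by norm_num)]
    refine Finset.sum_eq_zero fun p _ => ?_
    rw [integral_const_mul]
    have := integral_comp_eval (μ := fun _ : ι => gaussianReal 0 1) (i := p)
      (f := fun t : ℝ => t) (by fun_prop)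
    rw [show ∫ y : ι → ℝ, y p ∂(stdNormal ι) = 0 by rw [stdNormal, this]; simp, mul_zero]
  have hvar := variance_sum_pi (μ := fun _ : ι => gaussianReal 0 1) (X := fun p t => c p * t) hL
  have e : (∑ i, fun ω : ι → ℝ => c i * ω i) = fun ω => ∑ i, c i * ω i := by
    ext ω; simp
  rw [e] at hvar
  change Var[_; stdNormal ι] = _ at hvar
  rw [variance_of_integral_eq_zero hsum.1.aemeasurable hmean] at hvar
  rw [← ofReal_integral_eq_lintegral_ofReal hsum.integrable_sq (ae_of_all _ fun _ => sq_nonneg _),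
    hvar]
  congr 1
  refine Finset.sum_congr rfl fun p _ => ?_
  rw [variance_const_mul]
  have : Var[fun t : ℝ => t; gaussianReal 0 1] = 1 := by
    have := variance_id_gaussianReal (μ := 0) (v := 1)
    exact this
  rw [this, mul_one]

/-- Given a few vectors in `ℝˡ`, an orthonormal basis (the rows of `O`) of which all but a few
members (those in `s`) are orthogonal to these vectors. -/
theorem exists_orthogonal_of_family {ℓ : ℕ} {κ : Type*} [Fintype κ] (v : κ → Fin ℓ → ℝ)
    (h : Fintype.card κ ≤ ℓ) :
    ∃ (O : Matrix (Fin ℓ) (Fin ℓ) ℝ) (s : Finset (Fin ℓ)), Oᵀ * O = 1 ∧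
      s.card = ℓ - Fintype.card κ ∧ ∀ i ∈ s, ∀ a, O i ⬝ᵥ v a = 0 := by
  let S : Submodule ℝ (EuclideanSpace ℝ (Fin ℓ)) :=
    Submodule.span ℝ (Set.range fun a => (WithLp.toLp 2 (v a) : EuclideanSpace ℝ (Fin ℓ)))
  have hS : Module.finrank ℝ S ≤ Fintype.card κ := finrank_range_le_card _
  have hSo : ℓ - Fintype.card κ ≤ Module.finrank ℝ Sᗮ := by
    have := S.finrank_add_finrank_orthogonal
    rw [finrank_euclideanSpace_fin] at this
    omega
  have hSl : Module.finrank ℝ Sᗮ ≤ ℓ := by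
    have := Sᗮ.finrank_le
    rwa [finrank_euclideanSpace_fin] at this
  let u := stdOrthonormalBasis ℝ Sᗮ
  let w : Fin ℓ → EuclideanSpace ℝ (Fin ℓ) := fun i =>
    if h : (i : ℕ) < Module.finrank ℝ Sᗮ then (u ⟨i, h⟩ : EuclideanSpace ℝ (Fin ℓ)) else 0
  have hw : Orthonormal ℝ
      (({i : Fin ℓ | (i : ℕ) < Module.finrank ℝ Sᗮ} : Set (Fin ℓ)).domRestrict w) := by
    have h1 : Orthonormal ℝ fun i : Fin (Module.finrank ℝ Sᗮ) =>
        (u i : EuclideanSpace ℝ (Fin ℓ)) :=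
      u.orthonormal.comp_linearIsometry Sᗮ.subtypeₗᵢ
    have h2 := h1.comp (fun i : ({i : Fin ℓ | (i : ℕ) < Module.finrank ℝ Sᗮ} : Set (Fin ℓ)) =>
      (⟨i.1, i.2⟩ : Fin (Module.finrank ℝ Sᗮ))) (fun a b hab => by
        ext; simpa using hab)
    have h3 : ({i : Fin ℓ | (i : ℕ) < Module.finrank ℝ Sᗮ} : Set (Fin ℓ)).domRestrict w =
        fun i => (u ⟨i.1, i.2⟩ : EuclideanSpace ℝ (Fin ℓ)) := by
      funext i
      have := i.2
      simp only [Set.mem_ofPred_eq] at this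
      simp [Set.domRestrict, w, this]
    rw [h3]
    exact h2
  obtain ⟨b, hb⟩ := hw.exists_orthonormalBasis_extension_of_card_eq (𝕜 := ℝ) (ι := Fin ℓ) (by simp)
  let O : Matrix (Fin ℓ) (Fin ℓ) ℝ := Matrix.of fun i j => b i j
  have hO : O * Oᵀ = 1 := by
    ext i j
    have := orthonormal_iff_ite.1 b.orthonormal i j
    simp only [PiLp.inner_apply, RCLike.inner_apply, conj_trivial] at this
    simp [Matrix.mul_apply, O, Matrix.one_apply, ← this, mul_comm]
  refine ⟨O, Finset.univ.filter fun i => (i : ℕ) < ℓ - Fintype.card κ, mul_eq_one_comm.1 hO, ?_, ?_⟩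
  · rw [Fin.card_filter_val_lt]; omega
  · intro i hi a
    have hi : (i : ℕ) < ℓ - Fintype.card κ := by simpa using hi
    have hi' : (i : ℕ) < Module.finrank ℝ Sᗮ := by omega
    have h1 : b i ∈ Sᗮ := by
      rw [hb i hi']
      simp [w, hi']
    have h2 := Submodule.inner_right_of_mem_orthogonal
      (Submodule.subset_span (Set.mem_range_self a) : WithLp.toLp 2 (v a) ∈ S) h1
    simp only [PiLp.inner_apply, RCLike.inner_apply, conj_trivial] at h2
    simpa [dotProduct, O, mul_comm] using h2

theorem lintegral_inv_sum_sq_mulVec_le {ℓ : ℕ} (O : Matrix (Fin ℓ) (Fin ℓ) ℝ) (hO : Oᵀ * O = 1)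
    (s : Finset (Fin ℓ)) (hs : 3 ≤ s.card) :
    ∫⁻ y, (ENNReal.ofReal (∑ i ∈ s, (O i ⬝ᵥ y) ^ 2))⁻¹ ∂(stdNormal (Fin ℓ)) ≤
      ENNReal.ofReal (1 / ((s.card : ℝ) - 2)) := by
  refine le_trans (le_of_eq ?_) (lintegral_inv_sum_sq_le s hs)
  conv_rhs => rw [← stdNormal_map_mulVec O hO]
  rw [lintegral_map (by fun_prop) (by unfold Matrix.mulVec dotProduct; fun_prop)]
  rfl

/-- A standard normal vector almost surely avoids a given subspace of codimension at least
three. -/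
theorem ae_notMem_span {ℓ : ℕ} {κ : Type*} [Fintype κ] (v : κ → Fin ℓ → ℝ)
    (h : Fintype.card κ + 3 ≤ ℓ) :
    ∀ᵐ y ∂(stdNormal (Fin ℓ)), y ∉ Submodule.span ℝ (Set.range v) := by
  obtain ⟨O, s, hO, hs, hsv⟩ := exists_orthogonal_of_family v (by omega)
  have h1 := lintegral_inv_sum_sq_mulVec_le O hO s (by omega)
  have h2 := ae_lt_top (μ := stdNormal (Fin ℓ))
    (f := fun y => (ENNReal.ofReal (∑ i ∈ s, (O i ⬝ᵥ y) ^ 2))⁻¹)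
    (by unfold dotProduct; fun_prop) (h1.trans_lt ENNReal.ofReal_lt_top).ne
  filter_upwards [h2] with y hy hmem
  have : ∑ i ∈ s, (O i ⬝ᵥ y) ^ 2 = 0 := by
    refine Finset.sum_eq_zero fun i hi => ?_
    have : O i ⬝ᵥ y = 0 := by
      clear hy
      induction hmem using Submodule.span_induction with
      | mem x hx => obtain ⟨a, rfl⟩ := hx; exact hsv i hi a
      | zero => simp
      | add x z _ _ hx hz => rw [dotProduct_add, hx, hz, add_zero]
      | smul c x _ hx => rw [dotProduct_smul, hx, smul_zero]
    rw [this]; norm_num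
  rw [this] at hy
  simp at hy

/-- Distinct rows of a Gaussian matrix that is wide enough are almost surely linearly
independent. -/
theorem ae_linearIndependent_rows {n ℓ : ℕ} :
    ∀ {k : ℕ} (e : Fin k → Fin n), Function.Injective e → k + 2 ≤ ℓ →
    ∀ᵐ x ∂(stdNormal (Fin n × Fin ℓ)), LinearIndependent ℝ fun a j => x (e a, j) := by
  intro k
  induction k with
  | zero => intro e _ _; exact ae_of_all _ fun x => linearIndependent_empty_type
  | succ k ih =>
    intro e he hk
    have ih' := ih (fun a => e a.castSucc) (he.comp (Fin.castSucc_injective k)) (by omega)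
    refine ae_stdNormal_of_ae_mergeOn (fun q => q.1 ≠ e (Fin.last k)) ?_ ?_
    · have h1 : IsOpen {f : Fin (k + 1) → Fin ℓ → ℝ | LinearIndependent ℝ f} :=
        isOpen_setOfPred_linearIndependent
      exact (h1.preimage (f := fun (x : Fin n × Fin ℓ → ℝ) a j => x (e a, j))
        (by fun_prop)).measurableSet
    · filter_upwards [ih'] with x hx
      have h2 := ae_notMem_span (fun (a : Fin k) j => x (e a.castSucc, j)) (by simp; omega)
      rw [← stdNormal_map_comp (f := fun j : Fin ℓ => (e (Fin.last k), j))
        (fun a b hab => by simpa using hab)] at h2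
      have h3 := ae_of_ae_map (Measurable.aemeasurable (by fun_prop)) h2
      filter_upwards [h3] with y hy
      rw [linearIndependent_finSucc']
      have e1 : (Fin.init fun (a : Fin (k + 1)) (j : Fin ℓ) =>
          mergeOn (fun q => q.1 ≠ e (Fin.last k)) x y (e a, j)) =
          fun (a : Fin k) j => x (e a.castSucc, j) := by
        funext a j
        have : e a.castSucc ≠ e (Fin.last k) := fun h => (Fin.castSucc_lt_last a).ne (he h)
        simp [Fin.init, mergeOn, this]
      rw [e1]
      refine ⟨hx, ?_⟩
      simpa [mergeOn] using hy

/-- A diagonal entry of the inverse Gram matrix is at most the inverse of the squared distance of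
the corresponding row from a subspace that contains the other rows. -/
theorem inv_gram_apply_le {k ℓ : ℕ} (G : Matrix (Fin k) (Fin ℓ) ℝ) (j : Fin k)
    (O : Matrix (Fin ℓ) (Fin ℓ) ℝ) (hO : Oᵀ * O = 1) (s : Finset (Fin ℓ))
    (hs : ∀ i ∈ s, ∀ a, a ≠ j → O i ⬝ᵥ G a = 0) :
    ENNReal.ofReal ((G * Gᵀ)⁻¹ j j) ≤ (ENNReal.ofReal (∑ i ∈ s, (O i ⬝ᵥ G j) ^ 2))⁻¹ := by
  by_cases hdet : IsUnit (G * Gᵀ).det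
  swap
  · rw [Matrix.nonsing_inv_apply_not_isUnit _ hdet]; simp
  have hO' : ∀ a b, O a ⬝ᵥ O b = if a = b then 1 else 0 := by
    intro a b
    have := congrFun (congrFun (mul_eq_one_comm.1 hO : O * Oᵀ = 1) a) b
    simpa [Matrix.mul_apply, Matrix.one_apply, dotProduct] using this
  set σ := ∑ i ∈ s, (O i ⬝ᵥ G j) ^ 2 with hσ
  have hσ0 : 0 ≤ σ := Finset.sum_nonneg fun i _ => sq_nonneg _
  set N := (G * Gᵀ)⁻¹ with hN
  rcases hσ0.eq_or_lt with h0 | hpos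
  · rw [← h0]; simp
  -- `h` is the component of row `j` in the span of the rows of `O` in `s`, orthogonal to all other
  -- rows of `G`
  let h : Fin ℓ → ℝ := ∑ i ∈ s, (O i ⬝ᵥ G j) • O i
  have hh : h ⬝ᵥ h = σ := by
    simp only [h, sum_dotProduct, dotProduct_sum, smul_dotProduct, dotProduct_smul, hO',
      smul_eq_mul]
    rw [hσ]
    refine Finset.sum_congr rfl fun i hi => ?_
    simp [hi, sq]
  have hGh : G *ᵥ h = σ • Pi.single j 1 := by
    funext a
    simp only [Matrix.mulVec, h, dotProduct_sum, dotProduct_smul, Pi.smul_apply, smul_eq_mul]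
    by_cases ha : a = j
    · subst ha
      simp only [Pi.single_eq_same, mul_one, hσ]
      refine Finset.sum_congr rfl fun i _ => ?_
      rw [dotProduct_comm (G a), sq]
    · rw [Pi.single_eq_of_ne ha, mul_zero]
      refine Finset.sum_eq_zero fun i hi => ?_
      rw [dotProduct_comm (G a), hs i hi a ha, mul_zero]
  -- `w` is the dual vector of row `j`; its squared norm is the diagonal entry in question, which the
  -- Cauchy–Schwarz inequality for `w` and `h` bounds
  let w : Fin ℓ → ℝ := Gᵀ *ᵥ (N *ᵥ Pi.single j 1)
  have hNN : G * Gᵀ * N = 1 := Matrix.mul_nonsing_inv _ hdet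
  have hNs : Nᵀ = N := by
    rw [hN, Matrix.transpose_nonsing_inv, Matrix.transpose_mul, Matrix.transpose_transpose]
  have hGw : G *ᵥ w = Pi.single j 1 := by
    simp only [w, Matrix.mulVec_mulVec, ← Matrix.mul_assoc, hNN, Matrix.one_mulVec]
  have hwx : ∀ x : Fin ℓ → ℝ, w ⬝ᵥ x = N j ⬝ᵥ (G *ᵥ x) := by
    intro x
    have : w = (N * G) j := by
      funext b
      simp only [w, Matrix.mulVec_mulVec, Matrix.mulVec_single_one, Matrix.col_apply]
      rw [← Matrix.transpose_apply (Gᵀ * N), Matrix.transpose_mul, hNs, Matrix.transpose_transpose]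
    rw [this]
    have h2 : (N * G) j ⬝ᵥ x = ((N * G) *ᵥ x) j := rfl
    rw [h2, ← Matrix.mulVec_mulVec]
    rfl
  have hww : w ⬝ᵥ w = N j j := by rw [hwx, hGw]; simp
  have hwh : w ⬝ᵥ h = σ * N j j := by rw [hwx, hGh]; simp
  have hN0 : 0 ≤ N j j := by
    rw [← hww]; exact Finset.sum_nonneg fun i _ => mul_self_nonneg _
  have hCS : (w ⬝ᵥ h) ^ 2 ≤ (w ⬝ᵥ w) * (h ⬝ᵥ h) := by
    have := Finset.sum_mul_sq_le_sq_mul_sq Finset.univ w h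
    simpa [dotProduct, sq] using this
  rw [hww, hwh, hh] at hCS
  have hle : N j j ≤ σ⁻¹ := by
    rcases hN0.eq_or_lt with hz | hp
    · rw [← hz]; positivity
    · rw [le_inv_comm₀ hp hpos, inv_eq_one_div, le_div_iff₀ hp]
      have : (σ * N j j) * (σ * N j j) ≤ 1 * (σ * N j j) := by nlinarith
      exact le_of_mul_le_mul_right this (by positivity)
  rw [← ENNReal.ofReal_inv_of_pos hpos]
  exact ENNReal.ofReal_le_ofReal hle

theorem isUnit_det_gram_of_linearIndependent {k ℓ : ℕ} {G : Matrix (Fin k) (Fin ℓ) ℝ}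
    (h : LinearIndependent ℝ G.row) : IsUnit (G * Gᵀ).det := by
  have h1 := Matrix.PosDef.mul_conjTranspose_self G (Matrix.vecMul_injective_iff.2 h)
  rw [Matrix.conjTranspose_eq_transpose_of_trivial] at h1
  exact h1.det_pos.ne'.isUnit

theorem measurable_inv_apply {X : Type*} [TopologicalSpace X] [MeasurableSpace X]
    [OpensMeasurableSpace X] {k : ℕ} {M : X → Matrix (Fin k) (Fin k) ℝ} (hM : Continuous M)
    (i j : Fin k) : Measurable fun x => (M x)⁻¹ i j := by
  simp only [Matrix.inv_def, Ring.inverse_eq_inv', Matrix.smul_apply, smul_eq_mul]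
  refine Measurable.mul ?_ ?_
  · exact (hM.matrix_det).measurable.inv
  · exact ((continuous_apply j).comp ((continuous_apply i).comp hM.matrix_adjugate)).measurable

/-- The matrix with the given entries. -/
def matrixOfPairs {n ℓ : ℕ} (x : Fin n × Fin ℓ → ℝ) : Matrix (Fin n) (Fin ℓ) ℝ :=
  Matrix.of fun i j => x (i, j)

theorem continuous_matrixOfPairs {n ℓ : ℕ} :
    Continuous (matrixOfPairs : (Fin n × Fin ℓ → ℝ) → Matrix (Fin n) (Fin ℓ) ℝ) :=
  continuous_pi fun i => continuous_pi fun j => continuous_apply (i, j)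

/-- The mean of a diagonal entry of the inverse Gram matrix of `k` Gaussian rows: given the other
rows, the squared distance of row `j` from their span is at least a sum of `ℓ - k + 1` independent
squared standard normals. -/
theorem lintegral_inv_gram_apply_le {n ℓ k : ℕ} (e : Fin k → Fin n) (he : Function.Injective e)
    (hℓ : k + 2 ≤ ℓ) (j : Fin k) :
    ∫⁻ x, ENNReal.ofReal (((matrixOfPairs x).submatrix e id *
        ((matrixOfPairs x).submatrix e id)ᵀ)⁻¹ j j) ∂(stdNormal (Fin n × Fin ℓ)) ≤
      ENNReal.ofReal (1 / ((ℓ : ℝ) - k - 1)) := by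
  have hk : 1 ≤ k := by have := j.isLt; omega
  have hcont : Continuous fun x : Fin n × Fin ℓ → ℝ => (matrixOfPairs x).submatrix e id :=
    continuous_matrixOfPairs.matrix_submatrix e id
  rw [lintegral_stdNormal_eq_mergeOn (fun q => q.1 ≠ e j)
    (measurable_inv_apply (hcont.matrix_mul hcont.matrix_transpose) j j).ennreal_ofReal]
  have hcard : Fintype.card {a : Fin k // a ≠ j} = k - 1 := by simp
  have key : ∀ x : Fin n × Fin ℓ → ℝ, ∫⁻ y, ENNReal.ofReal
      (((matrixOfPairs (mergeOn (fun q => q.1 ≠ e j) x y)).submatrix e id *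
        ((matrixOfPairs (mergeOn (fun q => q.1 ≠ e j) x y)).submatrix e id)ᵀ)⁻¹ j j)
        ∂(stdNormal (Fin n × Fin ℓ)) ≤ ENNReal.ofReal (1 / ((ℓ : ℝ) - k - 1)) := by
    intro x
    obtain ⟨O, s, hO, hs, hsv⟩ := exists_orthogonal_of_family
      (fun (a : {a : Fin k // a ≠ j}) (b : Fin ℓ) => x (e a, b)) (by omega)
    have h1 := lintegral_inv_sum_sq_mulVec_le O hO s (by omega)
    rw [← stdNormal_map_comp (f := fun b : Fin ℓ => (e j, b)) (fun a b hab => by simpa using hab),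
      lintegral_map (by unfold dotProduct; fun_prop) (by fun_prop)] at h1
    refine le_trans (lintegral_mono fun y => ?_) (h1.trans (le_of_eq ?_))
    · refine (inv_gram_apply_le _ j O hO s fun i hi a ha => ?_).trans (le_of_eq ?_)
      · have h2 := hsv i hi ⟨a, ha⟩
        simp only [dotProduct] at h2 ⊢
        rw [← h2]
        refine Finset.sum_congr rfl fun b _ => ?_
        have : e a ≠ e j := fun h => ha (he h)
        simp [matrixOfPairs, mergeOn, this]
      · congr 2
        refine Finset.sum_congr rfl fun i _ => ?_
        simp [matrixOfPairs, mergeOn, dotProduct]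
    · rw [hs, hcard, Nat.cast_sub (by omega), Nat.cast_sub hk]
      push_cast
      congr 2
      ring
  calc _ ≤ ∫⁻ x : Fin n × Fin ℓ → ℝ, ENNReal.ofReal (1 / ((ℓ : ℝ) - k - 1))
        ∂(stdNormal (Fin n × Fin ℓ)) := lintegral_mono key
    _ = _ := by simp

theorem frobenius_sq_pinv_eq {k ℓ : ℕ} (G : Matrix (Fin k) (Fin ℓ) ℝ) :
    ‖Gᵀ * (G * Gᵀ)⁻¹‖ ^ 2 = ∑ j, (G * Gᵀ)⁻¹ j j := by
  rw [frobenius_sq_eq_trace, Matrix.transpose_mul, Matrix.transpose_nonsing_inv,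
    Matrix.transpose_mul, Matrix.transpose_transpose, Matrix.mul_assoc, ← Matrix.mul_assoc G]
  by_cases hdet : IsUnit (G * Gᵀ).det
  · rw [Matrix.mul_nonsing_inv _ hdet, Matrix.mul_one]; rfl
  · rw [Matrix.nonsing_inv_apply_not_isUnit _ hdet]; simp

theorem measurable_frobenius_gaussian_pinv {m n ℓ k : ℕ} (e : Fin k → Fin n)
    (D : Matrix (Fin m) (Fin n) ℝ) :
    Measurable fun x : Fin n × Fin ℓ → ℝ => ENNReal.ofReal (‖D * matrixOfPairs x *
      (((matrixOfPairs x).submatrix e id)ᵀ * ((matrixOfPairs x).submatrix e id *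
        ((matrixOfPairs x).submatrix e id)ᵀ)⁻¹)‖ ^ 2) := by
  have hcont : Continuous fun x : Fin n × Fin ℓ → ℝ => (matrixOfPairs x).submatrix e id :=
    continuous_matrixOfPairs.matrix_submatrix e id
  have hinv := measurable_inv_apply (hcont.matrix_mul hcont.matrix_transpose)
  have hH : ∀ a b, Measurable fun x : Fin n × Fin ℓ → ℝ =>
      (((matrixOfPairs x).submatrix e id)ᵀ * ((matrixOfPairs x).submatrix e id *
        ((matrixOfPairs x).submatrix e id)ᵀ)⁻¹) a b := by
    intro a b
    simp only [Matrix.mul_apply (M := ((matrixOfPairs _).submatrix e id)ᵀ)]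
    refine Finset.measurable_sum _ fun c _ => Measurable.mul ?_ (hinv c b)
    simp only [Matrix.transpose_apply, Matrix.submatrix_apply, matrixOfPairs, Matrix.of_apply]
    fun_prop
  refine Measurable.ennreal_ofReal ?_
  simp only [frobenius_sq]
  refine Finset.measurable_sum _ fun i _ => Finset.measurable_sum _ fun b _ =>
    Measurable.pow_const ?_ 2
  change Measurable fun x => ∑ j, (D * matrixOfPairs x) i j * (((matrixOfPairs x).submatrix e id)ᵀ *
    ((matrixOfPairs x).submatrix e id * ((matrixOfPairs x).submatrix e id)ᵀ)⁻¹) j b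
  refine Finset.measurable_sum _ fun j _ => Measurable.mul ?_ (hH j b)
  simp only [Matrix.mul_apply, matrixOfPairs, Matrix.of_apply]
  fun_prop

/-- The rows of the Gaussian matrix outside the range of `e`, the only ones that `D` meets, are
independent of those in the range. Given the latter, the mean of the left-hand side is `‖D‖ ^ 2`
times the trace of an inverse Gram matrix. -/
theorem lintegral_frobenius_gaussian_pinv_le {m n ℓ k : ℕ} (e : Fin k → Fin n)
    (he : Function.Injective e) (hℓ : k + 2 ≤ ℓ) (D : Matrix (Fin m) (Fin n) ℝ)
    (hD : ∀ i a, D i (e a) = 0) :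
    ∫⁻ x, ENNReal.ofReal (‖D * matrixOfPairs x * (((matrixOfPairs x).submatrix e id)ᵀ *
        ((matrixOfPairs x).submatrix e id * ((matrixOfPairs x).submatrix e id)ᵀ)⁻¹)‖ ^ 2)
        ∂(stdNormal (Fin n × Fin ℓ)) ≤ ENNReal.ofReal (‖D‖ ^ 2 * (k / ((ℓ : ℝ) - k - 1))) := by
  set G : (Fin n × Fin ℓ → ℝ) → Matrix (Fin k) (Fin ℓ) ℝ :=
    fun x => (matrixOfPairs x).submatrix e id with hG
  have hcont : Continuous G := continuous_matrixOfPairs.matrix_submatrix e id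
  have hinv : ∀ a b, Measurable fun x => (G x * (G x)ᵀ)⁻¹ a b :=
    measurable_inv_apply (hcont.matrix_mul hcont.matrix_transpose)
  have hmeas : Measurable fun x => ENNReal.ofReal
      (‖D * matrixOfPairs x * ((G x)ᵀ * (G x * (G x)ᵀ)⁻¹)‖ ^ 2) :=
    measurable_frobenius_gaussian_pinv e D
  rw [lintegral_stdNormal_eq_mergeOn (fun q => ∃ a, q.1 = e a) hmeas]
  have hGx : ∀ x y, G (mergeOn (fun q => ∃ a, q.1 = e a) x y) = G x := by
    intro x y
    ext a b
    simp [hG, matrixOfPairs, mergeOn]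
  have hDy : ∀ x y : Fin n × Fin ℓ → ℝ, D * matrixOfPairs (mergeOn (fun q => ∃ a, q.1 = e a) x y) =
      D * matrixOfPairs y := by
    intro x y
    ext i b
    simp only [Matrix.mul_apply, matrixOfPairs, Matrix.of_apply, mergeOn]
    refine Finset.sum_congr rfl fun c _ => ?_
    by_cases hc : ∃ a, c = e a
    · obtain ⟨a, rfl⟩ := hc; rw [hD]; simp
    · rw [if_neg hc]
  have hinner : ∀ x, ∫⁻ y, ENNReal.ofReal (‖D * matrixOfPairs y *
      ((G x)ᵀ * (G x * (G x)ᵀ)⁻¹)‖ ^ 2) ∂(stdNormal (Fin n × Fin ℓ)) =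
      ENNReal.ofReal (‖D‖ ^ 2) * ∑ j, ENNReal.ofReal ((G x * (G x)ᵀ)⁻¹ j j) := by
    intro x
    set H := (G x)ᵀ * (G x * (G x)ᵀ)⁻¹ with hH
    have e1 : ∀ y : Fin n × Fin ℓ → ℝ, ENNReal.ofReal (‖D * matrixOfPairs y * H‖ ^ 2) =
        ∑ i, ∑ b, ENNReal.ofReal ((∑ q : Fin n × Fin ℓ, D i q.1 * H q.2 b * y q) ^ 2) := by
      intro y
      rw [frobenius_sq, ENNReal.ofReal_sum_of_nonneg fun i _ => by positivity]
      refine Finset.sum_congr rfl fun i _ => ?_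
      rw [ENNReal.ofReal_sum_of_nonneg fun i _ => by positivity]
      refine Finset.sum_congr rfl fun b _ => ?_
      congr 2
      rw [Fintype.sum_prod_type, Finset.sum_comm]
      simp only [Matrix.mul_apply, matrixOfPairs, Matrix.of_apply, Finset.sum_mul]
      refine Finset.sum_congr rfl fun j _ => Finset.sum_congr rfl fun c _ => by ring
    simp_rw [e1]
    rw [lintegral_finsetSum _ fun i _ => by fun_prop]
    have e2 : ∀ i, ∫⁻ y : Fin n × Fin ℓ → ℝ, ∑ b, ENNReal.ofReal
        ((∑ q : Fin n × Fin ℓ, D i q.1 * H q.2 b * y q) ^ 2) ∂(stdNormal (Fin n × Fin ℓ)) =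
        ∑ b, ENNReal.ofReal (∑ q : Fin n × Fin ℓ, (D i q.1 * H q.2 b) ^ 2) := by
      intro i
      rw [lintegral_finsetSum _ fun i _ => by fun_prop]
      exact Finset.sum_congr rfl fun b _ => lintegral_sq_sum_stdNormal _
    simp_rw [e2]
    have e3 : ∀ j, 0 ≤ (G x * (G x)ᵀ)⁻¹ j j := by
      intro j
      by_cases hdet : IsUnit (G x * (G x)ᵀ).det
      · have hpsd : (G x * (G x)ᵀ)⁻¹.PosSemidef := by
          have := (Matrix.posSemidef_self_mul_conjTranspose (G x)).inv
          rwa [Matrix.conjTranspose_eq_transpose_of_trivial] at this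
        exact hpsd.diag_nonneg
      · rw [Matrix.nonsing_inv_apply_not_isUnit _ hdet]; simp
    rw [← ENNReal.ofReal_sum_of_nonneg fun j _ => e3 j, ← frobenius_sq_pinv_eq, ← hH,
      ← ENNReal.ofReal_mul (by positivity), frobenius_sq D, frobenius_sq H]
    have e4 : ∀ i, ∑ b, ENNReal.ofReal (∑ q : Fin n × Fin ℓ, (D i q.1 * H q.2 b) ^ 2) =
        ENNReal.ofReal (∑ b, ∑ q : Fin n × Fin ℓ, (D i q.1 * H q.2 b) ^ 2) := fun i =>
      (ENNReal.ofReal_sum_of_nonneg fun b _ => by positivity).symm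
    simp_rw [e4]
    rw [← ENNReal.ofReal_sum_of_nonneg fun i _ => by positivity]
    congr 1
    rw [Finset.sum_mul, Finset.sum_comm (f := fun i j => H i j ^ 2)]
    refine Finset.sum_congr rfl fun i _ => ?_
    simp only [Fintype.sum_prod_type, mul_pow, ← Finset.mul_sum, ← Finset.sum_mul]
  simp_rw [hGx, hDy, hinner]
  rw [lintegral_const_mul _ (Finset.measurable_sum _ fun j _ => (hinv j j).ennreal_ofReal),
    lintegral_finsetSum _ fun j _ => (hinv j j).ennreal_ofReal,
    ENNReal.ofReal_mul (by positivity)]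
  gcongr
  calc ∑ j, ∫⁻ x, ENNReal.ofReal ((G x * (G x)ᵀ)⁻¹ j j) ∂(stdNormal (Fin n × Fin ℓ))
      ≤ ∑ j : Fin k, ENNReal.ofReal (1 / ((ℓ : ℝ) - k - 1)) :=
        Finset.sum_le_sum fun j _ => lintegral_inv_gram_apply_le e he hℓ j
    _ = ENNReal.ofReal (k / ((ℓ : ℝ) - k - 1)) := by
        rw [Finset.sum_const, Finset.card_univ, Fintype.card_fin, nsmul_eq_mul,
          ← ENNReal.ofReal_natCast, ← ENNReal.ofReal_mul (by positivity)]
        congr 1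
        ring

/-- A matrix with orthonormal columns is part of an orthogonal matrix. -/
theorem exists_orthogonal_extension {n k : ℕ} (V : Matrix (Fin n) (Fin k) ℝ) (hV : Vᵀ * V = 1) :
    ∃ (e : Fin k → Fin n) (O : Matrix (Fin n) (Fin n) ℝ), Function.Injective e ∧ Oᵀ * O = 1 ∧
      ∀ i a, O i (e a) = V i a := by
  have hkn : k ≤ n := by
    have h1 : (Vᵀ * V).rank = k := by rw [hV, Matrix.rank_one, Fintype.card_fin]
    have h2 := Matrix.rank_mul_le_right Vᵀ V
    have h3 := V.rank_le_height
    omega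
  let w : Fin n → EuclideanSpace ℝ (Fin n) := fun i =>
    if h : (i : ℕ) < k then WithLp.toLp 2 (fun a => V a ⟨i, h⟩) else 0
  have hw : Orthonormal ℝ (({i : Fin n | (i : ℕ) < k} : Set (Fin n)).domRestrict w) := by
    rw [orthonormal_iff_ite]
    rintro ⟨i, hi⟩ ⟨j, hj⟩
    simp only [Set.mem_ofPred_eq] at hi hj
    have := congrFun (congrFun hV ⟨i, hi⟩) ⟨j, hj⟩
    simp only [Matrix.mul_apply, Matrix.transpose_apply, Matrix.one_apply] at this
    simp only [Set.domRestrict, w, hi, hj, dif_pos, PiLp.inner_apply, RCLike.inner_apply,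
      conj_trivial]
    simp_rw [mul_comm]
    rw [this]
    simp [Fin.ext_iff]
  obtain ⟨b, hb⟩ := hw.exists_orthonormalBasis_extension_of_card_eq (𝕜 := ℝ) (ι := Fin n) (by simp)
  refine ⟨Fin.castLE hkn, Matrix.of fun i j => b j i, Fin.castLE_injective hkn, ?_, ?_⟩
  · ext i j
    have := orthonormal_iff_ite.1 b.orthonormal i j
    simp only [PiLp.inner_apply, RCLike.inner_apply, conj_trivial] at this
    simp [Matrix.mul_apply, Matrix.one_apply, ← this, mul_comm]
  · intro i a
    simp [hb (Fin.castLE hkn a) (by simp), w]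

open scoped Kronecker in
/-- The law of the sketch matrix is invariant under orthogonal changes of coordinates. -/
theorem map_orthogonal_mul_sketchMatrix {n ℓ : ℕ} (O : Matrix (Fin n) (Fin n) ℝ) (hO : Oᵀ * O = 1) :
    (Measure.infinitePi fun _ : ℕ => gaussianReal 0 1).map
      (fun g (q : Fin n × Fin ℓ) => (Oᵀ * sketchMatrix n ℓ g) q.1 q.2) =
      stdNormal (Fin n × Fin ℓ) := by
  have hinj : Function.Injective fun q : Fin n × Fin ℓ => (q.1 : ℕ) * ℓ + q.2 := by
    rintro ⟨a, b⟩ ⟨c, d⟩ h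
    simp only at h
    have hℓ : 0 < ℓ := by have := b.isLt; omega
    have h1 := congrArg (· / ℓ) h
    have h2 := congrArg (· % ℓ) h
    simp only [mul_comm _ ℓ, Nat.mul_add_div hℓ, Nat.div_eq_of_lt b.isLt, Nat.div_eq_of_lt d.isLt,
      Nat.mul_add_mod, Nat.mod_eq_of_lt b.isLt, Nat.mod_eq_of_lt d.isLt] at h1 h2
    ext
    · simpa using h1
    · simpa using h2
  have h1 := Measure.map_infinitePi_infinitePi_of_inj (P := fun _ : ℕ => gaussianReal 0 1) hinj
  rw [Measure.infinitePi_eq_pi (ι := Fin n × Fin ℓ)] at h1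
  have hK : (Oᵀ ⊗ₖ (1 : Matrix (Fin ℓ) (Fin ℓ) ℝ))ᵀ *
      (Oᵀ ⊗ₖ (1 : Matrix (Fin ℓ) (Fin ℓ) ℝ)) = 1 := by
    rw [← Matrix.kroneckerMap_transpose, ← Matrix.mul_kronecker_mul, Matrix.transpose_transpose,
      mul_eq_one_comm.1 hO, Matrix.transpose_one, Matrix.one_mul, Matrix.one_kronecker_one]
  have h2 := stdNormal_map_mulVec _ hK
  rw [stdNormal, ← h1, Measure.map_map (by unfold Matrix.mulVec dotProduct; fun_prop)
    (by fun_prop)] at h2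
  rw [stdNormal, ← h1]
  convert h2 using 1
  · congr 1
    funext g q
    obtain ⟨i, j⟩ := q
    simp only [Function.comp, Matrix.mulVec, dotProduct, Fintype.sum_prod_type,
      Matrix.kroneckerMap_apply, Matrix.one_apply, Matrix.mul_apply, sketchMatrix, Matrix.of_apply]
    simp

/-- The two facts about a Gaussian test matrix `Ω` behind the randomized singular value
decomposition: if `V` has `k` orthonormal columns then `VᵀΩ` almost surely has full rank, and its
pseudoinverse amplifies the part `D * Ω` of the sketch orthogonal to `V` little on average. -/
theorem gaussian_sketch {m n ℓ k : ℕ} (V : Matrix (Fin n) (Fin k) ℝ) (hV : Vᵀ * V = 1)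
    (hℓ : k + 2 ≤ ℓ) :
    (∀ᵐ g ∂(Measure.infinitePi fun _ : ℕ => gaussianReal 0 1),
      IsUnit ((Vᵀ * sketchMatrix n ℓ g) * (Vᵀ * sketchMatrix n ℓ g)ᵀ).det) ∧
    ∀ D : Matrix (Fin m) (Fin n) ℝ, D * V = 0 →
      ∫⁻ g, ENNReal.ofReal (‖D * sketchMatrix n ℓ g * ((Vᵀ * sketchMatrix n ℓ g)ᵀ *
        ((Vᵀ * sketchMatrix n ℓ g) * (Vᵀ * sketchMatrix n ℓ g)ᵀ)⁻¹)‖ ^ 2)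
        ∂(Measure.infinitePi fun _ : ℕ => gaussianReal 0 1) ≤
        ENNReal.ofReal (‖D‖ ^ 2 * (k / ((ℓ : ℝ) - k - 1))) := by
  obtain ⟨e, O, he, hO, hOV⟩ := exists_orthogonal_extension V hV
  have hlaw := map_orthogonal_mul_sketchMatrix (ℓ := ℓ) O hO
  have hm : Measurable fun (g : ℕ → ℝ) (q : Fin n × Fin ℓ) =>
      (Oᵀ * sketchMatrix n ℓ g) q.1 q.2 := by
    simp only [Matrix.mul_apply, sketchMatrix, Matrix.of_apply]
    fun_prop
  have hG : ∀ g, Vᵀ * sketchMatrix n ℓ g =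
      (matrixOfPairs fun q => (Oᵀ * sketchMatrix n ℓ g) q.1 q.2).submatrix e id := by
    intro g
    ext a b
    simp [matrixOfPairs, Matrix.mul_apply, hOV]
  constructor
  · have h1 := ae_linearIndependent_rows (ℓ := ℓ) e he hℓ
    rw [← hlaw] at h1
    filter_upwards [ae_of_ae_map hm.aemeasurable h1] with g hg
    rw [hG]
    exact isUnit_det_gram_of_linearIndependent hg
  · intro D hDV
    have hD : ∀ i a, (D * O) i (e a) = 0 := by
      intro i a
      have := congrFun (congrFun hDV i) a
      simpa [Matrix.mul_apply, hOV] using this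
    have h1 := lintegral_frobenius_gaussian_pinv_le (ℓ := ℓ) e he hℓ (D * O) hD
    have hnorm : ‖D * O‖ ^ 2 = ‖D‖ ^ 2 := by
      rw [frobenius_sq_eq_trace', Matrix.transpose_mul, Matrix.mul_assoc, ← Matrix.mul_assoc O,
        mul_eq_one_comm.1 hO, Matrix.one_mul, ← frobenius_sq_eq_trace']
    rw [hnorm] at h1
    refine le_trans ?_ h1
    rw [← hlaw]
    rw [lintegral_map (measurable_frobenius_gaussian_pinv e (D * O)) hm]
    refine lintegral_mono fun g => le_of_eq ?_
    rw [← hG]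
    congr 4
    have : D * sketchMatrix n ℓ g = D * (O * Oᵀ) * sketchMatrix n ℓ g := by
      rw [mul_eq_one_comm.1 hO, Matrix.mul_one]
    rw [this]
    simp only [Matrix.mul_assoc]
    rfl

/-! ### Orthogonal projections and low-rank approximation -/

theorem pinv_mul_self_symm {p n : ℕ} (R : Matrix (Fin p) (Fin n) ℝ) :
    (pinv R * R)ᵀ = pinv R * R := (pinv_spec R).symm_right

theorem pinv_mul_self_idem {p n : ℕ} (R : Matrix (Fin p) (Fin n) ℝ) :
    pinv R * R * (pinv R * R) = pinv R * R := by
  rw [← Matrix.mul_assoc, (pinv_spec R).self_mul_mul]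

theorem mul_pinv_symm {p n : ℕ} (R : Matrix (Fin p) (Fin n) ℝ) :
    (R * pinv R)ᵀ = R * pinv R := (pinv_spec R).symm_left

theorem mul_pinv_idem {p n : ℕ} (R : Matrix (Fin p) (Fin n) ℝ) :
    R * pinv R * (R * pinv R) = R * pinv R := by
  rw [← Matrix.mul_assoc, (pinv_spec R).mul_mul_self]

/-- A symmetric matrix that fixes the columns of `Z` and whose columns are combinations of those
of `Z` is the orthogonal projection `Z Z†`. -/
theorem eq_mul_pinv_of_proj {p n : ℕ} {Z : Matrix (Fin p) (Fin n) ℝ} {P : Matrix (Fin p) (Fin p) ℝ}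
    (hs : Pᵀ = P) (hP : P * Z = Z) {T : Matrix (Fin n) (Fin p) ℝ} (hT : P = Z * T) :
    P = Z * pinv Z := by
  have h1 : P * (Z * pinv Z) = Z * pinv Z := by rw [← Matrix.mul_assoc, hP]
  have h2 : Z * pinv Z * P = P := by
    rw [hT, ← Matrix.mul_assoc, (pinv_spec Z).mul_mul_self]
  rw [← h1]
  conv_lhs => rw [← hs, ← h2]
  rw [Matrix.transpose_mul, hs, mul_pinv_symm]

/-- The residual of a projection is optimal among all approximations with rows in its range. -/
theorem frobenius_sub_mul_proj_le {m n : ℕ} {Q : Matrix (Fin n) (Fin n) ℝ} (hs : Qᵀ = Q)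
    (hi : Q * Q = Q) (A F : Matrix (Fin m) (Fin n) ℝ) (hF : F * Q = F) :
    ‖A - A * Q‖ ^ 2 ≤ ‖A - F‖ ^ 2 := by
  have h := frobenius_sq_mul_proj_le hs hi (A - F)
  rw [Matrix.sub_mul, hF, sub_sub_sub_cancel_right] at h
  nlinarith [sq_nonneg ‖A * Q - F‖]

theorem frobenius_sq_isometry_mul {m n k : ℕ} {U : Matrix (Fin m) (Fin k) ℝ} (hU : Uᵀ * U = 1)
    (X : Matrix (Fin k) (Fin n) ℝ) : ‖U * X‖ ^ 2 = ‖X‖ ^ 2 := by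
  rw [frobenius_sq_eq_trace, Matrix.transpose_mul, Matrix.mul_assoc, ← Matrix.mul_assoc Uᵀ, hU,
    Matrix.one_mul, ← frobenius_sq_eq_trace]

theorem frobenius_sq_mul_isometry {m n k : ℕ} {V : Matrix (Fin n) (Fin k) ℝ} (hV : Vᵀ * V = 1)
    (X : Matrix (Fin m) (Fin k) ℝ) : ‖X * Vᵀ‖ ^ 2 = ‖X‖ ^ 2 := by
  rw [frobenius_sq_eq_trace', Matrix.transpose_mul, Matrix.transpose_transpose, Matrix.mul_assoc,
    ← Matrix.mul_assoc Vᵀ, hV, Matrix.one_mul, ← frobenius_sq_eq_trace']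

theorem isometry_proj_symm {m k : ℕ} (U : Matrix (Fin m) (Fin k) ℝ) : (U * Uᵀ)ᵀ = U * Uᵀ := by
  rw [Matrix.transpose_mul, Matrix.transpose_transpose]

theorem isometry_proj_idem {m k : ℕ} {U : Matrix (Fin m) (Fin k) ℝ} (hU : Uᵀ * U = 1) :
    U * Uᵀ * (U * Uᵀ) = U * Uᵀ := by
  rw [Matrix.mul_assoc, ← Matrix.mul_assoc Uᵀ, hU, Matrix.one_mul]

theorem frobenius_sq_transpose_isometry_mul_le {m n k : ℕ} {U : Matrix (Fin m) (Fin k) ℝ}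
    (hU : Uᵀ * U = 1) (X : Matrix (Fin m) (Fin n) ℝ) : ‖Uᵀ * X‖ ^ 2 ≤ ‖X‖ ^ 2 := by
  rw [← frobenius_sq_isometry_mul hU, ← Matrix.mul_assoc]
  nlinarith [frobenius_sq_proj_mul_le (isometry_proj_symm U) (isometry_proj_idem hU) X,
    sq_nonneg ‖X - U * Uᵀ * X‖]

theorem frobenius_sq_isometry {m k : ℕ} {U : Matrix (Fin m) (Fin k) ℝ} (hU : Uᵀ * U = 1) :
    ‖U‖ ^ 2 = k := by
  rw [frobenius_sq_eq_trace, hU]; simp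

theorem submatrix_castLE_isometry {m k q : ℕ} (h : k ≤ q) {U : Matrix (Fin m) (Fin q) ℝ}
    (hU : Uᵀ * U = 1) :
    (U.submatrix id (Fin.castLE h))ᵀ * U.submatrix id (Fin.castLE h) = 1 := by
  ext i j
  have := congrFun (congrFun hU (Fin.castLE h i)) (Fin.castLE h j)
  simpa [Matrix.mul_apply, Matrix.one_apply] using this

theorem IsTruncatedSVD.left_orthonormal {m n k : ℕ} {M : Matrix (Fin m) (Fin n) ℝ}
    {U : Matrix (Fin m) (Fin k) ℝ} {σ : Fin k → ℝ} {V : Matrix (Fin n) (Fin k) ℝ}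
    (h : IsTruncatedSVD M U σ V) : Uᵀ * U = 1 := by
  obtain ⟨q, hq, U', σ', V', hM, rfl, rfl, rfl⟩ := h
  exact submatrix_castLE_isometry hq hM.left_orthonormal

theorem IsTruncatedSVD.right_orthonormal {m n k : ℕ} {M : Matrix (Fin m) (Fin n) ℝ}
    {U : Matrix (Fin m) (Fin k) ℝ} {σ : Fin k → ℝ} {V : Matrix (Fin n) (Fin k) ℝ}
    (h : IsTruncatedSVD M U σ V) : Vᵀ * V = 1 := by
  obtain ⟨q, hq, U', σ', V', hM, rfl, rfl, rfl⟩ := h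
  exact submatrix_castLE_isometry hq hM.right_orthonormal

theorem transpose_mul_submatrix_castLE {m k q : ℕ} (h : k ≤ q) {U : Matrix (Fin m) (Fin q) ℝ}
    (hU : Uᵀ * U = 1) :
    Uᵀ * U.submatrix id (Fin.castLE h) = (1 : Matrix _ _ ℝ).submatrix id (Fin.castLE h) := by
  rw [← hU]; ext i j; simp [Matrix.mul_apply]

theorem IsTruncatedSVD.mul_right {m n k : ℕ} {M : Matrix (Fin m) (Fin n) ℝ}
    {U : Matrix (Fin m) (Fin k) ℝ} {σ : Fin k → ℝ} {V : Matrix (Fin n) (Fin k) ℝ}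
    (h : IsTruncatedSVD M U σ V) : M * V = U * Matrix.diagonal σ := by
  obtain ⟨q, hq, U', σ', V', hM, rfl, rfl, rfl⟩ := h
  rw [hM.eq, Matrix.mul_assoc, transpose_mul_submatrix_castLE hq hM.right_orthonormal]
  ext i j
  simp [Matrix.mul_apply, Matrix.diagonal_apply, Matrix.one_apply]

theorem IsTruncatedSVD.transpose_mul {m n k : ℕ} {M : Matrix (Fin m) (Fin n) ℝ}
    {U : Matrix (Fin m) (Fin k) ℝ} {σ : Fin k → ℝ} {V : Matrix (Fin n) (Fin k) ℝ}
    (h : IsTruncatedSVD M U σ V) : Uᵀ * M = Matrix.diagonal σ * Vᵀ := by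
  obtain ⟨q, hq, U', σ', V', hM, rfl, rfl, rfl⟩ := h
  have h1 : (U'.submatrix id (Fin.castLE hq))ᵀ * U' =
      (1 : Matrix _ _ ℝ).submatrix (Fin.castLE hq) id := by
    rw [← hM.left_orthonormal]; ext i j; simp [Matrix.mul_apply]
  conv_lhs => rw [hM.eq]
  rw [← Matrix.mul_assoc, ← Matrix.mul_assoc, h1]
  ext i j
  simp [Matrix.mul_apply, Matrix.diagonal_apply, Matrix.one_apply]

/-- The rank-`k` truncation is `M` restricted to the span of the top right singular vectors. -/
theorem IsTruncatedSVD.eq_mul_proj {m n k : ℕ} {M : Matrix (Fin m) (Fin n) ℝ}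
    {U : Matrix (Fin m) (Fin k) ℝ} {σ : Fin k → ℝ} {V : Matrix (Fin n) (Fin k) ℝ}
    (h : IsTruncatedSVD M U σ V) : U * Matrix.diagonal σ * Vᵀ = M * (V * Vᵀ) := by
  rw [← Matrix.mul_assoc, h.mul_right]

theorem IsRankTruncation.exists_right {m n k : ℕ} {A Ak : Matrix (Fin m) (Fin n) ℝ}
    (h : IsRankTruncation k A Ak) :
    ∃ V : Matrix (Fin n) (Fin k) ℝ, Vᵀ * V = 1 ∧ Ak = A * (V * Vᵀ) := by
  obtain ⟨U, σ, V, hA, rfl⟩ := h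
  exact ⟨V, hA.right_orthonormal, hA.eq_mul_proj⟩

/-- A mass of at most `k`, of which each index carries at most `1`, is best placed on the first `k`
indices. -/
theorem sum_antitone_mul_le {q k : ℕ} (hk : k ≤ q) (a c : Fin q → ℝ) (ha : Antitone a)
    (ha0 : ∀ i, 0 ≤ a i) (hc0 : ∀ i, 0 ≤ c i) (hc1 : ∀ i, c i ≤ 1) (hc : ∑ i, c i ≤ k) :
    ∑ i, a i * c i ≤ ∑ i : Fin k, a (Fin.castLE hk i) := by
  have hsub : ∀ f : Fin q → ℝ, ∑ i : Fin k, f (Fin.castLE hk i) =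
      ∑ i : Fin q, if (i : ℕ) < k then f i else 0 := by
    intro f
    rw [← Finset.sum_filter]
    refine Finset.sum_bij (fun i _ => Fin.castLE hk i) (by simp)
      (fun i _ j _ h => Fin.castLE_injective hk h) (fun b hb => ?_) (by simp)
    exact ⟨⟨b, by simpa using hb⟩, by simp, rfl⟩
  rcases hk.eq_or_lt with rfl | hlt
  · refine Finset.sum_le_sum fun i _ => ?_
    simpa using mul_le_mul_of_nonneg_left (hc1 i) (ha0 i)
  · set t := a ⟨k, hlt⟩ with ht
    have h1 : ∑ i : Fin q, (a i - t) * c i ≤ ∑ i : Fin q, if (i : ℕ) < k then a i - t else 0 := by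
      refine Finset.sum_le_sum fun i _ => ?_
      split_ifs with hi
      · have : t ≤ a i := ha (by rw [Fin.le_def]; exact hi.le)
        nlinarith [hc1 i]
      · have : a i ≤ t := ha (by rw [Fin.le_def]; simpa using hi)
        nlinarith [hc0 i]
    rw [← hsub fun i => a i - t] at h1
    simp only [sub_mul, Finset.sum_sub_distrib, Finset.sum_const, Finset.card_univ,
      Fintype.card_fin, nsmul_eq_mul, ← Finset.mul_sum] at h1
    nlinarith [ha0 ⟨k, hlt⟩]

/-- A truncated singular value decomposition is optimal among approximations with rows in a
`k`-dimensional space. -/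
theorem IsTruncatedSVD.optimal {m n k : ℕ} {M : Matrix (Fin m) (Fin n) ℝ}
    {U : Matrix (Fin m) (Fin k) ℝ} {σ : Fin k → ℝ} {V : Matrix (Fin n) (Fin k) ℝ}
    (h : IsTruncatedSVD M U σ V) {W : Matrix (Fin n) (Fin k) ℝ} (hW : Wᵀ * W = 1)
    (N : Matrix (Fin m) (Fin n) ℝ) (hN : N * (W * Wᵀ) = N) :
    ‖M - U * Matrix.diagonal σ * Vᵀ‖ ^ 2 ≤ ‖M - N‖ ^ 2 := by
  refine le_trans ?_ (frobenius_sub_mul_proj_le (isometry_proj_symm W)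
    (isometry_proj_idem hW) M N hN)
  have hproj : ∀ W : Matrix (Fin n) (Fin k) ℝ, Wᵀ * W = 1 →
      ‖M - M * (W * Wᵀ)‖ ^ 2 = ‖M‖ ^ 2 - ‖M * W‖ ^ 2 := by
    intro W hW
    have := frobenius_sq_mul_proj_le (isometry_proj_symm W) (isometry_proj_idem hW) M
    rw [← frobenius_sq_mul_isometry hW (M * W), Matrix.mul_assoc M W]
    linarith
  rw [h.eq_mul_proj, hproj V h.right_orthonormal, hproj W hW, h.mul_right]
  have hU := h.left_orthonormal
  obtain ⟨q, hq, U', σ', V', hM, rfl, rfl, rfl⟩ := h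
  have hdiag : ∀ (a p : ℕ) (τ : Fin a → ℝ) (X : Matrix (Fin a) (Fin p) ℝ),
      ‖Matrix.diagonal τ * X‖ ^ 2 = ∑ i, τ i ^ 2 * ∑ j, X i j ^ 2 := by
    intro a p τ X
    rw [frobenius_sq]
    simp only [Matrix.diagonal_mul, mul_pow, Finset.mul_sum]
  have h1 : ‖M * W‖ ^ 2 = ∑ i, σ' i ^ 2 * ∑ j, (V'ᵀ * W) i j ^ 2 := by
    rw [hM.eq, Matrix.mul_assoc, Matrix.mul_assoc, frobenius_sq_isometry_mul hM.left_orthonormal,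
      hdiag]
  have h2 : ‖U'.submatrix id (Fin.castLE hq) * Matrix.diagonal (σ' ∘ Fin.castLE hq)‖ ^ 2 =
      ∑ i : Fin k, σ' (Fin.castLE hq i) ^ 2 := by
    rw [frobenius_sq_isometry_mul hU, ← Matrix.mul_one (Matrix.diagonal _), hdiag]
    refine Finset.sum_congr rfl fun i _ => ?_
    simp [Matrix.one_apply]
  rw [h1, h2]
  have h3 := sum_antitone_mul_le hq (fun i => σ' i ^ 2) (fun i => ∑ j, (V'ᵀ * W) i j ^ 2)
    (fun i j hij => by
      have := hM.antitone hij
      have := hM.nonneg j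
      simp only
      gcongr)
    (fun i => sq_nonneg _) (fun i => by positivity) (fun i => ?_) ?_
  · linarith
  · have e1 : ∑ j, (V'ᵀ * W) i j ^ 2 = ‖Wᵀ * V'.submatrix id (fun _ : Fin 1 => i)‖ ^ 2 := by
      rw [frobenius_sq]
      refine Finset.sum_congr rfl fun j _ => ?_
      simp only [Finset.univ_unique, Finset.sum_singleton, Matrix.mul_apply, Matrix.transpose_apply,
        Matrix.submatrix_apply, id]
      congr 1
      exact Finset.sum_congr rfl fun a _ => mul_comm _ _
    rw [e1]
    refine (frobenius_sq_transpose_isometry_mul_le hW _).trans (le_of_eq ?_)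
    have := congrFun (congrFun hM.right_orthonormal i) i
    simp only [Matrix.mul_apply, Matrix.transpose_apply, Matrix.one_apply_eq] at this
    rw [frobenius_sq, ← this]
    simp [sq]
  · rw [← frobenius_sq, ← frobenius_sq_isometry hW]
    exact frobenius_sq_transpose_isometry_mul_le hM.right_orthonormal W

/-- The error of the randomized singular value decomposition, in terms of the amplification of
the part of `A` orthogonal to `W` by the pseudoinverse of `WᵀΩ`. -/
theorem IsTruncatedSVD.randomized_error_le {m n k ℓ : ℕ} {A : Matrix (Fin m) (Fin n) ℝ}
    {Ω : Matrix (Fin n) (Fin ℓ) ℝ} {U : Matrix (Fin m) (Fin k) ℝ} {σ : Fin k → ℝ}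
    {V : Matrix (Fin n) (Fin k) ℝ}
    (h : IsTruncatedSVD (A * Ω * pinv (A * Ω) * A) U σ V) {W : Matrix (Fin n) (Fin k) ℝ}
    (hW : Wᵀ * W = 1) (hdet : IsUnit ((Wᵀ * Ω) * (Wᵀ * Ω)ᵀ).det) :
    ‖A - U * Matrix.diagonal σ * Vᵀ‖ ^ 2 ≤ ‖A - A * (W * Wᵀ)‖ ^ 2 +
      ‖(A - A * (W * Wᵀ)) * Ω * ((Wᵀ * Ω)ᵀ * ((Wᵀ * Ω) * (Wᵀ * Ω)ᵀ)⁻¹)‖ ^ 2 := by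
  set P := A * Ω * pinv (A * Ω) with hP
  set H := (Wᵀ * Ω)ᵀ * ((Wᵀ * Ω) * (Wᵀ * Ω)ᵀ)⁻¹ with hH
  set N := A * Ω * H * Wᵀ with hN
  have hPs : Pᵀ = P := mul_pinv_symm _
  have hPi : P * P = P := mul_pinv_idem _
  have hpyth : ∀ X : Matrix (Fin m) (Fin n) ℝ, P * X = X →
      ‖A - X‖ ^ 2 = ‖A - P * A‖ ^ 2 + ‖P * A - X‖ ^ 2 := by
    intro X hX
    rw [← frobenius_sq_add_of_transpose_mul, sub_add_sub_cancel]
    rw [← hX, ← Matrix.mul_sub, ← Matrix.mul_assoc, Matrix.transpose_sub, Matrix.transpose_mul, hPs,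
      Matrix.sub_mul, Matrix.mul_assoc Aᵀ, hPi, sub_self, Matrix.zero_mul]
  have hPN : P * N = N := by
    have h0 : P * (A * Ω) = A * Ω := by rw [hP, (pinv_spec (A * Ω)).mul_mul_self]
    rw [hN, ← Matrix.mul_assoc, ← Matrix.mul_assoc, h0]
  have hNW : N * (W * Wᵀ) = N := by
    rw [hN, Matrix.mul_assoc, ← Matrix.mul_assoc Wᵀ, hW, Matrix.one_mul]
  have hPM : P * (U * Matrix.diagonal σ * Vᵀ) = U * Matrix.diagonal σ * Vᵀ := by
    rw [h.eq_mul_proj, ← Matrix.mul_assoc P, ← Matrix.mul_assoc P, hPi]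
  have h1 := h.optimal hW N hNW
  have hGH : Wᵀ * Ω * H = 1 := by
    rw [hH, ← Matrix.mul_assoc, Matrix.mul_nonsing_inv _ hdet]
  set D := A - A * (W * Wᵀ) with hD
  have hDW : D * W = 0 := by
    rw [hD, Matrix.sub_mul, Matrix.mul_assoc, Matrix.mul_assoc W, hW, Matrix.mul_one, sub_self]
  have hAN : A - N = D + -(D * Ω * H * Wᵀ) := by
    have : D * Ω * H * Wᵀ = N - A * (W * Wᵀ) := by
      rw [hD, hN]
      simp only [Matrix.sub_mul]
      congr 1
      calc A * (W * Wᵀ) * Ω * H * Wᵀ = A * W * (Wᵀ * Ω * H) * Wᵀ := by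
            simp only [Matrix.mul_assoc]
        _ = _ := by rw [hGH, Matrix.mul_one, Matrix.mul_assoc]
    rw [this, hD]; abel
  calc ‖A - U * Matrix.diagonal σ * Vᵀ‖ ^ 2
      = ‖A - P * A‖ ^ 2 + ‖P * A - U * Matrix.diagonal σ * Vᵀ‖ ^ 2 := hpyth _ hPM
    _ ≤ ‖A - P * A‖ ^ 2 + ‖P * A - N‖ ^ 2 := by linarith
    _ = ‖A - N‖ ^ 2 := (hpyth N hPN).symm
    _ = ‖D‖ ^ 2 + ‖D * Ω * H * Wᵀ‖ ^ 2 := by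
        rw [hAN, frobenius_sq_add_of_mul_transpose, norm_neg]
        rw [Matrix.transpose_neg, Matrix.transpose_mul, Matrix.transpose_transpose, Matrix.mul_neg,
          ← Matrix.mul_assoc, hDW, Matrix.zero_mul, neg_zero]
    _ = _ := by rw [frobenius_sq_mul_isometry hW]

/-- Where the singular values do not vanish, the left singular vectors lie in the sketched column
space, so that truncation is projection onto them. -/
theorem IsTruncatedSVD.eq_proj_mul {m n k : ℕ} {A : Matrix (Fin m) (Fin n) ℝ}
    {P : Matrix (Fin m) (Fin m) ℝ} (hs : Pᵀ = P) (hi : P * P = P)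
    {U : Matrix (Fin m) (Fin k) ℝ} {σ : Fin k → ℝ} {V : Matrix (Fin n) (Fin k) ℝ}
    (h : IsTruncatedSVD (P * A) U σ V) (hσ : ∀ i, 0 < σ i) :
    U * Matrix.diagonal σ * Vᵀ = U * Uᵀ * A := by
  have h1 : P * U = U := by
    have h2 : P * (U * Matrix.diagonal σ) = U * Matrix.diagonal σ := by
      rw [← h.mul_right, ← Matrix.mul_assoc, ← Matrix.mul_assoc, hi]
    ext i j
    have := congrFun (congrFun h2 i) j
    rw [← Matrix.mul_assoc, Matrix.mul_diagonal, Matrix.mul_diagonal] at this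
    exact mul_right_cancel₀ (hσ j).ne' this
  have h3 : Uᵀ * P = Uᵀ := by
    rw [← hs, ← Matrix.transpose_mul, h1]
  rw [Matrix.mul_assoc, ← h.transpose_mul, ← Matrix.mul_assoc Uᵀ, h3, Matrix.mul_assoc]

/-- Row selection by weights `s`: if the weighted rows of `U` form an approximate isometry and the
weights do not enlarge the residual `A - U Uᵀ A`, then projecting onto the rows of `A` with
non-zero weight is nearly as good as projecting onto the columns of `U`. -/
theorem frobenius_sub_mul_proj_le_of_weights {m n k : ℕ} (A : Matrix (Fin m) (Fin n) ℝ)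
    {U : Matrix (Fin m) (Fin k) ℝ} (hU : Uᵀ * U = 1) (s : Fin m → ℝ) (hs : ∀ i, 0 ≤ s i) {θ : ℝ}
    (hθ : 0 < θ)
    (hN : ∀ z : Fin k → ℝ, θ * (z ⬝ᵥ z) ≤ ∑ i, s i * (U *ᵥ z) i ^ 2)
    (hE : ∑ i, s i * ∑ j, (A - U * Uᵀ * A) i j ^ 2 ≤ ‖A - U * Uᵀ * A‖ ^ 2)
    {Q : Matrix (Fin n) (Fin n) ℝ} (hQs : Qᵀ = Q) (hQi : Q * Q = Q)
    (hQ : ∀ i, s i ≠ 0 → (A * Q) i = A i) :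
    ‖A - A * Q‖ ^ 2 ≤ (1 + 1 / θ) * ‖A - U * Uᵀ * A‖ ^ 2 := by
  set S := Matrix.diagonal s with hS
  set N := Uᵀ * S * U with hNdef
  set E := A - U * Uᵀ * A with hEdef
  have hquad : ∀ z : Fin k → ℝ, z ⬝ᵥ (N *ᵥ z) = ∑ i, s i * (U *ᵥ z) i ^ 2 := by
    intro z
    rw [hNdef, ← Matrix.mulVec_mulVec, ← Matrix.mulVec_mulVec, Matrix.dotProduct_mulVec,
      Matrix.vecMul_transpose, dotProduct]
    refine Finset.sum_congr rfl fun i _ => ?_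
    rw [hS, Matrix.mulVec_diagonal]
    ring
  have hinj : Function.Injective N.mulVec := by
    rw [← Matrix.coe_mulVecLin, ← LinearMap.ker_eq_bot, LinearMap.ker_eq_bot']
    intro z hz
    have h1 := hN z
    have hz : N *ᵥ z = 0 := hz
    rw [← hquad, hz, dotProduct_zero] at h1
    have h2 : 0 ≤ z ⬝ᵥ z := Finset.sum_nonneg fun i _ => mul_self_nonneg _
    exact dotProduct_self_eq_zero.1 (le_antisymm (by nlinarith) h2)
  have hdet : IsUnit N.det := (Matrix.isUnit_iff_isUnit_det _).1
    (Matrix.mulVec_injective_iff_isUnit.1 hinj)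
  set F := U * (N⁻¹ * (Uᵀ * (S * A))) with hF
  have hSA : S * A * Q = S * A := by
    ext i j
    rw [Matrix.mul_assoc, hS, Matrix.diagonal_mul, Matrix.diagonal_mul]
    by_cases h : s i = 0
    · simp [h]
    · rw [hQ i h]
  have hFQ : F * Q = F := by
    rw [hF]
    simp only [Matrix.mul_assoc]
    rw [← Matrix.mul_assoc S, hSA]
  set Z := N⁻¹ * (Uᵀ * (S * E)) with hZ
  have hUE : Uᵀ * E = 0 := by
    rw [hEdef, Matrix.mul_sub, ← Matrix.mul_assoc, ← Matrix.mul_assoc, hU, Matrix.one_mul, sub_self]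
  have hAF : A - F = E + -(U * Z) := by
    have hA : A = U * Uᵀ * A + E := by rw [hEdef]; abel
    have h1 : Uᵀ * (S * A) = N * (Uᵀ * A) + Uᵀ * (S * E) := by
      conv_lhs => rw [hA]
      rw [Matrix.mul_add, Matrix.mul_add, hNdef]
      simp only [Matrix.mul_assoc]
    have h2 : F = U * Uᵀ * A + U * Z := by
      rw [hF, h1, Matrix.mul_add, ← Matrix.mul_assoc N⁻¹, Matrix.nonsing_inv_mul _ hdet,
        Matrix.one_mul, Matrix.mul_add, ← Matrix.mul_assoc U Uᵀ]
    rw [h2, hEdef]; abel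
  have hZle : ‖Z‖ ^ 2 ≤ 1 / θ * ∑ i, s i * ∑ j, E i j ^ 2 := by
    have hcol : ∀ j, ∑ a, Z a j ^ 2 ≤ 1 / θ * ∑ i, s i * E i j ^ 2 := by
      intro j
      set z : Fin k → ℝ := fun a => Z a j with hz
      set y : Fin m → ℝ := fun i => E i j with hy
      have hNz : N *ᵥ z = Uᵀ *ᵥ (S *ᵥ y) := by
        have h1 : N * Z = Uᵀ * (S * E) := by
          rw [hZ, ← Matrix.mul_assoc, Matrix.mul_nonsing_inv _ hdet, Matrix.one_mul]
        funext a
        have := congrFun (congrFun h1 a) j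
        rw [← Matrix.mul_assoc Uᵀ] at this
        rw [Matrix.mulVec_mulVec]
        exact this
      have h2 : z ⬝ᵥ (N *ᵥ z) = ∑ i, s i * ((U *ᵥ z) i * y i) := by
        rw [hNz, Matrix.dotProduct_mulVec, Matrix.vecMul_transpose, dotProduct]
        refine Finset.sum_congr rfl fun i _ => ?_
        rw [hS, Matrix.mulVec_diagonal]
        ring
      rw [hquad] at h2
      have h3 : 0 ≤ ∑ i, s i * (y i - (U *ᵥ z) i) ^ 2 :=
        Finset.sum_nonneg fun i _ => mul_nonneg (hs i) (sq_nonneg _)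
      have h4 : ∑ i, s i * (y i - (U *ᵥ z) i) ^ 2 = ∑ i, s i * y i ^ 2 +
          ∑ i, s i * (U *ᵥ z) i ^ 2 - 2 * ∑ i, s i * ((U *ᵥ z) i * y i) := by
        rw [Finset.mul_sum, ← Finset.sum_add_distrib, ← Finset.sum_sub_distrib]
        exact Finset.sum_congr rfl fun i _ => by ring
      have h5 := hN z
      have h6 : z ⬝ᵥ z = ∑ a, Z a j ^ 2 := by
        rw [dotProduct]; exact Finset.sum_congr rfl fun a _ => by simp [hz, sq]
      rw [h6] at h5
      rw [one_div, ← div_eq_inv_mul, le_div_iff₀ hθ]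
      have h7 : ∑ i, s i * E i j ^ 2 = ∑ i, s i * y i ^ 2 := rfl
      linarith
    rw [frobenius_sq, Finset.sum_comm]
    refine (Finset.sum_le_sum fun j _ => hcol j).trans (le_of_eq ?_)
    rw [← Finset.mul_sum, Finset.sum_comm]
    simp only [Finset.mul_sum]
  calc ‖A - A * Q‖ ^ 2 ≤ ‖A - F‖ ^ 2 := frobenius_sub_mul_proj_le hQs hQi A F hFQ
    _ = ‖E‖ ^ 2 + ‖Z‖ ^ 2 := by
        rw [hAF, frobenius_sq_add_of_transpose_mul, norm_neg, frobenius_sq_isometry_mul hU]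
        rw [Matrix.mul_neg, ← Matrix.mul_assoc, ← Matrix.transpose_transpose (Eᵀ * U),
          Matrix.transpose_mul, Matrix.transpose_transpose, hUE, Matrix.transpose_zero,
          Matrix.zero_mul, neg_zero]
    _ ≤ ‖E‖ ^ 2 + 1 / θ * ‖E‖ ^ 2 := by
        have : 1 / θ * ∑ i, s i * ∑ j, E i j ^ 2 ≤ 1 / θ * ‖E‖ ^ 2 :=
          mul_le_mul_of_nonneg_left hE (by positivity)
        linarith
    _ = _ := by ring

/-- A matrix of rank at least `k` has `k` orthonormal vectors in its row space. -/
theorem exists_orthonormal_rows {m n k : ℕ} (A : Matrix (Fin m) (Fin n) ℝ) (hk : k ≤ A.rank) :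
    ∃ (V : Matrix (Fin n) (Fin k) ℝ) (T : Matrix (Fin k) (Fin m) ℝ), Vᵀ * V = 1 ∧ Vᵀ = T * A := by
  let S : Submodule ℝ (EuclideanSpace ℝ (Fin n)) :=
    Submodule.span ℝ (Set.range fun i => (WithLp.toLp 2 (A i) : EuclideanSpace ℝ (Fin n)))
  have hS : Module.finrank ℝ S = A.rank := by
    have h1 : S = (Submodule.span ℝ (Set.range A.row)).map
        (WithLp.linearEquiv 2 ℝ (Fin n → ℝ)).symm.toLinearMap := by
      rw [Submodule.map_span, ← Set.range_comp]
      rfl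
    rw [Matrix.rank_eq_finrank_span_row, h1]
    exact LinearEquiv.finrank_map_eq (WithLp.linearEquiv 2 ℝ (Fin n → ℝ)).symm _
  let u := stdOrthonormalBasis ℝ S
  have hk' : k ≤ Module.finrank ℝ S := by omega
  have hmem : ∀ a : Fin k, ∃ t : Fin m → ℝ, ∀ j,
      (u (Fin.castLE hk' a) : EuclideanSpace ℝ (Fin n)) j = ∑ i, t i * A i j := by
    intro a
    have h1 := (u (Fin.castLE hk' a)).2
    rw [Submodule.mem_span_range_iff_exists_fun] at h1
    obtain ⟨t, ht⟩ := h1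
    exact ⟨t, fun j => by rw [← ht]; simp⟩
  choose t ht using hmem
  refine ⟨Matrix.of fun j a => (u (Fin.castLE hk' a) : EuclideanSpace ℝ (Fin n)) j,
    Matrix.of t, ?_, ?_⟩
  · ext a b
    have h1 : Orthonormal ℝ fun i : Fin (Module.finrank ℝ S) => (u i : EuclideanSpace ℝ (Fin n)) :=
      u.orthonormal.comp_linearIsometry S.subtypeₗᵢ
    have := orthonormal_iff_ite.1 h1 (Fin.castLE hk' a) (Fin.castLE hk' b)
    simp only [PiLp.inner_apply, RCLike.inner_apply, conj_trivial] at this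
    simp only [Matrix.mul_apply, Matrix.transpose_apply, Matrix.of_apply, Matrix.one_apply]
    rw [Finset.sum_congr rfl fun j _ => mul_comm _ _, this]
    simp
  · ext a j
    simp [Matrix.mul_apply, ht]

theorem le_rank_sketch {m n k ℓ : ℕ} {A : Matrix (Fin m) (Fin n) ℝ} {V : Matrix (Fin n) (Fin k) ℝ}
    {T : Matrix (Fin k) (Fin m) ℝ} (hT : Vᵀ = T * A) (Ω : Matrix (Fin n) (Fin ℓ) ℝ)
    (hdet : IsUnit ((Vᵀ * Ω) * (Vᵀ * Ω)ᵀ).det) : k ≤ (A * Ω).rank := by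
  have h1 : ((Vᵀ * Ω) * (Vᵀ * Ω)ᵀ).rank = k := by
    rw [Matrix.rank_of_isUnit _ ((Matrix.isUnit_iff_isUnit_det _).2 hdet), Fintype.card_fin]
  have h2 := Matrix.rank_mul_le_left (Vᵀ * Ω) (Vᵀ * Ω)ᵀ
  rw [h1, hT, Matrix.mul_assoc] at h2
  exact h2.trans (Matrix.rank_mul_le_right _ _)

/-! ### Dual set sparsification -/

/-- `M = Q diag(lam) Qᵀ` with `Q` orthogonal. -/
structure IsEigenDecomp {k : ℕ} (M Q : Matrix (Fin k) (Fin k) ℝ) (lam : Fin k → ℝ) : Prop where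
  orthonormal : Qᵀ * Q = 1
  eq : M = Q * Matrix.diagonal lam * Qᵀ

theorem IsEigenDecomp.of_mul {k : ℕ} {M Q : Matrix (Fin k) (Fin k) ℝ} {lam : Fin k → ℝ}
    (h1 : Qᵀ * Q = 1) (h2 : M * Q = Q * Matrix.diagonal lam) : IsEigenDecomp M Q lam :=
  ⟨h1, by rw [← h2, Matrix.mul_assoc, mul_eq_one_comm.1 h1, Matrix.mul_one]⟩

theorem isEigenDecomp_of_isHermitian {k : ℕ} {M : Matrix (Fin k) (Fin k) ℝ} (hM : M.IsHermitian) :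
    IsEigenDecomp M (hM.eigenvectorUnitary : Matrix (Fin k) (Fin k) ℝ) hM.eigenvalues := by
  constructor
  · have := Unitary.coe_star_mul_self hM.eigenvectorUnitary
    simpa [Matrix.star_eq_conjTranspose, Matrix.conjTranspose_eq_transpose_of_trivial] using this
  · have h := hM.spectral_theorem
    rw [Unitary.conjStarAlgAut_apply] at h
    simpa [Matrix.star_eq_conjTranspose, Matrix.conjTranspose_eq_transpose_of_trivial,
      Function.comp_def] using h

section EigenDecomp

variable {k : ℕ} {M Q : Matrix (Fin k) (Fin k) ℝ} {lam : Fin k → ℝ}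

theorem dotProduct_conj_diagonal_mulVec (Q : Matrix (Fin k) (Fin k) ℝ) (f : Fin k → ℝ)
    (z : Fin k → ℝ) : z ⬝ᵥ ((Q * Matrix.diagonal f * Qᵀ) *ᵥ z) = ∑ i, f i * (Qᵀ *ᵥ z) i ^ 2 := by
  rw [← Matrix.mulVec_mulVec, ← Matrix.mulVec_mulVec, Matrix.dotProduct_mulVec,
    ← Matrix.mulVec_transpose, dotProduct]
  refine Finset.sum_congr rfl fun i _ => ?_
  rw [Matrix.mulVec_diagonal]
  ring

theorem trace_conj_diagonal (hQ : Qᵀ * Q = 1) (f : Fin k → ℝ) :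
    (Q * Matrix.diagonal f * Qᵀ).trace = ∑ i, f i := by
  rw [Matrix.trace_mul_comm, ← Matrix.mul_assoc, hQ, Matrix.one_mul, Matrix.trace_diagonal]

theorem conj_diagonal_mul (hQ : Qᵀ * Q = 1) (f g : Fin k → ℝ) :
    (Q * Matrix.diagonal f * Qᵀ) * (Q * Matrix.diagonal g * Qᵀ) =
      Q * Matrix.diagonal (fun i => f i * g i) * Qᵀ := by
  rw [← Matrix.diagonal_mul_diagonal]
  calc _ = Q * Matrix.diagonal f * (Qᵀ * Q) * Matrix.diagonal g * Qᵀ := by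
        simp only [Matrix.mul_assoc]
    _ = _ := by rw [hQ, Matrix.mul_one, Matrix.mul_assoc Q]

theorem IsEigenDecomp.sub_smul_one (h : IsEigenDecomp M Q lam) (L : ℝ) :
    M - L • (1 : Matrix (Fin k) (Fin k) ℝ) =
      Q * Matrix.diagonal (fun i => lam i - L) * Qᵀ := by
  have h1 : Matrix.diagonal (fun i => lam i - L) = Matrix.diagonal lam - L • 1 := by
    ext i j; by_cases hij : i = j <;> simp [hij]
  rw [h1, Matrix.mul_sub, Matrix.sub_mul, ← h.eq, Matrix.mul_smul, Matrix.smul_mul, Matrix.mul_one,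
    mul_eq_one_comm.1 h.orthonormal]

theorem IsEigenDecomp.resolvent_eq (h : IsEigenDecomp M Q lam) {L : ℝ} (hL : ∀ i, lam i ≠ L) :
    (M - L • (1 : Matrix (Fin k) (Fin k) ℝ))⁻¹ =
      Q * Matrix.diagonal (fun i => (lam i - L)⁻¹) * Qᵀ := by
  refine Matrix.inv_eq_right_inv ?_
  rw [h.sub_smul_one, conj_diagonal_mul h.orthonormal]
  simp only [mul_inv_cancel₀ (sub_ne_zero.2 (hL _)), Matrix.diagonal_one, Matrix.mul_one,
    mul_eq_one_comm.1 h.orthonormal]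

theorem IsEigenDecomp.trace_resolvent (h : IsEigenDecomp M Q lam) {L : ℝ} (hL : ∀ i, lam i ≠ L) :
    (M - L • (1 : Matrix (Fin k) (Fin k) ℝ))⁻¹.trace = ∑ i, (lam i - L)⁻¹ := by
  rw [h.resolvent_eq hL, trace_conj_diagonal h.orthonormal]

/-- All eigenvalues of `M` exceed `L`, in terms of the quadratic form of `M`. -/
def EigenvaluesAbove {k : ℕ} (L : ℝ) (M : Matrix (Fin k) (Fin k) ℝ) : Prop :=
  ∀ z : Fin k → ℝ, z ≠ 0 → L * (z ⬝ᵥ z) < z ⬝ᵥ (M *ᵥ z)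

theorem sum_sq_transpose_mulVec (hQ : Qᵀ * Q = 1) (z : Fin k → ℝ) :
    ∑ i, (Qᵀ *ᵥ z) i ^ 2 = z ⬝ᵥ z := by
  have := dotProduct_conj_diagonal_mulVec Q (fun _ => 1) z
  rw [Matrix.diagonal_one, Matrix.mul_one, mul_eq_one_comm.1 hQ, Matrix.one_mulVec] at this
  simpa using this.symm

theorem IsEigenDecomp.eigenvaluesAbove_iff (h : IsEigenDecomp M Q lam) {L : ℝ} :
    EigenvaluesAbove L M ↔ ∀ i, L < lam i := by
  constructor
  · intro hM i
    have hz : Qᵀ *ᵥ (Q *ᵥ Pi.single i 1) = Pi.single i 1 := by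
      rw [Matrix.mulVec_mulVec, h.orthonormal, Matrix.one_mulVec]
    have h1 := hM (Q *ᵥ Pi.single i 1) (fun h0 => by
      rw [h0, Matrix.mulVec_zero] at hz
      have := congrFun hz i
      simp at this)
    rw [← sum_sq_transpose_mulVec h.orthonormal, h.eq, dotProduct_conj_diagonal_mulVec, hz] at h1
    simpa [Pi.single_apply, ite_pow] using h1
  · intro hl z hz
    rw [← sum_sq_transpose_mulVec h.orthonormal, h.eq, dotProduct_conj_diagonal_mulVec,
      Finset.mul_sum]
    refine Finset.sum_lt_sum (fun i _ => mul_le_mul_of_nonneg_right (hl i).le (sq_nonneg _)) ?_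
    by_contra hcon
    push Not at hcon
    apply hz
    have h0 : ∀ i, (Qᵀ *ᵥ z) i = 0 := by
      intro i
      have h1 := hcon i (Finset.mem_univ i)
      by_contra h2
      have h3 : 0 < (Qᵀ *ᵥ z) i ^ 2 := by positivity
      nlinarith [hl i]
    have h4 : Q *ᵥ (Qᵀ *ᵥ z) = 0 := by rw [show Qᵀ *ᵥ z = 0 from funext h0, Matrix.mulVec_zero]
    rwa [Matrix.mulVec_mulVec, mul_eq_one_comm.1 h.orthonormal, Matrix.one_mulVec] at h4

end EigenDecomp

theorem barrier_eq_trace {k : ℕ} {M : Matrix (Fin k) (Fin k) ℝ} (hM : M.IsHermitian) {L : ℝ}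
    (h : EigenvaluesAbove L M) :
    barrier L hM = (M - L • (1 : Matrix (Fin k) (Fin k) ℝ))⁻¹.trace := by
  have hd := isEigenDecomp_of_isHermitian hM
  rw [hd.trace_resolvent fun i => ((hd.eigenvaluesAbove_iff.1 h) i).ne']
  rfl

/-- The sum of the barrier terms `(λ_i - L)⁻¹`, in any eigenvalue decomposition. -/
theorem IsEigenDecomp.barrier_eq {k : ℕ} {M Q : Matrix (Fin k) (Fin k) ℝ} {lam : Fin k → ℝ}
    (h : IsEigenDecomp M Q lam) (hM : M.IsHermitian) {L : ℝ} (hL : EigenvaluesAbove L M) :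
    barrier L hM = ∑ i, (lam i - L)⁻¹ := by
  rw [barrier_eq_trace hM hL, h.trace_resolvent fun i => (h.eigenvaluesAbove_iff.1 hL i).ne']

/-- The largest admissible value of the inverse weight of a vector `v` in a step of dual set
sparsification with current barrier `L` and current matrix `M`. -/
noncomputable def invWeightBound {k : ℕ} (L : ℝ) {M : Matrix (Fin k) (Fin k) ℝ}
    (hM : M.IsHermitian) (v : Fin k → ℝ) : ℝ :=
  (v ⬝ᵥ (((M - (L + 1) • (1 : Matrix (Fin k) (Fin k) ℝ))⁻¹ *
      (M - (L + 1) • (1 : Matrix (Fin k) (Fin k) ℝ))⁻¹) *ᵥ v)) /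
      (barrier (L + 1) hM - barrier L hM) -
    v ⬝ᵥ ((M - (L + 1) • (1 : Matrix (Fin k) (Fin k) ℝ))⁻¹ *ᵥ v)

theorem EigenvaluesAbove.mono {k : ℕ} {M : Matrix (Fin k) (Fin k) ℝ} {L L' : ℝ} (h : L' ≤ L)
    (hM : EigenvaluesAbove L M) : EigenvaluesAbove L' M := fun z hz =>
  (mul_le_mul_of_nonneg_right h (Finset.sum_nonneg fun _ _ => mul_self_nonneg _)).trans_lt (hM z hz)

theorem IsEigenDecomp.invWeightBound_eq {k : ℕ} {M Q : Matrix (Fin k) (Fin k) ℝ} {lam : Fin k → ℝ}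
    (h : IsEigenDecomp M Q lam) (hM : M.IsHermitian) {L : ℝ} (hL : EigenvaluesAbove (L + 1) M)
    (v : Fin k → ℝ) :
    invWeightBound L hM v =
      (∑ i, ((lam i - (L + 1))⁻¹ * (lam i - (L + 1))⁻¹) * (Qᵀ *ᵥ v) i ^ 2) /
        (∑ i, (lam i - (L + 1))⁻¹ - ∑ i, (lam i - L)⁻¹) -
      ∑ i, (lam i - (L + 1))⁻¹ * (Qᵀ *ᵥ v) i ^ 2 := by
  rw [invWeightBound, h.barrier_eq hM hL, h.barrier_eq hM (hL.mono (by linarith)),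
    h.resolvent_eq fun i => (h.eigenvaluesAbove_iff.1 hL i).ne', conj_diagonal_mul h.orthonormal,
    dotProduct_conj_diagonal_mulVec, dotProduct_conj_diagonal_mulVec]

/-- If the barrier function is less than one at `L`, the barrier can be moved by one. -/
theorem EigenvaluesAbove.add_one {k : ℕ} {M : Matrix (Fin k) (Fin k) ℝ} (hM : M.IsHermitian)
    {L : ℝ} (hL : EigenvaluesAbove L M) (hb : barrier L hM < 1) : EigenvaluesAbove (L + 1) M := by
  have h := isEigenDecomp_of_isHermitian hM
  rw [h.eigenvaluesAbove_iff] at hL ⊢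
  intro i
  have h1 : (hM.eigenvalues i - L)⁻¹ ≤ barrier L hM :=
    Finset.single_le_sum (f := fun i => (hM.eigenvalues i - L)⁻¹)
      (fun j _ => inv_nonneg.2 (sub_nonneg.2 (hL j).le)) (Finset.mem_univ i)
  have h2 : (hM.eigenvalues i - L)⁻¹ < 1 := by linarith
  have h3 := (inv_lt_one₀ (sub_pos.2 (hL i))).1 h2
  linarith

theorem barrier_lt_barrier_add_one {k : ℕ} (hk : 1 ≤ k) {M : Matrix (Fin k) (Fin k) ℝ}
    (hM : M.IsHermitian) {L : ℝ} (hL : EigenvaluesAbove (L + 1) M) :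
    barrier L hM < barrier (L + 1) hM := by
  have h := (isEigenDecomp_of_isHermitian hM).eigenvaluesAbove_iff.1 hL
  have : Nonempty (Fin k) := ⟨⟨0, hk⟩⟩
  refine Finset.sum_lt_sum_of_nonempty Finset.univ_nonempty fun i _ => ?_
  exact inv_strictAnti₀ (by linarith [h i]) (by linarith)

/-- An admissible step keeps the eigenvalues above the moved barrier and does not increase the
barrier function. The second part is the Sherman-Morrison formula. -/
theorem barrier_step {k : ℕ} (hk : 1 ≤ k) {M M' : Matrix (Fin k) (Fin k) ℝ} (hM : M.IsHermitian)
    (hM' : M'.IsHermitian) {L t : ℝ} {v : Fin k → ℝ} (hL : EigenvaluesAbove (L + 1) M) (ht : 0 < t)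
    (htv : t⁻¹ ≤ invWeightBound L hM v) (hMM : M' = M + t • Matrix.vecMulVec v v) :
    EigenvaluesAbove (L + 1) M' ∧ barrier (L + 1) hM' ≤ barrier L hM := by
  have hab : EigenvaluesAbove (L + 1) M' := by
    intro z hz
    refine (hL z hz).trans_le ?_
    rw [hMM, Matrix.add_mulVec, dotProduct_add, Matrix.smul_mulVec, dotProduct_smul,
      Matrix.vecMulVec_mulVec]
    have : 0 ≤ z ⬝ᵥ (MulOpposite.op (v ⬝ᵥ z) • v) := by
      have e : z ⬝ᵥ (MulOpposite.op (v ⬝ᵥ z) • v) = (v ⬝ᵥ z) * (v ⬝ᵥ z) := by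
        rw [dotProduct_smul, dotProduct_comm z]; simp
      rw [e]; exact mul_self_nonneg _
    simp only [smul_eq_mul]
    nlinarith
  refine ⟨hab, ?_⟩
  have hd := isEigenDecomp_of_isHermitian hM
  have hlam := hd.eigenvaluesAbove_iff.1 hL
  have hne : ∀ i, hM.eigenvalues i ≠ L + 1 := fun i => (hlam i).ne'
  set W := (M - (L + 1) • (1 : Matrix (Fin k) (Fin k) ℝ))⁻¹ with hW
  have hNW : (M - (L + 1) • (1 : Matrix (Fin k) (Fin k) ℝ)) * W = 1 := by
    rw [hW, hd.resolvent_eq hne, hd.sub_smul_one, conj_diagonal_mul hd.orthonormal]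
    simp only [mul_inv_cancel₀ (sub_ne_zero.2 (hne _)), Matrix.diagonal_one, Matrix.mul_one,
      mul_eq_one_comm.1 hd.orthonormal]
  have hWs : Wᵀ = W := by
    rw [hW, hd.resolvent_eq hne, Matrix.transpose_mul, Matrix.transpose_mul,
      Matrix.transpose_transpose, Matrix.diagonal_transpose, Matrix.mul_assoc]
  set a := v ⬝ᵥ (W *ᵥ v) with ha
  have ha0 : 0 ≤ a := by
    rw [ha, hW, hd.resolvent_eq hne, dotProduct_conj_diagonal_mulVec]
    exact Finset.sum_nonneg fun i _ => mul_nonneg (inv_nonneg.2 (by linarith [hlam i]))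
      (sq_nonneg _)
  set b := v ⬝ᵥ ((W * W) *ᵥ v) with hb
  have hdφ := barrier_lt_barrier_add_one hk hM hL
  have htv' : t⁻¹ ≤ b / (barrier (L + 1) hM - barrier L hM) - a := htv
  have hta : 0 < 1 + t * a := by positivity
  have hvw : W * Matrix.vecMulVec v v * W = Matrix.vecMulVec (W *ᵥ v) (W *ᵥ v) := by
    rw [Matrix.mul_vecMulVec, Matrix.vecMulVec_mul, ← Matrix.mulVec_transpose, hWs]
  have hvWv : Matrix.vecMulVec v v * W * Matrix.vecMulVec v v = a • Matrix.vecMulVec v v := by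
    rw [Matrix.mul_assoc, Matrix.mul_vecMulVec, Matrix.vecMulVec_mul_vecMulVec, ← ha,
      Matrix.vecMulVec_smul]
  have hinv : (M' - (L + 1) • (1 : Matrix (Fin k) (Fin k) ℝ))⁻¹ =
      W - (t / (1 + t * a)) • (W * Matrix.vecMulVec v v * W) := by
    refine Matrix.inv_eq_right_inv ?_
    have e1 : M' - (L + 1) • (1 : Matrix (Fin k) (Fin k) ℝ) =
        (M - (L + 1) • 1) + t • Matrix.vecMulVec v v := by rw [hMM]; abel
    rw [e1, Matrix.add_mul, Matrix.mul_sub, Matrix.mul_sub, hNW, Matrix.mul_smul, Matrix.mul_smul,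
      Matrix.smul_mul, Matrix.smul_mul, ← Matrix.mul_assoc, ← Matrix.mul_assoc, hNW,
      Matrix.one_mul]
    have e2 : Matrix.vecMulVec v v * (W * Matrix.vecMulVec v v * W) =
        a • (Matrix.vecMulVec v v * W) := by
      rw [← Matrix.mul_assoc, ← Matrix.mul_assoc, hvWv, Matrix.smul_mul]
    rw [e2]
    ext i j
    simp only [Matrix.add_apply, Matrix.sub_apply, Matrix.smul_apply, smul_eq_mul]
    field_simp
    ring
  have htr : (W * Matrix.vecMulVec v v * W).trace = b := by
    rw [hvw, Matrix.trace_vecMulVec, hb, ← Matrix.mulVec_mulVec, Matrix.dotProduct_mulVec v,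
      ← Matrix.mulVec_transpose, hWs]
  rw [barrier_eq_trace hM' hab, hinv, Matrix.trace_sub, Matrix.trace_smul, htr, smul_eq_mul,
    ← barrier_eq_trace hM hL]
  have hpos : 0 < barrier (L + 1) hM - barrier L hM := by linarith
  have h1 : t⁻¹ + a ≤ b / (barrier (L + 1) hM - barrier L hM) := by linarith
  rw [le_div_iff₀ hpos] at h1
  have h2 : t / (1 + t * a) * (t⁻¹ + a) = 1 := by field_simp
  have h3 : 0 ≤ t / (1 + t * a) := by positivity
  nlinarith [mul_le_mul_of_nonneg_left h1 h3]

/-- Averaged over the rows of a matrix with orthonormal columns, the admissible inverse weights are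
large. By the Cauchy-Schwarz inequality this holds as long as the barrier function is at most
one. -/
theorem one_sub_barrier_le_sum {N k : ℕ} (hk : 1 ≤ k) {U : Matrix (Fin N) (Fin k) ℝ}
    (hU : Uᵀ * U = 1) {M : Matrix (Fin k) (Fin k) ℝ} (hM : M.IsHermitian) {L : ℝ}
    (hL : EigenvaluesAbove (L + 1) M) (hb : barrier L hM ≤ 1) :
    1 - barrier L hM ≤ ∑ j, invWeightBound L hM (U j) := by
  have hd := isEigenDecomp_of_isHermitian hM
  have hlam := hd.eigenvaluesAbove_iff.1 hL
  have hdφ := barrier_lt_barrier_add_one hk hM hL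
  have hsum : ∀ X : Matrix (Fin k) (Fin k) ℝ, ∑ j, U j ⬝ᵥ (X *ᵥ U j) = X.trace := by
    intro X
    have h1 : (U * X * Uᵀ).trace = X.trace := by
      rw [Matrix.trace_mul_comm, ← Matrix.mul_assoc, hU, Matrix.one_mul]
    rw [← h1, Matrix.mul_assoc, Matrix.trace]
    refine Finset.sum_congr rfl fun j _ => ?_
    simp only [Matrix.diag_apply, Matrix.mul_apply (M := U), dotProduct, Matrix.mulVec]
    rfl
  simp only [invWeightBound]
  rw [Finset.sum_sub_distrib, ← Finset.sum_div, hsum, hsum,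
    hd.resolvent_eq fun i => (hlam i).ne', conj_diagonal_mul hd.orthonormal,
    trace_conj_diagonal hd.orthonormal, trace_conj_diagonal hd.orthonormal]
  set a : Fin k → ℝ := fun i => (hM.eigenvalues i - (L + 1))⁻¹ with ha
  set b : Fin k → ℝ := fun i => (hM.eigenvalues i - L)⁻¹ with hbdef
  have e1 : barrier (L + 1) hM = ∑ i, a i := rfl
  have e2 : barrier L hM = ∑ i, b i := rfl
  have hab : ∀ i, a i - b i = a i * b i := by
    intro i
    have h1 := hlam i
    have h2 : hM.eigenvalues i - (L + 1) ≠ 0 := by linarith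
    have h3 : hM.eigenvalues i - L ≠ 0 := by linarith
    simp only [ha, hbdef]
    field_simp
    ring
  have ha0 : ∀ i, 0 < a i := fun i => inv_pos.2 (by linarith [hlam i])
  have hb0 : ∀ i, 0 < b i := fun i => inv_pos.2 (by linarith [hlam i])
  rw [e1, e2] at hdφ ⊢
  rw [e2] at hb
  set d := ∑ i, a i - ∑ i, b i with hddef
  have hd0 : 0 < d := by rw [hddef]; linarith
  have hd1 : d = ∑ i, a i * b i := by
    rw [hddef, ← Finset.sum_sub_distrib]; exact Finset.sum_congr rfl fun i _ => hab i
  have hCS : d ^ 2 ≤ (∑ i, a i ^ 2 * b i) * ∑ i, b i := by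
    rw [hd1]
    have := Finset.sum_mul_sq_le_sq_mul_sq Finset.univ (fun i => a i * √(b i)) (fun i => √(b i))
    refine le_trans (le_of_eq ?_) (this.trans (le_of_eq ?_))
    · congr 1
      refine Finset.sum_congr rfl fun i _ => ?_
      rw [mul_assoc, Real.mul_self_sqrt (hb0 i).le]
    · congr 1
      · refine Finset.sum_congr rfl fun i _ => ?_
        rw [mul_pow, Real.sq_sqrt (hb0 i).le]
      · exact Finset.sum_congr rfl fun i _ => Real.sq_sqrt (hb0 i).le
  have hA : ∑ i, a i * a i = d + ∑ i, a i ^ 2 * b i := by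
    rw [hd1, ← Finset.sum_add_distrib]
    refine Finset.sum_congr rfl fun i _ => ?_
    linear_combination a i * hab i
  have hA0 : 0 ≤ ∑ i, a i ^ 2 * b i :=
    Finset.sum_nonneg fun i _ => mul_nonneg (sq_nonneg _) (hb0 i).le
  have h2 : d + d ^ 2 ≤ ∑ i, a i * a i := by
    rw [hA]; nlinarith
  have h3 : 1 + d ≤ (∑ i, a i * a i) / d := by
    rw [le_div_iff₀ hd0]; nlinarith
  linarith

/-- The state of dual set sparsification before iteration `τ`: the barrier `τ - √(r k)` lies below
the spectrum and the barrier function has not increased. -/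
def DualSetInvariant {k : ℕ} (r τ : ℕ) {M : Matrix (Fin k) (Fin k) ℝ} (hM : M.IsHermitian) : Prop :=
  EigenvaluesAbove ((τ : ℝ) - √(r * k)) M ∧ barrier ((τ : ℝ) - √(r * k)) hM ≤ √(k / r)

theorem sqrt_div_lt_one {k r : ℕ} (hkr : k < r) : √((k : ℝ) / r) < 1 := by
  rw [Real.sqrt_lt' one_pos, one_pow, div_lt_one (by exact_mod_cast (Nat.zero_le k).trans_lt hkr)]
  exact_mod_cast hkr

theorem sqrt_mul_eq_mul_sqrt_div {k r : ℕ} (hr : 0 < r) : √((r : ℝ) * k) = r * √((k : ℝ) / r) := by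
  have hr' : (0 : ℝ) < r := by exact_mod_cast hr
  have : (r : ℝ) * k = r ^ 2 * (k / r) := by field_simp
  rw [this, Real.sqrt_mul (by positivity), Real.sqrt_sq hr'.le]

theorem dualSetInvariant_zero {N k r : ℕ} (hk : 1 ≤ k) (hkr : k < r) (v : Fin N → Fin k → ℝ)
    (j : ℕ → Fin N) (t : ℕ → ℝ) : DualSetInvariant r 0 (dualSetMatrix_isHermitian v j t 0) := by
  have hk' : (0 : ℝ) < k := by exact_mod_cast hk
  have hr' : (0 : ℝ) < r := by exact_mod_cast (Nat.zero_le k).trans_lt hkr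
  have h0 : dualSetMatrix v j t 0 = 0 := by simp [dualSetMatrix]
  have hs : 0 < √((r : ℝ) * k) := Real.sqrt_pos.2 (by positivity)
  have hab : EigenvaluesAbove (((0 : ℕ) : ℝ) - √(r * k)) (dualSetMatrix v j t 0) := by
    intro z hz
    rw [h0, Matrix.zero_mulVec, dotProduct_zero]
    have h1 : 0 ≤ z ⬝ᵥ z := Finset.sum_nonneg fun i _ => mul_self_nonneg _
    have h2 : z ⬝ᵥ z ≠ 0 := fun h => hz (dotProduct_self_eq_zero.1 h)
    have h3 : 0 < z ⬝ᵥ z := lt_of_le_of_ne h1 h2.symm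
    push_cast
    nlinarith
  refine ⟨hab, le_of_eq ?_⟩
  have hd : IsEigenDecomp (dualSetMatrix v j t 0) 1 (fun _ => 0) := ⟨by simp, by simp [h0]⟩
  rw [hd.barrier_eq _ hab]
  have h1 : √((r : ℝ) * k) * √((k : ℝ) / r) = k := by
    rw [← Real.sqrt_mul (by positivity)]
    rw [show (r : ℝ) * k * (k / r) = k ^ 2 by field_simp, Real.sqrt_sq hk'.le]
  simp only [Nat.cast_zero, zero_sub, neg_neg, Finset.sum_const, Finset.card_univ, Fintype.card_fin,
    nsmul_eq_mul]
  rw [← div_eq_mul_inv, div_eq_iff hs.ne', mul_comm, h1]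

theorem DualSetInvariant.above_succ {k r τ : ℕ} (hkr : k < r) {M : Matrix (Fin k) (Fin k) ℝ}
    {hM : M.IsHermitian} (h : DualSetInvariant r τ hM) :
    EigenvaluesAbove ((τ : ℝ) - √(r * k) + 1) M :=
  h.1.add_one hM (h.2.trans_lt (sqrt_div_lt_one hkr))

theorem DualSetInvariant.step {k r τ : ℕ} (hk : 1 ≤ k) (hkr : k < r)
    {M M' : Matrix (Fin k) (Fin k) ℝ} {hM : M.IsHermitian} (hM' : M'.IsHermitian)
    (h : DualSetInvariant r τ hM) {t : ℝ} {v : Fin k → ℝ} (ht : 0 < t)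
    (htv : t⁻¹ ≤ invWeightBound ((τ : ℝ) - √(r * k)) hM v)
    (hMM : M' = M + t • Matrix.vecMulVec v v) : DualSetInvariant r (τ + 1) hM' := by
  have h1 := barrier_step hk hM hM' (h.above_succ hkr) ht htv hMM
  have e : ((τ + 1 : ℕ) : ℝ) - √(r * k) = (τ : ℝ) - √(r * k) + 1 := by push_cast; ring
  rw [DualSetInvariant, e]
  exact ⟨h1.1, h1.2.trans h.2⟩

/-- Each iteration has an index with an admissible weight. -/
theorem DualSetInvariant.exists_index {N l k r τ : ℕ} (hk : 1 ≤ k) (hkr : k < r)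
    {U : Matrix (Fin N) (Fin k) ℝ} (hU : Uᵀ * U = 1) (x : Fin N → Fin l → ℝ)
    {M : Matrix (Fin k) (Fin k) ℝ} {hM : M.IsHermitian} (h : DualSetInvariant r τ hM) :
    ∃ j, 0 < invWeightBound ((τ : ℝ) - √(r * k)) hM (U j) ∧
      ((∑ i, x i ⬝ᵥ x i) / (1 - √(k / r)))⁻¹ * (x j ⬝ᵥ x j) ≤
        invWeightBound ((τ : ℝ) - √(r * k)) hM (U j) := by
  have hc := sqrt_div_lt_one hkr
  have h1 := one_sub_barrier_le_sum hk hU hM (h.above_succ hkr) (h.2.trans hc.le)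
  set f := fun j => invWeightBound ((τ : ℝ) - √(r * k)) hM (U j) with hf
  set g := fun j => ((∑ i, x i ⬝ᵥ x i) / (1 - √(k / r)))⁻¹ * (x j ⬝ᵥ x j) with hg
  have hx0 : ∀ j, 0 ≤ x j ⬝ᵥ x j := fun j => Finset.sum_nonneg fun i _ => mul_self_nonneg _
  have hX0 : 0 ≤ ∑ i, x i ⬝ᵥ x i := Finset.sum_nonneg fun i _ => hx0 i
  have hg0 : ∀ j, 0 ≤ g j := fun j =>
    mul_nonneg (inv_nonneg.2 (div_nonneg hX0 (by linarith))) (hx0 j)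
  have hgs : ∑ j, g j ≤ 1 - √(k / r) := by
    rw [hg, ← Finset.mul_sum, inv_div]
    rcases hX0.eq_or_lt with h0 | h0
    · rw [← h0, div_zero, zero_mul]; linarith
    · rw [div_mul_cancel₀ _ h0.ne']
  have hfs : 1 - √(k / r) ≤ ∑ j, f j := by linarith [h.2]
  by_contra hcon
  push Not at hcon
  -- where `f` is positive it is less than `g`, so that its sum would be too small
  have hle : ∀ j, f j ≤ g j := by
    intro j
    by_cases hj : 0 < f j
    · exact (hcon j hj).le
    · exact (not_lt.1 hj).trans (hg0 j)
  have hpos : ∃ j, 0 < f j := by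
    by_contra hn
    push Not at hn
    have := Finset.sum_nonpos fun j (_ : j ∈ Finset.univ) => hn j
    linarith
  obtain ⟨j, hj⟩ := hpos
  have := Finset.sum_lt_sum (fun i (_ : i ∈ Finset.univ) => hle i) ⟨j, Finset.mem_univ j, hcon j hj⟩
  linarith

/-- The conditions on iteration `τ` of dual set sparsification with current matrix `M`. -/
def DualSetStep {N l k : ℕ} (x : Fin N → Fin l → ℝ) (v : Fin N → Fin k → ℝ) (r τ : ℕ)
    {M : Matrix (Fin k) (Fin k) ℝ} (hM : M.IsHermitian) (j : Fin N) (t : ℝ) : Prop :=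
  0 < t ∧ ((∑ i, x i ⬝ᵥ x i) / (1 - √(k / r)))⁻¹ * (x j ⬝ᵥ x j) ≤ t⁻¹ ∧
    t⁻¹ ≤ invWeightBound ((τ : ℝ) - √(r * k)) hM (v j)

theorem dualSetInvariant_of_steps {N l k r : ℕ} (hk : 1 ≤ k) (hkr : k < r)
    {x : Fin N → Fin l → ℝ} {v : Fin N → Fin k → ℝ} {j : ℕ → Fin N} {t : ℕ → ℝ} :
    ∀ τ, (∀ τ' < τ, DualSetStep x v r τ' (dualSetMatrix_isHermitian v j t τ') (j τ') (t τ')) →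
      DualSetInvariant r τ (dualSetMatrix_isHermitian v j t τ) := by
  intro τ
  induction τ with
  | zero => intro _; exact dualSetInvariant_zero hk hkr v j t
  | succ τ ih =>
    intro h
    have h1 := ih fun τ' h' => h τ' (h'.trans (Nat.lt_succ_self τ))
    have h2 := h τ (Nat.lt_succ_self τ)
    exact h1.step hk hkr _ h2.1 h2.2.2 (by rw [dualSetMatrix, Finset.sum_range_succ]; rfl)

/-- What dual set sparsification achieves: the weighted vectors `v i` form an approximate isometry
and the weights do not enlarge the Frobenius norm of the `x i`. -/
theorem IsDualSetOutput.bounds {N l k r : ℕ} (hk : 1 ≤ k) {x : Fin N → Fin l → ℝ}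
    {U : Matrix (Fin N) (Fin k) ℝ} {s : Fin N → ℝ} (h : IsDualSetOutput x (fun i => U i) r s) :
    (∀ i, 0 ≤ s i) ∧ (∀ z, (1 - √(k / r)) ^ 2 * (z ⬝ᵥ z) ≤ ∑ i, s i * (U *ᵥ z) i ^ 2) ∧
      ∑ i, s i * (x i ⬝ᵥ x i) ≤ ∑ i, x i ⬝ᵥ x i := by
  obtain ⟨hkr, j, t, hstep, hs⟩ := h
  have hstep' : ∀ τ < r, DualSetStep x (fun i => U i) r τ
      (dualSetMatrix_isHermitian (fun i => U i) j t τ) (j τ) (t τ) := hstep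
  have hr : 0 < r := (Nat.zero_le k).trans_lt hkr
  have hr' : (0 : ℝ) < r := by exact_mod_cast hr
  have hc := sqrt_div_lt_one hkr
  set c := √((k : ℝ) / r) with hcdef
  have hswap : ∀ f : Fin N → ℝ, ∑ i, s i * f i =
      (1 - c) / r * ∑ τ ∈ Finset.range r, t τ * f (j τ) := by
    intro f
    simp_rw [hs, mul_assoc, ← Finset.mul_sum, Finset.sum_mul]
    rw [Finset.sum_comm]
    congr 1
    refine Finset.sum_congr rfl fun τ _ => ?_
    simp [ite_mul]
  refine ⟨fun i => ?_, fun z => ?_, ?_⟩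
  · rw [hs]
    refine mul_nonneg (div_nonneg (by linarith) hr'.le) (Finset.sum_nonneg fun τ hτ => ?_)
    split_ifs
    · exact (hstep' τ (Finset.mem_range.1 hτ)).1.le
    · exact le_rfl
  · have hinv := dualSetInvariant_of_steps hk hkr r hstep'
    by_cases hz : z = 0
    · subst hz; simp
    have h1 := hinv.1 z hz
    rw [sqrt_mul_eq_mul_sqrt_div hr, ← hcdef] at h1
    have h2 : z ⬝ᵥ (dualSetMatrix (fun i => U i) j t r *ᵥ z) =
        ∑ τ ∈ Finset.range r, t τ * (U *ᵥ z) (j τ) ^ 2 := by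
      rw [dualSetMatrix, Matrix.sum_mulVec, dotProduct_sum]
      refine Finset.sum_congr rfl fun τ _ => ?_
      rw [Matrix.smul_mulVec, dotProduct_smul, Matrix.vecMulVec_mulVec, dotProduct_smul,
        dotProduct_comm z]
      simp [Matrix.mulVec, sq]
    rw [h2] at h1
    rw [hswap fun i => (U *ᵥ z) i ^ 2]
    have h3 : (1 - c) / r * ((r - r * c) * (z ⬝ᵥ z)) = (1 - c) ^ 2 * (z ⬝ᵥ z) := by
      field_simp
    rw [← h3]
    exact mul_le_mul_of_nonneg_left h1.le (div_nonneg (by linarith) hr'.le)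
  · rw [hswap]
    set X := ∑ i, x i ⬝ᵥ x i with hX
    have hx0 : ∀ i, 0 ≤ x i ⬝ᵥ x i := fun i => Finset.sum_nonneg fun a _ => mul_self_nonneg _
    have hX0 : 0 ≤ X := Finset.sum_nonneg fun i _ => hx0 i
    have h1 : ∀ τ ∈ Finset.range r, t τ * (x (j τ) ⬝ᵥ x (j τ)) ≤ X / (1 - c) := by
      intro τ hτ
      obtain ⟨ht, hle, -⟩ := hstep' τ (Finset.mem_range.1 hτ)
      rcases hX0.eq_or_lt with h0 | h0
      · have : x (j τ) ⬝ᵥ x (j τ) = 0 := by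
          refine le_antisymm ?_ (hx0 _)
          rw [h0]
          exact Finset.single_le_sum (f := fun i => x i ⬝ᵥ x i) (fun i _ => hx0 i)
            (Finset.mem_univ (j τ))
        rw [this, mul_zero]
        exact div_nonneg hX0 (by linarith)
      · have hδ : 0 < X / (1 - c) := div_pos h0 (by linarith)
        rw [inv_mul_le_iff₀ hδ] at hle
        calc t τ * (x (j τ) ⬝ᵥ x (j τ)) ≤ t τ * (X / (1 - c) * (t τ)⁻¹) :=
              mul_le_mul_of_nonneg_left hle ht.le
          _ = X / (1 - c) := by field_simp
    have h2 := Finset.sum_le_sum h1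
    rw [Finset.sum_const, Finset.card_range, nsmul_eq_mul] at h2
    calc (1 - c) / r * ∑ τ ∈ Finset.range r, t τ * (x (j τ) ⬝ᵥ x (j τ))
        ≤ (1 - c) / r * (r * (X / (1 - c))) :=
          mul_le_mul_of_nonneg_left h2 (div_nonneg (by linarith) hr'.le)
      _ = X := by
          have : 1 - c ≠ 0 := by linarith
          field_simp

/-! ### Adaptive sampling -/

/-- A selected row is reproduced by the projection onto the span of the selected rows. -/
theorem mul_pinv_mul_selectRows_apply {m n : ℕ} (A : Matrix (Fin m) (Fin n) ℝ) {l : List ℕ}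
    {i : Fin m} (hi : (i : ℕ) ∈ l) :
    (A * (pinv (selectRows A l) * selectRows A l)) i = A i := by
  obtain ⟨a, ha⟩ := List.get_of_mem hi
  have h1 := (pinv_spec (selectRows A l)).mul_mul_self
  rw [Matrix.mul_assoc] at h1
  have h2 : selectRows A l a = A i := by
    funext j
    have h3 : l.get a < m := by rw [ha]; exact i.isLt
    simp only [selectRows, Matrix.of_apply, dif_pos h3]
    congr 1
    exact Fin.ext ha
  have h4 := congrFun h1 a
  rw [Matrix.mul_apply_eq_vecMul, h2] at h4
  rw [Matrix.mul_apply_eq_vecMul, h4]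

/-- A projection that fixes every row of `R` fixes the row space of `R`. -/
theorem pinv_mul_selectRows_mul {m n : ℕ} (A : Matrix (Fin m) (Fin n) ℝ) {l : List ℕ}
    (hl : ∀ i ∈ l, i < m) {Q : Matrix (Fin n) (Fin n) ℝ}
    (hQ : ∀ i : Fin m, (i : ℕ) ∈ l → (A * Q) i = A i) : selectRows A l * Q = selectRows A l := by
  funext a
  have h1 : selectRows A l a = A ⟨l.get a, hl _ (List.get_mem l a)⟩ := by
    funext j
    simp only [selectRows, Matrix.of_apply, dif_pos (hl _ (List.get_mem l a))]
  have h2 := hQ ⟨l.get a, hl _ (List.get_mem l a)⟩ (List.get_mem l a)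
  rw [Matrix.mul_apply_eq_vecMul] at h2 ⊢
  rw [h1, h2]

theorem integral_unitInterval_indicator {a b : ℝ} (ha : 0 ≤ a) (hab : a ≤ b) (hb : b ≤ 1) :
    ∫ u : unitInterval, (Set.Ico a b).indicator (fun _ => (1 : ℝ)) (u : ℝ) = b - a := by
  have h1 : ∫ u : unitInterval, (Set.Ico a b).indicator (fun _ => (1 : ℝ)) (u : ℝ) =
      ∫ x in unitInterval, (Set.Ico a b).indicator (fun _ => (1 : ℝ)) x :=
    integral_subtype_comap measurableSet_Icc _
  rw [h1, integral_indicator measurableSet_Ico, Measure.restrict_restrict measurableSet_Ico]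
  have h2 : Set.Ico a b ∩ unitInterval = Set.Ico a b :=
    Set.inter_eq_left.2 fun x hx => ⟨ha.trans hx.1, hx.2.le.trans hb⟩
  rw [h2]
  simp [hab]

section Adaptive

variable {m n : ℕ}

/-- The `i`-th of the consecutive intervals of lengths `p 0, p 1, …`. -/
def cumInterval (p : Fin m → ℝ) (i : Fin m) : Set ℝ :=
  Set.Ico (∑ a ∈ Finset.Iio i, p a) (∑ a ∈ Finset.Iic i, p a)

theorem cumInterval_disjoint {p : Fin m → ℝ} (hp : ∀ i, 0 ≤ p i) {i j : Fin m} {u : ℝ}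
    (hi : u ∈ cumInterval p i) (hj : u ∈ cumInterval p j) : i = j := by
  have key : ∀ {i j : Fin m}, u ∈ cumInterval p i → u ∈ cumInterval p j → ¬ i < j := by
    intro i j hi hj hij
    have h1 : ∑ a ∈ Finset.Iic i, p a ≤ ∑ a ∈ Finset.Iio j, p a :=
      Finset.sum_le_sum_of_subset_of_nonneg
        (fun a ha => Finset.mem_Iio.2 ((Finset.mem_Iic.1 ha).trans_lt hij)) fun a _ _ => hp a
    have := hi.2
    have := hj.1
    linarith
  exact le_antisymm (not_lt.1 (key hj hi)) (not_lt.1 (key hi hj))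

theorem integral_cumInterval {p : Fin m → ℝ} (hp : ∀ i, 0 ≤ p i) (hp1 : ∑ i, p i = 1) (i : Fin m) :
    ∫ u : unitInterval, (cumInterval p i).indicator (fun _ => (1 : ℝ)) (u : ℝ) = p i := by
  have h1 : ∑ a ∈ Finset.Iic i, p a = ∑ a ∈ Finset.Iio i, p a + p i := by
    rw [← Finset.Iio_insert, Finset.sum_insert (by simp), add_comm]
  rw [cumInterval, integral_unitInterval_indicator (Finset.sum_nonneg fun a _ => hp a)
    (by rw [h1]; linarith [hp i]) (by
      rw [← hp1]
      exact Finset.sum_le_sum_of_subset_of_nonneg (Finset.subset_univ _) fun a _ _ => hp a), h1]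
  ring

/-- The importance sampling estimate of `∑ i, w i * p i` by `w i`, with `i` drawn from `p` by
inversion at `u`. -/
noncomputable def sampleValue (p w : Fin m → ℝ) (u : ℝ) : ℝ :=
  ∑ i, w i * (cumInterval p i).indicator (fun _ => (1 : ℝ)) u

theorem sampleValue_of_mem {p : Fin m → ℝ} (hp : ∀ i, 0 ≤ p i) (w : Fin m → ℝ) {i : Fin m} {u : ℝ}
    (hu : u ∈ cumInterval p i) : sampleValue p w u = w i := by
  rw [sampleValue, Finset.sum_eq_single i]
  · rw [Set.indicator_of_mem hu, mul_one]
  · intro j _ hj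
    rw [Set.indicator_of_notMem fun h => hj (cumInterval_disjoint hp h hu), mul_zero]
  · simp

theorem measurable_sampleValue (p w : Fin m → ℝ) : Measurable (sampleValue p w) :=
  Finset.measurable_sum _ fun _ _ =>
    (measurable_const.indicator measurableSet_Ico).const_mul _

theorem integral_sampleValue {p : Fin m → ℝ} (hp : ∀ i, 0 ≤ p i) (hp1 : ∑ i, p i = 1)
    (w : Fin m → ℝ) : ∫ u : unitInterval, sampleValue p w u = ∑ i, w i * p i := by
  simp only [sampleValue]
  rw [integral_finsetSum]
  · refine Finset.sum_congr rfl fun i _ => ?_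
    rw [integral_const_mul, integral_cumInterval hp hp1]
  · intro i _
    refine Integrable.const_mul ?_ _
    refine Integrable.mono' (integrable_const (1 : ℝ)) ?_ (ae_of_all _ fun u => ?_)
    · exact ((measurable_const.indicator measurableSet_Ico).comp
        measurable_subtype_coe).aestronglyMeasurable
    · simp only [Set.indicator]
      split_ifs <;> simp

theorem sampleValue_sq {p : Fin m → ℝ} (hp : ∀ i, 0 ≤ p i) (w : Fin m → ℝ) (u : ℝ) :
    sampleValue p w u ^ 2 = sampleValue p (fun i => w i ^ 2) u := by
  by_cases h : ∃ i, u ∈ cumInterval p i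
  · obtain ⟨i, hi⟩ := h
    rw [sampleValue_of_mem hp w hi, sampleValue_of_mem hp _ hi]
  · push Not at h
    simp [sampleValue, h]

theorem memLp_sampleValue (p w : Fin m → ℝ) :
    MemLp (fun u : unitInterval => sampleValue p w u) 2 volume := by
  refine MemLp.of_bound ((measurable_sampleValue p w).comp
    measurable_subtype_coe).aestronglyMeasurable (∑ i, |w i|) (ae_of_all _ fun u => ?_)
  refine (norm_sum_le _ _).trans (Finset.sum_le_sum fun i _ => ?_)
  rw [Real.norm_eq_abs, abs_mul]
  simp only [Set.indicator]
  split_ifs <;> simp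

/-- The mean squared error of the average of `r` independent importance sampling estimates. -/
theorem lintegral_sq_sub_sampleValue_le {p : Fin m → ℝ} (hp : ∀ i, 0 ≤ p i) (hp1 : ∑ i, p i = 1)
    (w : Fin m → ℝ) {r : ℕ} (hr : 1 ≤ r) :
    ∫⁻ u : ℕ → unitInterval, ENNReal.ofReal ((∑ i, w i * p i -
        (1 / (r : ℝ)) * ∑ t ∈ Finset.range r, sampleValue p w (u t)) ^ 2)
        ∂(Measure.infinitePi fun _ : ℕ => (volume : Measure unitInterval)) ≤
      ENNReal.ofReal ((1 / (r : ℝ)) * ∑ i, w i ^ 2 * p i) := by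
  have hr' : (0 : ℝ) < r := by exact_mod_cast hr
  set μ := Measure.infinitePi fun _ : ℕ => (volume : Measure unitInterval) with hμ
  have hL := memLp_sampleValue p w
  have hmp : ∀ t, MeasurePreserving (fun u : ℕ → unitInterval => u t) μ volume :=
    fun t => measurePreserving_eval_infinitePi _ t
  have hXL : ∀ t, MemLp (fun u : ℕ → unitInterval => sampleValue p w (u t)) 2 μ :=
    fun t => hL.comp_measurePreserving (hmp t)
  have hind : iIndepFun (fun (t : ℕ) (u : ℕ → unitInterval) => sampleValue p w (u t)) μ :=
    iIndepFun_infinitePi (X := fun _ (u : unitInterval) => sampleValue p w u)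
      fun _ => (measurable_sampleValue p w).comp measurable_subtype_coe
  have hvar := IndepFun.variance_sum (μ := μ) (s := Finset.range r)
    (X := fun t u => sampleValue p w (u t)) (fun t _ => hXL t)
    (fun a _ b _ hab => hind.indepFun hab)
  have hmean : ∀ t, ∫ u, sampleValue p w (u t) ∂μ = ∑ i, w i * p i := by
    intro t
    rw [← integral_sampleValue hp hp1, ← (hmp t).map_eq,
      integral_map (measurable_pi_apply t).aemeasurable]
    exact ((measurable_sampleValue p w).comp measurable_subtype_coe).aestronglyMeasurable
  have hvar1 : ∀ t, Var[fun u => sampleValue p w (u t); μ] ≤ ∑ i, w i ^ 2 * p i := by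
    intro t
    refine (variance_le_expectation_sq (hXL t).1).trans (le_of_eq ?_)
    simp only [Pi.pow_apply, sampleValue_sq hp]
    rw [← integral_sampleValue hp hp1, ← (hmp t).map_eq,
      integral_map (measurable_pi_apply t).aemeasurable]
    exact ((measurable_sampleValue p _).comp measurable_subtype_coe).aestronglyMeasurable
  set X : (ℕ → unitInterval) → ℝ := ∑ t ∈ Finset.range r, fun u => sampleValue p w (u t) with hX
  have hXa : ∀ u, X u = ∑ t ∈ Finset.range r, sampleValue p w (u t) := by
    intro u; simp [hX]
  have hXL' : MemLp X 2 μ := by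
    have := memLp_finsetSum (μ := μ) (p := 2) (Finset.range r)
      (f := fun t (u : ℕ → unitInterval) => sampleValue p w (u t)) fun t _ => hXL t
    convert this using 1
    ext u; exact hXa u
  have hEX : ∫ u, X u ∂μ = r * ∑ i, w i * p i := by
    simp_rw [hXa]
    rw [integral_finsetSum _ fun t _ => (hXL t).integrable (by norm_num)]
    simp [hmean]
  have hint : Integrable (fun u => (X u - r * ∑ i, w i * p i) ^ 2) μ :=
    (hXL'.sub (memLp_const _)).integrable_sq
  have hval : ∫ u, (X u - r * ∑ i, w i * p i) ^ 2 ∂μ ≤ r * ∑ i, w i ^ 2 * p i := by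
    rw [← hEX, ← variance_eq_integral hXL'.1.aemeasurable, hvar]
    refine (Finset.sum_le_sum fun t _ => hvar1 t).trans (le_of_eq ?_)
    simp
  have e : ∀ u : ℕ → unitInterval, (∑ i, w i * p i -
      (1 / (r : ℝ)) * ∑ t ∈ Finset.range r, sampleValue p w (u t)) ^ 2 =
      (1 / (r : ℝ) ^ 2) * (X u - r * ∑ i, w i * p i) ^ 2 := by
    intro u
    rw [hXa]
    field_simp
    ring
  simp_rw [e]
  rw [← ofReal_integral_eq_lintegral_ofReal (hint.const_mul _)
    (ae_of_all _ fun u => by positivity), integral_const_mul]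
  refine ENNReal.ofReal_le_ofReal ?_
  calc 1 / (r : ℝ) ^ 2 * ∫ u, (X u - r * ∑ i, w i * p i) ^ 2 ∂μ
      ≤ 1 / (r : ℝ) ^ 2 * (r * ∑ i, w i ^ 2 * p i) := mul_le_mul_of_nonneg_left hval (by positivity)
    _ = _ := by field_simp

/-- The error when the rows `L` are extended by rows `l` drawn by adaptive sampling. The
approximation behind it replaces each row of the residual by its importance sampling estimate. -/
theorem adaptive_error_le (A : Matrix (Fin m) (Fin n) ℝ) {P : Matrix (Fin m) (Fin m) ℝ}
    (hPs : Pᵀ = P) (hPi : P * P = P) {L : List ℕ} (hL : ∀ i ∈ L, i < m) (l : List (Fin m))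
    {u : ℕ → ℝ} (hl : IsAdaptiveSample A (selectRows A L) u l)
    {B : Matrix (Fin m) (Fin n) ℝ} (hB : B = A - A * pinv (selectRows A L) * selectRows A L)
    {R : Matrix (Fin (L ++ l.map Fin.val).length) (Fin n) ℝ}
    (hR : R = selectRows A (L ++ l.map Fin.val)) {p : Fin m → ℝ}
    (hp : p = fun i => (∑ j, B i j ^ 2) / ‖B‖ ^ 2) :
    ‖A - P * A * pinv R * R‖ ^ 2 ≤ ‖A - P * A‖ ^ 2 + ∑ a, ∑ b,
      (∑ i, P a i * B i b / p i * p i - (1 / (l.length : ℝ)) *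
        ∑ t ∈ Finset.range l.length, sampleValue p (fun i => P a i * B i b / p i) (u t)) ^ 2 := by
  have hp0 : ∀ i, 0 ≤ p i := fun i => by rw [hp]; positivity
  set Q := pinv R * R with hQ
  have hQs : Qᵀ = Q := pinv_mul_self_symm R
  have hQi : Q * Q = Q := pinv_mul_self_idem R
  have hQA : ∀ i : Fin m, (i : ℕ) ∈ L ++ l.map Fin.val → (A * Q) i = A i := by
    intro i hi
    rw [hQ, hR]
    exact mul_pinv_mul_selectRows_apply A hi
  set R₁ := selectRows A L with hR₁
  have hR₁Q : R₁ * Q = R₁ := pinv_mul_selectRows_mul A hL fun i hi =>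
    hQA i (List.mem_append_left _ hi)
  have hpyth : ‖A - P * A * pinv R * R‖ ^ 2 = ‖A - P * A‖ ^ 2 + ‖P * A - P * A * Q‖ ^ 2 := by
    rw [Matrix.mul_assoc (P * A), ← hQ, ← frobenius_sq_add_of_transpose_mul, sub_add_sub_cancel]
    rw [Matrix.mul_assoc, ← Matrix.mul_sub, ← Matrix.mul_assoc, Matrix.transpose_sub,
      Matrix.transpose_mul, hPs, Matrix.sub_mul, Matrix.mul_assoc Aᵀ, hPi, sub_self,
      Matrix.zero_mul]
  rw [hpyth]
  have hBQ : A * pinv R₁ * R₁ * Q = A * pinv R₁ * R₁ := by rw [Matrix.mul_assoc, hR₁Q]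
  by_cases hB0 : B = 0
  · -- the rows `L` already span all rows of `A`
    have hA : A = A * pinv R₁ * R₁ := by
      rw [hB0] at hB; exact (sub_eq_zero.1 hB.symm)
    have : P * A * Q = P * A := by
      rw [Matrix.mul_assoc]
      conv_lhs => rw [hA]
      rw [hBQ, ← hA]
    rw [this, sub_self, norm_zero]
    have : 0 ≤ ∑ a, ∑ b,
      (∑ i, P a i * B i b / p i * p i - (1 / (l.length : ℝ)) *
        ∑ t ∈ Finset.range l.length, sampleValue p (fun i => P a i * B i b / p i) (u t)) ^ 2 := by
      positivity
    linarith
  have hmem : ∀ t : Fin l.length, u t ∈ cumInterval p (l.get t) := by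
    intro t
    have h1 := hl (by rw [hB] at hB0; exact hB0) t
    rw [hp, hB]
    exact h1
  have hBn : ‖B‖ ^ 2 ≠ 0 := by
    have : ‖B‖ ≠ 0 := norm_ne_zero_iff.2 hB0
    positivity
  have hpB : ∀ i, p i = 0 → ∀ j, B i j = 0 := by
    intro i hi j
    rw [hp] at hi
    have h1 : ∑ j, B i j ^ 2 = 0 := by
      rcases div_eq_zero_iff.1 hi with h | h
      · exact h
      · exact absurd h hBn
    have := (Finset.sum_eq_zero_iff_of_nonneg fun j _ => sq_nonneg (B i j)).1 h1 j
      (Finset.mem_univ j)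
    simpa using this
  -- the weights of the importance sampling estimate of the residual
  set d : Fin m → ℝ := fun i => (1 / (l.length : ℝ)) *
    ∑ t : Fin l.length, if l.get t = i then 1 / p i else 0 with hd
  have hdl : ∀ i, i ∉ l → d i = 0 := by
    intro i hi
    rw [hd]
    simp only [mul_eq_zero]
    right
    refine Finset.sum_eq_zero fun t _ => ?_
    rw [if_neg]
    intro h
    exact hi (h ▸ List.get_mem l t)
  set F := P * (A * pinv R₁ * R₁ + Matrix.diagonal d * B) with hF
  have hdB : Matrix.diagonal d * B * Q = Matrix.diagonal d * B := by
    ext i j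
    rw [Matrix.mul_assoc, Matrix.diagonal_mul, Matrix.diagonal_mul]
    by_cases hi : i ∈ l
    · have h1 : (B * Q) i = B i := by
        have h2 : (B * Q) i = (A * Q) i - (A * pinv R₁ * R₁ * Q) i := by
          rw [hB, Matrix.sub_mul]; rfl
        rw [h2, hBQ, hQA i (List.mem_append_right _ (List.mem_map_of_mem hi)), hB]; rfl
      rw [h1]
    · rw [hdl i hi, zero_mul, zero_mul]
  have hFQ : F * Q = F := by
    rw [hF, Matrix.mul_assoc, Matrix.add_mul, hBQ, hdB]
  have hopt := frobenius_sub_mul_proj_le hQs hQi (P * A) F hFQ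
  have hPAF : P * A - F = P * B - P * (Matrix.diagonal d * B) := by
    have hPB : P * B = P * A - P * (A * pinv R₁ * R₁) := by rw [hB, Matrix.mul_sub]
    rw [hF, Matrix.mul_add, hPB]; abel
  rw [hPAF, frobenius_sq (P * B - _)] at hopt
  refine (add_le_add_iff_left _).2 (hopt.trans (le_of_eq ?_))
  refine Finset.sum_congr rfl fun a _ => Finset.sum_congr rfl fun b _ => ?_
  congr 1
  rw [Matrix.sub_apply, Matrix.mul_apply, Matrix.mul_apply]
  congr 1
  · refine Finset.sum_congr rfl fun i _ => ?_
    by_cases hi : p i = 0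
    · rw [hpB i hi]; simp
    · field_simp
  · rw [Finset.sum_range]
    have h1 : ∀ t : Fin l.length, sampleValue p (fun i => P a i * B i b / p i) (u t) =
        P a (l.get t) * B (l.get t) b / p (l.get t) := fun t => sampleValue_of_mem hp0 _ (hmem t)
    simp_rw [h1, Matrix.diagonal_mul, hd, Finset.mul_sum, Finset.sum_mul, Finset.mul_sum]
    rw [Finset.sum_comm]
    refine Finset.sum_congr rfl fun t _ => ?_
    rw [Finset.sum_eq_single (l.get t)]
    · simp only [if_pos]; ring
    · intro i _ hi
      rw [if_neg fun h => hi h.symm]; ring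
    · simp

/-- The expected error after adaptive sampling of `r` rows. -/
theorem lintegral_adaptive_error_le (A : Matrix (Fin m) (Fin n) ℝ) {P : Matrix (Fin m) (Fin m) ℝ}
    (hPs : Pᵀ = P) (hPi : P * P = P) {L : List ℕ} (hL : ∀ i ∈ L, i < m) {r : ℕ} (hr : 1 ≤ r)
    (out : (ℕ → unitInterval) → List ℕ)
    (hout : ∀ᵐ u ∂(Measure.infinitePi fun _ : ℕ => (volume : Measure unitInterval)),
      ∃ l : List (Fin m), l.length = r ∧
        IsAdaptiveSample A (selectRows A L) (fun t => (u t : ℝ)) l ∧ out u = L ++ l.map Fin.val) :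
    ∫⁻ u, ENNReal.ofReal
        (‖A - P * A * pinv (selectRows A (out u)) * selectRows A (out u)‖ ^ 2)
        ∂(Measure.infinitePi fun _ : ℕ => (volume : Measure unitInterval)) ≤
      ENNReal.ofReal (‖A - P * A‖ ^ 2 +
        P.trace / r * ‖A - A * pinv (selectRows A L) * selectRows A L‖ ^ 2) := by
  have hr' : (0 : ℝ) < r := by exact_mod_cast hr
  set B := A - A * pinv (selectRows A L) * selectRows A L with hB
  set p : Fin m → ℝ := fun i => (∑ j, B i j ^ 2) / ‖B‖ ^ 2 with hp
  have hp0 : ∀ i, 0 ≤ p i := fun i => by simp only [hp]; positivity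
  set μ := Measure.infinitePi fun _ : ℕ => (volume : Measure unitInterval) with hμ
  have hPd : ∀ i, ∑ a, P a i ^ 2 = P i i := by
    intro i
    conv_rhs => rw [← hPi, Matrix.mul_apply]
    refine Finset.sum_congr rfl fun a _ => ?_
    rw [sq]
    congr 1
    exact (congrFun (congrFun hPs i) a)
  have hPtr : 0 ≤ P.trace := Finset.sum_nonneg fun i _ => by
    rw [Matrix.diag_apply, ← hPd]; positivity
  by_cases hB0 : B = 0
  · -- all rows are spanned, and there is no error beyond that of the projection
    calc _ ≤ ∫⁻ u, ENNReal.ofReal (‖A - P * A‖ ^ 2) ∂μ := by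
          refine lintegral_mono_ae ?_
          filter_upwards [hout] with u hu
          obtain ⟨l, hl, hs, ho⟩ := hu
          refine ENNReal.ofReal_le_ofReal ?_
          rw [ho]
          refine (adaptive_error_le A hPs hPi hL l hs hB rfl hp).trans (le_of_eq ?_)
          simp [hB0, sampleValue]
      _ ≤ _ := by
          simp only [lintegral_const, measure_univ, mul_one]
          exact ENNReal.ofReal_le_ofReal (le_add_of_nonneg_right (by positivity))
  have hBn : 0 < ‖B‖ ^ 2 := by
    have : 0 < ‖B‖ := norm_pos_iff.2 hB0
    positivity
  have hp1 : ∑ i, p i = 1 := by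
    simp only [hp]
    rw [← Finset.sum_div, ← frobenius_sq, div_self hBn.ne']
  have hmeas : ∀ a b, Measurable fun u : ℕ → unitInterval => ENNReal.ofReal
      ((∑ i, P a i * B i b / p i * p i - (1 / (r : ℝ)) *
        ∑ t ∈ Finset.range r, sampleValue p (fun i => P a i * B i b / p i) (u t)) ^ 2) := by
    intro a b
    refine Measurable.ennreal_ofReal ((measurable_const.sub ((Finset.measurable_sum _ fun t _ =>
      ?_).const_mul _)).pow_const 2)
    exact (measurable_sampleValue _ _).comp (measurable_subtype_coe.comp (measurable_pi_apply t))
  calc _ ≤ ∫⁻ u, (ENNReal.ofReal (‖A - P * A‖ ^ 2) + ∑ a, ∑ b, ENNReal.ofReal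
        ((∑ i, P a i * B i b / p i * p i - (1 / (r : ℝ)) *
          ∑ t ∈ Finset.range r, sampleValue p (fun i => P a i * B i b / p i) (u t)) ^ 2)) ∂μ := by
        refine lintegral_mono_ae ?_
        filter_upwards [hout] with u hu
        obtain ⟨l, hl, hs, ho⟩ := hu
        rw [ho]
        refine (ENNReal.ofReal_le_ofReal
          (adaptive_error_le A hPs hPi hL l hs hB rfl hp)).trans (le_of_eq ?_)
        rw [ENNReal.ofReal_add (by positivity) (by positivity), hl,
          ENNReal.ofReal_sum_of_nonneg fun a _ => by positivity]
        congr 1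
        exact Finset.sum_congr rfl fun a _ => ENNReal.ofReal_sum_of_nonneg fun b _ => by positivity
    _ = ENNReal.ofReal (‖A - P * A‖ ^ 2) + ∑ a, ∑ b, ∫⁻ u, ENNReal.ofReal
        ((∑ i, P a i * B i b / p i * p i - (1 / (r : ℝ)) *
          ∑ t ∈ Finset.range r, sampleValue p (fun i => P a i * B i b / p i) (u t)) ^ 2) ∂μ := by
        rw [lintegral_add_left measurable_const, lintegral_finsetSum _ fun a _ =>
          Finset.measurable_sum _ fun b _ => hmeas a b]
        congr 1
        · simp
        · exact Finset.sum_congr rfl fun a _ => lintegral_finsetSum _ fun b _ => hmeas a b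
    _ ≤ ENNReal.ofReal (‖A - P * A‖ ^ 2) + ∑ a, ∑ b, ENNReal.ofReal
        ((1 / (r : ℝ)) * ∑ i, (P a i * B i b / p i) ^ 2 * p i) := by
        gcongr with a _ b _
        exact lintegral_sq_sub_sampleValue_le hp0 hp1 _ hr
    _ = ENNReal.ofReal (‖A - P * A‖ ^ 2 + ∑ a, ∑ b,
        (1 / (r : ℝ)) * ∑ i, (P a i * B i b / p i) ^ 2 * p i) := by
        have h0 : ∀ a b, 0 ≤ (1 / (r : ℝ)) * ∑ i, (P a i * B i b / p i) ^ 2 * p i := fun a b =>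
          mul_nonneg (by positivity) (Finset.sum_nonneg fun i _ => mul_nonneg (sq_nonneg _) (hp0 i))
        rw [ENNReal.ofReal_add (by positivity)
          (Finset.sum_nonneg fun a _ => Finset.sum_nonneg fun b _ => h0 a b),
          ENNReal.ofReal_sum_of_nonneg fun a _ => Finset.sum_nonneg fun b _ => h0 a b]
        congr 1
        exact Finset.sum_congr rfl fun a _ =>
          (ENNReal.ofReal_sum_of_nonneg fun b _ => h0 a b).symm
    _ ≤ _ := by
        refine ENNReal.ofReal_le_ofReal ((add_le_add_iff_left _).2 ?_)
        have e1 : ∑ a, ∑ b, (1 / (r : ℝ)) * ∑ i, (P a i * B i b / p i) ^ 2 * p i =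
            (1 / (r : ℝ)) * ∑ i, P i i * ((∑ b, B i b ^ 2) / p i) := by
          simp_rw [← Finset.mul_sum]
          congr 1
          rw [Finset.sum_congr rfl fun a (_ : a ∈ Finset.univ) => Finset.sum_comm, Finset.sum_comm]
          refine Finset.sum_congr rfl fun i _ => ?_
          rw [← hPd, Finset.sum_div, Finset.sum_mul_sum]
          refine Finset.sum_congr rfl fun a _ => Finset.sum_congr rfl fun b _ => ?_
          by_cases hi : p i = 0
          · simp [hi]
          · field_simp
        have e2 : ∀ i, P i i * ((∑ b, B i b ^ 2) / p i) ≤ P i i * ‖B‖ ^ 2 := by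
          intro i
          refine mul_le_mul_of_nonneg_left ?_ (by rw [← hPd]; positivity)
          by_cases hi : ∑ b, B i b ^ 2 = 0
          · rw [hi, zero_div]; exact hBn.le
          · simp only [hp]
            rw [div_div_eq_mul_div, mul_comm, mul_div_assoc, div_self hi, mul_one]
        rw [e1]
        calc (1 / (r : ℝ)) * ∑ i, P i i * ((∑ b, B i b ^ 2) / p i)
            ≤ (1 / (r : ℝ)) * ∑ i, P i i * ‖B‖ ^ 2 :=
              mul_le_mul_of_nonneg_left (Finset.sum_le_sum fun i _ => e2 i) (by positivity)
          _ = P.trace / r * ‖B‖ ^ 2 := by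
              rw [← Finset.sum_mul, Matrix.trace]
              simp only [Matrix.diag_apply]
              ring

end Adaptive

theorem trace_mul_pinv {m c : ℕ} (C : Matrix (Fin m) (Fin c) ℝ) :
    (C * pinv C).trace = C.rank := by
  have hidem := mul_pinv_idem C
  have hrank : (C * pinv C).rank = C.rank := by
    refine le_antisymm (Matrix.rank_mul_le_left _ _) ?_
    conv_lhs => rw [← (pinv_spec C).mul_mul_self]
    exact Matrix.rank_mul_le_left _ _
  have hproj : LinearMap.IsProj (LinearMap.range (C * pinv C).mulVecLin)
      (C * pinv C).mulVecLin := by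
    refine ⟨fun x => LinearMap.mem_range_self _ x, ?_⟩
    rintro _ ⟨y, rfl⟩
    simp only [Matrix.mulVecLin_apply]
    rw [Matrix.mulVec_mulVec, hidem]
  have h := hproj.trace
  rw [← Matrix.toLin'_apply', Matrix.trace_toLin'_eq] at h
  rw [h, ← hrank]
  rfl

/-! ### Reasoning about programs -/

namespace RealRAM

/-- The command `c`, started in the state `s`, takes at most `T` operations and ends in a state
with the property `Q`. -/
def Run (S : EigenSolver) (ω : Tape) (c : Cmd) (s : State) (T : ℕ) (Q : State → Prop) : Prop :=
  Q (c.exec S ω s) ∧ (c.exec S ω s).clock ≤ s.clock + T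

/-- The natural-number arrays that a command may write to. -/
def Cmd.natWrites : Cmd → List ℕ
  | .skip => []
  | .setN a _ _ => [a]
  | .setR _ _ _ _ => []
  | .gauss _ _ _ => []
  | .unif _ _ _ => []
  | .eig _ _ _ _ => []
  | .seq c d => c.natWrites ++ d.natWrites
  | .ite _ c d => c.natWrites ++ d.natWrites
  | .loop x _ c => x :: c.natWrites

/-- The real arrays that a command may write to. -/
def Cmd.realWrites : Cmd → List ℕ
  | .skip => []
  | .setN _ _ _ => []
  | .setR a _ _ _ => [a]
  | .gauss a _ _ => [a]
  | .unif a _ _ => [a]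
  | .eig _ _ lam vec => [lam, vec]
  | .seq c d => c.realWrites ++ d.realWrites
  | .ite _ c d => c.realWrites ++ d.realWrites
  | .loop _ _ c => c.realWrites

/-- The command draws no uniform numbers. -/
def Cmd.unifFree : Cmd → Bool
  | .unif _ _ _ => false
  | .seq c d => c.unifFree && d.unifFree
  | .ite _ c d => c.unifFree && d.unifFree
  | .loop _ _ c => c.unifFree
  | _ => true

/-- The command draws no normal numbers. -/
def Cmd.gaussFree : Cmd → Bool
  | .gauss _ _ _ => false
  | .seq c d => c.gaussFree && d.gaussFree
  | .ite _ c d => c.gaussFree && d.gaussFree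
  | .loop _ _ c => c.gaussFree
  | _ => true

/-- `s'` differs from `s` only where a run of `c` can make a difference. -/
structure Frame (c : Cmd) (s s' : State) : Prop where
  nat : ∀ a, a ∉ c.natWrites → s'.nat a = s.nat a
  real : ∀ a, a ∉ c.realWrites → s'.real a = s.real a
  unif : c.unifFree = true → s'.unifUsed = s.unifUsed
  gauss : c.gaussFree = true → s'.gaussUsed = s.gaussUsed

theorem frame_loop_aux {S : EigenSolver} {ω : Tape} {c : Cmd}
    (hc : ∀ s, Frame c s (c.exec S ω s)) (x : ℕ) (e : NExp) (s : State) (t n : ℕ) :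
    Frame (.loop x e c) s (Nat.rec (s.tick t)
      (fun i s' => c.exec S ω ((s'.setN x 0 i).tick 1)) n) := by
  induction n with
  | zero => exact ⟨fun _ _ => rfl, fun _ _ => rfl, fun _ => rfl, fun _ => rfl⟩
  | succ n ih =>
    refine ⟨fun a ha => ?_, fun a ha => ?_, fun h => ?_, fun h => ?_⟩
    · have h2 : a ≠ x ∧ a ∉ c.natWrites := by simpa [Cmd.natWrites] using ha
      refine ((hc _).nat a h2.2).trans (Eq.trans ?_ (ih.nat a ha))
      funext i
      simp [State.tick, State.setN, h2.1]
    · exact ((hc _).real a ha).trans (ih.real a ha)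
    · exact ((hc _).unif h).trans (ih.unif h)
    · exact ((hc _).gauss h).trans (ih.gauss h)

theorem frame (S : EigenSolver) (ω : Tape) (c : Cmd) (s : State) : Frame c s (c.exec S ω s) := by
  induction c generalizing s with
  | skip => exact ⟨fun _ _ => rfl, fun _ _ => rfl, fun _ => rfl, fun _ => rfl⟩
  | setN a e v =>
    refine ⟨fun b hb => ?_, fun _ _ => rfl, fun _ => rfl, fun _ => rfl⟩
    have : b ≠ a := by simpa [Cmd.natWrites] using hb
    funext i
    simp [Cmd.exec, State.tick, State.setN, this]
  | setR a e f v =>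
    refine ⟨fun _ _ => rfl, fun b hb => ?_, fun _ => rfl, fun _ => rfl⟩
    have : b ≠ a := by simpa [Cmd.realWrites] using hb
    funext i j
    simp [Cmd.exec, State.tick, State.setR, this]
  | gauss a e f =>
    refine ⟨fun _ _ => rfl, fun b hb => ?_, fun _ => rfl,
      fun h => by simp [Cmd.gaussFree] at h⟩
    have : b ≠ a := by simpa [Cmd.realWrites] using hb
    funext i j
    simp [Cmd.exec, State.tick, State.setR, this]
  | unif a e f =>
    refine ⟨fun _ _ => rfl, fun b hb => ?_, fun h => by simp [Cmd.unifFree] at h,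
      fun _ => rfl⟩
    have : b ≠ a := by simpa [Cmd.realWrites] using hb
    funext i j
    simp [Cmd.exec, State.tick, State.setR, this]
  | eig M e lam vec =>
    refine ⟨fun _ _ => rfl, fun b hb => ?_, fun _ => rfl, fun _ => rfl⟩
    have : b ≠ lam ∧ b ≠ vec := by simpa [Cmd.realWrites] using hb
    funext i j
    simp [Cmd.exec, State.tick, State.eig, this.1, this.2]
  | seq c d ihc ihd =>
    refine ⟨fun a ha => ?_, fun a ha => ?_, fun h => ?_, fun h => ?_⟩
    · have h2 : a ∉ c.natWrites ∧ a ∉ d.natWrites := by simpa [Cmd.natWrites] using ha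
      exact ((ihd _).nat a h2.2).trans ((ihc s).nat a h2.1)
    · have h2 : a ∉ c.realWrites ∧ a ∉ d.realWrites := by simpa [Cmd.realWrites] using ha
      exact ((ihd _).real a h2.2).trans ((ihc s).real a h2.1)
    · have h2 : c.unifFree = true ∧ d.unifFree = true := by simpa [Cmd.unifFree] using h
      exact ((ihd _).unif h2.2).trans ((ihc s).unif h2.1)
    · have h2 : c.gaussFree = true ∧ d.gaussFree = true := by simpa [Cmd.gaussFree] using h
      exact ((ihd _).gauss h2.2).trans ((ihc s).gauss h2.1)
  | ite t c d ihc ihd =>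
    refine ⟨fun a ha => ?_, fun a ha => ?_, fun h => ?_, fun h => ?_⟩
    · have h2 : a ∉ c.natWrites ∧ a ∉ d.natWrites := by simpa [Cmd.natWrites] using ha
      simp only [Cmd.exec]
      split_ifs
      · exact (ihc _).nat a h2.1
      · exact (ihd _).nat a h2.2
    · have h2 : a ∉ c.realWrites ∧ a ∉ d.realWrites := by simpa [Cmd.realWrites] using ha
      simp only [Cmd.exec]
      split_ifs
      · exact (ihc _).real a h2.1
      · exact (ihd _).real a h2.2
    · have h2 : c.unifFree = true ∧ d.unifFree = true := by simpa [Cmd.unifFree] using h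
      simp only [Cmd.exec]
      split_ifs
      · exact (ihc _).unif h2.1
      · exact (ihd _).unif h2.2
    · have h2 : c.gaussFree = true ∧ d.gaussFree = true := by simpa [Cmd.gaussFree] using h
      simp only [Cmd.exec]
      split_ifs
      · exact (ihc _).gauss h2.1
      · exact (ihd _).gauss h2.2
  | loop x e c ih => exact frame_loop_aux ih x e s _ _

section Rules

variable {S : EigenSolver} {ω : Tape} {s : State}

theorem Run.mono {c : Cmd} {T T' : ℕ} {Q Q' : State → Prop} (h : Run S ω c s T Q) (hT : T ≤ T')
    (hQ : ∀ s', Frame c s s' → Q s' → Q' s') : Run S ω c s T' Q' :=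
  ⟨hQ _ (frame S ω c s) h.1, h.2.trans (Nat.add_le_add_left hT _)⟩

theorem Run.seq {c d : Cmd} {T₁ T₂ : ℕ} {Q₁ Q₂ : State → Prop} (h₁ : Run S ω c s T₁ Q₁)
    (h₂ : ∀ s', Frame c s s' → Q₁ s' → Run S ω d s' T₂ Q₂) :
    Run S ω (.seq c d) s (T₁ + T₂) Q₂ := by
  have h := h₂ _ (frame S ω c s) h₁.1
  refine ⟨h.1, h.2.trans ?_⟩
  have := h₁.2
  omega

theorem Run.ite {t : Test} {c d : Cmd} {T : ℕ} {Q : State → Prop}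
    (hc : t.holds s → Run S ω c (s.tick (t.cost + 1)) T Q)
    (hd : ¬t.holds s → Run S ω d (s.tick (t.cost + 1)) T Q) :
    Run S ω (.ite t c d) s (T + t.cost + 1) Q := by
  unfold Run
  simp only [Cmd.exec]
  split_ifs with h
  · refine ⟨(hc h).1, (hc h).2.trans ?_⟩
    simp only [State.tick]
    omega
  · refine ⟨(hd h).1, (hd h).2.trans ?_⟩
    simp only [State.tick]
    omega

theorem Run.loop {x : ℕ} {e : NExp} {c : Cmd} {T : ℕ} (I : ℕ → State → Prop)
    (h0 : I 0 (s.tick (e.cost + 1)))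
    (hstep : ∀ i < e.eval s, ∀ s', Frame (.loop x e c) s s' → I i s' →
      Run S ω c ((s'.setN x 0 i).tick 1) T (I (i + 1))) :
    Run S ω (.loop x e c) s (e.eval s * (T + 1) + e.cost + 1) (I (e.eval s)) := by
  unfold Run
  simp only [Cmd.exec]
  have key : ∀ n ≤ e.eval s, I n (Nat.rec (s.tick (e.cost + 1))
      (fun i s' => c.exec S ω ((s'.setN x 0 i).tick 1)) n) ∧
      State.clock (Nat.rec (s.tick (e.cost + 1))
        (fun i s' => c.exec S ω ((s'.setN x 0 i).tick 1)) n) ≤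
        s.clock + (n * (T + 1) + e.cost + 1) := by
    intro n
    induction n with
    | zero =>
      intro _
      refine ⟨h0, ?_⟩
      change s.clock + (e.cost + 1) ≤ _
      omega
    | succ n ih =>
      intro hn
      obtain ⟨h1, h2⟩ := ih (by omega)
      have h3 := hstep n (by omega) _ (frame_loop_aux (frame S ω c) x e s _ n) h1
      refine ⟨h3.1, h3.2.trans ?_⟩
      have e1 : ∀ s' : State, ((s'.setN x 0 n).tick 1).clock = s'.clock + 1 := fun _ => rfl
      rw [e1, Nat.add_one_mul]
      omega
  exact key _ le_rfl

/-- A bound for the cost of evaluating all expressions in a command once. -/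
def Cmd.weight : Cmd → ℕ
  | .skip => 1
  | .setN _ e v => e.cost + v.cost + 1
  | .setR _ e f v => e.cost + f.cost + v.cost + 1
  | .gauss _ e f => e.cost + f.cost + 1
  | .unif _ e f => e.cost + f.cost + 1
  | .eig _ e _ _ => e.cost + 2
  | .seq c d => c.weight + d.weight
  | .ite t c d => c.weight + d.weight + t.cost + 1
  | .loop _ e c => c.weight + e.cost + 2

/-- As `Run`, with a bound for the running time up to a factor that depends only on the command:
`W` bounds the number of iterations of the innermost loops, and the cost of eigenvalue
decompositions. The rules below add up the factors. -/
def RunW (S : EigenSolver) (ω : Tape) (c : Cmd) (s : State) (W : ℕ) (Q : State → Prop) : Prop :=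
  Run S ω c s (c.weight * (W + 1)) Q

theorem RunW.mono {c : Cmd} {W W' : ℕ} {Q Q' : State → Prop} (h : RunW S ω c s W Q)
    (hW : W ≤ W') (hQ : ∀ s', Frame c s s' → Q s' → Q' s') : RunW S ω c s W' Q' :=
  Run.mono h (Nat.mul_le_mul_left _ (by omega)) hQ

theorem RunW.seq {c d : Cmd} {W : ℕ} {Q₁ Q₂ : State → Prop} (h₁ : RunW S ω c s W Q₁)
    (h₂ : ∀ s', Frame c s s' → Q₁ s' → RunW S ω d s' W Q₂) : RunW S ω (.seq c d) s W Q₂ :=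
  (Run.seq h₁ h₂).mono (le_of_eq (by simp only [Cmd.weight]; ring)) fun _ _ h => h

theorem RunW.ite {t : Test} {c d : Cmd} {W : ℕ} {Q : State → Prop}
    (hc : t.holds s → RunW S ω c (s.tick (t.cost + 1)) W Q)
    (hd : ¬t.holds s → RunW S ω d (s.tick (t.cost + 1)) W Q) :
    RunW S ω (.ite t c d) s W Q := by
  refine (Run.ite (T := (c.weight + d.weight) * (W + 1))
    (fun h => Run.mono (hc h) ?_ fun _ _ h => h)
    (fun h => Run.mono (hd h) ?_ fun _ _ h => h)).mono ?_ fun _ _ h => h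
  · exact Nat.mul_le_mul_right _ (by omega)
  · exact Nat.mul_le_mul_right _ (by omega)
  · simp only [Cmd.weight]
    nlinarith [Nat.zero_le (t.cost * W)]

theorem RunW.loop {x : ℕ} {e : NExp} {c : Cmd} {w W n : ℕ} (I : ℕ → State → Prop)
    (hn : e.eval s = n) (hW : n * (w + 1) ≤ W) (h0 : I 0 (s.tick (e.cost + 1)))
    (hstep : ∀ i < n, ∀ s', Frame (.loop x e c) s s' → I i s' →
      RunW S ω c ((s'.setN x 0 i).tick 1) w (I (i + 1))) :
    RunW S ω (.loop x e c) s W (I n) := by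
  subst hn
  refine (Run.loop I h0 hstep).mono ?_ fun _ _ h => h
  simp only [Cmd.weight]
  have h1 : e.eval s * (c.weight * (w + 1)) ≤ c.weight * W := by
    calc _ = c.weight * (e.eval s * (w + 1)) := by ring
      _ ≤ _ := Nat.mul_le_mul_left _ hW
  have h2 : e.eval s ≤ W := le_trans (by nlinarith [Nat.zero_le (e.eval s * w)]) hW
  nlinarith [Nat.zero_le (e.cost * W), Nat.zero_le c.weight]

theorem Run.toW {c : Cmd} {T W : ℕ} {Q : State → Prop} (h : Run S ω c s T Q) (hT : T ≤ c.weight) :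
    RunW S ω c s W Q :=
  h.mono (hT.trans (Nat.le_mul_of_pos_right _ (Nat.succ_pos _))) fun _ _ h => h

theorem run_skip {W : ℕ} : RunW S ω .skip s W fun s' => s' = s.tick 1 :=
  Run.toW ⟨rfl, le_rfl⟩ le_rfl

theorem run_setN {a : ℕ} {e v : NExp} {i w : ℕ} (he : e.eval s = i) (hv : v.eval s = w)
    {W : ℕ} : RunW S ω (.setN a e v) s W fun s' =>
      (∀ b j, s'.nat b j = if b = a ∧ j = i then w else s.nat b j) ∧ s'.real = s.real := by
  subst he hv
  exact Run.toW ⟨⟨fun _ _ => rfl, rfl⟩, le_rfl⟩ le_rfl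

theorem exec_setR {a : ℕ} {e f : NExp} {v : RExp} {i j : ℕ} {w : ℝ} (he : e.eval s = i)
    (hf : f.eval s = j) (hv : v.eval s = w) :
    Run S ω (.setR a e f v) s (e.cost + f.cost + v.cost + 1) fun s' =>
      (∀ b i' j', s'.real b i' j' = if b = a ∧ i' = i ∧ j' = j then w else s.real b i' j') ∧
      s'.nat = s.nat := by
  subst he hf hv
  exact ⟨⟨fun _ _ _ => rfl, rfl⟩, le_rfl⟩

theorem run_setR {a : ℕ} {e f : NExp} {v : RExp} {i j : ℕ} {w : ℝ} (he : e.eval s = i)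
    (hf : f.eval s = j) (hv : v.eval s = w) {W : ℕ} :
    RunW S ω (.setR a e f v) s W fun s' =>
      (∀ b i' j', s'.real b i' j' = if b = a ∧ i' = i ∧ j' = j then w else s.real b i' j') ∧
      s'.nat = s.nat :=
  (exec_setR he hf hv).toW le_rfl

theorem run_gauss {a : ℕ} {e f : NExp} {i j : ℕ} (he : e.eval s = i) (hf : f.eval s = j)
    {W : ℕ} : RunW S ω (.gauss a e f) s W fun s' =>
      (∀ b i' j', s'.real b i' j' =
        if b = a ∧ i' = i ∧ j' = j then ω.1 s.gaussUsed else s.real b i' j') ∧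
      s'.gaussUsed = s.gaussUsed + 1 := by
  subst he hf
  exact Run.toW ⟨⟨fun _ _ _ => rfl, rfl⟩, le_rfl⟩ le_rfl

theorem run_unif {a : ℕ} {e f : NExp} {i j : ℕ} (he : e.eval s = i) (hf : f.eval s = j)
    {W : ℕ} : RunW S ω (.unif a e f) s W fun s' =>
      (∀ b i' j', s'.real b i' j' =
        if b = a ∧ i' = i ∧ j' = j then (ω.2 s.unifUsed : ℝ) else s.real b i' j') ∧
      s'.unifUsed = s.unifUsed + 1 := by
  subst he hf
  exact Run.toW ⟨⟨fun _ _ _ => rfl, rfl⟩, le_rfl⟩ le_rfl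

/-- The upper left corner of a two-dimensional array, as a matrix. -/
def toMat (m n : ℕ) (f : ℕ → ℕ → ℝ) : Matrix (Fin m) (Fin n) ℝ := Matrix.of fun i j => f i j

theorem toMat_apply {m n : ℕ} (f : ℕ → ℕ → ℝ) (i : Fin m) (j : Fin n) : toMat m n f i j = f i j :=
  rfl

theorem run_eig {M lam vec d : ℕ} {e : NExp} (he : e.eval s = d) (hne : lam ≠ vec)
    {W : ℕ} (hW : d ^ 3 ≤ W) : RunW S ω (.eig M e lam vec) s W fun s' =>
      (toMat d d (s.real M)).IsSymm →
        (toMat d d (s'.real vec))ᵀ * toMat d d (s'.real vec) = 1 ∧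
        toMat d d (s.real M) * toMat d d (s'.real vec) =
          toMat d d (s'.real vec) * Matrix.diagonal (fun i : Fin d => s'.real lam 0 i) ∧
        Antitone fun i : Fin d => s'.real lam 0 i := by
  subst he
  refine ⟨fun h => ?_, ?_⟩
  rotate_left
  · change s.clock + (e.cost + e.eval s ^ 3 + 1) ≤ s.clock + (e.cost + 2) * (W + 1)
    nlinarith [Nat.zero_le (e.cost * W)]
  set s' := (Cmd.eig M e lam vec).exec S ω s
  have h1 : toMat _ _ (s'.real vec) = Matrix.of (S.vec (e.eval s) (toMat _ _ (s.real M))) := by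
    ext i j
    simp only [toMat_apply, s', Cmd.exec, State.tick, State.eig]
    rw [dif_pos ⟨trivial, i.2, j.2⟩]
    rfl
  have h2 : (fun i : Fin (e.eval s) => s'.real lam 0 i) =
      S.val (e.eval s) (toMat _ _ (s.real M)) := by
    funext i
    simp only [s', Cmd.exec, State.tick, State.eig]
    rw [dif_neg fun h => hne h.1, dif_pos ⟨trivial, trivial, i.2⟩]
    rfl
  rw [h1, h2]
  exact ⟨S.orthonormal _ _ h, S.eigen _ _ h, S.antitone _ _ h⟩

end Rules

/-! ### Measurability of the final memory -/

/-- A random state, all of whose components are measurable. -/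
structure MeasState {Ω : Type*} [MeasurableSpace Ω] (σ : Ω → State) : Prop where
  nat : ∀ a i, Measurable fun ω => (σ ω).nat a i
  real : ∀ a i j, Measurable fun ω => (σ ω).real a i j
  gauss : Measurable fun ω => (σ ω).gaussUsed
  unif : Measurable fun ω => (σ ω).unifUsed

section Measurability

variable {Ω : Type*} [MeasurableSpace Ω] {σ : Ω → State}

theorem measurable_countable_index {β : Type*} [MeasurableSpace β] {f : ℕ → Ω → β}
    (hf : ∀ i, Measurable (f i)) {N : Ω → ℕ} (hN : Measurable N) :
    Measurable fun ω => f (N ω) ω :=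
  (measurable_from_prod_countable_right (f := fun p : ℕ × Ω => f p.1 p.2) hf).comp
    (hN.prodMk measurable_id)

theorem MeasState.index {f : ℕ → Ω → State} (hf : ∀ i, MeasState (f i)) {N : Ω → ℕ}
    (hN : Measurable N) : MeasState fun ω => f (N ω) ω :=
  ⟨fun a i => measurable_countable_index (fun b => (hf b).nat a i) hN,
    fun a i j => measurable_countable_index (fun b => (hf b).real a i j) hN,
    measurable_countable_index (fun b => (hf b).gauss) hN,
    measurable_countable_index (fun b => (hf b).unif) hN⟩

theorem MeasState.ite {p : Ω → Prop} [DecidablePred p] (hp : MeasurableSet {ω | p ω})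
    {σ τ : Ω → State} (hσ : MeasState σ) (hτ : MeasState τ) :
    MeasState fun ω => if p ω then σ ω else τ ω := by
  refine ⟨fun a i => ?_, fun a i j => ?_, ?_, ?_⟩
  · simp only [apply_ite State.nat, ite_apply]
    exact Measurable.ite hp (hσ.nat a i) (hτ.nat a i)
  · simp only [apply_ite State.real, ite_apply]
    exact Measurable.ite hp (hσ.real a i j) (hτ.real a i j)
  · simp only [apply_ite State.gaussUsed]
    exact Measurable.ite hp hσ.gauss hτ.gauss
  · simp only [apply_ite State.unifUsed]
    exact Measurable.ite hp hσ.unif hτ.unif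

theorem MeasState.tick (h : MeasState σ) (t : Ω → ℕ) : MeasState fun ω => (σ ω).tick (t ω) :=
  ⟨h.nat, h.real, h.gauss, h.unif⟩

theorem MeasState.setN (h : MeasState σ) (a : ℕ) {i v : Ω → ℕ} (hi : Measurable i)
    (hv : Measurable v) : MeasState fun ω => (σ ω).setN a (i ω) (v ω) := by
  refine ⟨fun b j => ?_, h.real, h.gauss, h.unif⟩
  refine Measurable.ite ?_ hv (h.nat b j)
  by_cases hb : b = a
  · simpa [hb] using measurableSet_eq_fun measurable_const hi
  · simp [hb]

theorem MeasState.setR (h : MeasState σ) (a : ℕ) {i j : Ω → ℕ} {v : Ω → ℝ} (hi : Measurable i)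
    (hj : Measurable j) (hv : Measurable v) :
    MeasState fun ω => (σ ω).setR a (i ω) (j ω) (v ω) := by
  refine ⟨h.nat, fun b i' j' => ?_, h.gauss, h.unif⟩
  refine Measurable.ite ?_ hv (h.real b i' j')
  by_cases hb : b = a
  · have h2 : MeasurableSet {ω | i' = i ω ∧ j' = j ω} :=
      (measurableSet_eq_fun measurable_const hi).inter (measurableSet_eq_fun measurable_const hj)
    simpa [hb] using h2
  · simp [hb]

theorem MeasState.nexp (h : MeasState σ) (e : NExp) : Measurable fun ω => e.eval (σ ω) := by
  induction e with
  | lit c => exact measurable_const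
  | get a e ih => exact measurable_countable_index (fun i => h.nat a i) ih
  | plus e f ihe ihf => exact ihe.add ihf
  | minus e f ihe ihf => exact ihe.sub ihf
  | half e ih => exact (measurable_from_top (f := fun n : ℕ => n / 2)).comp ih

theorem MeasState.rexp (h : MeasState σ) (x : RExp) : Measurable fun ω => x.eval (σ ω) := by
  induction x with
  | ofNat e => exact (measurable_from_top (f := fun n : ℕ => (n : ℝ))).comp (h.nexp e)
  | get a e f =>
    exact measurable_countable_index (f := fun i ω => (σ ω).real a i (f.eval (σ ω)))
      (fun i => measurable_countable_index (fun j => h.real a i j) (h.nexp f)) (h.nexp e)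
  | plus x y ihx ihy => exact ihx.add ihy
  | minus x y ihx ihy => exact ihx.sub ihy
  | times x y ihx ihy => exact ihx.mul ihy
  | quot x y ihx ihy => exact ihx.div ihy
  | sqrt x ih => exact ih.sqrt

theorem MeasState.test (h : MeasState σ) (t : Test) : MeasurableSet {ω | t.holds (σ ω)} := by
  cases t with
  | nle e f => exact measurableSet_le (h.nexp e) (h.nexp f)
  | rle x y => exact measurableSet_le (h.rexp x) (h.rexp y)

theorem MeasState.eig (h : MeasState σ) (S : EigenSolver) (M d lam vec : ℕ) :
    MeasState fun ω => (σ ω).eig S M d lam vec := by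
  have hB : Measurable fun ω => (fun i j : Fin d => (σ ω).real M i j) :=
    measurable_pi_lambda _ fun i => measurable_pi_lambda _ fun j => h.real M i j
  refine ⟨h.nat, fun a i j => ?_, h.gauss, h.unif⟩
  simp only [State.eig]
  split_ifs with h1 h2
  · exact (measurable_pi_apply _).comp ((measurable_pi_apply _).comp ((S.measurable_vec d).comp hB))
  · exact (measurable_pi_apply _).comp ((S.measurable_val d).comp hB)
  · exact h.real a i j

theorem MeasState.exec (S : EigenSolver) {T : Ω → Tape} (hT : Measurable T) (c : Cmd)
    {σ : Ω → State} (h : MeasState σ) : MeasState fun ω => c.exec S (T ω) (σ ω) := by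
  induction c generalizing σ with
  | skip => exact h.tick _
  | setN a e v => exact (h.setN a (h.nexp e) (h.nexp v)).tick _
  | setR a e f v => exact (h.setR a (h.nexp e) (h.nexp f) (h.rexp v)).tick _
  | gauss a e f =>
    have hg : Measurable fun ω => (T ω).1 (σ ω).gaussUsed :=
      measurable_countable_index (f := fun i ω => (T ω).1 i)
        (fun i => (measurable_pi_apply i).comp (measurable_fst.comp hT)) h.gauss
    have := (h.setR a (h.nexp e) (h.nexp f) hg).tick fun _ => e.cost + f.cost + 1
    exact ⟨this.nat, this.real, h.gauss.add_const 1, h.unif⟩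
  | unif a e f =>
    have hg : Measurable fun ω => ((T ω).2 (σ ω).unifUsed : ℝ) :=
      measurable_subtype_coe.comp (measurable_countable_index (f := fun i ω => (T ω).2 i)
        (fun i => (measurable_pi_apply i).comp (measurable_snd.comp hT)) h.unif)
    have := (h.setR a (h.nexp e) (h.nexp f) hg).tick fun _ => e.cost + f.cost + 1
    exact ⟨this.nat, this.real, h.gauss, h.unif.add_const 1⟩
  | eig M e lam vec =>
    exact (MeasState.index (f := fun d ω => (σ ω).eig S M d lam vec)
      (fun d => h.eig S M d lam vec) (h.nexp e)).tick _
  | seq c d ihc ihd => exact ihd (ihc h)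
  | ite t c d ihc ihd =>
    classical
    exact MeasState.ite (h.test t) (ihc (h.tick _)) (ihd (h.tick _))
  | loop x e c ih =>
    refine MeasState.index (f := fun n ω => Nat.rec ((σ ω).tick (e.cost + 1))
      (fun i s' => c.exec S (T ω) ((s'.setN x 0 i).tick 1)) n) (fun n => ?_) (h.nexp e)
    induction n with
    | zero => exact h.tick _
    | succ n ihn => exact ih ((ihn.setN x measurable_const measurable_const).tick _)

theorem MeasState.output (h : MeasState σ) (l : List ℕ) :
    MeasurableSet {ω | (σ ω).output = l} := by
  have : {ω | (σ ω).output = l} = {ω | (σ ω).nat 1 0 = l.length} ∩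
      ⋂ i : Fin l.length, {ω | (σ ω).nat 2 i = l.get i} := by
    ext ω
    simp only [Set.mem_ofPred_eq, Set.mem_inter_iff, Set.mem_iInter, State.output]
    constructor
    · rintro rfl
      simp
    · rintro ⟨h1, h2⟩
      refine List.ext_get (by simpa using h1) fun i hi hi' => ?_
      simpa using h2 ⟨i, hi'⟩
  rw [this]
  exact (measurableSet_eq_fun (h.nat 1 0) measurable_const).inter
    (MeasurableSet.iInter fun i => measurableSet_eq_fun (h.nat 2 i) measurable_const)

end Measurability

/-- A command that draws no uniform numbers depends on the normal numbers only. -/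
theorem exec_congr_of_unifFree (S : EigenSolver) {ω ω' : Tape} (hω : ω.1 = ω'.1) (c : Cmd)
    (hc : c.unifFree = true) (s : State) : c.exec S ω s = c.exec S ω' s := by
  induction c generalizing s with
  | skip => rfl
  | setN a e v => rfl
  | setR a e f v => rfl
  | gauss a e f => simp only [Cmd.exec, hω]
  | unif a e f => simp [Cmd.unifFree] at hc
  | eig M e lam vec => rfl
  | seq c d ihc ihd =>
    have h2 : c.unifFree = true ∧ d.unifFree = true := by simpa [Cmd.unifFree] using hc
    simp only [Cmd.exec]
    rw [ihc h2.1, ihd h2.2]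
  | ite t c d ihc ihd =>
    have h2 : c.unifFree = true ∧ d.unifFree = true := by simpa [Cmd.unifFree] using hc
    simp only [Cmd.exec]
    rw [ihc h2.1, ihd h2.2]
  | loop x e c ih =>
    have h2 : c.unifFree = true := hc
    simp only [Cmd.exec]
    congr 1
    funext i s'
    exact ih h2 _

end RealRAM

/-! ### Filling arrays by sums -/

namespace RealRAM

/-- The scalar variable stored in entry `0` of the natural-number array `a`. -/
abbrev nvar (a : ℕ) : NExp := .get a (.lit 0)

/-- The scalar variable stored in entry `(0, 0)` of the real array `a`. -/
abbrev rvar (a : ℕ) : RExp := .get a (.lit 0) (.lit 0)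

/-- Entry `(o + i, j)` of the real array `a` becomes `init + ∑ l < L, e` for `i < N`, `j < M`. The
expressions may refer to `i`, `j`, `l` as the variables `20`, `21`, `22`. -/
def fillSum (a : ℕ) (o N M L : NExp) (init e : RExp) : Cmd :=
  .loop 20 N <| .loop 21 M <|
    .seq (.setR a (.plus o (nvar 20)) (nvar 21) init) <|
      .loop 22 L (.setR a (.plus o (nvar 20)) (nvar 21)
        (.plus (.get a (.plus o (nvar 20)) (nvar 21)) e))

/-- The states `s` and `s'` agree except for the real array `a` and the loop counters. -/
structure Sim (a : ℕ) (s s' : State) : Prop where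
  nat : ∀ b, b ∉ ([20, 21, 22] : List ℕ) → s'.nat b = s.nat b
  real : ∀ b, b ≠ a → s'.real b = s.real b

theorem Sim.setN {a : ℕ} {s s' : State} (h : Sim a s s') {x : ℕ}
    (hx : x ∈ ([20, 21, 22] : List ℕ)) (i v t : ℕ) : Sim a s ((s'.setN x i v).tick t) := by
  refine ⟨fun b hb => ?_, h.real⟩
  rw [← h.nat b hb]
  have : b ≠ x := fun h => hb (h ▸ hx)
  funext j
  simp [State.tick, State.setN, this]

/-- The loop nest `fillSum` stores `g i j + ∑ l < L, f i j l` in array `a`. The expressions are only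
required to have the right values in states that agree with `s` up to array `a` and the loop
counters; the initial value may read the entry that is about to be overwritten. -/
theorem fillSum_run {S : EigenSolver} {ω : Tape} {s : State} {a : ℕ} {o N M L : NExp}
    {init e : RExp} {W : ℕ} (oo nn mm ll : ℕ) (g : ℕ → ℕ → ℝ) (f : ℕ → ℕ → ℕ → ℝ)
    (hW : nn * (mm * (ll + 1) + 1) ≤ W)
    (ho : ∀ s', Sim a s s' → o.eval s' = oo) (hN : ∀ s', Sim a s s' → N.eval s' = nn)
    (hM : ∀ s', Sim a s s' → M.eval s' = mm) (hL : ∀ s', Sim a s s' → L.eval s' = ll)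
    (hg : ∀ s' i j, Sim a s s' → s'.nat 20 0 = i → s'.nat 21 0 = j → i < nn → j < mm →
      s'.real a (oo + i) j = s.real a (oo + i) j → init.eval s' = g i j)
    (hf : ∀ s' i j l, Sim a s s' → s'.nat 20 0 = i → s'.nat 21 0 = j → s'.nat 22 0 = l → i < nn →
      j < mm → l < ll → e.eval s' = f i j l) :
    RunW S ω (fillSum a o N M L init e) s W fun s' => Sim a s s' ∧
      (∀ i < nn, ∀ j < mm, s'.real a (oo + i) j = g i j + ∑ l ∈ Finset.range ll, f i j l) ∧
      ∀ i j, ¬(oo ≤ i ∧ i < oo + nn ∧ j < mm) → s'.real a i j = s.real a i j := by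
  have hNs := hN s ⟨fun _ _ => rfl, fun _ _ => rfl⟩
  -- the value of an entry when the entries before `(i, j)` have been filled
  let val : ℕ → ℕ → ℕ → ℕ → ℝ := fun i j i' j' =>
    if oo ≤ i' ∧ i' < oo + nn ∧ j' < mm ∧ (i' < oo + i ∨ i' = oo + i ∧ j' < j) then
      g (i' - oo) j' + ∑ l ∈ Finset.range ll, f (i' - oo) j' l
    else s.real a i' j'
  let inv : ℕ → ℕ → State → Prop := fun i j s' => Sim a s s' ∧ ∀ i' j',
    s'.real a i' j' = val i j i' j'
  have hrun := Run.loop (S := S) (ω := ω) (s := s) (x := 20) (e := N)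
    (c := .loop 21 M (.seq (.setR a (.plus o (nvar 20)) (nvar 21) init) <|
      .loop 22 L (.setR a (.plus o (nvar 20)) (nvar 21)
        (.plus (.get a (.plus o (nvar 20)) (nvar 21)) e))))
    (T := mm * (((o.cost + 3 + 2 + init.cost + 1) +
      (ll * ((o.cost + 3 + 2 + (o.cost + 3 + 2 + 1 + e.cost + 1) + 1) + 1)
        + L.cost + 1)) + 1) + M.cost + 1)
    (fun i s' => inv i 0 s') ?_ ?_
  · refine hrun.mono ?_ ?_
    · rw [hNs]
      refine le_trans ?_ (Nat.mul_le_mul_left _ (Nat.add_le_add_right hW 1))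
      simp only [fillSum, Cmd.weight, NExp.cost, RExp.cost]
      generalize o.cost = a₁
      generalize N.cost = a₂
      generalize M.cost = a₃
      generalize L.cost = a₄
      generalize init.cost = a₅
      generalize e.cost = a₆
      have hmono : ∀ p, 0 ≤ nn * mm * ll * p ∧ 0 ≤ nn * mm * p ∧ 0 ≤ nn * p :=
        fun p => ⟨Nat.zero_le _, Nat.zero_le _, Nat.zero_le _⟩
      linarith [hmono a₁, hmono a₂, hmono a₃, hmono a₄, hmono a₅, hmono a₆, hmono 1]
    · rintro s' - ⟨hs', h⟩
      rw [hNs] at h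
      refine ⟨hs', fun i hi j hj => ?_, fun i j hij => ?_⟩
      · rw [h]
        simp only [val]
        rw [if_pos (by omega), Nat.add_sub_cancel_left]
      · rw [h]
        simp only [val]
        rw [if_neg (by omega)]
  · refine ⟨⟨fun _ _ => rfl, fun _ _ => rfl⟩, fun i' j' => ?_⟩
    simp only [val]
    rw [if_neg (by omega)]
    rfl
  · rintro i hi s₁ - h₁
    rw [hNs] at hi
    set s₂ := (s₁.setN 20 0 i).tick 1 with hs₂
    have h₂ : inv i 0 s₂ := ⟨h₁.1.setN (by decide) _ _ _, h₁.2⟩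
    have hi₂ : s₂.nat 20 0 = i := by simp [hs₂, State.tick, State.setN]
    have hrun2 := Run.loop (S := S) (ω := ω) (s := s₂) (x := 21) (e := M)
      (c := .seq (.setR a (.plus o (nvar 20)) (nvar 21) init) <|
        .loop 22 L (.setR a (.plus o (nvar 20)) (nvar 21)
        (.plus (.get a (.plus o (nvar 20)) (nvar 21)) e)))
      (T := (o.cost + 3 + 2 + init.cost + 1) +
        (ll * ((o.cost + 3 + 2 + (o.cost + 3 + 2 + 1 + e.cost + 1) + 1) + 1) + L.cost + 1))
      (fun j s' => inv i j s' ∧ s'.nat 20 0 = i) ⟨⟨⟨h₂.1.nat, h₂.1.real⟩, h₂.2⟩, hi₂⟩ ?_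
    · refine hrun2.mono (le_of_eq ?_) ?_
      · rw [hM s₂ h₂.1]
      · rintro s' - ⟨h, -⟩
        rw [hM s₂ h₂.1] at h
        refine ⟨h.1, fun i' j' => (h.2 i' j').trans ?_⟩
        simp only [val]
        congr 1
        apply propext
        omega
    · rintro j hj s₃ - ⟨h₃, hi₃⟩
      rw [hM s₂ h₂.1] at hj
      set s₄ := (s₃.setN 21 0 j).tick 1 with hs₄
      have h₄ : Sim a s s₄ := h₃.1.setN (by decide) _ _ _
      have hi₄ : s₄.nat 20 0 = i := by simpa [hs₄, State.tick, State.setN] using hi₃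
      have hj₄ : s₄.nat 21 0 = j := by simp [hs₄, State.tick, State.setN]
      have hr₄ : s₄.real = s₃.real := rfl
      have heo : ∀ s', Sim a s s' → s'.nat 20 0 = i →
          (NExp.plus o (nvar 20)).eval s' = oo + i := by
        intro s' h h'
        simp only [NExp.eval, ho s' h, h']
      have hej : ∀ s' : State, s'.nat 21 0 = j → (nvar 21).eval s' = j := fun s' h => h
      refine (Run.seq (T₂ := ll * ((o.cost + 3 + 2 + (o.cost + 3 + 2 + 1 + e.cost + 1) + 1)
        + 1) + L.cost + 1) (exec_setR (heo s₄ h₄ hi₄) (hej s₄ hj₄) (hg s₄ i j h₄ hi₄ hj₄ hi hj ?_))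
        fun s₅ f₅ h₅ => ?_).mono (le_of_eq ?_) fun s' _ h => h
      · rw [hr₄, h₃.2]
        simp only [val]
        rw [if_neg (by omega)]
      · have h₅' : Sim a s s₅ := by
          refine ⟨fun b hb => ?_, fun b hb => ?_⟩
          · rw [h₅.2, h₄.nat b hb]
          · rw [← h₄.real b hb]
            funext i' j'
            rw [h₅.1, if_neg fun h => hb h.1]
        have hi₅ : s₅.nat 20 0 = i := by rw [h₅.2, hi₄]
        have hj₅ : s₅.nat 21 0 = j := by rw [h₅.2, hj₄]
        refine (Run.loop (T := o.cost + 3 + 2 + (o.cost + 3 + 2 + 1 + e.cost + 1) + 1)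
          (fun l s' => Sim a s s' ∧ s'.nat 20 0 = i ∧ s'.nat 21 0 = j ∧
            s'.real a (oo + i) j = g i j + ∑ l' ∈ Finset.range l, f i j l' ∧
            ∀ i' j', ¬(i' = oo + i ∧ j' = j) → s'.real a i' j' = s₃.real a i' j') ?_ ?_).mono
          (le_of_eq ?_) ?_
        · refine ⟨⟨h₅'.nat, h₅'.real⟩, hi₅, hj₅, ?_, fun i' j' h => ?_⟩
          · change s₅.real a (oo + i) j = _
            rw [h₅.1, if_pos ⟨rfl, rfl, rfl⟩]
            simp
          · change s₅.real a i' j' = _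
            rw [h₅.1, if_neg fun h' => h h'.2, hr₄]
        · rintro l hl s₆ - ⟨h₆, hi₆, hj₆, hv₆, ho₆⟩
          rw [hL s₅ h₅'] at hl
          set s₇ := (s₆.setN 22 0 l).tick 1 with hs₇
          have h₇ : Sim a s s₇ := h₆.setN (by decide) _ _ _
          have hi₇ : s₇.nat 20 0 = i := by simpa [hs₇, State.tick, State.setN] using hi₆
          have hj₇ : s₇.nat 21 0 = j := by simpa [hs₇, State.tick, State.setN] using hj₆
          have hl₇ : s₇.nat 22 0 = l := by simp [hs₇, State.tick, State.setN]
          have hval : (RExp.plus (.get a (.plus o (nvar 20)) (nvar 21)) e).eval s₇ =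
              g i j + ∑ l' ∈ Finset.range (l + 1), f i j l' := by
            have e1 : (RExp.get a (.plus o (nvar 20)) (nvar 21)).eval s₇ =
              s₆.real a (oo + i) j := by
              simp only [RExp.eval, heo s₇ h₇ hi₇, hej s₇ hj₇]
              rfl
            rw [Finset.sum_range_succ, ← add_assoc, ← hv₆, ← e1,
              ← hf s₇ i j l h₇ hi₇ hj₇ hl₇ hi hj hl]
            rfl
          refine (exec_setR (heo s₇ h₇ hi₇) (hej s₇ hj₇) hval).mono (le_of_eq ?_) ?_
          · simp only [NExp.cost, RExp.cost]
          · rintro s₈ - ⟨h₈, h₈'⟩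
            refine ⟨⟨fun b hb => ?_, fun b hb => ?_⟩, ?_, ?_, ?_, fun i' j' h => ?_⟩
            · rw [h₈', h₇.nat b hb]
            · rw [← h₇.real b hb]
              funext i' j'
              rw [h₈, if_neg fun h => hb h.1]
            · rw [h₈', hi₇]
            · rw [h₈', hj₇]
            · rw [h₈, if_pos ⟨rfl, rfl, rfl⟩]
            · rw [h₈, if_neg fun h' => h h'.2]
              exact ho₆ i' j' h
        · rw [hL s₅ h₅']
        · rintro s' - ⟨h, hi', -, hv, ho'⟩
          rw [hL s₅ h₅'] at hv
          refine ⟨⟨h, fun i' j' => ?_⟩, hi'⟩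
          by_cases hij : i' = oo + i ∧ j' = j
          · obtain ⟨rfl, rfl⟩ := hij
            rw [hv]
            simp only [val]
            rw [if_pos ⟨by omega, by omega, hj, Or.inr ⟨trivial, by omega⟩⟩,
              Nat.add_sub_cancel_left]
          · rw [ho' i' j' hij, h₃.2]
            simp only [val]
            congr 1
            apply propext
            omega
      · simp only [NExp.cost]

/-- Filling a matrix at the origin. -/
theorem fillMat_run {S : EigenSolver} {ω : Tape} {s : State} {a : ℕ} {N M L : NExp}
    {init e : RExp} {W : ℕ} (nn mm ll : ℕ) (g : ℕ → ℕ → ℝ) (f : ℕ → ℕ → ℕ → ℝ)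
    (hW : nn * (mm * (ll + 1) + 1) ≤ W)
    (hN : ∀ s', Sim a s s' → N.eval s' = nn)
    (hM : ∀ s', Sim a s s' → M.eval s' = mm) (hL : ∀ s', Sim a s s' → L.eval s' = ll)
    (hg : ∀ s' i j, Sim a s s' → s'.nat 20 0 = i → s'.nat 21 0 = j → i < nn → j < mm →
      s'.real a i j = s.real a i j → init.eval s' = g i j)
    (hf : ∀ s' i j l, Sim a s s' → s'.nat 20 0 = i → s'.nat 21 0 = j → s'.nat 22 0 = l → i < nn →
      j < mm → l < ll → e.eval s' = f i j l) :
    RunW S ω (fillSum a (.lit 0) N M L init e) s W fun s' => Sim a s s' ∧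
      ∀ i < nn, ∀ j < mm, s'.real a i j = g i j + ∑ l ∈ Finset.range ll, f i j l := by
  refine (fillSum_run 0 nn mm ll g f hW (fun _ _ => rfl) hN hM hL ?_ hf).mono le_rfl ?_
  · intro s' i j h h1 h2 h3 h4 h5
    rw [Nat.zero_add] at h5
    exact hg s' i j h h1 h2 h3 h4 h5
  · rintro s' - ⟨hs', h, -⟩
    exact ⟨hs', fun i hi j hj => by simpa using h i hi j hj⟩

end RealRAM

/-! ### Gram–Schmidt orthogonalization -/

namespace RealRAM

/-- The first `q` rows of `Q` are orthonormal vectors in `ℝᵈ` that are combinations of the columns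
of the `d × C` matrix `Z`, and the first `c` of these columns are combinations of them. -/
structure GramSchmidtInv (d C : ℕ) (Z Q : ℕ → ℕ → ℝ) (q c : ℕ) : Prop where
  orth : ∀ i < q, ∀ j < q, ∑ l ∈ Finset.range d, Q i l * Q j l = if i = j then 1 else 0
  span : ∀ i < q, ∃ t : ℕ → ℝ, ∀ l < d, Q i l = ∑ j ∈ Finset.range C, t j * Z l j
  proj : ∀ j < c, ∀ l < d,
    ∑ i ∈ Finset.range q, (∑ l' ∈ Finset.range d, Q i l' * Z l' j) * Q i l = Z l j

section GramSchmidt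

variable {d C q c : ℕ} {Z Q : ℕ → ℕ → ℝ}

theorem GramSchmidtInv.congr (h : GramSchmidtInv d C Z Q q c) {Q' : ℕ → ℕ → ℝ}
    (hQ : ∀ i < q, ∀ l < d, Q' i l = Q i l) : GramSchmidtInv d C Z Q' q c := by
  refine ⟨fun i hi j hj => ?_, fun i hi => ?_, fun j hj l hl => ?_⟩
  · rw [← h.orth i hi j hj]
    refine Finset.sum_congr rfl fun l hl => ?_
    rw [hQ i hi l (Finset.mem_range.1 hl), hQ j hj l (Finset.mem_range.1 hl)]
  · obtain ⟨t, ht⟩ := h.span i hi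
    exact ⟨t, fun l hl => by rw [hQ i hi l hl, ht l hl]⟩
  · rw [← h.proj j hj l hl]
    refine Finset.sum_congr rfl fun i hi => ?_
    rw [hQ i (Finset.mem_range.1 hi) l hl]
    congr 1
    refine Finset.sum_congr rfl fun l' hl' => ?_
    rw [hQ i (Finset.mem_range.1 hi) l' (Finset.mem_range.1 hl')]

/-- The orthonormal rows as a matrix. -/
theorem GramSchmidtInv.matrix (h : GramSchmidtInv d C Z Q q c) :
    toMat q d Q * (toMat q d Q)ᵀ = 1 ∧
    ∃ T : Matrix (Fin q) (Fin C) ℝ, toMat q d Q = T * (toMat d C Z)ᵀ := by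
  constructor
  · ext i j
    simp only [Matrix.mul_apply, Matrix.transpose_apply, toMat_apply, Matrix.one_apply, Fin.ext_iff]
    rw [← h.orth i i.2 j j.2, Finset.sum_range]
  · choose! t ht using h.span
    refine ⟨toMat q C t, ?_⟩
    ext i l
    rw [toMat_apply, ht i i.2 l l.2, Finset.sum_range]
    simp only [Matrix.mul_apply, Matrix.transpose_apply, toMat_apply]

theorem GramSchmidtInv.le_rank (h : GramSchmidtInv d C Z Q q c) : q ≤ (toMat d C Z).rank := by
  obtain ⟨h1, T, hT⟩ := h.matrix
  calc q = (1 : Matrix (Fin q) (Fin q) ℝ).rank := by rw [Matrix.rank_one, Fintype.card_fin]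
    _ = (T * (toMat d C Z)ᵀ * (toMat q d Q)ᵀ).rank := by rw [← h1, ← hT]
    _ ≤ (T * (toMat d C Z)ᵀ).rank := Matrix.rank_mul_le_left _ _
    _ ≤ (toMat d C Z)ᵀ.rank := Matrix.rank_mul_le_right _ _
    _ = _ := Matrix.rank_transpose _

theorem GramSchmidtInv.mul_mul (h : GramSchmidtInv d C Z Q q C) :
    (toMat q d Q)ᵀ * (toMat q d Q * toMat d C Z) = toMat d C Z := by
  ext l j
  simp only [Matrix.mul_apply, Matrix.transpose_apply, toMat_apply]
  rw [← h.proj j j.2 l l.2, Finset.sum_range]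
  refine Finset.sum_congr rfl fun i _ => ?_
  rw [Finset.sum_range, mul_comm]

/-- The residual of column `c`. -/
theorem GramSchmidtInv.step_zero (h : GramSchmidtInv d C Z Q q c) {w : ℕ → ℝ}
    (hw : ∀ l < d, w l = Z l c - ∑ i ∈ Finset.range q,
      (∑ l' ∈ Finset.range d, Q i l' * Z l' c) * Q i l)
    (h0 : ∑ l ∈ Finset.range d, w l * w l ≤ 0) : GramSchmidtInv d C Z Q q (c + 1) := by
  refine ⟨h.orth, h.span, fun j hj l hl => ?_⟩
  rcases Nat.lt_succ_iff_lt_or_eq.1 hj with hj | rfl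
  · exact h.proj j hj l hl
  · have h1 : ∑ l ∈ Finset.range d, w l * w l = 0 :=
      le_antisymm h0 (Finset.sum_nonneg fun _ _ => mul_self_nonneg _)
    have h2 := (Finset.sum_eq_zero_iff_of_nonneg fun l _ => mul_self_nonneg (w l)).1 h1 l
      (Finset.mem_range.2 hl)
    have h3 := hw l hl
    rw [mul_self_eq_zero.1 h2] at h3
    linarith

theorem GramSchmidtInv.step_pos (h : GramSchmidtInv d C Z Q q c) (hc : c < C) {w : ℕ → ℝ}
    (hw : ∀ l < d, w l = Z l c - ∑ i ∈ Finset.range q,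
      (∑ l' ∈ Finset.range d, Q i l' * Z l' c) * Q i l)
    {ν : ℝ} (hν : ν = ∑ l ∈ Finset.range d, w l * w l) (h0 : 0 < ν) {Q' : ℕ → ℕ → ℝ}
    (hQ : ∀ i < q, ∀ l < d, Q' i l = Q i l) (hq : ∀ l < d, Q' q l = w l / Real.sqrt ν) :
    GramSchmidtInv d C Z Q' (q + 1) (c + 1) := by
  have h' := h.congr hQ
  have hs : 0 < Real.sqrt ν := Real.sqrt_pos.2 h0
  have hss : Real.sqrt ν * Real.sqrt ν = ν := Real.mul_self_sqrt h0.le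
  -- the residual is orthogonal to the previous vectors
  have hperp : ∀ i < q, ∑ l ∈ Finset.range d, Q' i l * w l = 0 := by
    intro i hi
    have e1 : ∑ l ∈ Finset.range d, Q' i l * w l = ∑ l ∈ Finset.range d, Q i l * Z l c -
        ∑ i' ∈ Finset.range q, (∑ l' ∈ Finset.range d, Q i' l' * Z l' c) *
          ∑ l ∈ Finset.range d, Q i l * Q i' l := by
      simp_rw [Finset.mul_sum]
      rw [Finset.sum_comm, ← Finset.sum_sub_distrib]
      refine Finset.sum_congr rfl fun l hl => ?_
      have hl := Finset.mem_range.1 hl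
      rw [hQ i hi l hl, hw l hl, mul_sub, Finset.mul_sum]
      congr 1
      exact Finset.sum_congr rfl fun i' _ => by ring
    have e2 : ∑ i' ∈ Finset.range q, (∑ l' ∈ Finset.range d, Q i' l' * Z l' c) *
        ∑ l ∈ Finset.range d, Q i l * Q i' l = ∑ l' ∈ Finset.range d, Q i l' * Z l' c := by
      rw [Finset.sum_eq_single i]
      · rw [h.orth i hi i hi, if_pos rfl, mul_one]
      · intro i' hi' hne
        rw [h.orth i hi i' (Finset.mem_range.1 hi'), if_neg (Ne.symm hne), mul_zero]
      · intro hi'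
        exact absurd (Finset.mem_range.2 hi) hi'
    rw [e1, e2, sub_self]
  have hqq : ∀ i < q, ∑ l ∈ Finset.range d, Q' i l * Q' q l = 0 := by
    intro i hi
    have : ∑ l ∈ Finset.range d, Q' i l * Q' q l =
        (∑ l ∈ Finset.range d, Q' i l * w l) / Real.sqrt ν := by
      rw [Finset.sum_div]
      exact Finset.sum_congr rfl fun l hl => by
        rw [hq l (Finset.mem_range.1 hl), mul_div_assoc]
    rw [this, hperp i hi, zero_div]
  have hcol : ∑ l ∈ Finset.range d, Q' q l * Z l c = Real.sqrt ν := by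
    have e1 : ∑ l ∈ Finset.range d, Q' q l * Z l c = ∑ l ∈ Finset.range d, Q' q l * w l +
        ∑ i ∈ Finset.range q, (∑ l' ∈ Finset.range d, Q i l' * Z l' c) *
          ∑ l ∈ Finset.range d, Q' i l * Q' q l := by
      simp_rw [Finset.mul_sum]
      rw [Finset.sum_comm, ← Finset.sum_add_distrib]
      refine Finset.sum_congr rfl fun l hl => ?_
      have hl := Finset.mem_range.1 hl
      rw [hw l hl, mul_sub, Finset.mul_sum, sub_add, eq_comm, sub_eq_self, sub_eq_zero]
      refine Finset.sum_congr rfl fun i hi => ?_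
      rw [hQ i (Finset.mem_range.1 hi) l hl]
      ring
    rw [e1, Finset.sum_eq_zero (s := Finset.range q) fun i hi => by
      rw [hqq i (Finset.mem_range.1 hi), mul_zero], add_zero]
    have e2 : ∑ l ∈ Finset.range d, Q' q l * w l = ν / Real.sqrt ν := by
      rw [hν, Finset.sum_div, ← hν]
      exact Finset.sum_congr rfl fun l hl => by
        rw [hq l (Finset.mem_range.1 hl)]; ring
    rw [e2, div_eq_iff hs.ne', hss]
  refine ⟨fun i hi j hj => ?_, fun i hi => ?_, fun j hj l hl => ?_⟩
  · rcases Nat.lt_succ_iff_lt_or_eq.1 hi with hi | rfl <;>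
      rcases Nat.lt_succ_iff_lt_or_eq.1 hj with hj | rfl
    · exact h'.orth i hi j hj
    · rw [hqq i hi, if_neg (by omega)]
    · rw [if_neg (by omega), ← hqq j hj]
      exact Finset.sum_congr rfl fun l _ => mul_comm _ _
    · rw [if_pos rfl]
      have : ∑ l ∈ Finset.range d, Q' j l * Q' j l = ν / ν := by
        rw [hν, Finset.sum_div, ← hν]
        refine Finset.sum_congr rfl fun l hl => ?_
        rw [hq l (Finset.mem_range.1 hl), div_mul_div_comm, hss]
      rw [this, div_self h0.ne']
  · rcases Nat.lt_succ_iff_lt_or_eq.1 hi with hi | rfl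
    · exact h'.span i hi
    · choose! t ht using h.span
      refine ⟨fun j => ((if j = c then 1 else 0) - ∑ i' ∈ Finset.range i,
        (∑ l' ∈ Finset.range d, Q i' l' * Z l' c) * t i' j) / Real.sqrt ν, fun l hl => ?_⟩
      rw [hq l hl, hw l hl]
      have e1 : ∑ j ∈ Finset.range C, (if j = c then (1 : ℝ) else 0) * Z l j = Z l c := by
        rw [Finset.sum_eq_single c]
        · simp
        · intro j _ hj
          simp [hj]
        · intro hj
          exact absurd (Finset.mem_range.2 hc) hj
      have e2 : ∑ i' ∈ Finset.range i, (∑ l' ∈ Finset.range d, Q i' l' * Z l' c) * Q i' l =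
          ∑ j ∈ Finset.range C, (∑ i' ∈ Finset.range i,
            (∑ l' ∈ Finset.range d, Q i' l' * Z l' c) * t i' j) * Z l j := by
        simp_rw [Finset.sum_mul _ _ (Z l _)]
        rw [Finset.sum_comm]
        refine Finset.sum_congr rfl fun i' hi' => ?_
        rw [ht i' (Finset.mem_range.1 hi') l hl, Finset.mul_sum]
        exact Finset.sum_congr rfl fun j _ => by ring
      rw [e2]
      conv_lhs => rw [← e1]
      rw [← Finset.sum_sub_distrib, Finset.sum_div]
      exact Finset.sum_congr rfl fun j _ => by ring
  · rcases Nat.lt_succ_iff_lt_or_eq.1 hj with hj | rfl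
    · rw [Finset.sum_range_succ, h'.proj j hj l hl]
      -- the new vector is orthogonal to the columns treated before
      have : ∑ l' ∈ Finset.range d, Q' q l' * Z l' j = 0 := by
        have e1 : ∑ l' ∈ Finset.range d, Q' q l' * Z l' j = ∑ i ∈ Finset.range q,
            (∑ l' ∈ Finset.range d, Q' i l' * Z l' j) * ∑ l ∈ Finset.range d, Q' i l * Q' q l := by
          simp_rw [Finset.mul_sum]
          rw [Finset.sum_comm]
          refine Finset.sum_congr rfl fun l' hl' => ?_
          conv_lhs => rw [← h'.proj j hj l' (Finset.mem_range.1 hl'), Finset.mul_sum]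
          exact Finset.sum_congr rfl fun i _ => by ring
        rw [e1]
        exact Finset.sum_eq_zero fun i hi => by rw [hqq i (Finset.mem_range.1 hi), mul_zero]
      rw [this]; ring
    · rw [Finset.sum_range_succ, hcol, hq l hl, mul_div_cancel₀ _ hs.ne', hw l hl]
      rw [add_comm, sub_add_eq_add_sub, sub_eq_iff_eq_add, add_right_inj]
      refine Finset.sum_congr rfl fun i hi => ?_
      have hi := Finset.mem_range.1 hi
      rw [hQ i hi l hl]
      congr 1
      exact Finset.sum_congr rfl fun l' hl' => by rw [hQ i hi l' (Finset.mem_range.1 hl')]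

end GramSchmidt

/-- One step of the Gram–Schmidt process. -/
def gramSchmidtStep (d : NExp) : Cmd :=
  .seq (fillSum 5 (.lit 0) (nvar 10) (.lit 1) d (.ofNat (.lit 0))
    (.times (.get 4 (nvar 20) (nvar 22)) (.get 3 (nvar 22) (nvar 24)))) <|
  .seq (fillSum 6 (.lit 0) (.lit 1) d (nvar 10) (.get 3 (nvar 21) (nvar 24))
    (.minus (.ofNat (.lit 0)) (.times (.get 5 (nvar 22) (.lit 0)) (.get 4 (nvar 22) (nvar 21))))) <|
  .seq (fillSum 7 (.lit 0) (.lit 1) (.lit 1) d (.ofNat (.lit 0))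
    (.times (.get 6 (.lit 0) (nvar 22)) (.get 6 (.lit 0) (nvar 22)))) <|
  .ite (.rle (rvar 7) (.ofNat (.lit 0))) .skip <|
    .seq (fillSum 4 (nvar 10) (.lit 1) d (.lit 0)
      (.quot (.get 6 (.lit 0) (nvar 21)) (.sqrt (rvar 7))) (.ofNat (.lit 0))) <|
    .setN 10 (.lit 0) (.plus (nvar 10) (.lit 1))

/-- The Gram–Schmidt process for the columns of the `d × C` matrix in the real array `3`. The
rows of the real array `4` become orthonormal vectors, and `10` is their number. -/
def gramSchmidt (d C : NExp) : Cmd :=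
  .seq (.setN 10 (.lit 0) (.lit 0)) (.loop 24 C (gramSchmidtStep d))

/-- The value of `d` cannot be changed by the Gram–Schmidt process. -/
def Stable (d : NExp) (s : State) (v : ℕ) : Prop :=
  ∀ s' : State, (∀ b, b ∉ ([10, 20, 21, 22, 24] : List ℕ) → s'.nat b = s.nat b) → d.eval s' = v

theorem gramSchmidtStep_run {S : EigenSolver} {ω : Tape} {s : State} {d : NExp} {dd cc c r : ℕ}
    (hd : Stable d s dd) (hc : s.nat 24 0 = c) (hcc : c < cc) (hr : s.nat 10 0 ≤ r)
    (h : GramSchmidtInv dd cc (s.real 3) (s.real 4) (s.nat 10 0) c) :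
    RunW S ω (gramSchmidtStep d) s ((r + 1) * (dd + 2)) fun s' =>
      GramSchmidtInv dd cc (s.real 3) (s'.real 4) (s'.nat 10 0) (c + 1) := by
  have hd' : ∀ {a} s', Sim a s s' → d.eval s' = dd := fun s' h' =>
    hd s' fun b hb => h'.nat b fun h => hb (by revert h; simp; tauto)
  generalize hq : s.nat 10 0 = q at hr h
  -- the coefficients of column `c`
  refine RunW.seq (fillMat_run q 1 dd (fun _ _ => 0) (fun i _ l => s.real 4 i l * s.real 3 l c)
    (by nlinarith) ?_ ?_ ?_ ?_ ?_) fun s₁ _ ⟨f₁, h₁⟩ => ?_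
  · intro s' h'; simp only [NExp.eval, h'.nat 10 (by decide), hq]
  · intro s' _; rfl
  · exact fun s' h' => hd' s' h'
  · intros; simp only [RExp.eval, NExp.eval, Nat.cast_zero]
  · intro s' i j l h' hi hj hl _ _ _
    simp only [RExp.eval, NExp.eval, hi, hl, h'.nat 24 (by decide), hc, h'.real 4 (by decide),
      h'.real 3 (by decide)]
  have hd₁ : ∀ {a} s', Sim a s₁ s' → d.eval s' = dd := fun s' h' => hd s' fun b hb => by
    have hb' : b ∉ ([20, 21, 22] : List ℕ) := fun h => hb (by revert h; simp; tauto)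
    rw [h'.nat b hb', f₁.nat b hb']
  have hq₁ : s₁.nat 10 0 = q := by rw [f₁.nat 10 (by decide), hq]
  have hc₁ : s₁.nat 24 0 = c := by rw [f₁.nat 24 (by decide), hc]
  have e4₁ := f₁.real 4 (by decide)
  have e3₁ := f₁.real 3 (by decide)
  -- the residual of column `c`
  refine RunW.seq (fillMat_run 1 dd q (fun _ l => s.real 3 l c)
    (fun _ l i => 0 - s₁.real 5 i 0 * s.real 4 i l) ?_ ?_ ?_ ?_ ?_ ?_) fun s₂ _ ⟨f₂, h₂⟩ => ?_
  · nlinarith [Nat.mul_le_mul_left dd hr]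
  · intro s' _; rfl
  · exact fun s' h' => hd₁ s' h'
  · intro s' h'; simp only [NExp.eval, h'.nat 10 (by decide), hq₁]
  · intro s' i j h' hi hj _ _ _
    simp only [RExp.eval, NExp.eval, hj, h'.nat 24 (by decide), hc₁, h'.real 3 (by decide), e3₁]
  · intro s' i j l h' hi hj hl _ _ _
    simp only [RExp.eval, NExp.eval, hj, hl, h'.real 5 (by decide), h'.real 4 (by decide), e4₁,
      Nat.cast_zero]
  have hw : ∀ l < dd, s₂.real 6 0 l = s.real 3 l c - ∑ i ∈ Finset.range q,
      (∑ l' ∈ Finset.range dd, s.real 4 i l' * s.real 3 l' c) * s.real 4 i l := by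
    intro l hl
    rw [h₂ 0 one_pos l hl, sub_eq_add_neg, ← Finset.sum_neg_distrib]
    congr 1
    refine Finset.sum_congr rfl fun i hi => ?_
    rw [h₁ i (Finset.mem_range.1 hi) 0 one_pos]
    ring
  have hd₂ : ∀ {a} s', Sim a s₂ s' → d.eval s' = dd := fun s' h' => hd s' fun b hb => by
    have hb' : b ∉ ([20, 21, 22] : List ℕ) := fun h => hb (by revert h; simp; tauto)
    rw [h'.nat b hb', f₂.nat b hb',
      f₁.nat b hb']
  have hq₂ : s₂.nat 10 0 = q := by rw [f₂.nat 10 (by decide), hq₁]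
  have e4₂ := (f₂.real 4 (by decide)).trans e4₁
  -- its squared norm
  refine RunW.seq (fillMat_run 1 1 dd (fun _ _ => 0) (fun _ _ l => s₂.real 6 0 l * s₂.real 6 0 l)
    (by nlinarith) ?_ ?_ ?_ ?_ ?_) fun s₃ _ ⟨f₃, h₃⟩ => ?_
  · intro s' _; rfl
  · intro s' _; rfl
  · exact fun s' h' => hd₂ s' h'
  · intros; simp only [RExp.eval, NExp.eval, Nat.cast_zero]
  · intro s' i j l h' hi hj hl _ _ _
    simp only [RExp.eval, NExp.eval, hl, h'.real 6 (by decide)]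
  have hν : s₃.real 7 0 0 = ∑ l ∈ Finset.range dd, s₂.real 6 0 l * s₂.real 6 0 l := by
    rw [h₃ 0 one_pos 0 one_pos, zero_add]
  have hd₃ : ∀ s', (∀ b, b ∉ ([20, 21, 22] : List ℕ) → s'.nat b = s₃.nat b) → d.eval s' = dd :=
    fun s' h' => hd s' fun b hb => by
      have hb' : b ∉ ([20, 21, 22] : List ℕ) := fun h => hb (by revert h; simp; tauto)
      rw [h' b hb', f₃.nat b hb',
        f₂.nat b hb',
        f₁.nat b hb']
  have hq₃ : s₃.nat 10 0 = q := by rw [f₃.nat 10 (by decide), hq₂]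
  have e4₃ := (f₃.real 4 (by decide)).trans e4₂
  have e6₃ := f₃.real 6 (by decide)
  refine RunW.ite (fun ht => ?_) (fun ht => ?_)
  · simp only [Test.holds, RExp.eval, NExp.eval, Nat.cast_zero] at ht
    refine run_skip.mono le_rfl fun s' _ hs' => ?_
    subst hs'
    change GramSchmidtInv dd cc (s.real 3) (s₃.real 4) (s₃.nat 10 0) (c + 1)
    rw [hq₃, e4₃]
    exact h.step_zero hw (hν ▸ ht)
  · simp only [Test.holds, RExp.eval, NExp.eval, Nat.cast_zero, not_le] at ht
    refine RunW.seq (fillSum_run q 1 dd 0 (fun _ l => s₂.real 6 0 l / Real.sqrt (s₃.real 7 0 0))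
      (fun _ _ _ => 0) (by nlinarith) ?_ ?_ ?_ ?_ ?_ ?_) fun s₄ _ ⟨f₄, h₄⟩ => ?_
    · intro s' h'
      simp only [NExp.eval, h'.nat 10 (by decide)]
      exact hq₃
    · intro s' _; rfl
    · exact fun s' h' => hd₃ s' h'.nat
    · intro s' _; rfl
    · intro s' i j h' hi hj _ _ _
      simp only [RExp.eval, NExp.eval, hj, h'.real 6 (by decide), h'.real 7 (by decide)]
      rw [← e6₃]
      rfl
    · intros; simp only [RExp.eval, NExp.eval, Nat.cast_zero]
    have hq₄ : s₄.nat 10 0 = q := by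
      rw [f₄.nat 10 (by decide)]; exact hq₃
    refine (run_setN rfl rfl).mono le_rfl fun s' f' hs' => ?_
    have e10 : s'.nat 10 0 = q + 1 := by
      rw [hs'.1]
      simp only [NExp.eval, hq₄]
      simp
    rw [e10, congrFun hs'.2 4]
    refine h.step_pos hcc hw hν ht ?_ ?_
    · intro i hi l _
      rw [h₄.2 i l (by omega), ← e4₃]
      rfl
    · intro l hl
      have := h₄.1 0 one_pos l hl
      simpa using this

theorem gramSchmidt_run {S : EigenSolver} {ω : Tape} {s : State} {d C : NExp} {dd cc W : ℕ}
    (hd : Stable d s dd) 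
    (hC : ∀ s', (∀ b, b ∉ ([10] : List ℕ) → s'.nat b = s.nat b) → C.eval s' = cc)
    (hW : cc * (((toMat dd cc (s.real 3)).rank + 1) * (dd + 3)) ≤ W) :
    RunW S ω (gramSchmidt d C) s W fun s' =>
      GramSchmidtInv dd cc (s.real 3) (s'.real 4) (s'.nat 10 0) cc := by
  have hr : ∀ q c Q, GramSchmidtInv dd cc (s.real 3) Q q c → q ≤ (toMat dd cc (s.real 3)).rank :=
    fun q c Q h => h.le_rank
  revert hW hr
  generalize (toMat dd cc (s.real 3)).rank = r
  intro hW hr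
  refine RunW.seq (run_setN rfl rfl) fun s₁ f₁ h₁ => ?_
  have hC₁ : C.eval s₁ = cc := hC s₁ f₁.nat
  have h10 : s₁.nat 10 0 = 0 := by rw [h₁.1]; rfl
  have hd₁ : Stable d s₁ dd := fun s' h' => hd s' fun b hb =>
    (h' b hb).trans (f₁.nat b fun h => hb (by revert h; simp only [Cmd.natWrites]; simp; tauto))
  have h3 : s₁.real 3 = s.real 3 := congrFun h₁.2 3
  rw [← h3] at hr ⊢
  refine (RunW.loop (w := (r + 1) * (dd + 2)) (fun c s' => GramSchmidtInv dd cc (s₁.real 3)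
    (s'.real 4) (s'.nat 10 0) c) hC₁ ?_ ?_ ?_).mono le_rfl fun s' _ h => h
  · refine le_trans (Nat.mul_le_mul_left _ ?_) hW
    nlinarith
  · change GramSchmidtInv _ _ _ _ (s₁.nat 10 0) _
    rw [h10]
    exact ⟨fun i hi => by omega, fun i hi => by omega, fun i hi => by omega⟩
  · intro c hc s₂ f₂ h₂
    have hq := hr _ _ _ h₂
    have h3' : s₂.real 3 = s₁.real 3 :=
      f₂.real 3 (by simp [gramSchmidtStep, fillSum, Cmd.realWrites])
    have hd₂ : Stable d s₂ dd :=
      fun s' h' => hd₁ s' fun b hb => (h' b hb).trans (f₂.nat b fun h => hb (by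
        revert h; simp only [gramSchmidtStep, fillSum, Cmd.natWrites]; simp; tauto))
    rw [← h3'] at h₂ ⊢
    have hc' : ((s₂.setN 24 0 c).tick 1).nat 24 0 = c := by simp [State.tick, State.setN]
    have hd₃ : Stable d ((s₂.setN 24 0 c).tick 1) dd := fun s' h' => hd₂ s' fun b hb =>
      (h' b hb).trans (by
        have : b ≠ 24 := fun h => hb (by simp [h])
        funext i
        simp [State.tick, State.setN, this])
    have h₃ : GramSchmidtInv dd cc (((s₂.setN 24 0 c).tick 1).real 3)
      (((s₂.setN 24 0 c).tick 1).real 4) (((s₂.setN 24 0 c).tick 1).nat 10 0) c := h₂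
    have hq' : ((s₂.setN 24 0 c).tick 1).nat 10 0 ≤ r := hq
    change RunW S ω _ _ _ fun s' => GramSchmidtInv dd cc (((s₂.setN 24 0 c).tick 1).real 3)
      (s'.real 4) (s'.nat 10 0) (c + 1)
    generalize (s₂.setN 24 0 c).tick 1 = s₃ at hc' hd₃ h₃ hq'
    exact gramSchmidtStep_run hd₃ hc' hc hq' h₃

end RealRAM

/-! ### The parameters of the algorithm -/

/-- The least natural number that is at least `ε ^ (-1 / 3)`. -/
noncomputable def rowScale (ε : ℝ) : ℕ := sInf {v : ℕ | 1 ≤ ε * ((v : ℝ) * v * v)}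

/-- The number of columns of the sketch. -/
noncomputable def sketchSize (k : ℕ) (ε : ℝ) : ℕ := k + 1 + k * rowScale ε ^ 2

/-- The number of iterations of dual set sparsification. -/
noncomputable def dualSetSize (k : ℕ) (ε : ℝ) : ℕ := 4 * (k * rowScale ε ^ 2)

/-- The number of rows drawn by adaptive sampling: the least integer that is at least
`(2 * ρ / ε) * (1 + 4 / rowScale ε)`. -/
noncomputable def sampleSize (ρ : ℕ) (ε : ℝ) : ℕ :=
  sInf {v : ℕ | 2 * (ρ : ℝ) * ((rowScale ε : ℝ) + 4) ≤ (v : ℝ) * (ε * (rowScale ε : ℝ))}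

section Parameters

variable {k ρ : ℕ} {ε : ℝ}

theorem one_le_mul_rowScale (hε : 0 < ε) :
    1 ≤ ε * ((rowScale ε : ℝ) * rowScale ε * rowScale ε) := by
  have hne : {v : ℕ | 1 ≤ ε * ((v : ℝ) * v * v)}.Nonempty := by
    obtain ⟨v, hv⟩ := exists_nat_ge (ε⁻¹ + 1)
    refine ⟨v, ?_⟩
    have h0 : 0 < ε⁻¹ := inv_pos.2 hε
    have h1 : (1 : ℝ) ≤ v := by linarith
    have h2 : (v : ℝ) ≤ (v : ℝ) * v * v := by nlinarith [mul_le_mul h1 h1 zero_le_one (by linarith)]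
    have h3 : 1 ≤ ε * v := by
      rw [← mul_inv_cancel₀ hε.ne']
      exact mul_le_mul_of_nonneg_left (by linarith) hε.le
    exact h3.trans (mul_le_mul_of_nonneg_left h2 hε.le)
  exact Nat.sInf_mem hne

theorem one_le_rowScale (hε : 0 < ε) : 1 ≤ rowScale ε := by
  by_contra h
  have h0 : rowScale ε = 0 := by omega
  have := one_le_mul_rowScale hε
  rw [h0] at this
  norm_num at this

theorem mul_rowScale_le (hε : 0 < ε) (hε1 : ε ≤ 1) :
    ε * ((rowScale ε : ℝ) * rowScale ε * rowScale ε) ≤ 8 := by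
  have h1 := one_le_rowScale hε
  rcases Nat.lt_or_ge 1 (rowScale ε) with h | h
  · have h2 : rowScale ε - 1 ∉ {v : ℕ | 1 ≤ ε * ((v : ℝ) * v * v)} :=
      Nat.notMem_of_lt_sInf (show rowScale ε - 1 < rowScale ε by omega)
    simp only [Set.mem_ofPred_eq, not_le] at h2
    set w : ℝ := ((rowScale ε - 1 : ℕ) : ℝ) with hw
    have e : (rowScale ε : ℝ) = w + 1 := by
      rw [hw, Nat.cast_sub h1]; simp
    have hw1 : 1 ≤ w := by
      rw [hw]; exact_mod_cast (by omega : 1 ≤ rowScale ε - 1)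
    rw [e]
    have h3 : (w + 1) * (w + 1) * (w + 1) ≤ 8 * (w * w * w) := by
      have : w + 1 ≤ 2 * w := by linarith
      calc (w + 1) * (w + 1) * (w + 1) ≤ (2 * w) * (2 * w) * (2 * w) := by gcongr
        _ = _ := by ring
    calc ε * ((w + 1) * (w + 1) * (w + 1)) ≤ ε * (8 * (w * w * w)) :=
          mul_le_mul_of_nonneg_left h3 hε.le
      _ ≤ 8 := by linarith
  · have h2 : rowScale ε = 1 := by omega
    rw [h2]
    norm_num
    linarith

theorem rowScale_sq_le (hε : 0 < ε) (hε1 : ε ≤ 1) :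
    ((rowScale ε : ℝ)) ^ 2 ≤ 4 * ε ^ (-(2 / 3) : ℝ) := by
  have h := mul_rowScale_le hε hε1
  set s : ℝ := (rowScale ε : ℝ)
  have hs : 0 ≤ s := Nat.cast_nonneg _
  have h1 : s * s * s ≤ 8 / ε := by rw [le_div_iff₀ hε]; linarith
  have h2 : (s * s * s) ^ (2 / 3 : ℝ) ≤ (8 / ε) ^ (2 / 3 : ℝ) :=
    Real.rpow_le_rpow (by positivity) h1 (by norm_num)
  have h3 : (s * s * s) ^ (2 / 3 : ℝ) = s ^ 2 := by
    have : s * s * s = s ^ (3 : ℝ) := by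
      rw [show (3 : ℝ) = ((3 : ℕ) : ℝ) by norm_num, Real.rpow_natCast]; ring
    rw [this, ← Real.rpow_mul hs, ← Real.rpow_natCast]
    norm_num
  have h4 : (8 / ε) ^ (2 / 3 : ℝ) = 4 * ε ^ (-(2 / 3) : ℝ) := by
    rw [Real.div_rpow (by norm_num) hε.le, Real.rpow_neg hε.le, div_eq_mul_inv]
    congr 1
    rw [show (8 : ℝ) = 2 ^ (3 : ℝ) by norm_num, ← Real.rpow_mul (by norm_num)]
    norm_num
  rw [← h3, ← h4]
  exact h2

theorem one_div_rowScale_le (hε : 0 < ε) : 1 / (rowScale ε : ℝ) ≤ ε ^ (1 / 3 : ℝ) := by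
  have h := one_le_mul_rowScale hε
  have hs1 : (1 : ℝ) ≤ rowScale ε := by exact_mod_cast one_le_rowScale hε
  set s : ℝ := (rowScale ε : ℝ)
  have hs : 0 < s := by linarith
  have h1 : (1 / s) ^ (3 : ℝ) ≤ ε := by
    rw [show (3 : ℝ) = ((3 : ℕ) : ℝ) by norm_num, Real.rpow_natCast, div_pow, one_pow,
      div_le_iff₀ (by positivity)]
    calc 1 ≤ _ := h
      _ = _ := by ring
  calc 1 / s = ((1 / s) ^ (3 : ℝ)) ^ (1 / 3 : ℝ) := by
        rw [← Real.rpow_mul (by positivity)]; norm_num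
    _ ≤ _ := Real.rpow_le_rpow (by positivity) h1 (by norm_num)

theorem le_sampleSize (hε : 0 < ε) : 2 * (ρ : ℝ) * ((rowScale ε : ℝ) + 4) ≤
    (sampleSize ρ ε : ℝ) * (ε * (rowScale ε : ℝ)) := by
  have hs1 : (1 : ℝ) ≤ rowScale ε := by exact_mod_cast one_le_rowScale hε
  have hne : {v : ℕ | 2 * (ρ : ℝ) * ((rowScale ε : ℝ) + 4) ≤
      (v : ℝ) * (ε * (rowScale ε : ℝ))}.Nonempty := by
    obtain ⟨v, hv⟩ := exists_nat_ge (2 * (ρ : ℝ) * ((rowScale ε : ℝ) + 4) / (ε * rowScale ε))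
    exact ⟨v, (div_le_iff₀ (by positivity)).1 hv⟩
  exact Nat.sInf_mem hne

theorem one_le_sampleSize (hε : 0 < ε) (hρ : 1 ≤ ρ) : 1 ≤ sampleSize ρ ε := by
  by_contra h
  have h0 : sampleSize ρ ε = 0 := by omega
  have h1 := le_sampleSize (ρ := ρ) hε
  have hs1 : (1 : ℝ) ≤ rowScale ε := by exact_mod_cast one_le_rowScale hε
  have hρ' : (1 : ℝ) ≤ ρ := by exact_mod_cast hρ
  rw [h0] at h1
  norm_num at h1
  nlinarith

theorem sampleSize_lt (hε : 0 < ε) (hρ : 1 ≤ ρ) : ((sampleSize ρ ε : ℝ) - 1) *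
    (ε * (rowScale ε : ℝ)) < 2 * (ρ : ℝ) * ((rowScale ε : ℝ) + 4) := by
  have h1 := one_le_sampleSize hε hρ
  have h2 := Nat.notMem_of_lt_sInf (show sampleSize ρ ε - 1 < sampleSize ρ ε by omega)
  simp only [Set.mem_ofPred_eq, not_le] at h2
  rwa [Nat.cast_sub h1, Nat.cast_one] at h2

theorem abs_rows_sub_le (hk : k ≤ ρ) (hρ : 1 ≤ ρ) (hε : 0 < ε) (hε1 : ε ≤ 1) :
    |((dualSetSize k ε + sampleSize ρ ε : ℕ) : ℝ) - 2 * ρ / ε| ≤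
      2 * ρ / ε * (13 * ε ^ (1 / 3 : ℝ)) := by
  have hs1 : (1 : ℝ) ≤ rowScale ε := by exact_mod_cast one_le_rowScale hε
  have hlo := le_sampleSize (ρ := ρ) hε
  have hhi := sampleSize_lt hε hρ
  have hsq := rowScale_sq_le hε hε1
  have hinv := one_div_rowScale_le hε
  have hk' : (k : ℝ) ≤ ρ := by exact_mod_cast hk
  have hρ' : (1 : ℝ) ≤ ρ := by exact_mod_cast hρ
  have e1 : ((dualSetSize k ε + sampleSize ρ ε : ℕ) : ℝ) =
      4 * (k * (rowScale ε : ℝ) ^ 2) + sampleSize ρ ε := by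
    simp [dualSetSize]
  rw [e1]
  set s : ℝ := (rowScale ε : ℝ)
  set N : ℝ := (sampleSize ρ ε : ℝ)
  set x := ε ^ (1 / 3 : ℝ) with hx
  have hx0 : 0 < x := Real.rpow_pos_of_pos hε _
  have hex : ε ^ (-(2 / 3) : ℝ) = x / ε := by
    rw [eq_div_iff hε.ne', hx]
    nth_rewrite 2 [← Real.rpow_one ε]
    rw [← Real.rpow_add hε]
    norm_num
  have hεx : ε ≤ x := by
    calc ε = ε ^ (1 : ℝ) := (Real.rpow_one ε).symm
      _ ≤ x := Real.rpow_le_rpow_of_exponent_ge hε hε1 (by norm_num)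
  have h1 : 2 * ρ / ε ≤ N := by
    rw [div_le_iff₀ hε]
    have : 2 * ρ * s ≤ N * ε * s := by nlinarith
    exact le_of_mul_le_mul_right this (by linarith)
  have h2 : N ≤ 2 * ρ / ε + 2 * ρ / ε * (4 * x) + 1 := by
    have h3 : N - 1 ≤ 2 * ρ / ε * (1 + 4 * (1 / s)) := by
      have : 2 * ρ / ε * (1 + 4 * (1 / s)) = 2 * ρ * (s + 4) / (ε * s) := by field_simp
      rw [this, le_div_iff₀ (by positivity)]
      exact hhi.le
    have h4 : 2 * ρ / ε * (1 + 4 * (1 / s)) ≤ 2 * ρ / ε * (1 + 4 * x) := by gcongr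
    linarith
  have h5 : 4 * (k * s ^ 2) ≤ 2 * ρ / ε * (8 * x) := by
    calc 4 * (k * s ^ 2) ≤ 4 * (ρ * (4 * (x / ε))) := by rw [← hex]; gcongr
      _ = _ := by ring
  have h6 : 1 ≤ 2 * ρ / ε * x := by
    rw [div_mul_eq_mul_div, le_div_iff₀ hε]
    nlinarith
  have h7 : 0 ≤ (k : ℝ) * s ^ 2 := by positivity
  rw [abs_of_nonneg (by linarith)]
  nlinarith

/-- The number of rows is at least `m` if it is not smaller than `m / 2`. -/
theorem le_sampleSize_of_lt {m : ℕ} (hε : 0 < ε) (h : ε * m < 2 * ρ) : m ≤ sampleSize ρ ε := by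
  have hs1 : (1 : ℝ) ≤ rowScale ε := by exact_mod_cast one_le_rowScale hε
  have hlo := le_sampleSize (ρ := ρ) hε
  have h1 : (m : ℝ) * (ε * rowScale ε) ≤ sampleSize ρ ε * (ε * rowScale ε) := by nlinarith
  exact_mod_cast le_of_mul_le_mul_right h1 (by positivity)

theorem sqrt_div_dualSetSize (hk : 1 ≤ k) (hε : 0 < ε) :
    Real.sqrt (k / (dualSetSize k ε : ℝ)) = 1 / (2 * rowScale ε) := by
  have hs1 : (1 : ℝ) ≤ rowScale ε := by exact_mod_cast one_le_rowScale hε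
  have hk' : (1 : ℝ) ≤ k := by exact_mod_cast hk
  have : (k : ℝ) / (dualSetSize k ε : ℝ) = (1 / (2 * rowScale ε)) ^ 2 := by
    simp only [dualSetSize]
    push_cast
    field_simp
    norm_num
  rw [this, Real.sqrt_sq (by positivity)]

theorem lt_dualSetSize (hk : 1 ≤ k) (hε : 0 < ε) : k < dualSetSize k ε := by
  have := one_le_rowScale hε
  unfold dualSetSize
  nlinarith [Nat.one_le_pow 2 _ this]

/-- With `s = rowScale ε`, the square root is `1 / (2 * s)` and the last quotient is `1 / s ^ 2`, so
that the factor in parentheses is at most `2 * (1 + 4 / s)`. -/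
theorem error_factor_le (hk : 1 ≤ k) (hε : 0 < ε) (hρ : 1 ≤ ρ) :
    (ρ : ℝ) / sampleSize ρ ε * ((1 + 1 / (1 - Real.sqrt (k / (dualSetSize k ε : ℝ))) ^ 2) *
      (1 + k / ((sketchSize k ε : ℝ) - k - 1))) ≤ ε := by
  rw [sqrt_div_dualSetSize hk hε]
  have hs1 : (1 : ℝ) ≤ rowScale ε := by exact_mod_cast one_le_rowScale hε
  have hk' : (1 : ℝ) ≤ k := by exact_mod_cast hk
  have hN : (1 : ℝ) ≤ sampleSize ρ ε := by exact_mod_cast one_le_sampleSize hε hρ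
  have hlo := le_sampleSize (ρ := ρ) hε
  have e1 : (k : ℝ) / ((sketchSize k ε : ℝ) - k - 1) = 1 / (rowScale ε : ℝ) ^ 2 := by
    have : (sketchSize k ε : ℝ) - k - 1 = k * (rowScale ε : ℝ) ^ 2 := by
      simp only [sketchSize]; push_cast; ring
    rw [this]
    field_simp
  rw [e1]
  set s : ℝ := (rowScale ε : ℝ)
  set N : ℝ := (sampleSize ρ ε : ℝ)
  have h2s : 0 < 2 * s - 1 := by linarith
  have e2 : 1 / (1 - 1 / (2 * s)) ^ 2 = 4 * s ^ 2 / (2 * s - 1) ^ 2 := by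
    have : 1 - 1 / (2 * s) = (2 * s - 1) / (2 * s) := by field_simp
    rw [this, div_pow, one_div_div]
    ring
  rw [e2]
  have key : (1 + 4 * s ^ 2 / (2 * s - 1) ^ 2) * (1 + 1 / s ^ 2) ≤ 2 * (s + 4) / s := by
    have e3 : (1 + 4 * s ^ 2 / (2 * s - 1) ^ 2) * (1 + 1 / s ^ 2) =
        (8 * s ^ 2 - 4 * s + 1) * (s ^ 2 + 1) / ((2 * s - 1) ^ 2 * s ^ 2) := by
      have hne : (2 * s - 1) ^ 2 ≠ 0 := by positivity
      have hs0 : s ^ 2 ≠ 0 := by positivity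
      rw [one_add_div hne, one_add_div hs0, div_mul_div_comm]
      congr 1
      ring
    rw [e3, div_le_div_iff₀ (by positivity) (by linarith)]
    have h3 : 0 ≤ s ^ 2 * ((s - 1) * (28 * s ^ 2 - 11 * s + 1)) := by
      have h4 : 0 ≤ (s - 1) * (28 * s ^ 2 - 11 * s + 1) :=
        mul_nonneg (by linarith) (by nlinarith)
      positivity
    have h5 : 0 ≤ s * ((s - 1) * (28 * s ^ 2 - 11 * s + 1)) :=
        mul_nonneg (by linarith) (mul_nonneg (by linarith) (by nlinarith))
    nlinarith
  calc (ρ : ℝ) / N * ((1 + 4 * s ^ 2 / (2 * s - 1) ^ 2) * (1 + 1 / s ^ 2))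
      ≤ ρ / N * (2 * (s + 4) / s) := by gcongr
    _ = 2 * ρ * (s + 4) / (N * s) := by field_simp
    _ ≤ ε := by
        rw [div_le_iff₀ (by positivity)]
        calc _ ≤ _ := hlo
          _ = _ := by ring

/-! Bounds for the parameters when `2 * ρ ≤ ε * m`, that is, when `A` has enough rows. -/

variable {m : ℕ}

theorem one_le_mul_rows (hε : 0 < ε) (hρ : 1 ≤ ρ) (hm : 2 * (ρ : ℝ) ≤ ε * m) :
    1 ≤ ε * ((m : ℝ) * m * m) := by
  have hρ' : (1 : ℝ) ≤ ρ := by exact_mod_cast hρ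
  have h1 : (1 : ℝ) ≤ m := by
    by_contra h
    have : m = 0 := by
      by_contra h0
      exact h (by exact_mod_cast Nat.one_le_iff_ne_zero.2 h0)
    rw [this] at hm
    norm_num at hm
    linarith
  have h2 : (m : ℝ) ≤ (m : ℝ) * m * m := by nlinarith [mul_le_mul h1 h1 zero_le_one (by linarith)]
  nlinarith [mul_le_mul_of_nonneg_left h2 hε.le]

theorem mul_rowScale_sq_le (hk : k ≤ ρ) (hε : 0 < ε) (hε1 : ε ≤ 1) (hm : 2 * (ρ : ℝ) ≤ ε * m) :
    k * rowScale ε ^ 2 ≤ 4 * m := by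
  have hs1 : (1 : ℝ) ≤ rowScale ε := by exact_mod_cast one_le_rowScale hε
  have h8 := mul_rowScale_le hε hε1
  have hk' : (k : ℝ) ≤ ρ := by exact_mod_cast hk
  have : (k : ℝ) * (rowScale ε : ℝ) ^ 2 ≤ 4 * m := by
    set s : ℝ := (rowScale ε : ℝ)
    have h1 : ε * (k * s ^ 2) ≤ ε * (4 * m) := by
      have h2 : ε * s ^ 2 ≤ 8 := by nlinarith [mul_pos hε (by positivity : 0 < s ^ 2)]
      calc ε * (k * s ^ 2) = k * (ε * s ^ 2) := by ring
        _ ≤ (ρ : ℝ) * 8 := by gcongr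
        _ ≤ _ := by linarith
    exact le_of_mul_le_mul_left h1 hε
  exact_mod_cast this

theorem sample_condition_rows (hε : 0 < ε) (hm : 2 * (ρ : ℝ) ≤ ε * m) :
    2 * (ρ : ℝ) * ((rowScale ε : ℝ) + 4) ≤ ((5 * m : ℕ) : ℝ) * (ε * (rowScale ε : ℝ)) := by
  have hs1 : (1 : ℝ) ≤ rowScale ε := by exact_mod_cast one_le_rowScale hε
  have h0 : 0 ≤ ε * (m : ℝ) := by positivity
  push_cast
  nlinarith [mul_le_mul hm (by linarith : (rowScale ε : ℝ) + 4 ≤ 5 * rowScale ε) (by linarith) h0]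

theorem sampleSize_le (hε : 0 < ε) (hm : 2 * (ρ : ℝ) ≤ ε * m) : sampleSize ρ ε ≤ 5 * m :=
  Nat.sInf_le (sample_condition_rows hε hm)

theorem sampleSize_le_cube (hε : 0 < ε) (hε1 : ε ≤ 1) (hρ : 1 ≤ ρ) :
    sampleSize ρ ε ≤ 11 * (ρ * rowScale ε ^ 3) := by
  have hs1 : (1 : ℝ) ≤ rowScale ε := by exact_mod_cast one_le_rowScale hε
  have hρ' : (1 : ℝ) ≤ ρ := by exact_mod_cast hρ
  have hhi := sampleSize_lt hε hρ
  have h1 := one_le_mul_rowScale hε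
  have : (sampleSize ρ ε : ℝ) ≤ 11 * (ρ * (rowScale ε : ℝ) ^ 3) := by
    set s : ℝ := (rowScale ε : ℝ)
    set N : ℝ := (sampleSize ρ ε : ℝ)
    have h2 : (N - 1) * ε * s ≤ 10 * ρ * s := by nlinarith
    have h3 : (N - 1) * ε ≤ 10 * ρ := le_of_mul_le_mul_right h2 (by linarith)
    have h4 : N * ε ≤ 11 * ρ := by nlinarith
    have h5 : 11 * (ρ : ℝ) ≤ 11 * (ρ * s ^ 3) * ε := by nlinarith
    exact le_of_mul_le_mul_right (h4.trans h5) hε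
  exact_mod_cast this

theorem cube_le_four_pow (T : ℕ) : (T + 1) ^ 3 ≤ 16 * 4 ^ T := by
  induction T with
  | zero => norm_num
  | succ n ih =>
    rcases Nat.lt_or_ge n 1 with h | h
    · interval_cases n; norm_num
    · have h1 : (n + 1 + 1) ^ 3 ≤ 4 * (n + 1) ^ 3 := by
        obtain ⟨p, rfl⟩ := Nat.exists_eq_add_of_le h
        nlinarith [Nat.zero_le (p ^ 3), Nat.zero_le (p ^ 2)]
      rw [pow_succ 4]
      omega

/-- Binary searches in the `m` rows do not dominate the running time: their number is at most
`5 * m` and at most `11 * ρ * s ^ 3`, and `log m` is less than a power of `m`. -/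
theorem sampleSize_mul_le {n T : ℕ} (hε : 0 < ε) (hε1 : ε ≤ 1) (hρ : 1 ≤ ρ) (hn : ρ ≤ n)
    (hm : 2 * (ρ : ℝ) ≤ ε * m) (hT : T = 0 ∨ 2 ^ (T - 1) < m) :
    sampleSize ρ ε * T ≤ 22 * (m * n * rowScale ε ^ 2) := by
  rcases hT with rfl | hT
  · simp
  rcases Nat.eq_zero_or_pos T with rfl | hT0
  · simp
  have h1 := sampleSize_le hε hm
  have h2 := (sampleSize_le_cube hε hε1 hρ).trans
    (Nat.mul_le_mul_left 11 (Nat.mul_le_mul_right _ hn))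
  have h3 : T ^ 3 ≤ 16 * m ^ 2 := by
    have h4 := cube_le_four_pow (T - 1)
    rw [Nat.sub_add_cancel hT0] at h4
    refine h4.trans (Nat.mul_le_mul_left _ ?_)
    calc 4 ^ (T - 1) = (2 ^ (T - 1)) ^ 2 := by rw [← pow_mul, mul_comm, pow_mul]; norm_num
      _ ≤ m ^ 2 := Nat.pow_le_pow_left hT.le 2
  refine (Nat.pow_le_pow_iff_left (n := 3) (by norm_num)).1 ?_
  generalize sampleSize ρ ε = N at h1 h2
  generalize rowScale ε = s at h2
  calc (N * T) ^ 3 = N * (N * N) * T ^ 3 := by ring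
    _ ≤ 5 * m * (11 * (n * s ^ 3) * (11 * (n * s ^ 3))) * (16 * m ^ 2) := by gcongr
    _ = 9680 * (m ^ 3 * n ^ 2 * s ^ 6) := by ring
    _ ≤ 10648 * (m ^ 3 * n ^ 3 * s ^ 6) := by
        have : n ^ 2 ≤ n ^ 3 := Nat.pow_le_pow_right (by omega) (by norm_num)
        gcongr
        norm_num
    _ = _ := by ring

end Parameters

namespace RealRAM

/-- Linear search for the least value of the variable `out` that passes the test `t`. -/
def search (out : ℕ) (B : NExp) (t : Test) : Cmd :=
  .seq (.setN out (.lit 0) (.lit 0)) <|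
    .loop 23 B (.ite t .skip (.setN out (.lit 0) (.plus (nvar out) (.lit 1))))

theorem search_run {S : EigenSolver} {ω : Tape} {s : State} {out bb W : ℕ} {B : NExp} {t : Test}
    (p : ℕ → Prop) (hout : out ≠ 23)
    (hB : ∀ s' : State, (∀ b, b ≠ out → s'.nat b = s.nat b) → B.eval s' = bb)
    (ht : ∀ s' : State, (∀ b, b ≠ out → b ≠ 23 → s'.nat b = s.nat b) → s'.real = s.real →
      (t.holds s' ↔ p (s'.nat out 0)))
    (hp : p bb) (hW : bb ≤ W) :
    RunW S ω (search out B t) s W fun s' => s'.nat out 0 = sInf {v | p v} := by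
  refine RunW.seq (run_setN rfl rfl) fun s₁ f₁ h₁ => ?_
  have h0 : s₁.nat out 0 = 0 := by rw [h₁.1]; simp [NExp.eval]
  have hB₁ : B.eval s₁ = bb := hB s₁ fun b hb => f₁.nat b (by simpa [Cmd.natWrites] using hb)
  refine (RunW.loop (w := 0) (fun i s' => (∀ v < s'.nat out 0, ¬p v) ∧
    (p (s'.nat out 0) ∨ s'.nat out 0 = i)) hB₁ (by omega) ?_ ?_).mono le_rfl ?_
  · change (∀ v < s₁.nat out 0, ¬p v) ∧ (p (s₁.nat out 0) ∨ s₁.nat out 0 = 0)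
    rw [h0]
    exact ⟨fun v hv => by omega, Or.inr rfl⟩
  · rintro i hi s₂ f₂ ⟨h₂, h₂'⟩
    have hn : ((s₂.setN 23 0 i).tick 1).nat out = s₂.nat out := by
      funext j
      simp [State.tick, State.setN, hout]
    have hf : ∀ t', ∀ b, b ≠ out → b ≠ 23 →
        (((s₂.setN 23 0 i).tick 1).tick t').nat b = s.nat b := by
      intro t' b hb hb'
      rw [← f₁.nat b (by simpa [Cmd.natWrites] using hb),
        ← f₂.nat b (by simp [Cmd.natWrites, hb, hb'])]
      funext j
      simp [State.tick, State.setN, hb']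
    have hr : ((s₂.setN 23 0 i).tick 1).real = s.real := by
      rw [← h₁.2]
      funext a
      exact f₂.real a (by simp [Cmd.realWrites])
    have ht' := ht ((s₂.setN 23 0 i).tick 1) (hf 0) hr
    rw [hn] at ht'
    refine RunW.ite (fun h => run_skip.mono le_rfl fun s' _ hs' => ?_)
      (fun h => (run_setN rfl rfl).mono le_rfl fun s' _ hs' => ?_)
    · subst hs'
      change (∀ v < ((s₂.setN 23 0 i).tick 1).nat out 0, _) ∧
        (p (((s₂.setN 23 0 i).tick 1).nat out 0)
        ∨ ((s₂.setN 23 0 i).tick 1).nat out 0 = _)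
      rw [hn]
      exact ⟨h₂, Or.inl (ht'.1 h)⟩
    · have hnp : ¬p (s₂.nat out 0) := fun hp' => h (ht'.2 hp')
      have hi' : s₂.nat out 0 = i := h₂'.resolve_left hnp
      have hv : s'.nat out 0 = i + 1 := by
        rw [hs'.1, if_pos ⟨rfl, rfl⟩]
        change ((s₂.setN 23 0 i).tick 1).nat out 0 + 1 = i + 1
        rw [hn, hi']
      rw [hv]
      refine ⟨fun v hv' => ?_, Or.inr rfl⟩
      rcases Nat.lt_succ_iff_lt_or_eq.1 hv' with hv' | rfl
      · exact h₂ v (by omega)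
      · rwa [← hi']
  · rintro s' - ⟨h1, h2⟩
    have hps : p (s'.nat out 0) := by
      rcases h2 with h2 | h2
      · exact h2
      · rw [h2]; exact hp
    refine le_antisymm ?_ (Nat.sInf_le hps)
    by_contra hlt
    exact h1 _ (not_le.1 hlt) (Nat.sInf_mem (s := {v | p v}) ⟨_, hps⟩)

/-- The computation of the parameters. The variables `3`, `4`, `5`, `6` become the scale, the
number of columns of the sketch, the number of iterations of dual set sparsification and the number
of samples, and `7` an upper bound for the binary logarithm of the number of rows. -/
def parameters : Cmd :=
  .seq (search 3 (nvar 0) (.rle (.ofNat (.lit 1)) (.times (rvar 1)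
    (.times (.times (.ofNat (nvar 3)) (.ofNat (nvar 3))) (.ofNat (nvar 3)))))) <|
  .seq (search 18 (.plus (.plus (nvar 0) (nvar 0)) (.plus (nvar 0) (nvar 0)))
    (.rle (.times (.ofNat (.get 0 (.lit 2))) (.times (.ofNat (nvar 3)) (.ofNat (nvar 3))))
      (.ofNat (nvar 18)))) <|
  .seq (.setN 4 (.lit 0) (.plus (.plus (.get 0 (.lit 2)) (.lit 1)) (nvar 18))) <|
  .seq (.setN 5 (.lit 0) (.plus (.plus (nvar 18) (nvar 18)) (.plus (nvar 18) (nvar 18)))) <|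
  .seq (search 6 (.plus (.plus (.plus (nvar 0) (nvar 0)) (.plus (nvar 0) (nvar 0))) (nvar 0))
    (.rle (.times (.times (.ofNat (.lit 2)) (.ofNat (.get 0 (.lit 3))))
        (.plus (.ofNat (nvar 3)) (.ofNat (.lit 4))))
      (.times (.ofNat (nvar 6)) (.times (rvar 1) (.ofNat (nvar 3)))))) <|
  .seq (.setN 8 (.lit 0) (.lit 1)) <|
  .seq (.setN 7 (.lit 0) (.lit 0)) <|
  .loop 23 (nvar 0) <| .ite (.nle (nvar 0) (nvar 8)) .skip <|
    .seq (.setN 8 (.lit 0) (.plus (nvar 8) (nvar 8))) (.setN 7 (.lit 0) (.plus (nvar 7) (.lit 1)))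

theorem parameters_run {S : EigenSolver} {ω : Tape} {s : State} {m k ρ W : ℕ} {ε : ℝ}
    (hsm : s.nat 0 0 = m) (hsk : s.nat 0 2 = k) (hsρ : s.nat 0 3 = ρ) (hsε : s.real 1 0 0 = ε)
    (hk : k ≤ ρ) (hρ : 1 ≤ ρ) (hε : 0 < ε) (hε1 : ε ≤ 1) (hm : 2 * (ρ : ℝ) ≤ ε * m)
    (hW : 5 * m ≤ W) :
    RunW S ω parameters s W fun s' => s'.nat 4 0 = sketchSize k ε ∧ s'.nat 5 0 = dualSetSize k ε ∧
      s'.nat 6 0 = sampleSize ρ ε ∧ m ≤ 2 ^ s'.nat 7 0 ∧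
      (s'.nat 7 0 = 0 ∨ 2 ^ (s'.nat 7 0 - 1) < m) := by
  refine RunW.seq (search_run (bb := m) (fun v => 1 ≤ ε * ((v : ℝ) * v * v)) (by decide)
    (fun s' h => ?_) (fun s' h h' => ?_) (one_le_mul_rows hε hρ hm) (by omega)) fun s₁ f₁ h₁ => ?_
  · simp only [NExp.eval, h 0 (by decide), hsm]
  · simp only [Test.holds, RExp.eval, NExp.eval, h', hsε, Nat.cast_one]
  have e3 : s₁.nat 3 0 = rowScale ε := h₁
  have g0 := f₁.nat 0 (by decide)
  have g1 := f₁.real 1 (by decide)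
  refine RunW.seq (search_run (bb := 4 * m)
    (fun v => (k : ℝ) * ((rowScale ε : ℝ) * rowScale ε) ≤ v) (by decide)
    (fun s' h => ?_) (fun s' h h' => ?_) ?_ (by omega)) fun s₂ f₂ h₂ => ?_
  · simp only [NExp.eval, h 0 (by decide), g0, hsm]; ring
  · simp only [Test.holds, RExp.eval, NExp.eval, h 0 (by decide) (by decide), g0, hsk,
      h 3 (by decide) (by decide), e3]
  · have := mul_rowScale_sq_le hk hε hε1 hm
    rw [← sq]
    exact_mod_cast this
  have e18 : s₂.nat 18 0 = k * rowScale ε ^ 2 := by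
    rw [h₂]
    refine le_antisymm (Nat.sInf_le ?_) (le_csInf ⟨k * rowScale ε ^ 2, ?_⟩ fun v hv => ?_)
    · simp only [Set.mem_ofPred_eq]; push_cast; rw [sq]
    · simp only [Set.mem_ofPred_eq]; push_cast; rw [sq]
    · simp only [Set.mem_ofPred_eq, ← sq] at hv
      exact_mod_cast hv
  have e3' := (congrFun (f₂.nat 3 (by decide)) 0).trans e3
  have g0' := (f₂.nat 0 (by decide)).trans g0
  have g1' := (f₂.real 1 (by decide)).trans g1
  refine RunW.seq (run_setN rfl rfl) fun s₃ f₃ h₃ => ?_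
  have e4 : s₃.nat 4 0 = sketchSize k ε := by
    rw [h₃.1]
    simp only [NExp.eval, g0', hsk, e18]
    rfl
  refine RunW.seq (run_setN rfl rfl) fun s₄ f₄ h₄ => ?_
  have e5 : s₄.nat 5 0 = dualSetSize k ε := by
    rw [h₄.1]
    simp only [NExp.eval, f₃.nat 18 (by decide), e18, dualSetSize, and_self, if_true]
    ring
  have g0₄ : s₄.nat 0 = s.nat 0 := by rw [f₄.nat 0 (by decide), f₃.nat 0 (by decide), g0']
  have g1₄ : s₄.real 1 = s.real 1 := by rw [h₄.2, h₃.2, g1']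
  have e3₄ : s₄.nat 3 0 = rowScale ε := by rw [f₄.nat 3 (by decide), f₃.nat 3 (by decide), e3']
  refine RunW.seq (search_run (bb := 5 * m) (fun v => 2 * (ρ : ℝ) * ((rowScale ε : ℝ) + 4) ≤
      (v : ℝ) * (ε * (rowScale ε : ℝ))) (by decide)
    (fun s' h => ?_) (fun s' h h' => ?_) (sample_condition_rows hε hm) (by omega))
    fun s₅ f₅ h₅ => ?_
  · simp only [NExp.eval, h 0 (by decide), g0₄, hsm]; ring
  · simp only [Test.holds, RExp.eval, NExp.eval, h 0 (by decide) (by decide), g0₄, hsρ,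
      h 3 (by decide) (by decide), e3₄, h', g1₄, hsε, Nat.cast_ofNat]
  refine RunW.seq (run_setN rfl rfl) fun s₆ f₆ h₆ => ?_
  refine RunW.seq (run_setN rfl rfl) fun s₇ f₇ h₇ => ?_
  have g0₇ : s₇.nat 0 = s.nat 0 := by
    rw [f₇.nat 0 (by decide), f₆.nat 0 (by decide), f₅.nat 0 (by decide), g0₄]
  have e4₇ : s₇.nat 4 0 = sketchSize k ε := by
    rw [f₇.nat 4 (by decide), f₆.nat 4 (by decide), f₅.nat 4 (by decide), f₄.nat 4 (by decide), e4]
  have e5₇ : s₇.nat 5 0 = dualSetSize k ε := by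
    rw [f₇.nat 5 (by decide), f₆.nat 5 (by decide), f₅.nat 5 (by decide), e5]
  have e6₇ : s₇.nat 6 0 = sampleSize ρ ε := by
    rw [f₇.nat 6 (by decide), f₆.nat 6 (by decide)]; exact h₅
  have e7₇ : s₇.nat 7 0 = 0 := by rw [h₇.1]; rfl
  have e8₇ : s₇.nat 8 0 = 1 := by rw [f₇.nat 8 (by decide), h₆.1]; rfl
  have hmpos : 1 ≤ m := by
    by_contra h0
    have : m = 0 := by omega
    rw [this] at hm
    norm_num at hm
    have : (1 : ℝ) ≤ ρ := by exact_mod_cast hρ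
    linarith
  refine (RunW.loop (w := 0) (n := m) (fun i s' => s'.nat 8 0 = 2 ^ s'.nat 7 0 ∧
    (m ≤ 2 ^ s'.nat 7 0 ∨ s'.nat 7 0 = i) ∧ (s'.nat 7 0 = 0 ∨ 2 ^ (s'.nat 7 0 - 1) < m))
    ?_ (by omega) ?_ ?_).mono le_rfl ?_
  · simp only [NExp.eval, g0₇, hsm]
  · change s₇.nat 8 0 = 2 ^ s₇.nat 7 0 ∧ (m ≤ 2 ^ s₇.nat 7 0 ∨ s₇.nat 7 0 = 0) ∧
      (s₇.nat 7 0 = 0 ∨ 2 ^ (s₇.nat 7 0 - 1) < m)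
    rw [e7₇, e8₇]
    exact ⟨rfl, Or.inr rfl, Or.inl rfl⟩
  · rintro i hi s₈ f₈ ⟨h1, h2, h3⟩
    have hm8 : s₈.nat 0 0 = m := by rw [f₈.nat 0 (by decide), g0₇, hsm]
    refine RunW.ite (fun ht => run_skip.mono le_rfl fun s' _ hs' => ?_) (fun ht => ?_)
    · subst hs'
      have ht : s₈.nat 0 0 ≤ s₈.nat 8 0 := ht
      rw [hm8, h1] at ht
      exact ⟨h1, Or.inl ht, h3⟩
    · have ht : ¬s₈.nat 0 0 ≤ s₈.nat 8 0 := ht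
      rw [hm8, h1] at ht
      have hi' := h2.resolve_left ht
      refine RunW.seq (run_setN (w := s₈.nat 8 0 + s₈.nat 8 0) rfl rfl) fun s₉ f₉ h₉ => ?_
      have e7₉ : s₉.nat 7 0 = s₈.nat 7 0 := by rw [f₉.nat 7 (by decide)]; rfl
      refine (run_setN (w := s₉.nat 7 0 + 1) rfl rfl).mono le_rfl fun s' f' hs' => ?_
      have e7' : s'.nat 7 0 = s₈.nat 7 0 + 1 := by rw [hs'.1, e7₉]; rfl
      have e8' : s'.nat 8 0 = s₈.nat 8 0 + s₈.nat 8 0 := by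
        rw [f'.nat 8 (by decide), h₉.1]; rfl
      rw [e7', e8', h1, hi']
      refine ⟨by rw [pow_succ]; ring, Or.inr rfl, Or.inr ?_⟩
      rw [hi'] at ht
      simpa using ht
  · rintro s' f' ⟨-, h2, h3⟩
    refine ⟨by rw [f'.nat 4 (by decide), e4₇], by rw [f'.nat 5 (by decide), e5₇],
      by rw [f'.nat 6 (by decide), e6₇], ?_, h3⟩
    rcases h2 with h2 | h2
    · exact h2
    · rw [h2]; exact Nat.lt_two_pow_self.le

end RealRAM

/-! ### The randomized singular value decomposition as a program -/

/-- The singular value decomposition of the projection of `A` to the row space of `Q`, from the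
eigenvalue decomposition of the small matrix `Q * A * (Q * A)ᵀ`. -/
theorem exists_truncatedSVD_of_eigen {m n q ℓ k : ℕ} {A : Matrix (Fin m) (Fin n) ℝ}
    {Ω : Matrix (Fin n) (Fin ℓ) ℝ} {Q : Matrix (Fin q) (Fin m) ℝ} {T : Matrix (Fin q) (Fin ℓ) ℝ}
    {W : Matrix (Fin q) (Fin q) ℝ} {lam : Fin q → ℝ} (hQ : Q * Qᵀ = 1) (hT : Q = T * (A * Ω)ᵀ)
    (hY : Qᵀ * (Q * (A * Ω)) = A * Ω) (hW : Wᵀ * W = 1)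
    (hlam : Q * A * (Q * A)ᵀ * W = W * Matrix.diagonal lam) (hanti : Antitone lam)
    (hk : k ≤ q) :
    ∃ (σ : Fin k → ℝ) (V : Matrix (Fin n) (Fin k) ℝ),
      IsTruncatedSVD (A * Ω * pinv (A * Ω) * A) ((Qᵀ * W).submatrix id (Fin.castLE hk)) σ V ∧
      ∀ i, 0 < σ i := by
  set B := Q * A with hB
  have hW' : W * Wᵀ = 1 := mul_eq_one_comm.1 hW
  have hproj : A * Ω * pinv (A * Ω) = Qᵀ * Q := by
    refine (eq_mul_pinv_of_proj (T := Tᵀ * Q) ?_ ?_ ?_).symm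
    · rw [Matrix.transpose_mul, Matrix.transpose_transpose]
    · rw [Matrix.mul_assoc, hY]
    · conv_lhs => rw [hT, Matrix.transpose_mul, Matrix.transpose_transpose, ← hT]
      rw [Matrix.mul_assoc]
  have hinv : T * Ωᵀ * Bᵀ = 1 := by
    calc T * Ωᵀ * Bᵀ = T * (A * Ω)ᵀ * Qᵀ := by
          rw [hB, Matrix.transpose_mul, Matrix.transpose_mul]; simp only [Matrix.mul_assoc]
      _ = 1 := by rw [← hT, hQ]
  have hdiag : Wᵀ * B * (Wᵀ * B)ᵀ = Matrix.diagonal lam := by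
    calc Wᵀ * B * (Wᵀ * B)ᵀ = Wᵀ * (B * Bᵀ * W) := by
          rw [Matrix.transpose_mul, Matrix.transpose_transpose]; simp only [Matrix.mul_assoc]
      _ = _ := by rw [hlam, ← Matrix.mul_assoc, hW, Matrix.one_mul]
  have hentry : ∀ i, ∑ j, (Wᵀ * B) i j ^ 2 = lam i := by
    intro i
    have := congrFun (congrFun hdiag i) i
    rw [Matrix.diagonal_apply_eq, Matrix.mul_apply] at this
    rw [← this]
    exact Finset.sum_congr rfl fun j _ => by rw [sq]; rfl
  have hpos : ∀ i, 0 < lam i := by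
    intro i
    rcases (Finset.sum_nonneg fun j _ => sq_nonneg ((Wᵀ * B) i j)).lt_or_eq with h | h
    · rwa [hentry] at h
    · -- otherwise `B` would have a left kernel
      exfalso
      have hz : ∀ j, (Wᵀ * B) i j = 0 := fun j => by
        simpa using (Finset.sum_eq_zero_iff_of_nonneg fun j _ => sq_nonneg ((Wᵀ * B) i j)).1
          h.symm j (Finset.mem_univ j)
      have h1 : T * Ωᵀ * (Wᵀ * B)ᵀ * Wᵀ = 1 := by
        rw [Matrix.transpose_mul, Matrix.transpose_transpose, ← Matrix.mul_assoc, hinv,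
          Matrix.one_mul, hW']
      have h2 : T * Ωᵀ * (Wᵀ * B)ᵀ = W := by
        calc T * Ωᵀ * (Wᵀ * B)ᵀ = T * Ωᵀ * (Wᵀ * B)ᵀ * (Wᵀ * W) := by rw [hW, Matrix.mul_one]
          _ = T * Ωᵀ * (Wᵀ * B)ᵀ * Wᵀ * W := by simp only [Matrix.mul_assoc]
          _ = W := by rw [h1, Matrix.one_mul]
      have h3 : ∀ a, W a i = 0 := by
        intro a
        rw [← h2, Matrix.mul_apply]
        exact Finset.sum_eq_zero fun j _ => by rw [Matrix.transpose_apply, hz, mul_zero]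
      have h4 := congrFun (congrFun hW i) i
      rw [Matrix.mul_apply, Matrix.one_apply_eq] at h4
      simp [h3] at h4
  have hs : ∀ i, 0 < Real.sqrt (lam i) := fun i => Real.sqrt_pos.2 (hpos i)
  have hsvd : IsSVD (A * Ω * pinv (A * Ω) * A) (Qᵀ * W) (fun i => Real.sqrt (lam i))
      ((Wᵀ * B)ᵀ * Matrix.diagonal fun i => (Real.sqrt (lam i))⁻¹) := by
    refine ⟨?_, ?_, fun i => (hs i).le, fun i j hij => Real.sqrt_le_sqrt (hanti hij), ?_⟩
    · calc (Qᵀ * W)ᵀ * (Qᵀ * W) = Wᵀ * (Q * Qᵀ) * W := by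
            rw [Matrix.transpose_mul, Matrix.transpose_transpose]; simp only [Matrix.mul_assoc]
        _ = 1 := by rw [hQ, Matrix.mul_one, hW]
    · rw [Matrix.transpose_mul, Matrix.transpose_transpose, Matrix.diagonal_transpose,
        Matrix.mul_assoc, ← Matrix.mul_assoc (Wᵀ * B), hdiag, Matrix.diagonal_mul_diagonal,
        Matrix.diagonal_mul_diagonal, ← Matrix.diagonal_one]
      congr 1
      funext i
      have h1 := Real.mul_self_sqrt (hpos i).le
      have h2 := (hs i).ne'
      field_simp
      rw [sq, h1]
    · rw [Matrix.transpose_mul, Matrix.transpose_transpose, Matrix.diagonal_transpose, hproj,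
        Matrix.mul_assoc (Qᵀ * W), ← Matrix.mul_assoc (Matrix.diagonal _),
        Matrix.diagonal_mul_diagonal]
      have : (fun i => Real.sqrt (lam i) * (Real.sqrt (lam i))⁻¹) = fun _ => 1 := by
        funext i
        exact mul_inv_cancel₀ (hs i).ne'
      rw [this, Matrix.diagonal_one, Matrix.one_mul, Matrix.mul_assoc Qᵀ W,
        ← Matrix.mul_assoc W, hW', Matrix.one_mul, hB, Matrix.mul_assoc]
  exact ⟨_, _, ⟨q, hk, _, _, _, hsvd, rfl, rfl, rfl⟩, fun i => hs _⟩

namespace RealRAM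

theorem fill_cost_le {a b c A B C : ℕ} (ha : a ≤ A) (hb : b ≤ B) (hc : c ≤ C) (hB : 1 ≤ B)
    (hC : 1 ≤ C) : a * (b * (c + 1) + 1) ≤ 3 * (A * B * C) := by
  calc a * (b * (c + 1) + 1) ≤ A * (B * (C + 1) + 1) := by gcongr
    _ ≤ A * (3 * (B * C)) := Nat.mul_le_mul_left _ (by nlinarith)
    _ = _ := by ring

/-- A Gaussian matrix, filled row by row. -/
def gaussMatrix (a : ℕ) (N M : NExp) : Cmd :=
  .loop 20 N (.loop 21 M (.gauss a (nvar 20) (nvar 21)))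

theorem gaussMatrix_run {S : EigenSolver} {ω : Tape} {s : State} {a nn mm W : ℕ} {N M : NExp}
    (hN : ∀ s', Sim a s s' → N.eval s' = nn) (hM : ∀ s', Sim a s s' → M.eval s' = mm)
    (hg : s.gaussUsed = 0) (hW : nn * (mm + 1) ≤ W) :
    RunW S ω (gaussMatrix a N M) s W fun s' => Sim a s s' ∧
      toMat nn mm (s'.real a) = sketchMatrix nn mm ω.1 := by
  refine (RunW.loop (w := mm) (fun i s' => Sim a s s' ∧ s'.gaussUsed = i * mm ∧
    ∀ i' < i, ∀ j' < mm, s'.real a i' j' = ω.1 (i' * mm + j'))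
    (hN s ⟨fun _ _ => rfl, fun _ _ => rfl⟩) hW ?_ ?_).mono le_rfl ?_
  · exact ⟨⟨fun _ _ => rfl, fun _ _ => rfl⟩, by rw [Nat.zero_mul]; exact hg,
      fun i' hi' => by omega⟩
  · rintro i hi s₁ - ⟨h₁, hg₁, hr₁⟩
    have h₂ : Sim a s ((s₁.setN 20 0 i).tick 1) := h₁.setN (by decide) _ _ _
    have hi₂ : ((s₁.setN 20 0 i).tick 1).nat 20 0 = i := by simp [State.tick, State.setN]
    have hg₂ : ((s₁.setN 20 0 i).tick 1).gaussUsed = i * mm := hg₁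
    have hr₂ : ∀ i' < i, ∀ j' < mm, ((s₁.setN 20 0 i).tick 1).real a i' j' =
      ω.1 (i' * mm + j') := hr₁
    generalize (s₁.setN 20 0 i).tick 1 = s₂ at h₂ hi₂ hg₂ hr₂
    refine (RunW.loop (w := 0) (fun j s' => Sim a s s' ∧ s'.nat 20 0 = i ∧
      s'.gaussUsed = i * mm + j ∧ ∀ i' j', (i' < i ∧ j' < mm ∨ i' = i ∧ j' < j) →
        s'.real a i' j' = ω.1 (i' * mm + j')) (hM s₂ h₂) (by omega) ?_ ?_).mono le_rfl ?_
    · refine ⟨⟨h₂.nat, h₂.real⟩, hi₂, hg₂, fun i' j' h => ?_⟩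
      exact hr₂ i' (by omega) j' (by omega)
    · rintro j hj s₃ - ⟨h₃, hi₃, hg₃, hr₃⟩
      have h₄ : Sim a s ((s₃.setN 21 0 j).tick 1) := h₃.setN (by decide) _ _ _
      have hi₄ : ((s₃.setN 21 0 j).tick 1).nat 20 0 = i := by
        simpa [State.tick, State.setN] using hi₃
      have hj₄ : ((s₃.setN 21 0 j).tick 1).nat 21 0 = j := by simp [State.tick, State.setN]
      refine (run_gauss (show (nvar 20).eval _ = i from hi₄)
        (show (nvar 21).eval _ = j from hj₄)).mono le_rfl ?_
      rintro s' f' ⟨hs', hgs'⟩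
      have hn' : s'.nat = ((s₃.setN 21 0 j).tick 1).nat := by
        funext b; exact f'.nat b (by simp [Cmd.natWrites])
      refine ⟨⟨fun b hb => by rw [hn']; exact h₄.nat b hb, fun b hb => ?_⟩, by rw [hn', hi₄], ?_,
        fun i' j' h => ?_⟩
      · rw [f'.real b (by simpa [Cmd.realWrites] using hb)]
        exact h₄.real b hb
      · rw [hgs']
        change s₃.gaussUsed + 1 = _
        rw [hg₃]; ring
      · rw [hs']
        split_ifs with hij
        · change ω.1 s₃.gaussUsed = _
          rw [hg₃, hij.2.1, hij.2.2]
        · refine hr₃ i' j' ?_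
          by_contra hcon
          exact hij ⟨rfl, by omega⟩
    · rintro s' - ⟨h, -, hg', hr'⟩
      refine ⟨h, by rw [hg']; ring, fun i' hi' j' hj' => hr' i' j' (by omega)⟩
  · rintro s' - ⟨h, -, hr'⟩
    refine ⟨h, ?_⟩
    ext i j
    rw [toMat_apply, hr' i i.2 j j.2]
    rfl

/-- Product of two matrices, both of them possibly transposed or restricted: `e` and `e'` read
the entries of the factors. -/
theorem toMat_mul {m n l : ℕ} {h : ℕ → ℕ → ℝ} {f g : ℕ → ℕ → ℝ}
    (H : ∀ i < m, ∀ j < n, h i j = 0 + ∑ x ∈ Finset.range l, f i x * g x j) :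
    toMat m n h = toMat m l f * toMat l n g := by
  ext i j
  rw [toMat_apply, H i i.2 j j.2, zero_add, Matrix.mul_apply, Finset.sum_range]
  rfl

/-- The randomized singular value decomposition: array `12` becomes the matrix of left singular
vectors, array `15` the residual and array `14` the squared norms of its rows. -/
def randomizedSVD : Cmd :=
  .seq (gaussMatrix 2 (.get 0 (.lit 1)) (nvar 4)) <|
  .seq (fillSum 3 (.lit 0) (nvar 0) (nvar 4) (.get 0 (.lit 1)) (.ofNat (.lit 0))
    (.times (.get 0 (nvar 20) (nvar 22)) (.get 2 (nvar 22) (nvar 21)))) <|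
  .seq (gramSchmidt (nvar 0) (nvar 4)) <|
  .seq (fillSum 8 (.lit 0) (nvar 10) (.get 0 (.lit 1)) (nvar 0) (.ofNat (.lit 0))
    (.times (.get 4 (nvar 20) (nvar 22)) (.get 0 (nvar 22) (nvar 21)))) <|
  .seq (fillSum 9 (.lit 0) (nvar 10) (nvar 10) (.get 0 (.lit 1)) (.ofNat (.lit 0))
    (.times (.get 8 (nvar 20) (nvar 22)) (.get 8 (nvar 21) (nvar 22)))) <|
  .seq (.eig 9 (nvar 10) 10 11) <|
  .seq (fillSum 12 (.lit 0) (nvar 0) (.get 0 (.lit 2)) (nvar 10) (.ofNat (.lit 0))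
    (.times (.get 4 (nvar 22) (nvar 20)) (.get 11 (nvar 22) (nvar 21)))) <|
  .seq (fillSum 13 (.lit 0) (.get 0 (.lit 2)) (.get 0 (.lit 1)) (nvar 0) (.ofNat (.lit 0))
    (.times (.get 12 (nvar 22) (nvar 20)) (.get 0 (nvar 22) (nvar 21)))) <|
  .seq (fillSum 15 (.lit 0) (nvar 0) (.get 0 (.lit 1)) (.get 0 (.lit 2))
    (.get 0 (nvar 20) (nvar 21)) (.minus (.ofNat (.lit 0))
      (.times (.get 12 (nvar 20) (nvar 22)) (.get 13 (nvar 22) (nvar 21))))) <|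
  fillSum 14 (.lit 0) (nvar 0) (.lit 1) (.get 0 (.lit 1)) (.ofNat (.lit 0))
    (.times (.get 15 (nvar 20) (nvar 22)) (.get 15 (nvar 20) (nvar 22)))

set_option maxHeartbeats 1000000 in
/-- The rank condition holds almost surely if `k ≤ A.rank`. Without it the columns that are computed need not be
orthonormal, but the residual in array `15`, its row norms in array `14` and the running time are as
stated. -/
theorem randomizedSVD_run {S : EigenSolver} {ω : Tape} {s : State} {m n k ℓ W : ℕ}
    {A : Matrix (Fin m) (Fin n) ℝ} (hsm : s.nat 0 0 = m) (hsn : s.nat 0 1 = n)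
    (hsk : s.nat 0 2 = k) (hsℓ : s.nat 4 0 = ℓ) (hsA : toMat m n (s.real 0) = A)
    (hg : s.gaussUsed = 0) (hk : 1 ≤ k) (hkℓ : k ≤ ℓ) (hkm : k ≤ m) (hkn : k ≤ n)
    (hW : 8 * (m * n * ℓ) ≤ W) :
    RunW S ω randomizedSVD s W fun s' =>
      (k ≤ (A * sketchMatrix n ℓ ω.1).rank → ∃ σ V,
        IsRandomizedSVD A ℓ ω.1 (toMat m k (s'.real 12)) σ V ∧ ∀ i, 0 < σ i) ∧
      toMat m n (s'.real 15) = A - toMat m k (s'.real 12) * (toMat m k (s'.real 12))ᵀ * A ∧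
      ∀ i < m, s'.real 14 i 0 = ∑ l ∈ Finset.range n, s'.real 15 i l * s'.real 15 i l := by
  have hm1 : 1 ≤ m := hk.trans hkm
  have hn1 : 1 ≤ n := hk.trans hkn
  have hℓ1 : 1 ≤ ℓ := hk.trans hkℓ
  have hmn : 1 ≤ m * n := Nat.one_le_iff_ne_zero.2 (by positivity)
  have hmnℓ : k * (m * n) ≤ m * n * ℓ := by rw [mul_comm]; exact Nat.mul_le_mul_left _ hkℓ
  have hmn' : m * n ≤ m * n * ℓ := Nat.le_mul_of_pos_right _ hℓ1
  -- the sketch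
  refine RunW.seq (gaussMatrix_run (nn := n) (mm := ℓ) ?_ ?_ hg ?_) fun s₁ _ ⟨f₁, h₁⟩ => ?_
  · intro s' h; simp only [NExp.eval, h.nat 0 (by decide), hsn]
  · intro s' h; simp only [NExp.eval, h.nat 4 (by decide), hsℓ]
  · have : n * (ℓ + 1) ≤ m * n * (2 * ℓ) := by
      calc n * (ℓ + 1) ≤ (m * n) * (2 * ℓ) :=
        Nat.mul_le_mul (Nat.le_mul_of_pos_left _ hm1) (by omega)
      _ = _ := rfl
    nlinarith
  have n0₁ := f₁.nat 0 (by decide)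
  have n4₁ := f₁.nat 4 (by decide)
  have r0₁ := f₁.real 0 (by decide)
  refine RunW.seq (fillMat_run m ℓ n (fun _ _ => 0) (fun i j l => s.real 0 i l * s₁.real 2 l j)
    ?_ ?_ ?_ ?_ ?_ ?_) fun s₂ _ ⟨f₂, h₂⟩ => ?_
  · refine (fill_cost_le le_rfl le_rfl le_rfl hℓ1 hn1).trans ?_
    calc _ = 3 * (m * n * ℓ) := by ring
      _ ≤ W := by linarith
  · intro s' h; simp only [NExp.eval, h.nat 0 (by decide), n0₁, hsm]
  · intro s' h; simp only [NExp.eval, h.nat 4 (by decide), n4₁, hsℓ]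
  · intro s' h; simp only [NExp.eval, h.nat 0 (by decide), n0₁, hsn]
  · intros; simp only [RExp.eval, NExp.eval, Nat.cast_zero]
  · intro s' i j l h hi hj hl _ _ _
    simp only [RExp.eval, NExp.eval, hi, hj, hl, h.real 0 (by decide), h.real 2 (by decide), r0₁]
  have hY : toMat m ℓ (s₂.real 3) = A * sketchMatrix n ℓ ω.1 := by
    rw [toMat_mul h₂, hsA, h₁]
  have n0₂ := (f₂.nat 0 (by decide)).trans n0₁
  have n4₂ := (f₂.nat 4 (by decide)).trans n4₁
  have r0₂ := (f₂.real 0 (by decide)).trans r0₁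
  -- an orthonormal basis of its range
  refine RunW.seq (gramSchmidt_run (dd := m) (cc := ℓ) ?_ ?_ ?_) fun s₃ f₃ h₃ => ?_
  · intro s' h; simp only [NExp.eval, h 0 (by decide), n0₂, hsm]
  · intro s' h; simp only [NExp.eval, h 4 (by decide), n4₂, hsℓ]
  · have hr : (toMat m ℓ (s₂.real 3)).rank ≤ n := by
      rw [hY]
      exact (Matrix.rank_mul_le_left _ _).trans
        ((Matrix.rank_le_card_width A).trans_eq (Fintype.card_fin n))
    calc _ ≤ ℓ * ((n + n) * (m + 3 * m)) := by gcongr; omega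
      _ = 8 * (m * n * ℓ) := by ring
      _ ≤ W := hW
  obtain ⟨hQ1, T, hT⟩ := h₃.matrix
  have hQY := h₃.mul_mul
  have hqr := h₃.le_rank
  rw [hY] at hT hQY hqr
  have n0₃ := (f₃.nat 0 (by decide)).trans n0₂
  have r0₃ := (f₃.real 0 (by decide)).trans r0₂
  generalize hq : s₃.nat 10 0 = q at hQ1 T hT hQY hqr
  clear h₃
  have hqℓ : q ≤ ℓ := hqr.trans ((Matrix.rank_le_card_width _).trans_eq (Fintype.card_fin ℓ))
  have hqA : q ≤ A.rank := hqr.trans (Matrix.rank_mul_le_left _ _)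
  have hqm : q ≤ m := hqA.trans ((Matrix.rank_le_card_height _).trans_eq (Fintype.card_fin m))
  have hqn : q ≤ n := hqA.trans ((Matrix.rank_le_card_width _).trans_eq (Fintype.card_fin n))
  have hkq : k ≤ (A * sketchMatrix n ℓ ω.1).rank → k ≤ q := by
    intro h
    refine h.trans ?_
    rw [← hQY]
    exact (Matrix.rank_mul_le_right _ _).trans ((Matrix.rank_mul_le_left _ _).trans
      ((Matrix.rank_le_card_height _).trans_eq (Fintype.card_fin q)))
  -- the projected matrix
  refine RunW.seq (fillMat_run q n m (fun _ _ => 0) (fun i j l => s₃.real 4 i l * s.real 0 l j)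
    ?_ ?_ ?_ ?_ ?_ ?_) fun s₄ _ ⟨f₄, h₄⟩ => ?_
  · refine (fill_cost_le hqℓ le_rfl le_rfl hn1 hm1).trans ?_
    calc _ = 3 * (m * n * ℓ) := by ring
      _ ≤ W := by linarith
  · intro s' h; simp only [NExp.eval, h.nat 10 (by decide), hq]
  · intro s' h; simp only [NExp.eval, h.nat 0 (by decide), n0₃, hsn]
  · intro s' h; simp only [NExp.eval, h.nat 0 (by decide), n0₃, hsm]
  · intros; simp only [RExp.eval, NExp.eval, Nat.cast_zero]
  · intro s' i j l h hi hj hl _ _ _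
    simp only [RExp.eval, NExp.eval, hi, hj, hl, h.real 0 (by decide), h.real 4 (by decide), r0₃]
  have hB : toMat q n (s₄.real 8) = toMat q m (s₃.real 4) * A := by rw [toMat_mul h₄, hsA]
  have n0₄ := (f₄.nat 0 (by decide)).trans n0₃
  have n10₄ : s₄.nat 10 0 = q := (congrFun (f₄.nat 10 (by decide)) 0).trans hq
  have r0₄ := (f₄.real 0 (by decide)).trans r0₃
  have r4₄ := f₄.real 4 (by decide)
  refine RunW.seq (fillMat_run q q n (fun _ _ => 0) (fun i j l => s₄.real 8 i l * s₄.real 8 j l)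
    ?_ ?_ ?_ ?_ ?_ ?_) fun s₅ _ ⟨f₅, h₅⟩ => ?_
  · refine (fill_cost_le hqℓ hqm le_rfl hm1 hn1).trans ?_
    calc _ = 3 * (m * n * ℓ) := by ring
      _ ≤ W := by linarith
  · intro s' h; simp only [NExp.eval, h.nat 10 (by decide), n10₄]
  · intro s' h; simp only [NExp.eval, h.nat 10 (by decide), n10₄]
  · intro s' h; simp only [NExp.eval, h.nat 0 (by decide), n0₄, hsn]
  · intros; simp only [RExp.eval, NExp.eval, Nat.cast_zero]
  · intro s' i j l h hi hj hl _ _ _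
    simp only [RExp.eval, NExp.eval, hi, hj, hl, h.real 8 (by decide)]
  have hG : toMat q q (s₅.real 9) =
      toMat q m (s₃.real 4) * A * (toMat q m (s₃.real 4) * A)ᵀ := by
    rw [toMat_mul (g := fun l j => s₄.real 8 j l) h₅, ← hB]
    rfl
  have n0₅ := (f₅.nat 0 (by decide)).trans n0₄
  have n10₅ := (congrFun (f₅.nat 10 (by decide)) 0).trans n10₄
  have r0₅ := (f₅.real 0 (by decide)).trans r0₄
  have r4₅ := (f₅.real 4 (by decide)).trans r4₄
  -- its singular values and left singular vectors
  refine RunW.seq (run_eig (show (nvar 10).eval s₅ = q from n10₅) (by decide) ?_) fun s₆ f₆ h₆ => ?_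
  · calc q ^ 3 = q * q * q := by ring
      _ ≤ m * n * ℓ := by gcongr
      _ ≤ W := by linarith
  rw [hG] at h₆
  obtain ⟨hW1, hlam, hanti⟩ := h₆ (by
    rw [Matrix.IsSymm, Matrix.transpose_mul, Matrix.transpose_transpose])
  have n0₆ := (f₆.nat 0 (by decide)).trans n0₅
  have n10₆ := (congrFun (f₆.nat 10 (by decide)) 0).trans n10₅
  have r0₆ := (f₆.real 0 (by decide)).trans r0₅
  have r4₆ := (f₆.real 4 (by decide)).trans r4₅
  refine RunW.seq (fillMat_run m k q (fun _ _ => 0) (fun i j l => s₃.real 4 l i * s₆.real 11 l j)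
    ?_ ?_ ?_ ?_ ?_ ?_) fun s₇ _ ⟨f₇, h₇⟩ => ?_
  · refine (fill_cost_le le_rfl le_rfl hqn hk hn1).trans ?_
    calc _ = 3 * (k * (m * n)) := by ring
      _ ≤ W := by linarith
  · intro s' h; simp only [NExp.eval, h.nat 0 (by decide), n0₆, hsm]
  · intro s' h; simp only [NExp.eval, h.nat 0 (by decide), n0₆, hsk]
  · intro s' h; simp only [NExp.eval, h.nat 10 (by decide), n10₆]
  · intros; simp only [RExp.eval, NExp.eval, Nat.cast_zero]
  · intro s' i j l h hi hj hl _ _ _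
    simp only [RExp.eval, NExp.eval, hi, hj, hl, h.real 11 (by decide), h.real 4 (by decide), r4₆]
  have n0₇ := (f₇.nat 0 (by decide)).trans n0₆
  have r0₇ := (f₇.real 0 (by decide)).trans r0₆
  -- the residual
  refine RunW.seq (fillMat_run k n m (fun _ _ => 0) (fun i j l => s₇.real 12 l i * s.real 0 l j)
    ?_ ?_ ?_ ?_ ?_ ?_) fun s₈ _ ⟨f₈, h₈⟩ => ?_
  · refine (fill_cost_le le_rfl le_rfl le_rfl hn1 hm1).trans ?_
    calc _ = 3 * (k * (m * n)) := by ring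
      _ ≤ W := by linarith
  · intro s' h; simp only [NExp.eval, h.nat 0 (by decide), n0₇, hsk]
  · intro s' h; simp only [NExp.eval, h.nat 0 (by decide), n0₇, hsn]
  · intro s' h; simp only [NExp.eval, h.nat 0 (by decide), n0₇, hsm]
  · intros; simp only [RExp.eval, NExp.eval, Nat.cast_zero]
  · intro s' i j l h hi hj hl _ _ _
    simp only [RExp.eval, NExp.eval, hi, hj, hl, h.real 12 (by decide), h.real 0 (by decide), r0₇]
  have hD : toMat k n (s₈.real 13) = (toMat m k (s₇.real 12))ᵀ * A := by
    rw [toMat_mul (f := fun i l => s₇.real 12 l i) h₈, hsA]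
    rfl
  have n0₈ := (f₈.nat 0 (by decide)).trans n0₇
  have r0₈ := (f₈.real 0 (by decide)).trans r0₇
  have r12₈ := f₈.real 12 (by decide)
  refine RunW.seq (fillMat_run m n k (fun i j => s.real 0 i j)
    (fun i j l => 0 - s₇.real 12 i l * s₈.real 13 l j) ?_ ?_ ?_ ?_ ?_ ?_) fun s₉ _ ⟨f₉, h₉⟩ => ?_
  · refine (fill_cost_le le_rfl le_rfl le_rfl hn1 hk).trans ?_
    calc _ = 3 * (k * (m * n)) := by ring
      _ ≤ W := by linarith
  · intro s' h; simp only [NExp.eval, h.nat 0 (by decide), n0₈, hsm]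
  · intro s' h; simp only [NExp.eval, h.nat 0 (by decide), n0₈, hsn]
  · intro s' h; simp only [NExp.eval, h.nat 0 (by decide), n0₈, hsk]
  · intro s' i j h hi hj _ _ _
    simp only [RExp.eval, NExp.eval, hi, hj, h.real 0 (by decide), r0₈]
  · intro s' i j l h hi hj hl _ _ _
    simp only [RExp.eval, NExp.eval, hi, hj, hl, h.real 12 (by decide), h.real 13 (by decide),
      r12₈, Nat.cast_zero]
  have hX : toMat m n (s₉.real 15) =
      A - toMat m k (s₇.real 12) * (toMat m k (s₇.real 12))ᵀ * A := by
    rw [Matrix.mul_assoc, ← hD]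
    ext i j
    rw [toMat_apply, h₉ i i.2 j j.2, Matrix.sub_apply, Matrix.mul_apply, ← hsA, sub_eq_add_neg,
      ← Finset.sum_neg_distrib, Finset.sum_range]
    simp only [zero_sub, toMat_apply]
  have n0₉ := (f₉.nat 0 (by decide)).trans n0₈
  have r12₉ := (f₉.real 12 (by decide)).trans r12₈
  refine (fillMat_run m 1 n (fun _ _ => 0) (fun i _ l => s₉.real 15 i l * s₉.real 15 i l)
    ?_ ?_ ?_ ?_ ?_ ?_).mono le_rfl ?_
  · refine (fill_cost_le le_rfl le_rfl le_rfl le_rfl hn1).trans ?_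
    calc _ = 3 * (m * n) := by ring
      _ ≤ W := by linarith
  · intro s' h; simp only [NExp.eval, h.nat 0 (by decide), n0₉, hsm]
  · intro s' _; rfl
  · intro s' h; simp only [NExp.eval, h.nat 0 (by decide), n0₉, hsn]
  · intros; simp only [RExp.eval, NExp.eval, Nat.cast_zero]
  · intro s' i j l h hi hj hl _ _ _
    simp only [RExp.eval, NExp.eval, hi, hl, h.real 15 (by decide)]
  rintro s' - ⟨f, h⟩
  rw [(f.real 12 (by decide)).trans r12₉, f.real 15 (by decide)]
  refine ⟨fun hr => ?_, hX, fun i hi => by rw [h i hi 0 one_pos, zero_add]⟩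
  have hkq' := hkq hr
  obtain ⟨σ, V, hσ, hpos⟩ := exists_truncatedSVD_of_eigen hQ1 hT hQY hW1 hlam hanti hkq'
  refine ⟨σ, V, ?_, hpos⟩
  have hU : toMat m k (s₇.real 12) =
      ((toMat q m (s₃.real 4))ᵀ * toMat q q (s₆.real 11)).submatrix id (Fin.castLE hkq') := by
    rw [toMat_mul (f := fun i l => s₃.real 4 l i) h₇]
    rfl
  rw [hU]
  exact hσ

end RealRAM

/-! ### Dual set sparsification as a program -/

theorem DualSetStep.congr {N l k r τ : ℕ} {x : Fin N → Fin l → ℝ} {v : Fin N → Fin k → ℝ}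
    {M M' : Matrix (Fin k) (Fin k) ℝ} {hM : M.IsHermitian} (hM' : M'.IsHermitian) (h : M = M')
    {j j' : Fin N} {t t' : ℝ} (hj : j = j') (ht : t = t') (hs : DualSetStep x v r τ hM j t) :
    DualSetStep x v r τ hM' j' t' := by
  subst h hj ht
  exact hs

theorem dualSetMatrix_congr {N k : ℕ} (v : Fin N → Fin k → ℝ) {j j' : ℕ → Fin N} {t t' : ℕ → ℝ}
    {τ : ℕ} (hj : ∀ i < τ, j i = j' i) (ht : ∀ i < τ, t i = t' i) :
    dualSetMatrix v j t τ = dualSetMatrix v j' t' τ :=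
  Finset.sum_congr rfl fun i hi => by
    rw [hj i (Finset.mem_range.1 hi), ht i (Finset.mem_range.1 hi)]

theorem dualSetMatrix_succ {N k : ℕ} (v : Fin N → Fin k → ℝ) (j : ℕ → Fin N) (t : ℕ → ℝ) (τ : ℕ) :
    dualSetMatrix v j t (τ + 1) =
      dualSetMatrix v j t τ + t τ • Matrix.vecMulVec (v (j τ)) (v (j τ)) :=
  Finset.sum_range_succ _ _

namespace RealRAM

theorem output_congr {s s' : State} (h1 : s'.nat 1 0 = s.nat 1 0) (h2 : s'.nat 2 = s.nat 2) :
    s'.output = s.output := by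
  rw [State.output, State.output, h1, h2]

theorem output_append {s s' : State} {j : ℕ} (h1 : s'.nat 1 0 = s.nat 1 0 + 1)
    (h2 : ∀ i, s'.nat 2 i = if i = s.nat 1 0 then j else s.nat 2 i) :
    s'.output = s.output ++ [j] := by
  rw [State.output, State.output, h1, List.range_succ, List.map_append]
  congr 1
  · refine List.map_congr_left fun i hi => ?_
    rw [h2, if_neg (by have := List.mem_range.1 hi; omega)]
  · simp [h2]

theorem output_length (s : State) : s.output.length = s.nat 1 0 := by simp [State.output]

/-- In iteration `25`, the upper bounds for the inverse weights of all indices go to the array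
`26`. -/
def dualSetBounds : Cmd :=
  .seq (.eig 18 (.get 0 (.lit 2)) 19 20) <|
  .seq (.setR 21 (.lit 0) (.lit 0) (.plus (.minus (.ofNat (nvar 25))
    (.sqrt (.times (.ofNat (nvar 5)) (.ofNat (.get 0 (.lit 2)))))) (.ofNat (.lit 1)))) <|
  .seq (fillSum 22 (.lit 0) (.lit 1) (.lit 1) (.get 0 (.lit 2)) (.ofNat (.lit 0))
    (.minus (.quot (.ofNat (.lit 1)) (.minus (.get 19 (.lit 0) (nvar 22)) (rvar 21)))
      (.quot (.ofNat (.lit 1)) (.minus (.get 19 (.lit 0) (nvar 22))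
        (.minus (rvar 21) (.ofNat (.lit 1))))))) <|
  .seq (fillSum 23 (.lit 0) (nvar 0) (.get 0 (.lit 2)) (.get 0 (.lit 2)) (.ofNat (.lit 0))
    (.times (.get 20 (nvar 22) (nvar 21)) (.get 12 (nvar 20) (nvar 22)))) <|
  .seq (fillSum 24 (.lit 0) (nvar 0) (.lit 1) (.get 0 (.lit 2)) (.ofNat (.lit 0))
    (.times (.times (.quot (.ofNat (.lit 1)) (.minus (.get 19 (.lit 0) (nvar 22)) (rvar 21)))
        (.quot (.ofNat (.lit 1)) (.minus (.get 19 (.lit 0) (nvar 22)) (rvar 21))))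
      (.times (.get 23 (nvar 20) (nvar 22)) (.get 23 (nvar 20) (nvar 22))))) <|
  .seq (fillSum 25 (.lit 0) (nvar 0) (.lit 1) (.get 0 (.lit 2)) (.ofNat (.lit 0))
    (.times (.quot (.ofNat (.lit 1)) (.minus (.get 19 (.lit 0) (nvar 22)) (rvar 21)))
      (.times (.get 23 (nvar 20) (nvar 22)) (.get 23 (nvar 20) (nvar 22))))) <|
  fillSum 26 (.lit 0) (nvar 0) (.lit 1) (.lit 0)
    (.minus (.quot (.get 24 (nvar 20) (.lit 0)) (rvar 22)) (.get 25 (nvar 20) (.lit 0)))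
    (.ofNat (.lit 0))

theorem dualSetBounds_run {S : EigenSolver} {ω : Tape} {s : State} {m k r τ : ℕ}
    (hsm : s.nat 0 0 = m) (hsk : s.nat 0 2 = k) (hsr : s.nat 5 0 = r) (hsτ : s.nat 25 0 = τ)
    (hk : 1 ≤ k) (hkm : k ≤ m) :
    RunW S ω dualSetBounds s (3 * (m * k * k)) fun s' =>
      ∀ hM : (toMat k k (s.real 18)).IsHermitian,
        EigenvaluesAbove ((τ : ℝ) - √(r * k) + 1) (toMat k k (s.real 18)) →
        ∀ i : Fin m, s'.real 26 i 0 =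
          invWeightBound ((τ : ℝ) - √(r * k)) hM (toMat m k (s.real 12) i) := by
  have hm1 : 1 ≤ m := hk.trans hkm
  have hmk : m ≤ m * k := Nat.le_mul_of_pos_right _ hk
  have hkk : m * k ≤ m * k * k := Nat.le_mul_of_pos_right _ hk
  refine RunW.seq (run_eig (show (NExp.get 0 (.lit 2)).eval s = k from hsk) (by decide) ?_)
    fun s₁ f₁ h₁ => ?_
  · calc k ^ 3 = k * k * k := by ring
      _ ≤ m * k * k := by gcongr
      _ ≤ _ := by linarith
  have n0₁ := f₁.nat 0 (by decide)
  have n5₁ := f₁.nat 5 (by decide)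
  have n25₁ := f₁.nat 25 (by decide)
  have r12₁ := f₁.real 12 (by decide)
  refine RunW.seq (run_setR (w := (τ : ℝ) - √(r * k) + 1) rfl rfl ?_) fun s₂ f₂ h₂ => ?_
  · simp only [RExp.eval, NExp.eval, n0₁, n5₁, n25₁, hsk, hsr, hsτ, Nat.cast_one]
  have n0₂ := (f₂.nat 0 (by decide)).trans n0₁
  have r12₂ := (f₂.real 12 (by decide)).trans r12₁
  have r19₂ := f₂.real 19 (by decide)
  have r20₂ := f₂.real 20 (by decide)
  have r21₂ : s₂.real 21 0 0 = (τ : ℝ) - √(r * k) + 1 := by rw [h₂.1]; rfl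
  generalize hL : (τ : ℝ) - √(r * k) = L at r21₂ ⊢
  refine RunW.seq (fillMat_run 1 1 k (fun _ _ => 0) (fun _ _ l => 1 / (s₁.real 19 0 l - (L + 1)) -
    1 / (s₁.real 19 0 l - (L + 1 - 1))) (by nlinarith) ?_ ?_ ?_ ?_ ?_) fun s₃ _ ⟨f₃, h₃⟩ => ?_
  · intro s' _; rfl
  · intro s' _; rfl
  · intro s' h; simp only [NExp.eval, h.nat 0 (by decide), n0₂, hsk]
  · intros; simp only [RExp.eval, NExp.eval, Nat.cast_zero]
  · intro s' i j l h hi hj hl _ _ _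
    simp only [RExp.eval, NExp.eval, hl, h.real 19 (by decide), h.real 21 (by decide), r21₂, r19₂,
      Nat.cast_one]
  have n0₃ := (f₃.nat 0 (by decide)).trans n0₂
  have r12₃ := (f₃.real 12 (by decide)).trans r12₂
  have r19₃ := (f₃.real 19 (by decide)).trans r19₂
  have r20₃ := (f₃.real 20 (by decide)).trans r20₂
  have r21₃ := (congrFun (congrFun (f₃.real 21 (by decide)) 0) 0).trans r21₂
  refine RunW.seq (fillMat_run m k k (fun _ _ => 0) (fun i j l => s₁.real 20 l j * s.real 12 i l)
    (fill_cost_le le_rfl le_rfl le_rfl hk hk) ?_ ?_ ?_ ?_ ?_) fun s₄ _ ⟨f₄, h₄⟩ => ?_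
  · intro s' h; simp only [NExp.eval, h.nat 0 (by decide), n0₃, hsm]
  · intro s' h; simp only [NExp.eval, h.nat 0 (by decide), n0₃, hsk]
  · intro s' h; simp only [NExp.eval, h.nat 0 (by decide), n0₃, hsk]
  · intros; simp only [RExp.eval, NExp.eval, Nat.cast_zero]
  · intro s' i j l h hi hj hl _ _ _
    simp only [RExp.eval, NExp.eval, hi, hj, hl, h.real 20 (by decide), h.real 12 (by decide), r20₃,
      r12₃]
  have n0₄ := (f₄.nat 0 (by decide)).trans n0₃
  have r19₄ := (f₄.real 19 (by decide)).trans r19₃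
  have r21₄ := (congrFun (congrFun (f₄.real 21 (by decide)) 0) 0).trans r21₃
  have r22₄ := f₄.real 22 (by decide)
  have hcost : m * (1 * (k + 1) + 1) ≤ 3 * (m * k * k) := by
    refine (fill_cost_le le_rfl le_rfl le_rfl le_rfl hk).trans ?_
    rw [mul_one]
    exact Nat.mul_le_mul_left _ hkk
  refine RunW.seq (fillMat_run m 1 k (fun _ _ => 0) (fun i _ l => 1 / (s₁.real 19 0 l - (L + 1)) *
    (1 / (s₁.real 19 0 l - (L + 1))) * (s₄.real 23 i l * s₄.real 23 i l)) hcost ?_ ?_ ?_ ?_ ?_)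
    fun s₅ _ ⟨f₅, h₅⟩ => ?_
  · intro s' h; simp only [NExp.eval, h.nat 0 (by decide), n0₄, hsm]
  · intro s' _; rfl
  · intro s' h; simp only [NExp.eval, h.nat 0 (by decide), n0₄, hsk]
  · intros; simp only [RExp.eval, NExp.eval, Nat.cast_zero]
  · intro s' i j l h hi hj hl _ _ _
    simp only [RExp.eval, NExp.eval, hi, hl, h.real 19 (by decide), h.real 21 (by decide),
      h.real 23 (by decide), r21₄, r19₄, Nat.cast_one]
  have n0₅ := (f₅.nat 0 (by decide)).trans n0₄
  have r19₅ := (f₅.real 19 (by decide)).trans r19₄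
  have r21₅ := (congrFun (congrFun (f₅.real 21 (by decide)) 0) 0).trans r21₄
  have r22₅ := (f₅.real 22 (by decide)).trans r22₄
  have r23₅ := f₅.real 23 (by decide)
  refine RunW.seq (fillMat_run m 1 k (fun _ _ => 0) (fun i _ l => 1 / (s₁.real 19 0 l - (L + 1)) *
    (s₄.real 23 i l * s₄.real 23 i l)) hcost ?_ ?_ ?_ ?_ ?_) fun s₆ _ ⟨f₆, h₆⟩ => ?_
  · intro s' h; simp only [NExp.eval, h.nat 0 (by decide), n0₅, hsm]
  · intro s' _; rfl
  · intro s' h; simp only [NExp.eval, h.nat 0 (by decide), n0₅, hsk]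
  · intros; simp only [RExp.eval, NExp.eval, Nat.cast_zero]
  · intro s' i j l h hi hj hl _ _ _
    simp only [RExp.eval, NExp.eval, hi, hl, h.real 19 (by decide), h.real 21 (by decide),
      h.real 23 (by decide), r21₅, r19₅, r23₅, Nat.cast_one]
  have n0₆ := (f₆.nat 0 (by decide)).trans n0₅
  have r22₆ := (f₆.real 22 (by decide)).trans r22₅
  have r24₆ := f₆.real 24 (by decide)
  refine (fillMat_run m 1 0 (fun i _ => s₅.real 24 i 0 / s₃.real 22 0 0 - s₆.real 25 i 0)
    (fun _ _ _ => 0) (by linarith) ?_ ?_ ?_ ?_ ?_).mono le_rfl ?_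
  · intro s' h; simp only [NExp.eval, h.nat 0 (by decide), n0₆, hsm]
  · intro s' _; rfl
  · intro s' _; rfl
  · intro s' i j h hi _ _ _ _
    simp only [RExp.eval, NExp.eval, hi, h.real 22 (by decide), h.real 24 (by decide),
      h.real 25 (by decide), r22₆, r24₆]
  · intros; simp only [RExp.eval, NExp.eval, Nat.cast_zero]
  rintro s' - ⟨-, h⟩ hM habove i
  obtain ⟨hQ, heig, -⟩ := h₁ (by
    have := hM
    rwa [Matrix.IsHermitian, Matrix.conjTranspose_eq_transpose_of_trivial] at this)
  have hz : ∀ a : Fin k, ((toMat k k (s₁.real 20))ᵀ *ᵥ (toMat m k (s.real 12) i)) a =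
      s₄.real 23 i a := by
    intro a
    rw [h₄ i i.2 a a.2, zero_add, Finset.sum_range]
    rfl
  rw [(IsEigenDecomp.of_mul hQ heig).invWeightBound_eq hM habove, h i i.2 0 one_pos,
    h₃ 0 one_pos 0 one_pos, h₅ i i.2 0 one_pos, h₆ i i.2 0 one_pos]
  simp only [Finset.sum_range, hz, zero_add, Finset.sum_const_zero, add_zero, one_div,
    add_sub_cancel_right, Finset.sum_sub_distrib, sq]

/-- Search for an index whose weight may be increased; the result is the variable `14`. -/
def dualSetChoose : Cmd :=
  .seq (.setN 14 (.lit 0) (.lit 0)) <|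
  .loop 26 (nvar 0) <| .ite (.rle (.get 26 (nvar 26) (.lit 0)) (.ofNat (.lit 0))) .skip <|
    .ite (.rle (.times (rvar 17) (.get 14 (nvar 26) (.lit 0))) (.get 26 (nvar 26) (.lit 0)))
      (.setN 14 (.lit 0) (nvar 26)) .skip

theorem dualSetChoose_run {S : EigenSolver} {ω : Tape} {s : State} {m : ℕ}
    (hsm : s.nat 0 0 = m) (hm : 1 ≤ m) :
    RunW S ω dualSetChoose s m fun s' => s'.nat 14 0 < m ∧
      ((∃ i < m, 0 < s.real 26 i 0 ∧ s.real 17 0 0 * s.real 14 i 0 ≤ s.real 26 i 0) →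
        0 < s.real 26 (s'.nat 14 0) 0 ∧
          s.real 17 0 0 * s.real 14 (s'.nat 14 0) 0 ≤ s.real 26 (s'.nat 14 0) 0) := by
  refine RunW.seq (run_setN rfl rfl) fun s₁ f₁ h₁ => ?_
  have h0 : s₁.nat 14 0 = 0 := by rw [h₁.1]; rfl
  have n0₁ := f₁.nat 0 (by decide)
  refine (RunW.loop (w := 0) (n := m) (fun c s' => s'.nat 14 0 < m ∧
    ((∃ i < c, 0 < s.real 26 i 0 ∧ s.real 17 0 0 * s.real 14 i 0 ≤ s.real 26 i 0) →
      0 < s.real 26 (s'.nat 14 0) 0 ∧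
        s.real 17 0 0 * s.real 14 (s'.nat 14 0) 0 ≤ s.real 26 (s'.nat 14 0) 0)) ?_ (by omega)
    ?_ ?_).mono le_rfl fun s' _ h => h
  · simp only [NExp.eval, n0₁, hsm]
  · change s₁.nat 14 0 < m ∧ _
    refine ⟨by omega, fun ⟨i, hi, _⟩ => by omega⟩
  · rintro c hc s₂ f₂ ⟨h2, h2'⟩
    have hr : ∀ t, ((((s₂.setN 26 0 c).tick 1).tick t)).real = s.real := by
      intro t
      rw [← h₁.2]
      funext a
      exact f₂.real a (by simp [Cmd.realWrites])
    have hc' : ∀ t, ((((s₂.setN 26 0 c).tick 1).tick t)).nat 26 0 = c := fun t => rfl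
    have hn : ∀ t, ((((s₂.setN 26 0 c).tick 1).tick t)).nat 14 0 = s₂.nat 14 0 := fun t => rfl
    have hkeep : (¬(0 < s.real 26 c 0 ∧ s.real 17 0 0 * s.real 14 c 0 ≤ s.real 26 c 0)) →
        ((∃ i < c + 1, 0 < s.real 26 i 0 ∧ s.real 17 0 0 * s.real 14 i 0 ≤ s.real 26 i 0) →
        0 < s.real 26 (s₂.nat 14 0) 0 ∧
        s.real 17 0 0 * s.real 14 (s₂.nat 14 0) 0 ≤ s.real 26 (s₂.nat 14 0) 0) := by
      rintro hnot ⟨i, hi, hi'⟩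
      rcases Nat.lt_succ_iff_lt_or_eq.1 hi with hi | rfl
      · exact h2' ⟨i, hi, hi'⟩
      · exact absurd hi' hnot
    refine RunW.ite (fun ht => run_skip.mono le_rfl fun s' _ hs' => ?_) (fun ht => ?_)
    · have ht' : s.real 26 c 0 ≤ 0 := by
        have : ((s₂.setN 26 0 c).tick 1).real 26 (((s₂.setN 26 0 c).tick 1).nat 26 0) 0 ≤
          ((0 : ℕ) : ℝ) := ht
        rw [hr 0 |> fun h => (h : ((s₂.setN 26 0 c).tick 1).real = _), hc' 0 |> fun h =>
          (h : ((s₂.setN 26 0 c).tick 1).nat 26 0 = _), Nat.cast_zero] at this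
        exact this
      subst hs'
      exact ⟨h2, hkeep fun h => absurd h.1 (not_lt.2 ht')⟩
    · have ht' : 0 < s.real 26 c 0 := by
        have : ¬((s₂.setN 26 0 c).tick 1).real 26 (((s₂.setN 26 0 c).tick 1).nat 26 0) 0 ≤
          ((0 : ℕ) : ℝ) := ht
        rw [hr 0 |> fun h => (h : ((s₂.setN 26 0 c).tick 1).real = _), hc' 0 |> fun h =>
          (h : ((s₂.setN 26 0 c).tick 1).nat 26 0 = _), Nat.cast_zero, not_le] at this
        exact this
      have hiff : ∀ t, Test.holds (((s₂.setN 26 0 c).tick 1).tick t)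
          (.rle (.times (rvar 17) (.get 14 (nvar 26) (.lit 0))) (.get 26 (nvar 26) (.lit 0))) ↔
          s.real 17 0 0 * s.real 14 c 0 ≤ s.real 26 c 0 := by
        intro t
        simp only [Test.holds, RExp.eval, NExp.eval, hr t, hc' t]
      refine RunW.ite (fun ht₂ => (run_setN (w := c) rfl rfl).mono le_rfl fun s' _ hs' => ?_)
        (fun ht₂ => run_skip.mono le_rfl fun s' _ hs' => ?_)
      · have e : s'.nat 14 0 = c := by rw [hs'.1]; rfl
        rw [e]
        exact ⟨hc, fun _ => ⟨ht', (hiff _).1 ht₂⟩⟩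
      · subst hs'
        exact ⟨h2, hkeep fun h => ht₂ ((hiff _).2 h.2)⟩

/-- Append the row `14` to the output unless it is marked. -/
def appendNew : Cmd :=
  .ite (.nle (.lit 1) (.get 13 (nvar 14))) .skip <|
    .seq (.setN 13 (nvar 14) (.lit 1)) <|
    .seq (.setN 2 (nvar 1) (nvar 14)) (.setN 1 (.lit 0) (.plus (nvar 1) (.lit 1)))

theorem appendNew_run {S : EigenSolver} {ω : Tape} {s : State} {W : ℕ}
    (hmark : ∀ i, 1 ≤ s.nat 13 i ↔ i ∈ s.output) :
    RunW S ω appendNew s W fun s' => (∀ i, 1 ≤ s'.nat 13 i ↔ i ∈ s'.output) ∧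
      s'.output = if s.nat 14 0 ∈ s.output then s.output else s.output ++ [s.nat 14 0] := by
  refine RunW.ite (fun ht => run_skip.mono le_rfl fun s' _ hs' => ?_) (fun ht => ?_)
  · have ht' : s.nat 14 0 ∈ s.output := (hmark _).1 ht
    subst hs'
    rw [if_pos ht']
    exact ⟨hmark, rfl⟩
  · have ht' : s.nat 14 0 ∉ s.output := fun h => ht ((hmark _).2 h)
    refine RunW.seq (run_setN (i := s.nat 14 0) (w := 1) rfl rfl) fun s₁ f₁ h₁ => ?_
    have n1₁ : s₁.nat 1 0 = s.nat 1 0 := by rw [f₁.nat 1 (by decide)]; rfl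
    have n14₁ : s₁.nat 14 0 = s.nat 14 0 := by rw [f₁.nat 14 (by decide)]; rfl
    refine RunW.seq (run_setN (i := s.nat 1 0) (w := s.nat 14 0)
      (show (nvar 1).eval s₁ = _ from n1₁) (show (nvar 14).eval s₁ = _ from n14₁))
      fun s₂ f₂ h₂ => ?_
    have n1₂ : s₂.nat 1 0 = s.nat 1 0 := by rw [f₂.nat 1 (by decide), n1₁]
    refine (run_setN (i := 0) (w := s.nat 1 0 + 1) rfl (congrArg (· + 1) n1₂)).mono le_rfl ?_
    rintro s' f' ⟨hs', -⟩
    have hout : s'.output = s.output ++ [s.nat 14 0] := by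
      refine output_append ?_ fun i => ?_
      · rw [hs', if_pos ⟨rfl, rfl⟩]
      · rw [f'.nat 2 (by decide), h₂.1]
        by_cases hi : i = s.nat 1 0
        · rw [if_pos ⟨rfl, hi⟩, if_pos hi]
        · rw [if_neg fun h => hi h.2, if_neg hi, f₁.nat 2 (by decide)]; rfl
    rw [if_neg ht']
    refine ⟨fun i => ?_, hout⟩
    rw [hout, f'.nat 13 (by decide), f₂.nat 13 (by decide), h₁.1, List.mem_append,
      List.mem_singleton]
    by_cases hi : i = s.nat 14 0
    · simp [hi]
    · rw [if_neg fun h => hi h.2, or_iff_left hi, ← hmark]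
      rfl

/-- One iteration of dual set sparsification. -/
def dualSetIteration : Cmd :=
  .seq dualSetBounds <| .seq dualSetChoose <|
  .seq (fillSum 18 (.lit 0) (.get 0 (.lit 2)) (.get 0 (.lit 2)) (.lit 0)
    (.plus (.get 18 (nvar 20) (nvar 21)) (.times
      (.quot (.ofNat (.lit 1)) (.get 26 (nvar 14) (.lit 0)))
      (.times (.get 12 (nvar 14) (nvar 20)) (.get 12 (nvar 14) (nvar 21))))) (.ofNat (.lit 0)))
  appendNew

/-- Dual set sparsification. The indices with positive weight form the output. -/
def dualSet : Cmd :=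
  .seq (fillSum 16 (.lit 0) (.lit 1) (.lit 1) (nvar 0) (.ofNat (.lit 0))
    (.get 14 (nvar 22) (.lit 0))) <|
  .seq (.ite (.rle (rvar 16) (.ofNat (.lit 0)))
    (.setR 17 (.lit 0) (.lit 0) (.ofNat (.lit 0)))
    (.setR 17 (.lit 0) (.lit 0) (.quot (.ofNat (.lit 1)) (.quot (rvar 16)
      (.minus (.ofNat (.lit 1)) (.sqrt (.quot (.ofNat (.get 0 (.lit 2))) (.ofNat (nvar 5))))))))) <|
  .seq (fillSum 18 (.lit 0) (.get 0 (.lit 2)) (.get 0 (.lit 2)) (.lit 0) (.ofNat (.lit 0))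
    (.ofNat (.lit 0))) <|
  .loop 25 (nvar 5) dualSetIteration

/-- The state before iteration `τ` of dual set sparsification with input vectors `x` and `v`. -/
structure DualSetState {m n k : ℕ} (x : Fin m → Fin n → ℝ) (v : Fin m → Fin k → ℝ) (r τ : ℕ)
    (s : State) : Prop where
  mark : ∀ i, 1 ≤ s.nat 13 i ↔ i ∈ s.output
  nodup : s.output.Nodup
  lt : ∀ i ∈ s.output, i < m
  length : s.output.length ≤ τ
  steps : (toMat m k (s.real 12))ᵀ * toMat m k (s.real 12) = 1 → ∃ (j : ℕ → Fin m) (t : ℕ → ℝ),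
    (∀ τ' < τ, DualSetStep x v r τ' (dualSetMatrix_isHermitian v j t τ') (j τ') (t τ')) ∧
    toMat k k (s.real 18) = dualSetMatrix v j t τ ∧
    ∀ i : Fin m, (i : ℕ) ∈ s.output ↔ ∃ τ' < τ, j τ' = i

theorem dualSetIteration_run {S : EigenSolver} {ω : Tape} {s : State} {m n k r τ : ℕ}
    {x : Fin m → Fin n → ℝ}
    (hsm : s.nat 0 0 = m) (hsk : s.nat 0 2 = k) (hsr : s.nat 5 0 = r) (hsτ : s.nat 25 0 = τ)
    (hk : 1 ≤ k) (hkm : k ≤ m) (hkr : k < r)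
    (hx : ∀ i : Fin m, s.real 14 i 0 = x i ⬝ᵥ x i)
    (hδ : s.real 17 0 0 = ((∑ i, x i ⬝ᵥ x i) / (1 - √(k / r)))⁻¹)
    (h : DualSetState x (toMat m k (s.real 12)) r τ s) :
    RunW S ω dualSetIteration s (3 * (m * k * k)) fun s' =>
      DualSetState x (toMat m k (s.real 12)) r (τ + 1) s' := by
  have hm1 : 1 ≤ m := hk.trans hkm
  have hmk : m ≤ m * k := Nat.le_mul_of_pos_right _ hk
  have hkk : m * k ≤ m * k * k := Nat.le_mul_of_pos_right _ hk
  refine RunW.seq (dualSetBounds_run hsm hsk hsr hsτ hk hkm) fun s₁ f₁ h₁ => ?_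
  have n0₁ := f₁.nat 0 (by decide)
  have r12₁ := f₁.real 12 (by decide)
  have r14₁ := f₁.real 14 (by decide)
  have r17₁ := f₁.real 17 (by decide)
  have r18₁ := f₁.real 18 (by decide)
  refine RunW.seq ((dualSetChoose_run (m := m) (by rw [n0₁, hsm]) hm1).mono (by linarith)
    fun _ _ h => h) fun s₂ f₂ h₂ => ?_
  rw [r14₁, r17₁] at h₂
  generalize hJ : s₂.nat 14 0 = J at h₂
  obtain ⟨hJm, hJ'⟩ := h₂
  have n0₂ := (f₂.nat 0 (by decide)).trans n0₁
  have r12₂ := (f₂.real 12 (by decide)).trans r12₁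
  have r18₂ := (f₂.real 18 (by decide)).trans r18₁
  have r26₂ := f₂.real 26 (by decide)
  refine RunW.seq (fillMat_run k k 0 (fun a b => s.real 18 a b + 1 / s₁.real 26 J 0 *
    (s.real 12 J a * s.real 12 J b)) (fun _ _ _ => 0) ?_ ?_ ?_ ?_ ?_ ?_) fun s₃ _ ⟨f₃, h₃⟩ => ?_
  · have : k * k ≤ m * k := Nat.mul_le_mul_right _ hkm
    nlinarith
  · intro s' h; simp only [NExp.eval, h.nat 0 (by decide), n0₂, hsk]
  · intro s' h; simp only [NExp.eval, h.nat 0 (by decide), n0₂, hsk]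
  · intro s' _; rfl
  · intro s' i j h hi hj _ _ he
    rw [r18₂] at he
    simp only [RExp.eval, NExp.eval, hi, hj, h.real 12 (by decide), h.real 26 (by decide),
      h.nat 14 (by decide), r12₂, r26₂, hJ, he, Nat.cast_one]
  · intros; simp only [RExp.eval, NExp.eval, Nat.cast_zero]
  have hout₃ : s₃.output = s.output :=
    output_congr (by rw [f₃.nat 1 (by decide), f₂.nat 1 (by decide), f₁.nat 1 (by decide)])
      (by rw [f₃.nat 2 (by decide), f₂.nat 2 (by decide), f₁.nat 2 (by decide)])
  have n14₃ : s₃.nat 14 0 = J := by rw [f₃.nat 14 (by decide), hJ]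
  refine (appendNew_run (W := 3 * (m * k * k)) fun i => ?_).mono le_rfl ?_
  · rw [hout₃, f₃.nat 13 (by decide), f₂.nat 13 (by decide), f₁.nat 13 (by decide)]
    exact h.mark i
  rintro s' f' ⟨hmark, hout⟩
  rw [hout₃, n14₃] at hout
  have r12' : s'.real 12 = s.real 12 := by
    rw [f'.real 12 (by decide), f₃.real 12 (by decide), r12₂]
  have r18' := f'.real 18 (by decide)
  have hmem : ∀ i, i ∈ s'.output ↔ i ∈ s.output ∨ i = J := by
    intro i
    rw [hout]
    split_ifs with hin
    · exact ⟨Or.inl, fun h => h.elim id fun h => h ▸ hin⟩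
    · rw [List.mem_append, List.mem_singleton]
  refine ⟨hmark, ?_, fun i hi => ?_, ?_, fun hU => ?_⟩
  · rw [hout]
    split_ifs with hin
    · exact h.nodup
    · exact List.nodup_append.2 ⟨h.nodup, List.nodup_singleton _, fun a ha b hb => by
        rw [List.mem_singleton.1 hb]; exact fun hab => hin (hab ▸ ha)⟩
  · rcases (hmem i).1 hi with hi | hi
    · exact h.lt i hi
    · omega
  · rw [hout]
    have := h.length
    split_ifs
    · omega
    · simp; omega
  · rw [r12'] at hU
    obtain ⟨j, t, hsteps, hM, hjl⟩ := h.steps hU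
    have hinv := dualSetInvariant_of_steps hk hkr τ hsteps
    have hherm : (toMat k k (s.real 18)).IsHermitian := by
      rw [hM]; exact dualSetMatrix_isHermitian _ _ _ _
    have hinv' : DualSetInvariant r τ hherm := by
      generalize dualSetMatrix_isHermitian (toMat m k (s.real 12)) j t τ = hD at hinv
      revert hinv hD
      rw [← hM]
      exact fun _ h => h
    have hb := h₁ hherm (hinv'.above_succ hkr)
    obtain ⟨i₀, hi₀, hi₀'⟩ := hinv'.exists_index hk hkr hU x
    have hgood := hJ' ⟨i₀, i₀.2, by rw [hb]; exact hi₀, by rw [hδ, hx, hb]; exact hi₀'⟩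
    have hbJ := hb ⟨J, hJm⟩
    have hxJ := hx ⟨J, hJm⟩
    simp only at hbJ hxJ
    set j' := Function.update j τ (⟨J, hJm⟩ : Fin m) with hj'
    set t' := Function.update t τ (1 / s₁.real 26 J 0) with ht'
    have ej : ∀ i < τ, j i = j' i := fun i hi => by
      rw [hj', Function.update_of_ne (by omega)]
    have et : ∀ i < τ, t i = t' i := fun i hi => by
      rw [ht', Function.update_of_ne (by omega)]
    refine ⟨j', t', fun τ' hτ' => ?_, ?_, fun i => ?_⟩
    · rcases Nat.lt_succ_iff_lt_or_eq.1 hτ' with hlt | rfl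
      · exact (hsteps τ' hlt).congr _ (dualSetMatrix_congr _ (fun i hi => ej i (hi.trans hlt))
          fun i hi => et i (hi.trans hlt)) (ej τ' hlt) (et τ' hlt)
      · have : DualSetStep x (toMat m k (s.real 12)) r τ' hherm ⟨J, hJm⟩ (1 / s₁.real 26 J 0) := by
          refine ⟨one_div_pos.2 hgood.1, ?_, ?_⟩
          · rw [one_div, inv_inv, ← hδ, ← hxJ]; exact hgood.2
          · rw [one_div, inv_inv, ← hbJ]
        refine this.congr _ (hM.trans (dualSetMatrix_congr _ ej et)) ?_ ?_
        · rw [hj', Function.update_self]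
        · rw [ht', Function.update_self]
    · refine Eq.trans ?_ (dualSetMatrix_succ _ _ _ _).symm
      refine Eq.trans ?_ (congrArg (· + _) (hM.trans (dualSetMatrix_congr _ ej et)))
      rw [r18']
      ext a b
      rw [toMat_apply, h₃ a a.2 b b.2, hj', ht', Function.update_self, Function.update_self]
      simp [Matrix.vecMulVec_apply, toMat_apply]
    · rw [hmem, hjl]
      constructor
      · rintro (⟨τ', hτ', he⟩ | he)
        · exact ⟨τ', by omega, by rw [← ej τ' hτ', he]⟩
        · exact ⟨τ, by omega, by rw [hj', Function.update_self]; exact Fin.ext he.symm⟩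
      · rintro ⟨τ', hτ', he⟩
        rcases Nat.lt_succ_iff_lt_or_eq.1 hτ' with hlt | rfl
        · exact Or.inl ⟨τ', hlt, by rw [ej τ' hlt, he]⟩
        · rw [hj', Function.update_self] at he
          exact Or.inr (congrArg Fin.val he).symm

/-- The rows chosen by `dualSet` are distinct and at most `r` in number. The weights certify them as
long as array `12` holds a matrix with orthonormal columns; the bounds on the output and on the time
do not need this. -/
theorem dualSet_run {S : EigenSolver} {ω : Tape} {s : State} {m n k r W : ℕ}
    {x : Fin m → Fin n → ℝ}
    (hsm : s.nat 0 0 = m) (hsk : s.nat 0 2 = k) (hsr : s.nat 5 0 = r)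
    (hs13 : ∀ i, s.nat 13 i = 0) (hs1 : s.nat 1 0 = 0)
    (hk : 1 ≤ k) (hkm : k ≤ m) (hkr : k < r)
    (hx : ∀ i : Fin m, s.real 14 i 0 = x i ⬝ᵥ x i)
    (hW : 4 * (r * (m * k * k)) ≤ W) :
    RunW S ω dualSet s W fun s' => s'.output.Nodup ∧ (∀ i ∈ s'.output, i < m) ∧
      s'.output.length ≤ r ∧
      ((toMat m k (s.real 12))ᵀ * toMat m k (s.real 12) = 1 → ∃ w : Fin m → ℝ,
        IsDualSetOutput x (toMat m k (s.real 12)) r w ∧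
        ∀ i : Fin m, (i : ℕ) ∈ s'.output ↔ w i ≠ 0) := by
  have hm1 : 1 ≤ m := hk.trans hkm
  have hr1 : 1 ≤ r := by omega
  have hmkk : 1 ≤ m * k * k := Nat.one_le_iff_ne_zero.2 (by positivity)
  have hrm : m * k * k ≤ r * (m * k * k) := Nat.le_mul_of_pos_left _ hr1
  have hmk : m ≤ m * k := Nat.le_mul_of_pos_right _ hk
  have hkk : m * k ≤ m * k * k := Nat.le_mul_of_pos_right _ hk
  have hc : √((k : ℝ) / r) < 1 := sqrt_div_lt_one hkr
  refine RunW.seq (fillMat_run 1 1 m (fun _ _ => 0) (fun _ _ l => s.real 14 l 0)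
    (by nlinarith) ?_ ?_ ?_ ?_ ?_) fun s₁ _ ⟨f₁, h₁⟩ => ?_
  · intro s' _; rfl
  · intro s' _; rfl
  · intro s' h; simp only [NExp.eval, h.nat 0 (by decide), hsm]
  · intros; simp only [RExp.eval, NExp.eval, Nat.cast_zero]
  · intro s' i j l h hi hj hl _ _ _
    simp only [RExp.eval, NExp.eval, hl, h.real 14 (by decide)]
  have hsum : s₁.real 16 0 0 = ∑ i, x i ⬝ᵥ x i := by
    rw [h₁ 0 one_pos 0 one_pos, zero_add, Finset.sum_range]
    exact Finset.sum_congr rfl fun i _ => hx i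
  have n0₁ := f₁.nat 0 (by decide)
  have n5₁ := f₁.nat 5 (by decide)
  refine RunW.seq (RunW.ite (Q := fun s' =>
      s'.real 17 0 0 = ((∑ i, x i ⬝ᵥ x i) / (1 - √(k / r)))⁻¹)
      (fun ht => (run_setR (w := 0) rfl rfl Nat.cast_zero).mono le_rfl fun s' _ hs' => ?_)
      (fun ht => (run_setR (w := ((∑ i, x i ⬝ᵥ x i) / (1 - √(k / r)))⁻¹) rfl rfl ?_).mono le_rfl
        fun s' _ hs' => ?_)) fun s₂ f₂ h₂ => ?_
  · have ht : s₁.real 16 0 0 ≤ ((0 : ℕ) : ℝ) := ht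
    rw [hsum, Nat.cast_zero] at ht
    have h0 : ∑ i, x i ⬝ᵥ x i = 0 := le_antisymm ht (Finset.sum_nonneg fun i _ =>
      Finset.sum_nonneg fun _ _ => mul_self_nonneg _)
    rw [hs'.1, if_pos ⟨rfl, rfl, rfl⟩, h0, zero_div, inv_zero]
  · change ((1 : ℕ) : ℝ) / (s₁.real 16 0 0 / (((1 : ℕ) : ℝ) -
      √((s₁.nat 0 2 : ℝ) / (s₁.nat 5 0 : ℝ)))) = _
    rw [hsum, n0₁, n5₁, hsk, hsr, Nat.cast_one, one_div]
  · rw [hs'.1, if_pos ⟨rfl, rfl, rfl⟩]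
  have n0₂ := (f₂.nat 0 (by decide)).trans n0₁
  refine RunW.seq (fillMat_run k k 0 (fun _ _ => 0) (fun _ _ _ => 0) ?_ ?_ ?_ ?_ ?_ ?_)
    fun s₃ _ ⟨f₃, h₃⟩ => ?_
  · have : k * k ≤ m * k := Nat.mul_le_mul_right _ hkm
    nlinarith
  · intro s' h; simp only [NExp.eval, h.nat 0 (by decide), n0₂, hsk]
  · intro s' h; simp only [NExp.eval, h.nat 0 (by decide), n0₂, hsk]
  · intro s' _; rfl
  · intros; simp only [RExp.eval, NExp.eval, Nat.cast_zero]
  · intros; simp only [RExp.eval, NExp.eval, Nat.cast_zero]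
  have n0₃ := (f₃.nat 0 (by decide)).trans n0₂
  have n5₃ : s₃.nat 5 0 = r := by rw [f₃.nat 5 (by decide), f₂.nat 5 (by decide), n5₁, hsr]
  have r12₃ : s₃.real 12 = s.real 12 := by
    rw [f₃.real 12 (by decide), f₂.real 12 (by decide), f₁.real 12 (by decide)]
  have r14₃ : s₃.real 14 = s.real 14 := by
    rw [f₃.real 14 (by decide), f₂.real 14 (by decide), f₁.real 14 (by decide)]
  have r17₃ : s₃.real 17 0 0 = ((∑ i, x i ⬝ᵥ x i) / (1 - √(k / r)))⁻¹ := by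
    rw [f₃.real 17 (by decide), h₂]
  have hout₃ : s₃.output = [] := by
    have : s₃.nat 1 0 = 0 := by
      rw [f₃.nat 1 (by decide), f₂.nat 1 (by decide), f₁.nat 1 (by decide), hs1]
    rw [State.output, this]; rfl
  refine (RunW.loop (w := 3 * (m * k * k)) (n := r)
    (fun τ s' => DualSetState x (toMat m k (s.real 12)) r τ s' ∧ s'.real 12 = s.real 12)
    (show (nvar 5).eval s₃ = r from n5₃) ?_ ?_ ?_).mono le_rfl ?_
  · calc r * (3 * (m * k * k) + 1) ≤ r * (4 * (m * k * k)) := Nat.mul_le_mul_left _ (by omega)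
      _ = 4 * (r * (m * k * k)) := by ring
      _ ≤ W := hW
  · have hout₃' : (s₃.tick ((nvar 5).cost + 1)).output = [] := hout₃
    refine ⟨⟨fun i => ?_, ?_, ?_, ?_, fun _ => ⟨fun _ => ⟨0, hm1⟩, fun _ => 0, fun τ' h => by omega,
      ?_, fun i => ?_⟩⟩, r12₃⟩
    · rw [hout₃']
      change 1 ≤ s₃.nat 13 i ↔ _
      rw [f₃.nat 13 (by decide), f₂.nat 13 (by decide), f₁.nat 13 (by decide), hs13]
      simp
    · rw [hout₃']; exact List.nodup_nil
    · rw [hout₃']; simp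
    · rw [hout₃']; simp
    · change toMat k k (s₃.real 18) = _
      ext a b
      rw [toMat_apply, h₃ a a.2 b b.2]
      simp [dualSetMatrix]
    · rw [hout₃']; simp
  · rintro τ hτ s₄ f₄ ⟨h₄, hr₄⟩
    have n0₄ : s₄.nat 0 = s.nat 0 := by rw [f₄.nat 0 (by decide), n0₃]
    have hr₄' : ((s₄.setN 25 0 τ).tick 1).real 12 = s.real 12 := hr₄
    rw [← hr₄'] at h₄ ⊢
    refine (dualSetIteration_run (k := k) (x := x) (τ := τ) ?_ ?_ ?_ rfl hk hkm hkr ?_ ?_ ?_).mono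
      le_rfl fun s' f' h' => ⟨h', f'.real 12 (by decide)⟩
    · change s₄.nat 0 0 = m
      rw [n0₄, hsm]
    · change s₄.nat 0 2 = k
      rw [n0₄, hsk]
    · change s₄.nat 5 0 = r
      rw [f₄.nat 5 (by decide), n5₃]
    · intro i
      change s₄.real 14 i 0 = _
      rw [f₄.real 14 (by decide), r14₃, hx]
    · change s₄.real 17 0 0 = _
      rw [f₄.real 17 (by decide), r17₃]
    · exact ⟨h₄.mark, h₄.nodup, h₄.lt, h₄.length, h₄.steps⟩
  · rintro s' - ⟨h, hr⟩
    refine ⟨h.nodup, h.lt, h.length, fun hU => ?_⟩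
    obtain ⟨j, t, hsteps, -, hjl⟩ := h.steps (by rw [hr]; exact hU)
    refine ⟨_, ⟨hkr, j, t, hsteps, fun i => rfl⟩, fun i => ?_⟩
    have hcoef : (1 - √((k : ℝ) / r)) / r ≠ 0 := by
      have : (0 : ℝ) < r := by exact_mod_cast hr1
      have : 0 < (1 - √((k : ℝ) / r)) / r := div_pos (by linarith) this
      exact this.ne'
    have hnn : ∀ τ ∈ Finset.range r, 0 ≤ if j τ = i then t τ else 0 := by
      intro τ hτ
      split_ifs
      · exact (hsteps τ (Finset.mem_range.1 hτ)).1.le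
      · exact le_rfl
    rw [hjl, ne_eq, mul_eq_zero, or_iff_right hcoef, Finset.sum_eq_zero_iff_of_nonneg hnn]
    push Not
    constructor
    · rintro ⟨τ, hτ, he⟩
      exact ⟨τ, Finset.mem_range.2 hτ, by rw [if_pos he]; exact (hsteps τ hτ).1.ne'⟩
    · rintro ⟨τ, hτ, he⟩
      refine ⟨τ, Finset.mem_range.1 hτ, ?_⟩
      by_contra hne
      exact he (if_neg hne)

end RealRAM

/-! ### Adaptive sampling as a program -/

/-- The projection onto the row space of `R` from an orthonormal basis of this space. -/
theorem pinv_mul_self_eq {p n q : ℕ} {R : Matrix (Fin p) (Fin n) ℝ} {Q : Matrix (Fin q) (Fin n) ℝ}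
    {T : Matrix (Fin q) (Fin p) ℝ} (hT : Q = T * (Rᵀ)ᵀ) (hZ : Qᵀ * (Q * Rᵀ) = Rᵀ) :
    pinv R * R = Qᵀ * Q := by
  have h1 : Qᵀ * Q = Rᵀ * pinv Rᵀ := by
    refine eq_mul_pinv_of_proj (T := Tᵀ * Q) ?_ ?_ ?_
    · rw [Matrix.transpose_mul, Matrix.transpose_transpose]
    · rw [Matrix.mul_assoc, hZ]
    · conv_lhs => rw [hT, Matrix.transpose_mul, Matrix.transpose_transpose, ← hT]
      rw [Matrix.mul_assoc]
  have h2 : pinv R * R = Rᵀ * pinv Rᵀ := by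
    refine eq_mul_pinv_of_proj (T := (pinv R)ᵀ) (pinv_mul_self_symm R) ?_ ?_
    · calc pinv R * R * Rᵀ = (pinv R * R)ᵀ * Rᵀ := by rw [pinv_mul_self_symm]
        _ = (R * pinv R * R)ᵀ := by rw [← Matrix.transpose_mul, Matrix.mul_assoc]
        _ = Rᵀ := by rw [(pinv_spec R).mul_mul_self]
    · rw [← Matrix.transpose_mul, pinv_mul_self_symm]
  rw [h1, h2]

theorem sum_Iio_fin {m : ℕ} (f : ℕ → ℝ) (a : Fin m) :
    ∑ i ∈ Finset.Iio a, f i = ∑ l ∈ Finset.range a, f l := by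
  rw [← Nat.Iio_eq_range, ← Fin.map_valEmbedding_Iio, Finset.sum_map]
  rfl

theorem sum_Iic_fin {m : ℕ} (f : ℕ → ℝ) (a : Fin m) :
    ∑ i ∈ Finset.Iic a, f i = ∑ l ∈ Finset.range (a + 1), f l := by
  have : Finset.range ((a : ℕ) + 1) = Finset.Iic (a : ℕ) := by ext; simp
  rw [this, ← Fin.map_valEmbedding_Iic, Finset.sum_map]
  rfl

namespace RealRAM

/-- Binary search in the sorted row `0` of the array `30` for the number in entry `(0, 1)` of the
array `31`. -/
def bisect : Cmd :=
  .seq (.setN 15 (.lit 0) (.lit 0)) <| .seq (.setN 16 (.lit 0) (nvar 0)) <|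
  .loop 28 (nvar 7) <| .seq (.setN 17 (.lit 0) (.half (.plus (nvar 15) (nvar 16)))) <|
    .ite (.rle (.get 30 (.lit 0) (nvar 17)) (.get 31 (.lit 0) (.lit 1)))
      (.setN 15 (.lit 0) (nvar 17)) (.setN 16 (.lit 0) (nvar 17))

/-- The bisection ends at an index between whose cumulative weights `x` lies. Only the lower bound
holds without the assumption that `x` is less than the total weight. -/
theorem bisect_run {S : EigenSolver} {ω : Tape} {s : State} {m T : ℕ} {x : ℝ}
    (hsm : s.nat 0 0 = m) (hsT : s.nat 7 0 = T) (hx : s.real 31 0 1 = x) (hm : 1 ≤ m)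
    (hT : m ≤ 2 ^ T) (h0 : s.real 30 0 0 ≤ x) :
    RunW S ω bisect s T fun s' => s'.nat 15 0 < m ∧ s.real 30 0 (s'.nat 15 0) ≤ x ∧
      (x < s.real 30 0 m → x < s.real 30 0 (s'.nat 15 0 + 1)) := by
  refine RunW.seq (run_setN (i := 0) (w := 0) rfl rfl) fun s₁ f₁ h₁ => ?_
  have n0₁ : s₁.nat 0 0 = m := by rw [f₁.nat 0 (by decide), hsm]
  refine RunW.seq (run_setN (i := 0) (w := m) rfl (show (nvar 0).eval s₁ = m from n0₁))
    fun s₂ f₂ h₂ => ?_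
  have n15₂ : s₂.nat 15 0 = 0 := by rw [f₂.nat 15 (by decide), h₁.1]; rfl
  have n16₂ : s₂.nat 16 0 = m := by rw [h₂.1]; rfl
  have n7₂ : s₂.nat 7 0 = T := by rw [f₂.nat 7 (by decide), f₁.nat 7 (by decide), hsT]
  have r₂ : s₂.real = s.real := by rw [h₂.2, h₁.2]
  refine (RunW.loop (w := 0) (n := T) (fun i s' => s'.nat 15 0 < s'.nat 16 0 ∧ s'.nat 16 0 ≤ m ∧
    s'.nat 16 0 ≤ s'.nat 15 0 + 2 ^ (T - i) ∧ s.real 30 0 (s'.nat 15 0) ≤ x ∧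
    (x < s.real 30 0 m → x < s.real 30 0 (s'.nat 16 0))) (show (nvar 7).eval s₂ = T from n7₂)
    (by omega) ?_ ?_).mono le_rfl ?_
  · change s₂.nat 15 0 < s₂.nat 16 0 ∧ s₂.nat 16 0 ≤ m ∧ s₂.nat 16 0 ≤ s₂.nat 15 0 + 2 ^ (T - 0) ∧
      s.real 30 0 (s₂.nat 15 0) ≤ x ∧ (x < s.real 30 0 m → x < s.real 30 0 (s₂.nat 16 0))
    rw [n15₂, n16₂]
    exact ⟨hm, le_rfl, by simpa using hT, h0, id⟩
  · rintro i hi s₃ f₃ ⟨ha, hb, hc, hd, he⟩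
    have r₃ : s₃.real = s.real := by
      rw [← r₂]; funext a; exact f₃.real a (by simp [Cmd.realWrites])
    have hpow : 2 ^ (T - i) = 2 * 2 ^ (T - (i + 1)) := by
      rw [← pow_succ']; congr 1; omega
    rw [hpow] at hc
    have hpos : 1 ≤ 2 ^ (T - (i + 1)) := Nat.one_le_two_pow
    generalize hlo : s₃.nat 15 0 = lo at ha hb hc hd he
    generalize hhi : s₃.nat 16 0 = hi' at ha hb hc hd he
    refine RunW.seq (run_setN (i := 0) (w := (lo + hi') / 2) rfl ?_) fun s₄ f₄ h₄ => ?_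
    · change (s₃.nat 15 0 + s₃.nat 16 0) / 2 = _
      rw [hlo, hhi]
    have n15₄ : s₄.nat 15 0 = lo := by rw [f₄.nat 15 (by decide)]; exact hlo
    have n16₄ : s₄.nat 16 0 = hi' := by rw [f₄.nat 16 (by decide)]; exact hhi
    have n17₄ : s₄.nat 17 0 = (lo + hi') / 2 := by rw [h₄.1]; rfl
    have hiff : Test.holds s₄ (.rle (.get 30 (.lit 0) (nvar 17)) (.get 31 (.lit 0) (.lit 1))) ↔
        s.real 30 0 ((lo + hi') / 2) ≤ x := by
      have : s₄.real = s.real := h₄.2.trans r₃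
      simp only [Test.holds, RExp.eval, NExp.eval, this, n17₄, hx]
    refine RunW.ite
      (fun ht => (run_setN (s := s₄.tick _) (a := 15) (e := .lit 0) (v := nvar 17) (i := 0)
        (w := (lo + hi') / 2) rfl n17₄).mono le_rfl fun s' f' hs' => ?_)
      (fun ht => (run_setN (s := s₄.tick _) (a := 16) (e := .lit 0) (v := nvar 17) (i := 0)
        (w := (lo + hi') / 2) rfl n17₄).mono le_rfl fun s' f' hs' => ?_)
    · have e15 : s'.nat 15 0 = (lo + hi') / 2 := by rw [hs'.1]; rfl
      have e16 : s'.nat 16 0 = hi' := by rw [f'.nat 16 (by decide)]; exact n16₄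
      rw [e15, e16]
      exact ⟨by omega, hb, by omega, hiff.1 ht, he⟩
    · have e16 : s'.nat 16 0 = (lo + hi') / 2 := by rw [hs'.1]; rfl
      have e15 : s'.nat 15 0 = lo := by rw [f'.nat 15 (by decide)]; exact n15₄
      rw [e15, e16]
      have ht' : x < s.real 30 0 ((lo + hi') / 2) := not_le.1 fun h => ht (hiff.2 h)
      refine ⟨?_, by omega, by omega, hd, fun _ => ht'⟩
      by_contra hcon
      have : (lo + hi') / 2 = lo := by omega
      rw [this] at ht'
      exact absurd hd (not_le.2 ht')
  · rintro s' - ⟨ha, hb, hc, hd, he⟩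
    rw [Nat.sub_self, pow_zero] at hc
    have : s'.nat 16 0 = s'.nat 15 0 + 1 := by omega
    rw [this] at he
    exact ⟨by omega, hd, he⟩

/-- Draw one row. -/
def sampleRow : Cmd :=
  .seq (.unif 31 (.lit 0) (.lit 0)) <|
  .seq (.setR 31 (.lit 0) (.lit 1) (.times (rvar 31) (.get 30 (.lit 0) (nvar 0)))) <|
  .seq bisect <|
  .seq (.setN 2 (nvar 1) (nvar 15)) (.setN 1 (.lit 0) (.plus (nvar 1) (.lit 1)))

theorem sampleRow_run {S : EigenSolver} {ω : Tape} {s : State} {m T : ℕ}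
    (hsm : s.nat 0 0 = m) (hsT : s.nat 7 0 = T) (hm : 1 ≤ m) (hT : m ≤ 2 ^ T)
    (h0 : s.real 30 0 0 = 0) (hpos : 0 ≤ s.real 30 0 m) :
    RunW S ω sampleRow s T fun s' => s'.unifUsed = s.unifUsed + 1 ∧ ∃ j : Fin m,
      s'.output = s.output ++ [(j : ℕ)] ∧
      s.real 30 0 j ≤ ω.2 s.unifUsed * s.real 30 0 m ∧
      (ω.2 s.unifUsed * s.real 30 0 m < s.real 30 0 m →
        ω.2 s.unifUsed * s.real 30 0 m < s.real 30 0 (j + 1)) := by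
  refine RunW.seq (run_unif (i := 0) (j := 0) rfl rfl) fun s₁ f₁ h₁ => ?_
  have n0₁ : s₁.nat 0 0 = m := by rw [f₁.nat 0 (by decide), hsm]
  have r30₁ := f₁.real 30 (by decide)
  have r31₁ : s₁.real 31 0 0 = ω.2 s.unifUsed := by rw [h₁.1]; rfl
  refine RunW.seq (run_setR (i := 0) (j := 1) (w := ω.2 s.unifUsed * s.real 30 0 m) rfl rfl ?_)
    fun s₂ f₂ h₂ => ?_
  · simp only [RExp.eval, NExp.eval, n0₁, r30₁, r31₁]
  have r30₂ := (f₂.real 30 (by decide)).trans r30₁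
  have r31₂ : s₂.real 31 0 1 = ω.2 s.unifUsed * s.real 30 0 m := by rw [h₂.1]; rfl
  refine RunW.seq (bisect_run (m := m) (by rw [f₂.nat 0 (by decide), n0₁])
    (by rw [f₂.nat 7 (by decide), f₁.nat 7 (by decide), hsT]) r31₂ hm hT ?_) fun s₃ f₃ h₃ => ?_
  · rw [r30₂, h0]
    exact mul_nonneg (ω.2 _).2.1 hpos
  rw [r30₂] at h₃
  have n1₃ : s₃.nat 1 0 = s.nat 1 0 := by
    rw [f₃.nat 1 (by decide), f₂.nat 1 (by decide), f₁.nat 1 (by decide)]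
  refine RunW.seq (run_setN (show (nvar 1).eval s₃ = s.nat 1 0 from n1₃) rfl) fun s₄ f₄ h₄ => ?_
  have n1₄ : s₄.nat 1 0 = s.nat 1 0 := by rw [f₄.nat 1 (by decide), n1₃]
  refine (run_setN (i := 0) (w := s.nat 1 0 + 1) rfl (congrArg (· + 1) n1₄)).mono le_rfl ?_
  rintro s' f' ⟨hs', -⟩
  refine ⟨?_, ⟨s₃.nat 15 0, h₃.1⟩, output_append ?_ fun i => ?_, h₃.2⟩
  · rw [f'.unif rfl, f₄.unif rfl, f₃.unif rfl, f₂.unif rfl, h₁.2]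
  · rw [hs', if_pos ⟨rfl, rfl⟩]
  · rw [f'.nat 2 (by decide), h₄.1]
    by_cases hi : i = s.nat 1 0
    · rw [if_pos ⟨rfl, hi⟩, if_pos hi]; rfl
    · rw [if_neg fun h => hi h.2, if_neg hi, f₃.nat 2 (by decide), f₂.nat 2 (by decide),
        f₁.nat 2 (by decide)]

/-- Adaptive sampling of rows in addition to the rows in the output. -/
def adaptiveSampling : Cmd :=
  .seq (fillSum 3 (.lit 0) (.get 0 (.lit 1)) (nvar 1) (.lit 0)
    (.get 0 (.get 2 (nvar 21)) (nvar 20)) (.ofNat (.lit 0))) <|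
  .seq (gramSchmidt (.get 0 (.lit 1)) (nvar 1)) <|
  .seq (fillSum 27 (.lit 0) (nvar 0) (nvar 10) (.get 0 (.lit 1)) (.ofNat (.lit 0))
    (.times (.get 0 (nvar 20) (nvar 22)) (.get 4 (nvar 21) (nvar 22)))) <|
  .seq (fillSum 28 (.lit 0) (nvar 0) (.get 0 (.lit 1)) (nvar 10)
    (.get 0 (nvar 20) (nvar 21)) (.minus (.ofNat (.lit 0))
      (.times (.get 27 (nvar 20) (nvar 22)) (.get 4 (nvar 22) (nvar 21))))) <|
  .seq (fillSum 29 (.lit 0) (nvar 0) (.lit 1) (.get 0 (.lit 1)) (.ofNat (.lit 0))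
    (.times (.get 28 (nvar 20) (nvar 22)) (.get 28 (nvar 20) (nvar 22)))) <|
  .seq (.setR 30 (.lit 0) (.lit 0) (.ofNat (.lit 0))) <|
  .seq (.loop 20 (nvar 0) (.setR 30 (.lit 0) (.plus (nvar 20) (.lit 1))
    (.plus (.get 30 (.lit 0) (nvar 20)) (.get 29 (nvar 20) (.lit 0))))) <|
  .loop 27 (nvar 6) sampleRow

set_option maxHeartbeats 1000000 in
/-- The drawn rows form an adaptive sample unless some uniform number equals `1`, which is a null
event. -/
theorem adaptiveSampling_run {S : EigenSolver} {ω : Tape} {s : State} {m n r₁ r₂ T W : ℕ}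
    {A : Matrix (Fin m) (Fin n) ℝ} (hsm : s.nat 0 0 = m) (hsn : s.nat 0 1 = n)
    (hsr : s.nat 6 0 = r₂) (hsT : s.nat 7 0 = T) (hsA : toMat m n (s.real 0) = A)
    (hu : s.unifUsed = 0) (hm : 1 ≤ m) (hn : 1 ≤ n) (hr : 1 ≤ r₁) (hT : m ≤ 2 ^ T)
    (hlen : s.output.length ≤ r₁) (hlt : ∀ i ∈ s.output, i < m)
    (hW : 8 * (m * n * r₁) ≤ W) (hW' : r₂ * (T + 1) ≤ W) :
    RunW S ω adaptiveSampling s W fun s' => ∃ l : List (Fin m), l.length = r₂ ∧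
      s'.output = s.output ++ l.map Fin.val ∧ ((∀ t, (ω.2 t : ℝ) < 1) →
        IsAdaptiveSample A (selectRows A s.output) (fun t => (ω.2 t : ℝ)) l) := by
  have hmn : m * n ≤ m * n * r₁ := Nat.le_mul_of_pos_right _ hr
  have hmn' : m ≤ m * n := Nat.le_mul_of_pos_right _ hn
  generalize hL : s.output = L at hlen hlt ⊢
  have hsc : s.nat 1 0 = L.length := by rw [← hL, output_length]
  have hget : ∀ j (hj : j < L.length), s.nat 2 j = L[j] := by
    intro j hj
    subst hL
    simp [State.output]
  -- an orthonormal basis of the row space of the selected rows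
  refine RunW.seq (fillMat_run n L.length 0 (fun j i => s.real 0 (s.nat 2 i) j) (fun _ _ _ => 0)
    ?_ ?_ ?_ ?_ ?_ ?_) fun s₁ F₁ ⟨f₁, h₁⟩ => ?_
  · calc n * (L.length * (0 + 1) + 1) ≤ n * (r₁ + r₁) := by gcongr; omega
      _ ≤ m * n * (r₁ + r₁) := Nat.mul_le_mul_right _ (Nat.le_mul_of_pos_left _ hm)
      _ = 2 * (m * n * r₁) := by ring
      _ ≤ W := by linarith
  · intro s' h; simp only [NExp.eval, h.nat 0 (by decide), hsn]
  · intro s' h; simp only [NExp.eval, h.nat 1 (by decide), hsc]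
  · intro s' _; rfl
  · intro s' i j h hi hj _ _ _
    simp only [RExp.eval, NExp.eval, hi, hj, h.nat 2 (by decide), h.real 0 (by decide)]
  · intros; simp only [RExp.eval, NExp.eval, Nat.cast_zero]
  have hZ : toMat n L.length (s₁.real 3) = (selectRows A L)ᵀ := by
    ext j i
    have hi : L.get i < m := hlt _ (List.get_mem L i)
    rw [toMat_apply, h₁ j j.2 i i.2, Matrix.transpose_apply, selectRows, Matrix.of_apply,
      dif_pos hi, ← hsA, hget i i.2]
    simp [toMat_apply]
  have n0₁ := f₁.nat 0 (by decide)
  have n1₁ := f₁.nat 1 (by decide)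
  have r0₁ := f₁.real 0 (by decide)
  refine RunW.seq (gramSchmidt_run (dd := n) (cc := L.length) ?_ ?_ ?_) fun s₂ f₂ h₂ => ?_
  · intro s' h; simp only [NExp.eval, h 0 (by decide), n0₁, hsn]
  · intro s' h; simp only [NExp.eval, h 1 (by decide), n1₁, hsc]
  · have hrk : (toMat n L.length (s₁.real 3)).rank ≤ m := by
      have : selectRows A L = (selectRows (1 : Matrix (Fin m) (Fin m) ℝ) L) * A := by
        ext i j
        rw [Matrix.mul_apply]
        have hi : L.get i < m := hlt _ (List.get_mem L i)
        simp only [selectRows, Matrix.of_apply, dif_pos hi, Matrix.one_apply, ite_mul, one_mul,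
          zero_mul, Finset.sum_ite_eq, Finset.mem_univ, if_true]
      rw [hZ, Matrix.rank_transpose, this]
      exact (Matrix.rank_mul_le_right _ _).trans
        ((Matrix.rank_le_card_height A).trans_eq (Fintype.card_fin m))
    calc _ ≤ r₁ * ((m + m) * (n + 3 * n)) := by gcongr; omega
      _ = 8 * (m * n * r₁) := by ring
      _ ≤ W := hW
  obtain ⟨-, M, hM⟩ := h₂.matrix
  have hproj := h₂.mul_mul
  have hqr : s₂.nat 10 0 ≤ r₁ := (h₂.le_rank.trans
    ((Matrix.rank_le_card_width _).trans_eq (Fintype.card_fin _))).trans hlen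
  rw [hZ] at hM hproj
  have hP := pinv_mul_self_eq hM hproj
  clear hM hproj h₂
  generalize hq : s₂.nat 10 0 = q at hqr hP
  have n0₂ := (f₂.nat 0 (by decide)).trans n0₁
  have r0₂ := (f₂.real 0 (by decide)).trans r0₁
  -- the residual
  refine RunW.seq (fillMat_run m q n (fun _ _ => 0) (fun i j l => s.real 0 i l * s₂.real 4 j l)
    ?_ ?_ ?_ ?_ ?_ ?_) fun s₃ F₃ ⟨f₃, h₃⟩ => ?_
  · refine (fill_cost_le le_rfl hqr le_rfl hr hn).trans ?_
    calc _ = 3 * (m * n * r₁) := by ring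
      _ ≤ W := by linarith
  · intro s' h; simp only [NExp.eval, h.nat 0 (by decide), n0₂, hsm]
  · intro s' h; simp only [NExp.eval, h.nat 10 (by decide), hq]
  · intro s' h; simp only [NExp.eval, h.nat 0 (by decide), n0₂, hsn]
  · intros; simp only [RExp.eval, NExp.eval, Nat.cast_zero]
  · intro s' i j l h hi hj hl _ _ _
    simp only [RExp.eval, NExp.eval, hi, hj, hl, h.real 0 (by decide), h.real 4 (by decide), r0₂]
  have hH : toMat m q (s₃.real 27) = A * (toMat q n (s₂.real 4))ᵀ := by
    rw [toMat_mul (g := fun l j => s₂.real 4 j l) h₃, hsA]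
    rfl
  have n0₃ := (f₃.nat 0 (by decide)).trans n0₂
  have n10₃ := (congrFun (f₃.nat 10 (by decide)) 0).trans hq
  have r0₃ := (f₃.real 0 (by decide)).trans r0₂
  have r4₃ := f₃.real 4 (by decide)
  refine RunW.seq (fillMat_run m n q (fun i j => s.real 0 i j)
    (fun i j l => 0 - s₃.real 27 i l * s₂.real 4 l j) ?_ ?_ ?_ ?_ ?_ ?_) fun s₄ F₄ ⟨f₄, h₄⟩ => ?_
  · refine (fill_cost_le le_rfl le_rfl hqr hn hr).trans ?_
    linarith
  · intro s' h; simp only [NExp.eval, h.nat 0 (by decide), n0₃, hsm]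
  · intro s' h; simp only [NExp.eval, h.nat 0 (by decide), n0₃, hsn]
  · intro s' h; simp only [NExp.eval, h.nat 10 (by decide), n10₃]
  · intro s' i j h hi hj _ _ _
    simp only [RExp.eval, NExp.eval, hi, hj, h.real 0 (by decide), r0₃]
  · intro s' i j l h hi hj hl _ _ _
    simp only [RExp.eval, NExp.eval, hi, hj, hl, h.real 27 (by decide), h.real 4 (by decide),
      r4₃, Nat.cast_zero]
  have hB : toMat m n (s₄.real 28) = A - A * pinv (selectRows A L) * selectRows A L := by
    rw [Matrix.mul_assoc A, hP, ← Matrix.mul_assoc, ← hH]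
    ext i j
    rw [toMat_apply, h₄ i i.2 j j.2, Matrix.sub_apply, Matrix.mul_apply, ← hsA, sub_eq_add_neg,
      ← Finset.sum_neg_distrib, Finset.sum_range]
    simp only [zero_sub, toMat_apply]
  have n0₄ := (f₄.nat 0 (by decide)).trans n0₃
  refine RunW.seq (fillMat_run m 1 n (fun _ _ => 0) (fun i _ l => s₄.real 28 i l * s₄.real 28 i l)
    ?_ ?_ ?_ ?_ ?_ ?_) fun s₅ F₅ ⟨f₅, h₅⟩ => ?_
  · refine (fill_cost_le le_rfl le_rfl le_rfl le_rfl hn).trans ?_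
    calc _ = 3 * (m * n) := by ring
      _ ≤ W := by linarith
  · intro s' h; simp only [NExp.eval, h.nat 0 (by decide), n0₄, hsm]
  · intro s' _; rfl
  · intro s' h; simp only [NExp.eval, h.nat 0 (by decide), n0₄, hsn]
  · intros; simp only [RExp.eval, NExp.eval, Nat.cast_zero]
  · intro s' i j l h hi hj hl _ _ _
    simp only [RExp.eval, NExp.eval, hi, hl, h.real 28 (by decide)]
  generalize hb : (fun i => s₅.real 29 i 0) = b
  have hb' : ∀ i, s₅.real 29 i 0 = b i := fun i => congrFun hb i
  have hbB : ∀ i : Fin m, b i =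
      ∑ j, (A - A * pinv (selectRows A L) * selectRows A L) i j ^ 2 := by
    intro i
    rw [← hb', h₅ i i.2 0 one_pos, zero_add, Finset.sum_range, ← hB]
    exact Finset.sum_congr rfl fun j _ => by rw [toMat_apply, sq]
  have hb0 : ∀ i < m, 0 ≤ b i := fun i hi => by
    rw [hbB ⟨i, hi⟩]; exact Finset.sum_nonneg fun _ _ => sq_nonneg _
  have hn₅ : ∀ a, a ∈ ([0, 1, 2, 6, 7] : List ℕ) → s₅.nat a = s.nat a := by
    intro a ha
    fin_cases ha <;> rw [f₅.nat _ (by decide), f₄.nat _ (by decide), f₃.nat _ (by decide),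
      f₂.nat _ (by decide), f₁.nat _ (by decide)]
  have hu₅ : s₅.unifUsed = 0 := by
    rw [F₅.unif rfl, F₄.unif rfl, F₃.unif rfl, f₂.unif rfl, F₁.unif rfl, hu]
  -- the partial sums of the squared row norms
  refine RunW.seq (run_setR (i := 0) (j := 0) (w := 0) rfl rfl Nat.cast_zero) fun s₆ f₆ h₆ => ?_
  have n0₆ : s₆.nat 0 0 = m := by rw [f₆.nat 0 (by decide), hn₅ 0 (by decide), hsm]
  refine RunW.seq (RunW.loop (w := 0) (n := m) (fun i s' => ∀ i' ≤ i, s'.real 30 0 i' =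
    ∑ l ∈ Finset.range i', b l) (show (nvar 0).eval s₆ = m from n0₆) (by linarith) ?_ ?_)
    fun s₇ f₇ h₇ => ?_
  · intro i' hi'
    have : i' = 0 := by omega
    subst this
    change s₆.real 30 0 0 = _
    rw [h₆.1]
    simp
  · intro i hi s' f' h'
    have r29 : s'.real 29 i 0 = b i := by rw [f'.real 29 (by decide), f₆.real 29 (by decide), hb']
    refine (run_setR (i := 0) (j := i + 1) (w := ∑ l ∈ Finset.range (i + 1), b l) rfl rfl ?_).mono
      le_rfl fun s'' f'' h'' i' hi' => ?_
    · change s'.real 30 0 i + s'.real 29 i 0 = _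
      rw [h' i le_rfl, r29, Finset.sum_range_succ]
    · rw [h''.1]
      by_cases he : i' = i + 1
      · rw [if_pos ⟨rfl, rfl, he⟩, he]
      · rw [if_neg fun h => he h.2.2]
        exact h' i' (by omega)
  have hn₇ : ∀ a, a ∈ ([0, 1, 2, 6, 7] : List ℕ) → s₇.nat a = s.nat a := by
    intro a ha
    rw [← hn₅ a ha]
    fin_cases ha <;> rw [f₇.nat _ (by decide), f₆.nat _ (by decide)]
  have hu₇ : s₇.unifUsed = 0 := by rw [f₇.unif rfl, f₆.unif rfl, hu₅]
  have hL₇ : s₇.output = L := by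
    rw [← hL]
    exact output_congr (by rw [hn₇ 1 (by decide)]) (hn₇ 2 (by decide))
  have h30 : s₇.real 30 0 0 = 0 := by rw [h₇ 0 (Nat.zero_le _)]; simp
  have htot : 0 ≤ ∑ l ∈ Finset.range m, b l :=
    Finset.sum_nonneg fun i hi => hb0 i (Finset.mem_range.1 hi)
  -- the draws
  refine (RunW.loop (w := T) (n := r₂) (fun τ s' => s'.unifUsed = τ ∧ ∃ l : List (Fin m),
    l.length = τ ∧ s'.output = L ++ l.map Fin.val ∧ ∀ t (ht : t < l.length),
      ∑ i ∈ Finset.range (l[t] : ℕ), b i ≤ ω.2 t * ∑ i ∈ Finset.range m, b i ∧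
      ((ω.2 t : ℝ) * ∑ i ∈ Finset.range m, b i < ∑ i ∈ Finset.range m, b i →
        (ω.2 t : ℝ) * ∑ i ∈ Finset.range m, b i < ∑ i ∈ Finset.range ((l[t] : ℕ) + 1), b i))
    (show (nvar 6).eval s₇ = r₂ from by
      change s₇.nat 6 0 = r₂; rw [hn₇ 6 (by decide), hsr]) hW' ?_ ?_).mono le_rfl ?_
  · exact ⟨hu₇, [], rfl, by rw [List.map_nil, List.append_nil]; exact hL₇,
      fun t ht => absurd ht (Nat.not_lt_zero t)⟩
  · rintro τ hτ s₈ f₈ ⟨hu₈, l, hl, hout, hlp⟩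
    have r30 : s₈.real 30 = s₇.real 30 := f₈.real 30 (by decide)
    have r30m : s₈.real 30 0 m = ∑ i ∈ Finset.range m, b i := by rw [r30, h₇ m le_rfl]
    refine (sampleRow_run (m := m) (T := T) ?_ ?_ hm hT ?_ ?_).mono le_rfl ?_
    · change s₈.nat 0 0 = m
      rw [f₈.nat 0 (by decide), hn₇ 0 (by decide), hsm]
    · change s₈.nat 7 0 = T
      rw [f₈.nat 7 (by decide), hn₇ 7 (by decide), hsT]
    · change s₈.real 30 0 0 = 0
      rw [r30, h30]
    · change 0 ≤ s₈.real 30 0 m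
      rw [r30m]; exact htot
    · rintro s' - ⟨hu', j, hj, hj1, hj2⟩
      have hu' : s'.unifUsed = s₈.unifUsed + 1 := hu'
      have hj : s'.output = s₈.output ++ [(j : ℕ)] := hj
      change s₈.real 30 0 j ≤ ω.2 s₈.unifUsed * s₈.real 30 0 m at hj1
      change (ω.2 s₈.unifUsed : ℝ) * s₈.real 30 0 m < s₈.real 30 0 m →
        (ω.2 s₈.unifUsed : ℝ) * s₈.real 30 0 m < s₈.real 30 0 (j + 1) at hj2
      rw [r30m, r30, h₇ j j.2.le, hu₈] at hj1
      rw [r30m, r30, h₇ (j + 1) j.2, hu₈] at hj2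
      refine ⟨by rw [hu', hu₈], l ++ [j], by simp [hl], by rw [hj, hout]; simp, fun t ht => ?_⟩
      rcases Nat.lt_or_ge t l.length with h | h
      · rw [List.getElem_append_left h]
        exact hlp t h
      · have : t = l.length := by simp at ht; omega
        subst this
        rw [List.getElem_append_right le_rfl]
        simp only [Nat.sub_self, List.getElem_cons_zero, hl]
        exact ⟨hj1, hj2⟩
  · rintro s' - ⟨-, l, hl, hout, hlp⟩
    refine ⟨l, hl, hout, fun hlt1 => ?_⟩
    simp only [IsAdaptiveSample]
    intro hB0 t
    have hnorm : ‖A - A * pinv (selectRows A L) * selectRows A L‖ ^ 2 =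
        ∑ i ∈ Finset.range m, b i := by
      rw [frobenius_sq, Finset.sum_range]
      exact Finset.sum_congr rfl fun i _ => (hbB i).symm
    have hpos : 0 < ∑ i ∈ Finset.range m, b i := by
      rw [← hnorm]
      have := norm_pos_iff.2 hB0
      positivity
    obtain ⟨h1, h2⟩ := hlp t t.2
    have h3 := h2 (by nlinarith [hlt1 t])
    simp only [hnorm, ← hbB]
    rw [sum_Iio_fin (fun i => b i / ∑ i ∈ Finset.range m, b i),
      sum_Iic_fin (fun i => b i / ∑ i ∈ Finset.range m, b i), ← Finset.sum_div, ← Finset.sum_div,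
      div_le_iff₀ hpos, lt_div_iff₀ hpos]
    exact ⟨h1, h3⟩

end RealRAM

/-! ### The program -/

/-- The list `L` enumerates the rows chosen by dual set sparsification after randomized singular
value decomposition with positive singular values. -/
def IsDualSetSelection {m n : ℕ} (A : Matrix (Fin m) (Fin n) ℝ) (k ℓ r : ℕ) (g : ℕ → ℝ)
    (L : List ℕ) : Prop :=
  ∃ (U : Matrix (Fin m) (Fin k) ℝ) (σ : Fin k → ℝ) (V : Matrix (Fin n) (Fin k) ℝ) (w : Fin m → ℝ),
    IsRandomizedSVD A ℓ g U σ V ∧ (∀ i, 0 < σ i) ∧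
    IsDualSetOutput (fun i => (A - U * Matrix.diagonal σ * Vᵀ) i) (fun i => U i) r w ∧
    ∀ i : Fin m, (i : ℕ) ∈ L ↔ w i ≠ 0

theorem IsRandomizedSVD.eq_proj_mul {m n k ℓ : ℕ} {A : Matrix (Fin m) (Fin n) ℝ} {g : ℕ → ℝ}
    {U : Matrix (Fin m) (Fin k) ℝ} {σ : Fin k → ℝ} {V : Matrix (Fin n) (Fin k) ℝ}
    (h : IsRandomizedSVD A ℓ g U σ V) (hσ : ∀ i, 0 < σ i) :
    U * Matrix.diagonal σ * Vᵀ = U * Uᵀ * A :=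
  IsTruncatedSVD.eq_proj_mul (mul_pinv_symm _) (mul_pinv_idem _) h hσ

namespace RealRAM

/-- The first two steps. -/
def firstRows : Cmd := .seq parameters <| .seq randomizedSVD dualSet

/-- Select all rows. -/
def allRows : Cmd :=
  .seq (.loop 20 (nvar 0) (.setN 2 (nvar 20) (nvar 20))) (.setN 1 (.lit 0) (nvar 0))

/-- The test `2 * ρ ≤ ε * m`. -/
def sizeTest : Test :=
  .rle (.times (.ofNat (.lit 2)) (.ofNat (.get 0 (.lit 3)))) (.times (rvar 1) (.ofNat (nvar 0)))

/-- Fast row selection. If `m < 2 * ρ / ε` then all rows can be afforded. -/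
def fastRowSelection : Cmd := .ite sizeTest (.seq firstRows adaptiveSampling) allRows

/-- The rows that the first two steps select. They depend on the normal numbers only. -/
noncomputable def firstOutput (S : EigenSolver) {m n : ℕ} (A : Matrix (Fin m) (Fin n) ℝ) (k ρ : ℕ)
    (ε : ℝ) (g : ℕ → ℝ) : List ℕ :=
  (firstRows.exec S (g, fun _ => 0) ((inputState A k ρ ε).tick (sizeTest.cost + 1))).output

section

variable {S : EigenSolver} {ω : Tape} {m n k ρ W : ℕ} {ε : ℝ} {A : Matrix (Fin m) (Fin n) ℝ}

theorem holds_sizeTest : sizeTest.holds (inputState A k ρ ε) ↔ 2 * (ρ : ℝ) ≤ ε * m := by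
  have h : (inputState A k ρ ε).real 1 0 0 = ε := by simp [inputState]
  have h3 : (inputState A k ρ ε).nat 0 3 = ρ := rfl
  have h0 : (inputState A k ρ ε).nat 0 0 = m := rfl
  simp [sizeTest, Test.holds, RExp.eval, NExp.eval, h, h3, h0]

theorem toMat_inputState (A : Matrix (Fin m) (Fin n) ℝ) (k ρ : ℕ) (ε : ℝ) :
    toMat m n ((inputState A k ρ ε).real 0) = A := by
  ext i j
  simp [toMat_apply, inputState]

theorem firstRows_run (hk : 1 ≤ k) (hkρ : k ≤ ρ) (hρm : ρ ≤ m) (hρn : ρ ≤ n) (hε : 0 < ε)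
    (hε1 : ε ≤ 1) (hm : 2 * (ρ : ℝ) ≤ ε * m)
    (hW : 40 * ((m * n * k + m * k ^ 3) * rowScale ε ^ 2) ≤ W) :
    RunW S ω firstRows ((inputState A k ρ ε).tick (sizeTest.cost + 1)) W fun s' =>
      s'.output = firstOutput S A k ρ ε ω.1 ∧
      s'.nat 6 0 = sampleSize ρ ε ∧ m ≤ 2 ^ s'.nat 7 0 ∧
      (s'.nat 7 0 = 0 ∨ 2 ^ (s'.nat 7 0 - 1) < m) ∧ s'.output.Nodup ∧ (∀ i ∈ s'.output, i < m) ∧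
      s'.output.length ≤ dualSetSize k ε ∧
      (k ≤ (A * sketchMatrix n (sketchSize k ε) ω.1).rank →
        IsDualSetSelection A k (sketchSize k ε) (dualSetSize k ε) ω.1 s'.output) := by
  have hs1 : 1 ≤ rowScale ε := one_le_rowScale hε
  have hkm := hkρ.trans hρm
  have hkn := hkρ.trans hρn
  have hm1 := hk.trans hkm
  have hn1 := hk.trans hkn
  suffices h : RunW S ω firstRows ((inputState A k ρ ε).tick (sizeTest.cost + 1)) W fun s' =>
      s'.nat 6 0 = sampleSize ρ ε ∧ m ≤ 2 ^ s'.nat 7 0 ∧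
      (s'.nat 7 0 = 0 ∨ 2 ^ (s'.nat 7 0 - 1) < m) ∧ s'.output.Nodup ∧ (∀ i ∈ s'.output, i < m) ∧
      s'.output.length ≤ dualSetSize k ε ∧
      (k ≤ (A * sketchMatrix n (sketchSize k ε) ω.1).rank →
        IsDualSetSelection A k (sketchSize k ε) (dualSetSize k ε) ω.1 s'.output) from
    ⟨⟨congrArg State.output (exec_congr_of_unifFree S rfl firstRows rfl _), h.1⟩, h.2⟩
  have hX : m * n * k * rowScale ε ^ 2 + m * k ^ 3 * rowScale ε ^ 2 =
    (m * n * k + m * k ^ 3) * rowScale ε ^ 2 := by ring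
  have hs2 : 1 ≤ rowScale ε ^ 2 := Nat.one_le_pow _ _ hs1
  generalize hs : (inputState A k ρ ε).tick (sizeTest.cost + 1) = s
  have hA : toMat m n (s.real 0) = A := by rw [← hs]; exact toMat_inputState A k ρ ε
  have n0 : s.nat 0 0 = m := by rw [← hs]; rfl
  have n1 : s.nat 0 1 = n := by rw [← hs]; rfl
  have n2 : s.nat 0 2 = k := by rw [← hs]; rfl
  have n3 : s.nat 0 3 = ρ := by rw [← hs]; rfl
  have r1 : s.real 1 0 0 = ε := by rw [← hs]; simp [inputState, State.tick]
  have hg : s.gaussUsed = 0 := by rw [← hs]; rfl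
  have n13 : ∀ i, s.nat 13 i = 0 := by intro i; rw [← hs]; rfl
  have n1' : s.nat 1 0 = 0 := by rw [← hs]; rfl
  have hmW : m ≤ m * n * k * rowScale ε ^ 2 := by
    calc m = m * 1 * 1 * 1 := by ring
      _ ≤ _ := by gcongr
  refine RunW.seq (parameters_run n0 n2 n3 r1 hkρ (hk.trans hkρ) hε hε1 hm
    (by linarith [Nat.zero_le (m * k ^ 3 * rowScale ε ^ 2)]))
    fun s₁ f₁ ⟨h4, h5, h6, h7, h7'⟩ => ?_
  have hkℓ : k ≤ sketchSize k ε := by rw [sketchSize]; omega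
  refine RunW.seq (randomizedSVD_run (A := A) (by rw [f₁.nat 0 (by decide), n0])
    (by rw [f₁.nat 0 (by decide), n1]) (by rw [f₁.nat 0 (by decide), n2]) h4
    (by rw [f₁.real 0 (by decide), hA]) (by rw [f₁.gauss rfl, hg]) hk hkℓ hkm hkn ?_)
    fun s₂ f₂ ⟨hU, hE, hx⟩ => ?_
  · have : sketchSize k ε ≤ 3 * (k * rowScale ε ^ 2) := by
      rw [sketchSize]
      have : k * 1 ≤ k * rowScale ε ^ 2 := Nat.mul_le_mul_left _ hs2
      omega
    calc _ ≤ 8 * (m * n * (3 * (k * rowScale ε ^ 2))) := by gcongr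
      _ = 24 * (m * n * k * rowScale ε ^ 2) := by ring
      _ ≤ W := by linarith [Nat.zero_le (m * k ^ 3 * rowScale ε ^ 2)]
  refine (dualSet_run (x := fun i => toMat m n (s₂.real 15) i)
    (by rw [f₂.nat 0 (by decide), f₁.nat 0 (by decide), n0])
    (by rw [f₂.nat 0 (by decide), f₁.nat 0 (by decide), n2])
    (by rw [f₂.nat 5 (by decide), h5])
    (by rw [f₂.nat 13 (by decide), f₁.nat 13 (by decide)]; exact n13)
    (by rw [f₂.nat 1 (by decide), f₁.nat 1 (by decide), n1']) hk hkm (lt_dualSetSize hk hε)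
    ?_ ?_).mono le_rfl fun s₃ f₃ ⟨hnd, hlt, hlen, hds⟩ => ?_
  · intro i
    rw [hx i i.2, Finset.sum_range]
    rfl
  · calc _ = 16 * (m * k ^ 3 * rowScale ε ^ 2) := by rw [dualSetSize]; ring
      _ ≤ W := by linarith [Nat.zero_le (m * n * k * rowScale ε ^ 2)]
  refine ⟨by rw [f₃.nat 6 (by decide), f₂.nat 6 (by decide), h6],
    by rw [f₃.nat 7 (by decide), f₂.nat 7 (by decide)]; exact h7,
    by rw [f₃.nat 7 (by decide), f₂.nat 7 (by decide)]; exact h7', hnd, hlt, hlen, fun hrk => ?_⟩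
  obtain ⟨σ, V, hsvd, hσ⟩ := hU hrk
  obtain ⟨w, hw, hwm⟩ := hds (IsTruncatedSVD.left_orthonormal hsvd)
  refine ⟨_, σ, V, w, hsvd, hσ, ?_, hwm⟩
  rw [hsvd.eq_proj_mul hσ, ← hE]
  exact hw

theorem allRows_run {s : State} (hs : s.nat 0 0 = m) (hW : m ≤ W) :
    RunW S ω allRows s W fun s' => s'.output = List.range m := by
  refine RunW.seq (RunW.loop (w := 0) (n := m) (fun i s' => ∀ j < i, s'.nat 2 j = j)
    (show (nvar 0).eval s = m from hs) (by omega) (fun j hj => absurd hj (Nat.not_lt_zero j))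
    fun i hi s' f' h' => ?_) fun s₁ f₁ h₁ => ?_
  · refine (run_setN (i := i) (w := i) rfl rfl).mono le_rfl fun s'' f'' h'' j hj => ?_
    rw [h''.1]
    by_cases he : j = i
    · rw [if_pos ⟨rfl, he⟩, he]
    · rw [if_neg fun h => he h.2]
      exact h' j (by omega)
  · have n0 : s₁.nat 0 0 = m := by rw [f₁.nat 0 (by decide), hs]
    refine (run_setN (i := 0) (w := m) rfl (show (nvar 0).eval s₁ = m from n0)).mono le_rfl
      fun s' f' h' => ?_
    have n1 : s'.nat 1 0 = m := by rw [h'.1]; rfl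
    rw [State.output, n1]
    conv_rhs => rw [← List.map_id (List.range m)]
    refine List.map_congr_left fun j hj => ?_
    rw [f'.nat 2 (by decide), h₁ j (List.mem_range.1 hj)]
    rfl

/-- The behaviour of the program in both cases of the size test. The first part of the output is
`firstOutput`, which depends on the normal variables only. -/
theorem fastRowSelection_run (hk : 1 ≤ k) (hkρ : k ≤ ρ) (hρm : ρ ≤ m) (hρn : ρ ≤ n) (hε : 0 < ε)
    (hε1 : ε ≤ 1) :
    RunW S ω fastRowSelection (inputState A k ρ ε)
      (40 * ((m * n * k + m * k ^ 3) * rowScale ε ^ 2)) fun s' =>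
      (ε * m < 2 * ρ → s'.output = List.range m) ∧
      (2 * (ρ : ℝ) ≤ ε * m → (firstOutput S A k ρ ε ω.1).Nodup ∧
        (∀ i ∈ firstOutput S A k ρ ε ω.1, i < m) ∧
        (firstOutput S A k ρ ε ω.1).length ≤ dualSetSize k ε ∧
        (k ≤ (A * sketchMatrix n (sketchSize k ε) ω.1).rank →
          IsDualSetSelection A k (sketchSize k ε) (dualSetSize k ε) ω.1
            (firstOutput S A k ρ ε ω.1)) ∧
        ∃ l : List (Fin m), l.length = sampleSize ρ ε ∧
          s'.output = firstOutput S A k ρ ε ω.1 ++ l.map Fin.val ∧ ((∀ t, (ω.2 t : ℝ) < 1) →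
            IsAdaptiveSample A (selectRows A (firstOutput S A k ρ ε ω.1))
              (fun t => (ω.2 t : ℝ)) l)) := by
  have hm1 := (hk.trans hkρ).trans hρm
  have hn1 := (hk.trans hkρ).trans hρn
  have hs2 : 1 ≤ rowScale ε ^ 2 := Nat.one_le_pow _ _ (one_le_rowScale hε)
  have hX : m * n * k * rowScale ε ^ 2 + m * k ^ 3 * rowScale ε ^ 2 =
    (m * n * k + m * k ^ 3) * rowScale ε ^ 2 := by ring
  have hmn : m * n * rowScale ε ^ 2 ≤ m * n * k * rowScale ε ^ 2 :=
    Nat.mul_le_mul_right _ (Nat.le_mul_of_pos_right _ hk)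
  have hmW : m ≤ m * n * rowScale ε ^ 2 := by
    calc m = m * 1 * 1 := by ring
      _ ≤ _ := by gcongr
  refine RunW.ite (fun ht => ?_) (fun ht => ?_)
  · rw [holds_sizeTest] at ht
    refine (RunW.seq (firstRows_run hk hkρ hρm hρn hε hε1 ht le_rfl)
      fun s₁ f₁ ⟨hL, h6, h7, h7', hnd, hlt, hlen, hsel⟩ => ?_).mono le_rfl
      fun _ _ h => ⟨fun h' => absurd ht (not_le.2 h'), fun _ => h⟩
    rw [← hL]
    refine (adaptiveSampling_run (r₁ := dualSetSize k ε) (A := A)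
      (by rw [f₁.nat 0 (by decide)]; rfl) (by rw [f₁.nat 0 (by decide)]; rfl)
      h6 rfl (by rw [f₁.real 0 (by decide)]; exact toMat_inputState A k ρ ε) (by rw [f₁.unif rfl]; rfl)
      hm1 hn1 (hk.trans (lt_dualSetSize hk hε).le) h7 hlen hlt ?_ ?_).mono le_rfl
      fun s₂ f₂ h₂ => ⟨hnd, hlt, hlen, hsel, h₂⟩
    · calc _ = 32 * (m * n * k * rowScale ε ^ 2) := by rw [dualSetSize]; ring
        _ ≤ _ := by linarith [Nat.zero_le (m * k ^ 3 * rowScale ε ^ 2)]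
    · have h1 := sampleSize_mul_le hε hε1 (hk.trans hkρ) hρn ht h7'
      have h2 := sampleSize_le hε ht
      rw [Nat.mul_add_one]
      linarith [Nat.zero_le (m * k ^ 3 * rowScale ε ^ 2)]
  · rw [holds_sizeTest] at ht
    exact (allRows_run (m := m) rfl
      (by linarith [Nat.zero_le (m * k ^ 3 * rowScale ε ^ 2)])).mono le_rfl
      fun s' _ h => ⟨fun _ => h, fun h' => absurd h' ht⟩

end

end RealRAM

/-! ### Almost sure properties and the expected error -/

theorem ae_le_rank_sketch {m n k ℓ : ℕ} {A : Matrix (Fin m) (Fin n) ℝ} (hk : k ≤ A.rank)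
    (hℓ : k + 2 ≤ ℓ) :
    ∀ᵐ g ∂(Measure.infinitePi fun _ : ℕ => gaussianReal 0 1),
      k ≤ (A * sketchMatrix n ℓ g).rank := by
  obtain ⟨V, T, hV, hT⟩ := exists_orthonormal_rows A hk
  filter_upwards [(gaussian_sketch (m := m) V hV hℓ).1] with g hg
  exact le_rank_sketch hT _ hg

theorem add_two_le_sketchSize {k : ℕ} {ε : ℝ} (hk : 1 ≤ k) (hε : 0 < ε) :
    k + 2 ≤ sketchSize k ε := by
  have h : 1 * 1 ≤ k * rowScale ε ^ 2 :=
    Nat.mul_le_mul hk (Nat.one_le_pow _ _ (one_le_rowScale hε))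
  rw [sketchSize]
  omega

theorem ae_unif_lt_one :
    ∀ᵐ u ∂(Measure.infinitePi fun _ : ℕ => (volume : Measure unitInterval)),
      ∀ t, (u t : ℝ) < 1 := by
  refine ae_all_iff.2 fun t => ?_
  have h : ∀ᵐ x ∂(volume : Measure unitInterval), x ≠ 1 := by
    rw [ae_iff]
    simp
  refine ((measurePreserving_eval_infinitePi (fun _ : ℕ => (volume : Measure unitInterval))
    t).quasiMeasurePreserving.ae h).mono fun u hu => ?_
  exact lt_of_le_of_ne (u t).2.2 fun he => hu (Subtype.ext he)

/-- The error of the first two steps, in terms of the error of the randomized singular value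
decomposition. -/
theorem IsDualSetSelection.error_le {m n k ℓ r : ℕ} {A : Matrix (Fin m) (Fin n) ℝ} {g : ℕ → ℝ}
    {L : List ℕ} (h : IsDualSetSelection A k ℓ r g L) (hk : 1 ≤ k)
    {W : Matrix (Fin n) (Fin k) ℝ} (hW : Wᵀ * W = 1)
    (hdet : IsUnit ((Wᵀ * sketchMatrix n ℓ g) * (Wᵀ * sketchMatrix n ℓ g)ᵀ).det) :
    ‖A - A * pinv (selectRows A L) * selectRows A L‖ ^ 2 ≤
      (1 + 1 / (1 - √(k / (r : ℝ))) ^ 2) * (‖A - A * (W * Wᵀ)‖ ^ 2 +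
        ‖(A - A * (W * Wᵀ)) * sketchMatrix n ℓ g * ((Wᵀ * sketchMatrix n ℓ g)ᵀ *
          ((Wᵀ * sketchMatrix n ℓ g) * (Wᵀ * sketchMatrix n ℓ g)ᵀ)⁻¹)‖ ^ 2) := by
  obtain ⟨U, σ, V, w, hsvd, hσ, hds, hw⟩ := h
  have hkr := hds.1
  have hlt := sqrt_div_lt_one hkr
  obtain ⟨hw0, hN, hE⟩ := hds.bounds hk
  have herr := IsTruncatedSVD.randomized_error_le hsvd hW hdet
  have hproj := hsvd.eq_proj_mul hσ
  rw [hproj] at herr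
  simp only [hproj] at hE
  have hpos : 0 < (1 - √(k / (r : ℝ))) ^ 2 := by
    have : 0 < 1 - √(k / (r : ℝ)) := by linarith
    positivity
  have hsq : ∀ i, (A - U * Uᵀ * A) i ⬝ᵥ (A - U * Uᵀ * A) i = ∑ j, (A - U * Uᵀ * A) i j ^ 2 :=
    fun i => Finset.sum_congr rfl fun j _ => (sq _).symm
  have hQ := frobenius_sub_mul_proj_le_of_weights A (IsTruncatedSVD.left_orthonormal hsvd) w hw0
    hpos hN (by simpa only [hsq, ← frobenius_sq] using hE)
    (pinv_mul_self_symm (selectRows A L)) (pinv_mul_self_idem (selectRows A L))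
    fun i hi => mul_pinv_mul_selectRows_apply A ((hw i).2 hi)
  rw [← Matrix.mul_assoc] at hQ
  refine hQ.trans (mul_le_mul_of_nonneg_left herr ?_)
  positivity

/-- The expectation over the Gaussian numbers and then over the uniform numbers. -/
theorem lintegral_selection_error_le {m n k ℓ r₁ r₂ : ℕ} {A Ak : Matrix (Fin m) (Fin n) ℝ}
    {P : Matrix (Fin m) (Fin m) ℝ} (hPs : Pᵀ = P) (hPi : P * P = P) (hAk : IsRankTruncation k A Ak)
    (hk : 1 ≤ k) (hℓ : k + 2 ≤ ℓ) (hr₂ : 1 ≤ r₂) (L : (ℕ → ℝ) → List ℕ) (hL : ∀ g, ∀ i ∈ L g, i < m)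
    (hsel : ∀ᵐ g ∂(Measure.infinitePi fun _ : ℕ => gaussianReal 0 1),
      IsDualSetSelection A k ℓ r₁ g (L g))
    (out : RealRAM.Tape → List ℕ)
    (hmeas : Measurable fun ω =>
      ‖A - P * A * pinv (selectRows A (out ω)) * selectRows A (out ω)‖ ^ 2)
    (hout : ∀ g, ∀ᵐ u ∂(Measure.infinitePi fun _ : ℕ => (volume : Measure unitInterval)),
      ∃ l : List (Fin m), l.length = r₂ ∧
        IsAdaptiveSample A (selectRows A (L g)) (fun t => (u t : ℝ)) l ∧
        out (g, u) = L g ++ l.map Fin.val) {ε : ℝ} (htr : 0 ≤ P.trace)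
    (hε : P.trace / r₂ * ((1 + 1 / (1 - √(k / (r₁ : ℝ))) ^ 2) * (1 + k / ((ℓ : ℝ) - k - 1))) ≤ ε) :
    ∫⁻ ω, ENNReal.ofReal (‖A - P * A * pinv (selectRows A (out ω)) * selectRows A (out ω)‖ ^ 2)
      ∂(RealRAM.tapeMeasure) ≤ ENNReal.ofReal (‖A - P * A‖ ^ 2 + ε * ‖A - Ak‖ ^ 2) := by
  obtain ⟨V, hV, hAV⟩ := hAk.exists_right
  obtain ⟨hdet, hint⟩ := gaussian_sketch (m := m) V hV hℓ
  have hDV : (A - Ak) * V = 0 := by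
    rw [hAV, Matrix.sub_mul, Matrix.mul_assoc A, Matrix.mul_assoc V, hV, Matrix.mul_one, sub_self]
  have hint := hint (A - Ak) hDV
  set c := P.trace / r₂ * (1 + 1 / (1 - √(k / (r₁ : ℝ))) ^ 2) with hc
  have hc0 : 0 ≤ c := by positivity
  have hq0 : (0 : ℝ) ≤ k / ((ℓ : ℝ) - k - 1) := by
    have : (k : ℝ) + 2 ≤ ℓ := by exact_mod_cast hℓ
    exact div_nonneg (Nat.cast_nonneg _) (by linarith)
  set q : ℝ := k / ((ℓ : ℝ) - k - 1) with hq
  set X : (ℕ → ℝ) → ℝ := fun g => ‖(A - Ak) * sketchMatrix n ℓ g * ((Vᵀ * sketchMatrix n ℓ g)ᵀ *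
    ((Vᵀ * sketchMatrix n ℓ g) * (Vᵀ * sketchMatrix n ℓ g)ᵀ)⁻¹)‖ ^ 2 with hX
  rw [RealRAM.tapeMeasure, lintegral_prod _ hmeas.ennreal_ofReal.aemeasurable]
  calc _ ≤ ∫⁻ g, (ENNReal.ofReal (‖A - P * A‖ ^ 2 + c * ‖A - Ak‖ ^ 2) +
        ENNReal.ofReal c * ENNReal.ofReal (X g))
        ∂(Measure.infinitePi fun _ : ℕ => gaussianReal 0 1) := by
        refine lintegral_mono_ae ?_
        filter_upwards [hsel, hdet] with g hg hgd
        refine (lintegral_adaptive_error_le A hPs hPi (hL g) hr₂ (fun u => out (g, u))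
          (hout g)).trans ?_
        have hX0 : 0 ≤ X g := by positivity
        rw [← ENNReal.ofReal_mul hc0, ← ENNReal.ofReal_add (by positivity) (by positivity)]
        refine ENNReal.ofReal_le_ofReal ?_
        have h1 := hg.error_le hk hV hgd
        rw [← hAV] at h1
        have h2 := mul_le_mul_of_nonneg_left h1 (by positivity : 0 ≤ P.trace / r₂)
        rw [← mul_assoc, ← hc] at h2
        linarith
    _ = ENNReal.ofReal (‖A - P * A‖ ^ 2 + c * ‖A - Ak‖ ^ 2) + ENNReal.ofReal c *
        ∫⁻ g, ENNReal.ofReal (X g) ∂(Measure.infinitePi fun _ : ℕ => gaussianReal 0 1) := by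
        rw [lintegral_add_left measurable_const, lintegral_const, measure_univ, mul_one,
          lintegral_const_mul' _ _ ENNReal.ofReal_ne_top]
    _ ≤ ENNReal.ofReal (‖A - P * A‖ ^ 2 + c * ‖A - Ak‖ ^ 2) + ENNReal.ofReal c *
        ENNReal.ofReal (‖A - Ak‖ ^ 2 * q) := by gcongr
    _ = ENNReal.ofReal (‖A - P * A‖ ^ 2 + c * (1 + q) * ‖A - Ak‖ ^ 2) := by
        rw [← ENNReal.ofReal_mul hc0, ← ENNReal.ofReal_add (by positivity) (by positivity)]
        congr 1
        ring
    _ ≤ _ := by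
        refine ENNReal.ofReal_le_ofReal ?_
        have : c * (1 + q) ≤ ε := by rw [hc, mul_assoc]; exact hε
        gcongr

namespace RealRAM

theorem measurableSet_output (S : EigenSolver) (P : Cmd) {m n : ℕ}
    (A : Matrix (Fin m) (Fin n) ℝ) (k ρ : ℕ) (ε : ℝ) (l : List ℕ) :
    MeasurableSet {ω | (P.final S ω A k ρ ε).output = l} :=
  (MeasState.exec S measurable_id P (σ := fun _ => inputState A k ρ ε)
    ⟨fun _ _ => measurable_const, fun _ _ _ => measurable_const, measurable_const,
      measurable_const⟩).output l

/-- A quantity that depends on the output only is measurable. -/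
theorem measurable_comp_output (S : EigenSolver) (P : Cmd) {m n : ℕ}
    (A : Matrix (Fin m) (Fin n) ℝ) (k ρ : ℕ) (ε : ℝ) (F : List ℕ → ℝ) :
    Measurable fun ω => F (P.final S ω A k ρ ε).output := by
  let _ : MeasurableSpace (List ℕ) := ⊤
  have h : Measurable fun ω => (P.final S ω A k ρ ε).output :=
    measurable_to_countable' fun l => measurableSet_output S P A k ρ ε l
  exact measurable_from_top.comp h

end RealRAM

/-! ### Analysis of the program -/

namespace RealRAM

variable {S : EigenSolver} {m n k ρ : ℕ} {ε : ℝ} {A : Matrix (Fin m) (Fin n) ℝ}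

theorem fastRowSelection_clock_le (hk : 1 ≤ k) (hkρ : k ≤ ρ) (hρm : ρ ≤ m) (hρn : ρ ≤ n)
    (hε : 0 < ε) (hε1 : ε ≤ 1) (ω : Tape) :
    ((fastRowSelection.final S ω A k ρ ε).clock : ℝ) ≤ 161 * fastRowSelection.weight *
      (((m * n * k + m * k ^ 3 : ℕ) : ℝ) * ε ^ (-(2 / 3) : ℝ)) := by
  have hm1 := (hk.trans hkρ).trans hρm
  have hn1 := (hk.trans hkρ).trans hρn
  have h := (fastRowSelection_run (S := S) (ω := ω) (A := A) hk hkρ hρm hρn hε hε1).2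
  have h0 : (inputState A k ρ ε).clock = 0 := rfl
  rw [h0, zero_add] at h
  have h' : ((fastRowSelection.final S ω A k ρ ε).clock : ℝ) ≤
      fastRowSelection.weight *
        (40 * (((m * n * k + m * k ^ 3 : ℕ) : ℝ) * (rowScale ε : ℝ) ^ 2) + 1) := by
    exact_mod_cast h
  have hX : (1 : ℝ) ≤ ((m * n * k + m * k ^ 3 : ℕ) : ℝ) := by
    have : 1 ≤ m * n * k + m * k ^ 3 :=
      (Nat.one_le_iff_ne_zero.2 (by positivity : m * n * k ≠ 0)).trans (Nat.le_add_right _ _)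
    exact_mod_cast this
  have hE : 1 ≤ ε ^ (-(2 / 3) : ℝ) :=
    Real.one_le_rpow_of_pos_of_le_one_of_nonpos hε hε1 (by norm_num)
  have hs := rowScale_sq_le hε hε1
  refine h'.trans ?_
  rw [mul_comm (161 : ℝ), mul_assoc (fastRowSelection.weight : ℝ)]
  refine mul_le_mul_of_nonneg_left ?_ (Nat.cast_nonneg (α := ℝ) fastRowSelection.weight)
  have h1 := mul_le_mul_of_nonneg_left hs
    (Nat.cast_nonneg (α := ℝ) (m * n * k + m * k ^ 3))
  have h2 : 1 ≤ ((m * n * k + m * k ^ 3 : ℕ) : ℝ) * ε ^ (-(2 / 3) : ℝ) :=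
    one_le_mul_of_one_le_of_one_le hX hE
  linarith

theorem fastRowSelection_output_le (hk : 1 ≤ k) (hkρ : k ≤ ρ) (hρm : ρ ≤ m) (hρn : ρ ≤ n)
    (hε : 0 < ε) (hε1 : ε ≤ 1) (ω : Tape) :
    (∀ i ∈ (fastRowSelection.final S ω A k ρ ε).output, i < m) ∧
      (fastRowSelection.final S ω A k ρ ε).output.length ≤ dualSetSize k ε + sampleSize ρ ε := by
  obtain ⟨h1, h2⟩ := (fastRowSelection_run (S := S) (ω := ω) (A := A) hk hkρ hρm hρn hε hε1).1
  change _ → (fastRowSelection.final S ω A k ρ ε).output = _ at h1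
  rcases lt_or_ge (ε * m) (2 * ρ) with hm | hm
  · rw [h1 hm]
    refine ⟨fun i hi => List.mem_range.1 hi, ?_⟩
    rw [List.length_range]
    exact (le_sampleSize_of_lt hε hm).trans (Nat.le_add_left _ _)
  · obtain ⟨-, hlt, hlen, -, l, hl, hout, -⟩ := h2 hm
    change (fastRowSelection.final S ω A k ρ ε).output = _ at hout
    rw [hout, List.length_append, List.length_map, hl]
    refine ⟨fun i hi => ?_, Nat.add_le_add_right hlen _⟩
    rcases List.mem_append.1 hi with h | h
    · exact hlt i h
    · obtain ⟨a, -, rfl⟩ := List.mem_map.1 h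
      exact a.2

theorem ae_isFastRowSelection (hk : 1 ≤ k) (hkρ : k ≤ ρ) (hρA : ρ ≤ A.rank) (hε : 0 < ε)
    (hε1 : ε ≤ 1) (hm : 2 * (ρ : ℝ) ≤ ε * m) :
    ∀ᵐ ω ∂(tapeMeasure), IsFastRowSelection A k (sketchSize k ε) (dualSetSize k ε) (sampleSize ρ ε)
      ω (fastRowSelection.final S ω A k ρ ε).output := by
  have hρm : ρ ≤ m := hρA.trans ((Matrix.rank_le_card_height A).trans_eq (Fintype.card_fin m))
  have hρn : ρ ≤ n := hρA.trans ((Matrix.rank_le_card_width A).trans_eq (Fintype.card_fin n))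
  filter_upwards [Measure.quasiMeasurePreserving_fst.ae
      (ae_le_rank_sketch (hkρ.trans hρA) (add_two_le_sketchSize hk hε)),
    Measure.quasiMeasurePreserving_snd.ae ae_unif_lt_one] with ω hrk hu
  obtain ⟨hnd, hlt, -, hsel, l, hl, hout, hl'⟩ :=
    (fastRowSelection_run (S := S) (ω := ω) (A := A) hk hkρ hρm hρn hε hε1).1.2 hm
  change (fastRowSelection.final S ω A k ρ ε).output = _ at hout
  obtain ⟨U, σ, V, w, hsvd, -, hds, hw⟩ := hsel hrk
  have hL : ∃ l₁ : List (Fin m), l₁.map Fin.val = firstOutput S A k ρ ε ω.1 :=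
    ⟨(firstOutput S A k ρ ε ω.1).pmap Fin.mk hlt, by simp [List.map_pmap]⟩
  obtain ⟨l₁, hl₁⟩ := hL
  rw [← hl₁] at hnd hw hout hl'
  refine ⟨U, σ, V, w, l₁, l, hsvd, hds, hnd.of_map _, fun i => ?_, hl, hl' hu, ?_⟩
  · rw [← hw, List.mem_map_of_injective Fin.val_injective]
  · rw [hout, List.map_append]

theorem lintegral_fastRowSelection_le {c : ℕ} {C : Matrix (Fin m) (Fin c) ℝ} (hC : C.rank = ρ)
    (hk : 1 ≤ k) (hkρ : k ≤ ρ) (hρA : ρ ≤ A.rank) (hε : 0 < ε) (hε1 : ε ≤ 1)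
    {Ak : Matrix (Fin m) (Fin n) ℝ} (hAk : IsRankTruncation k A Ak) :
    ∫⁻ ω, ENNReal.ofReal (‖A - C * pinv C * A *
        pinv (selectRows A (fastRowSelection.final S ω A k ρ ε).output) *
        selectRows A (fastRowSelection.final S ω A k ρ ε).output‖ ^ 2) ∂(tapeMeasure) ≤
      ENNReal.ofReal (‖A - C * pinv C * A‖ ^ 2 + ε * ‖A - Ak‖ ^ 2) := by
  have hρm : ρ ≤ m := hρA.trans ((Matrix.rank_le_card_height A).trans_eq (Fintype.card_fin m))
  have hρn : ρ ≤ n := hρA.trans ((Matrix.rank_le_card_width A).trans_eq (Fintype.card_fin n))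
  have hrun := fun ω =>
    (fastRowSelection_run (S := S) (ω := ω) (A := A) hk hkρ hρm hρn hε hε1).1
  rcases lt_or_ge (ε * m) (2 * ρ) with hm | hm
  · -- all rows are selected, and the error does not exceed that of the projection
    have herr : ∀ ω, ‖A - C * pinv C * A *
        pinv (selectRows A (fastRowSelection.final S ω A k ρ ε).output) *
        selectRows A (fastRowSelection.final S ω A k ρ ε).output‖ ^ 2 =
        ‖A - C * pinv C * A‖ ^ 2 := by
      intro ω
      have hout : (fastRowSelection.final S ω A k ρ ε).output = List.range m := (hrun ω).1 hm
      have hA : A * (pinv (selectRows A (List.range m)) * selectRows A (List.range m)) = A :=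
        funext fun i => mul_pinv_mul_selectRows_apply A (List.mem_range.2 i.2)
      rw [hout, Matrix.mul_assoc (C * pinv C * A), Matrix.mul_assoc (C * pinv C), hA]
    have : IsProbabilityMeasure tapeMeasure := by unfold tapeMeasure; infer_instance
    simp only [herr]
    rw [lintegral_const, measure_univ, mul_one]
    exact ENNReal.ofReal_le_ofReal (le_add_of_nonneg_right (by positivity))
  · have htr : (C * pinv C).trace = ρ := by rw [trace_mul_pinv, hC]
    refine lintegral_selection_error_le (ℓ := sketchSize k ε) (r₁ := dualSetSize k ε)
      (r₂ := sampleSize ρ ε) (mul_pinv_symm C) (mul_pinv_idem C) hAk hk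
      (add_two_le_sketchSize hk hε) (one_le_sampleSize hε (hk.trans hkρ))
      (firstOutput S A k ρ ε) (fun g => ?_) ?_
      (fun ω => (fastRowSelection.final S ω A k ρ ε).output)
      (measurable_comp_output S fastRowSelection A k ρ ε fun l =>
        ‖A - C * pinv C * A * pinv (selectRows A l) * selectRows A l‖ ^ 2) (fun g => ?_)
      (by rw [htr]; positivity) ?_
    · exact ((hrun (g, fun _ => 0)).2 hm).2.1
    · filter_upwards [ae_le_rank_sketch (hkρ.trans hρA) (add_two_le_sketchSize hk hε)] with g hg
      exact ((hrun (g, fun _ => 0)).2 hm).2.2.2.1 hg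
    · filter_upwards [ae_unif_lt_one] with u hu
      obtain ⟨-, -, -, -, l, hl, hout, hl'⟩ := (hrun (g, u)).2 hm
      exact ⟨l, hl, hl' hu, hout⟩
    · rw [htr]
      exact error_factor_le hk hε (hk.trans hkρ)

end RealRAM

theorem mainTheorem2 :
    ∃ (P : RealRAM.Cmd) (K : ℝ) (δ : ℝ → ℝ) (ℓ r₁ r₂ : ℕ → ℕ → ℝ → ℕ),
      Tendsto δ (𝓝[>] 0) (𝓝 0) ∧
      (∀ (k ρ : ℕ) (ε : ℝ), 1 ≤ k → k ≤ ρ → 0 < ε → ε ≤ 1 →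
        |((r₁ k ρ ε + r₂ k ρ ε : ℕ) : ℝ) - 2 * ρ / ε| ≤ 2 * ρ / ε * δ ε) ∧
      ∀ (S : RealRAM.EigenSolver) (m n c k ρ : ℕ) (ε : ℝ)
        (A : Matrix (Fin m) (Fin n) ℝ) (C : Matrix (Fin m) (Fin c) ℝ),
        C.rank = ρ → (C * pinv C * A).rank = ρ → 1 ≤ k → k ≤ ρ → 0 < ε → ε ≤ 1 →
        -- at most `r₁ + r₂` rows of `A` are selected
        (∀ ω, (∀ i ∈ (P.final S ω A k ρ ε).output, i < m) ∧
          (P.final S ω A k ρ ε).output.length ≤ r₁ k ρ ε + r₂ k ρ ε) ∧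
        -- the selection is random
        (∀ l, MeasurableSet {ω | (P.final S ω A k ρ ε).output = l}) ∧
        -- the error bound
        (∀ Ak, IsRankTruncation k A Ak →
          let err : RealRAM.Tape → ℝ := fun ω =>
            let R := selectRows A (P.final S ω A k ρ ε).output
            ‖A - C * pinv C * A * pinv R * R‖ ^ 2
          Integrable err RealRAM.tapeMeasure ∧
          ∫ ω, err ω ∂(RealRAM.tapeMeasure) ≤ ‖A - C * pinv C * A‖ ^ 2 + ε * ‖A - Ak‖ ^ 2) ∧
        -- the running time
        (∀ ω, ((P.final S ω A k ρ ε).clock : ℝ) ≤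
          K * (((m * n * k + m * k ^ 3 : ℕ) : ℝ) * ε ^ (-(2 / 3) : ℝ))) ∧
        -- the three steps of the algorithm
        (2 * ρ ≤ ε * m → ∀ᵐ ω ∂(RealRAM.tapeMeasure),
          IsFastRowSelection A k (ℓ k ρ ε) (r₁ k ρ ε) (r₂ k ρ ε) ω
            (P.final S ω A k ρ ε).output) := by
  refine ⟨RealRAM.fastRowSelection, 161 * RealRAM.fastRowSelection.weight,
    fun ε => 13 * ε ^ (1 / 3 : ℝ), fun k _ ε => sketchSize k ε, fun k _ ε => dualSetSize k ε,
    fun _ ρ ε => sampleSize ρ ε, ?_, fun k ρ ε hk hkρ hε hε1 =>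
      abs_rows_sub_le hkρ (hk.trans hkρ) hε hε1, ?_⟩
  · have h : Tendsto (fun ε : ℝ => 13 * ε ^ (1 / 3 : ℝ)) (𝓝 0) (𝓝 (13 * 0 ^ (1 / 3 : ℝ))) :=
      ((Real.continuous_rpow_const (by norm_num)).const_mul 13).tendsto 0
    rw [Real.zero_rpow (by norm_num), mul_zero] at h
    exact h.mono_left nhdsWithin_le_nhds
  · intro S m n c k ρ ε A C hC hCA hk hkρ hε hε1
    have hρA : ρ ≤ A.rank := hCA ▸ Matrix.rank_mul_le_right (C * pinv C) A
    have hρm : ρ ≤ m := hρA.trans ((Matrix.rank_le_card_height A).trans_eq (Fintype.card_fin m))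
    have hρn : ρ ≤ n := hρA.trans ((Matrix.rank_le_card_width A).trans_eq (Fintype.card_fin n))
    refine ⟨RealRAM.fastRowSelection_output_le hk hkρ hρm hρn hε hε1,
      RealRAM.measurableSet_output S _ A k ρ ε, fun Ak hAk => ?_,
      RealRAM.fastRowSelection_clock_le hk hkρ hρm hρn hε hε1,
      RealRAM.ae_isFastRowSelection hk hkρ hρA hε hε1⟩
    intro err
    have hle := RealRAM.lintegral_fastRowSelection_le (S := S) hC hk hkρ hρA hε hε1 hAk
    change ∫⁻ ω, ENNReal.ofReal (err ω) ∂(RealRAM.tapeMeasure) ≤ _ at hle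
    have herr0 : ∀ ω, 0 ≤ err ω := fun ω => sq_nonneg _
    have hmeas : Measurable err := RealRAM.measurable_comp_output S _ A k ρ ε fun l =>
      ‖A - C * pinv C * A * pinv (selectRows A l) * selectRows A l‖ ^ 2
    have hint : Integrable err RealRAM.tapeMeasure :=
      (lintegral_ofReal_ne_top_iff_integrable hmeas.aestronglyMeasurable
        (Eventually.of_forall herr0)).1 (hle.trans_lt ENNReal.ofReal_lt_top).ne
    refine ⟨hint, ?_⟩
    rw [← ofReal_integral_eq_lintegral_ofReal hint (Eventually.of_forall herr0)] at hle
    exact (ENNReal.ofReal_le_ofReal_iff (by positivity)).1 hle
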